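/- **Setting.** Let $R$ be a commutative ring and $A$ a commutative $R$-algebra. An *almost pre-Lie-Rinehart triple* $(A,H,Q)$ consists of $A$-modules $H$ and $Q$; alternating $R$-bilinear brackets $[\cdot,\cdot]_H$ on $H$ and $[\cdot,\cdot]_Q$ on $Q$; $A$-linear maps $H\to\mathrm{Der}_R(A)$, $x\mapsto x(\cdot)$, and $Q\to\mathrm{Der}_R(A)$, $\xi\mapsto\xi(\cdot)$, with $[x,ay]_H=x(a)y+a[x,y]_H$ and $[\xi,a\eta]_Q=\xi(a)\eta+a[\xi,\eta]_Q$; operations $H\otimes_RQ\to Q$, $x\otimes\xi\mapsto x\cdot\xi$, and $Q\otimes_RH\to H$, $\xi\otimes x\mapsto\xi\cdot x$, which are $A$-linear in the first variable and satisfy $x\cdot(a\xi)=x(a)\xi+a(x\cdot\xi)$ and $\xi\cdot(ax)=\xi(a)x+a(\xi\cdot x)$; and an alternating $A$-bilinear pairing $\delta\colon Q\times Q\to H$. It is a *pre-Lie-Rinehart triple* if $(A,H)$ is a Lie-Rinehart algebra (Jacobi identity, and $H\to\mathrm{Der}_R(A)$ is a morphism of Lie algebras) and $[x,y]_H\cdot\xi=x\cdot(y\cdot\xi)-y\cdot(x\cdot\xi)$.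 It is a (genuine) *Lie-Rinehart triple* if $(A,H\oplus Q)$ is a Lie-Rinehart algebra under the bracket $$[(x,\xi),(y,\eta)]=\bigl([x,y]_H+\delta(\xi,\eta)+\xi\cdot y-\eta\cdot x,\ [\xi,\eta]_Q+x\cdot\eta-y\cdot\xi\bigr)$$ and the action $(x,\xi)(a)=x(a)+\xi(a)$. The $A$-module $H$ has *property P* if $x\in H$ and $\varphi(x)=0$ for all $\varphi\in\mathrm{Hom}_A(H,A)$ imply $x=0$. Let $(A,H,Q)$ be a pre-Lie-Rinehart triple such that $Q$ is a finitely generated projective $A$-module of constant rank $n$, and let $\omega\colon\Lambda^n_AQ\to A$ be an isomorphism of $A$-modules which is invariant under $H$, that is, $x(\omega(u))=\omega(x\cdot u)$ for $x\in H$, $u\in\Lambda_A^nQ$; here $H$ acts on $\Lambda_AQ$ by derivations. (The triple is then called orientable, with invariant orientation form $\omega$.) **The bigraded algebra.** Put $\mathcal G=\mathrm{Alt}_A(H,\Lambda_AQ)$, $\mathcal G^q_p=\mathrm{Alt}^q_A(H,\Lambda^p_AQ)$, $|f|=p-q$ for $f\in\mathcal G^q_p$. The product of $f\in\mathcal G^{q}_{p}$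 and $g\in\mathcal G^{q'}_{p'}$ is $(-1)^{q(q'+p')}$ times the shuffle product $$(x_1,\dots,x_{q+q'})\mapsto\sum_\sigma\mathrm{sgn}(\sigma)\,f(x_{\sigma1},\dots,x_{\sigma q})\wedge g(x_{\sigma(q+1)},\dots,x_{\sigma(q+q')})$$ over $(q,q')$-shuffles $\sigma$. For a Lie-Rinehart-type structure on $L$ acting on $M$ put, for $f\in\mathrm{Alt}^q_A(L,M)$, $$(\partial_Lf)(x_0,\dots,x_q)=\sum_i(-1)^ix_i\bigl(f(\dots\widehat{x_i}\dots)\bigr)+\sum_{i<j}(-1)^{i+j}f([x_i,x_j],\dots\widehat{x_i}\dots\widehat{x_j}\dots).$$ * $d\colon\mathcal G^*_*\to\mathcal G^{*+1}_*$ is $df=(-1)^{|f|+1}\partial_Hf$. * $\phi^\omega$ is the map with components $\mathcal G^q_p\to\mathrm{Alt}_A^{m}(Q,\mathrm{Alt}^q_A(H,A))$, $m=n-p$, $\phi^\omega_f(\xi_1,\dots,\xi_{m})(x)=(-1)^{mq}\omega(f(x)\wedge\xi_1\wedge\dots\wedge\xi_{m})$, where $x=(x_1,\dots,x_q)$. *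 $d_1$ is $(-1)^{m+q+1}\partial_Q$ on $\mathrm{Alt}_A^m(Q,\mathrm{Alt}_A^q(H,A))$, where $\xi\in Q$ operates on $\alpha\in\mathrm{Alt}^q_A(H,A)$ by $\xi(\alpha)(x_1,\dots,x_q)=\xi(\alpha(x_1,\dots,x_q))-\sum_k\alpha(x_1,\dots,\xi\cdot x_k,\dots,x_q)$. * $\Delta_\omega\colon\mathcal G^*_*\to\mathcal G^*_{*-1}$ is determined by $\phi^\omega_{\Delta_\omega(f)}=(-1)^{n+1}d_1(\phi^\omega_f)$. * $\Psi_\delta\colon\mathcal G^*_*\to\mathcal G^{*-1}_{*-2}$ is the additive map determined by $$\Psi_\delta(\beta\,\xi_1\wedge\dots\wedge\xi_p)=\sum_{j<k}(-1)^{j+k}\langle\xi_j,\xi_k;\beta\rangle\,\xi_1\wedge\dots\widehat{\xi_j}\dots\widehat{\xi_k}\dots\wedge\xi_p$$ for $\beta\in\mathrm{Alt}^q_A(H,A)$, $\xi_i\in Q$, where $\langle\xi,\eta;\beta\rangle(x_1,\dots,x_{q-1})=\beta(x_1,\dots,x_{q-1},\delta(\xi,\eta))$, and $\langle\xi,\eta;\beta\rangle=0$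 for $q=0$. * *The bracket on $\mathcal G$*: an $R$-bilinear bracket $[\cdot,\cdot]$ on $\mathcal G$ of bidegree $(0,-1)$ is called an extended bracket if, for homogeneous $\alpha,\beta,\gamma\in\mathcal G$, $$[\alpha\beta,\gamma]=\alpha[\beta,\gamma]+(-1)^{|\alpha||\beta|}\beta[\alpha,\gamma],\qquad[\alpha,\beta]=-(-1)^{(|\alpha|-1)(|\beta|-1)}[\beta,\alpha],$$ and, for $\xi,\eta\in Q$ and $a\in\mathrm{Alt}_A(H,A)$, $[\xi,a]=\xi(a)$ and $[\xi,\eta]=[\xi,\eta]_Q$. **Quasi-Batalin-Vilkovisky algebras.** For an operator $D$ on a bigraded commutative algebra (with unit, graded commutative for the total degree) and homogeneous $a,b,c,e$ let $\Phi^2_D(a,b)=D(ab)-D(a)b-(-1)^{|a||b|}D(b)a+D(1)ab$, $$\begin{aligned}\Phi_D^3(a,b,c)=\ &D(abc)-D(ab)c-(-1)^{|a|(|b|+|c|)}D(bc)a-(-1)^{|c|(|a|+|b|)}D(ca)b\\&+D(a)bc+(-1)^{|a|(|b|+|c|)}D(b)ca+(-1)^{|c|(|a|+|b|)}D(c)ab-D(1)abc,\end{aligned}$$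 and $\Phi^4_D(a,b,c,e)=\Phi^3_D(a,b,ce)-\Phi^3_D(a,b,c)e-(-1)^{|c||e|}\Phi^3_D(a,b,e)c$; $D$ is of order $\le r$ if $\Phi^{r+1}_D=0$. A *quasi-Batalin-Vilkovisky algebra* $(\mathcal G;d,\Delta,\Psi)$ is a bigraded commutative $R$-algebra $\mathcal G$ with $R$-linear operators $d,\Delta,\Psi$ of bidegrees $(1,0)$, $(0,-1)$, $(-1,-2)$ and orders $\le1$, $\le2$, $\le3$, which vanish on $1$ and satisfy $$dd=0,\quad d\Delta+\Delta d=0,\quad d\Psi+\Delta\Delta+\Psi d=0,\quad\Delta\Psi+\Psi\Delta=0,\quad\Psi\Psi=0.$$ An $R$-linear operator $\Delta$ of bidegree $(0,-1)$ is a *strict generator* of a bracket $[\cdot,\cdot]$ if $[a,b]=(-1)^{|a|}\bigl(\Delta(ab)-(\Delta a)b-(-1)^{|a|}a(\Delta b)\bigr)$ for homogeneous $a,b$, $\Delta(1)=0$, $d\Delta+\Delta d=0$, $d\Psi+\Delta\Delta+\Psi d=0$ and $\Delta\Psi+\Psi\Delta=0$. **Theorem 6.10.** The map $\phi^\omega$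 and the canonical map $\mathrm{Alt}_A(H,A)\otimes_A\Lambda_AQ\to\mathrm{Alt}_A(H,\Lambda_AQ)$ are isomorphisms (so that $\Delta_\omega$ and $\Psi_\delta$ are well defined). If $(A,H,Q)$ is a genuine Lie-Rinehart triple, then $(\mathrm{Alt}_A(H,\Lambda_AQ);d,\Delta_\omega,\Psi_\delta)$ is a quasi-Batalin-Vilkovisky algebra, there is exactly one extended bracket on $\mathrm{Alt}_A(H,\Lambda_AQ)$, and $\Delta_\omega$ is a strict generator of it. Conversely, if $H$ has property P and $(\mathrm{Alt}_A(H,\Lambda_AQ);d,\Delta_\omega,\Psi_\delta)$ is a quasi-Batalin-Vilkovisky algebra, then $(A,H,Q)$ is a genuine Lie-Rinehart triple. -/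

import Mathlib

namespace AltTools

section
variable {R L M : Type*} [CommRing R] [AddCommGroup L] [Module R L] [AddCommGroup M] [Module R M]

/-- The sum over pairs `i < j` of `(-1)^(i+j) • B (v i) (v j) (v without v i, v j)`; the pair is
parametrised by `i` and by `k = j - 1 ≥ i`. -/
def pairSum {n : ℕ} (B : L → L → (Fin n → L) → M) (v : Fin (n + 2) → L) : M :=
  ∑ i : Fin (n + 2), ∑ k : Fin (n + 1), if i ≤ k.castSucc then
    (-1 : ℤ) ^ ((i : ℕ) + ((k : ℕ) + 1)) •
      B (v i) (v k.succ) (k.removeNth (i.removeNth v)) else 0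

theorem altUncurry_cons {n : ℕ} (f : L →ₗ[R] L [⋀^Fin (n + 1)]→ₗ[R] M) (x : L)
    (v : Fin (n + 1) → L) :
    AlternatingMap.alternatizeUncurryFin f (Fin.cons x v) = f x v -
      ∑ j : Fin (n + 1), (-1 : ℤ) ^ (j : ℕ) • f (v j) (Fin.cons x (j.removeNth v)) := by
  rw [AlternatingMap.alternatizeUncurryFin_apply, Fin.sum_univ_succ, sub_eq_add_neg,
    ← Finset.sum_neg_distrib]
  congr 1
  · simp [Fin.removeNth]
  · refine Finset.sum_congr rfl fun j _ => ?_
    rw [Fin.cons_succ, Fin.val_succ, pow_succ, mul_neg_one, neg_smul]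
    congr 3
    ext k
    refine Fin.cases ?_ (fun k => ?_) k <;> simp [Fin.removeNth]

theorem pairSum_cons_zero (B : L → L → (Fin 0 → L) → M) (x : L) (v : Fin 1 → L) :
    pairSum B (Fin.cons x v) = - B x (v 0) ![] := by
  simp [pairSum, Fin.sum_univ_succ]
  congr 1
  exact Subsingleton.elim _ _

theorem removeNth_succ_cons {n : ℕ} (x : L) (v : Fin (n + 1) → L) (j : Fin (n + 1)) :
    (j.succ).removeNth (Fin.cons x v : Fin (n + 2) → L) = Fin.cons x (j.removeNth v) := by
  ext k
  refine Fin.cases ?_ (fun k => ?_) k <;> simp [Fin.removeNth]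

theorem pairSum_cons_succ {n : ℕ} (B : L → L → (Fin (n + 1) → L) → M) (x : L)
    (v : Fin (n + 2) → L) :
    pairSum B (Fin.cons x v) =
      - (∑ j : Fin (n + 2), (-1 : ℤ) ^ (j : ℕ) • B x (v j) (j.removeNth v)) +
      pairSum (fun y z w => B y z (Fin.cons x w)) v := by
  unfold pairSum
  rw [Fin.sum_univ_succ]
  congr 1
  · rw [← Finset.sum_neg_distrib]
    refine Finset.sum_congr rfl fun j _ => ?_
    simp [pow_succ, Fin.removeNth]
  · refine Finset.sum_congr rfl fun i _ => ?_
    rw [Fin.sum_univ_succ]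
    simp only [Fin.castSucc_zero, Fin.le_zero_iff, Fin.succ_ne_zero, if_false, zero_add,
      Fin.cons_succ, removeNth_succ_cons, Fin.val_succ]
    refine Finset.sum_congr rfl fun k _ => ?_
    rw [show (i : ℕ) + 1 + ((k : ℕ) + 1 + 1) = (i + (k + 1)) + 2 by ring, pow_add]
    by_cases hik : i ≤ k.castSucc
    · rw [if_pos hik, if_pos (by rw [← Fin.succ_castSucc]; exact Fin.succ_le_succ_iff.2 hik)]
      simp
    · rw [if_neg hik, if_neg (by rw [← Fin.succ_castSucc, Fin.succ_le_succ_iff]; exact hik)]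

/-- An alternating map from a linear family of alternating maps `g x` such that `g x v = 0` as soon
as the first entry of `v` is `x`. -/
def uncurryAlt {n : ℕ} (g : L →ₗ[R] L [⋀^Fin n]→ₗ[R] M)
    (h : ∀ (x : L) (v : Fin n → L) (i : Fin n), v i = x → g x v = 0) :
    L [⋀^Fin (n + 1)]→ₗ[R] M where
  toMultilinearMap := LinearMap.uncurryLeft (AlternatingMap.toMultilinearMapLM ∘ₗ g)
  map_eq_zero_of_eq' := by
    intro v i j hv hij
    change g (v 0) (Fin.tail v) = 0
    obtain rfl | ⟨i, rfl⟩ := Fin.eq_zero_or_eq_succ i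
    · obtain rfl | ⟨j, rfl⟩ := Fin.eq_zero_or_eq_succ j
      · exact absurd rfl hij
      · exact h _ _ j hv.symm
    · obtain rfl | ⟨j, rfl⟩ := Fin.eq_zero_or_eq_succ j
      · exact h _ _ i hv
      · exact (g (v 0)).map_eq_zero_of_eq _ hv (fun e => hij (by rw [e]))

theorem uncurryAlt_cons {n : ℕ} (g : L →ₗ[R] L [⋀^Fin n]→ₗ[R] M)
    (h : ∀ (x : L) (v : Fin n → L) (i : Fin n), v i = x → g x v = 0) (x : L) (v : Fin n → L) :
    uncurryAlt g h (Fin.cons x v) = g x v := rfl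

theorem vanish_of_cons {n : ℕ} (g : L → L [⋀^Fin (n + 1)]→ₗ[R] M)
    (h : ∀ (x : L) (v : Fin n → L), g x (Fin.cons x v) = 0) (x : L) (v : Fin (n + 1) → L)
    (i : Fin (n + 1)) (hv : v i = x) : g x v = 0 := by
  have key : ∀ w : Fin (n + 1) → L, w 0 = x → g x w = 0 := by
    intro w hw
    rw [← Fin.cons_self_tail w, hw]
    exact h x _
  by_cases hi : i = 0
  · exact key v (hi ▸ hv)
  · have := (g x).map_swap v (Ne.symm hi)
    rw [key (v ∘ Equiv.swap 0 i) (by simp [hv])] at this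
    simpa using this.symm

theorem exists_pairSum : ∀ {n : ℕ} (B : L →ₗ[R] L →ₗ[R] L [⋀^Fin n]→ₗ[R] M),
    (∀ x, B x x = 0) → ∃ F : L [⋀^Fin (n + 2)]→ₗ[R] M,
      ∀ v, F v = pairSum (fun x y w => B x y w) v := by
  intro n
  induction n with
  | zero =>
    intro B hB
    let b : L →ₗ[R] L →ₗ[R] M := LinearMap.mk₂ R (fun x y => - B x y ![])
      (by intros; simp; abel) (by intros; simp) (by intros; simp; abel) (by intros; simp)
    let g : L →ₗ[R] L [⋀^Fin 1]→ₗ[R] M :=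
      ⟨⟨fun x => AlternatingMap.ofSubsingleton R L M (0 : Fin 1) (b x),
        fun x y => by ext; simp⟩, fun c x => by ext; simp⟩
    have hg : ∀ x v, g x v = - B x (v 0) ![] := fun x v => rfl
    refine ⟨uncurryAlt g fun x v i hi => ?_, fun v => ?_⟩
    · rw [hg, ← hi, Subsingleton.elim i 0, hB]; simp
    · rw [← Fin.cons_self_tail v, uncurryAlt_cons, pairSum_cons_zero, hg]
  | succ n ih =>
    intro B hB
    let B' : L → L →ₗ[R] L →ₗ[R] L [⋀^Fin n]→ₗ[R] M := fun x =>
      LinearMap.mk₂ R (fun y z => (B y z).curryLeft x) (by intros; simp) (by intros; simp)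
        (by intros; simp) (by intros; simp)
    have hB'a : ∀ x y z w, B' x y z w = B y z (Fin.cons x w) := fun x y z w => rfl
    have hB' : ∀ x y, B' x y y = 0 := by
      intro x y; ext w; rw [hB'a, hB]; rfl
    choose F hF using fun x => ih (B' x) (hB' x)
    let G : L → L [⋀^Fin (n + 2)]→ₗ[R] M := fun x =>
      - AlternatingMap.alternatizeUncurryFin (B x) + F x
    have hG : ∀ x v, G x v = pairSum (fun x y w => B x y w) (Fin.cons x v) := by
      intro x v
      rw [pairSum_cons_succ]
      change - AlternatingMap.alternatizeUncurryFin (B x) v + F x v = _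
      rw [AlternatingMap.alternatizeUncurryFin_apply, hF]
      rfl
    have hGadd : ∀ x y, G (x + y) = G x + G y := by
      intro x y; ext v
      rw [AlternatingMap.add_apply]
      change - AlternatingMap.alternatizeUncurryFin (B (x + y)) v + F (x + y) v =
        (- AlternatingMap.alternatizeUncurryFin (B x) v + F x v) +
        (- AlternatingMap.alternatizeUncurryFin (B y) v + F y v)
      rw [map_add, AlternatingMap.alternatizeUncurryFin_add, AlternatingMap.add_apply]
      have : F (x + y) v = F x v + F y v := by
        simp only [hF, pairSum, hB'a, ← Finset.sum_add_distrib]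
        refine Finset.sum_congr rfl fun i _ => Finset.sum_congr rfl fun k _ => ?_
        split_ifs
        · rw [← smul_add]; congr 1
          exact (B _ _).toMultilinearMap.cons_add _ _ _
        · simp
      rw [this]; abel
    have hGsmul : ∀ (c : R) x, G (c • x) = c • G x := by
      intro c x; ext v
      rw [AlternatingMap.smul_apply]
      change - AlternatingMap.alternatizeUncurryFin (B (c • x)) v + F (c • x) v =
        c • (- AlternatingMap.alternatizeUncurryFin (B x) v + F x v)
      rw [map_smul, AlternatingMap.alternatizeUncurryFin_smul, AlternatingMap.smul_apply]
      have : F (c • x) v = c • F x v := by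
        simp only [hF, pairSum, hB'a, Finset.smul_sum]
        refine Finset.sum_congr rfl fun i _ => Finset.sum_congr rfl fun k _ => ?_
        split_ifs
        · rw [smul_comm c]; congr 1
          exact (B _ _).toMultilinearMap.cons_smul _ _ _
        · simp
      rw [this, smul_add, smul_neg]
    let g : L →ₗ[R] L [⋀^Fin (n + 2)]→ₗ[R] M := ⟨⟨G, hGadd⟩, hGsmul⟩
    refine ⟨uncurryAlt g (vanish_of_cons G fun x v => ?_), fun v => ?_⟩
    · change - AlternatingMap.alternatizeUncurryFin (B x) (Fin.cons x v) + F x (Fin.cons x v) = 0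
      rw [altUncurry_cons, hF, hB]
      cases n with
      | zero =>
        rw [pairSum_cons_zero]
        simp only [hB'a, Fin.sum_univ_succ, AlternatingMap.zero_apply]
        rw [Subsingleton.elim (Fin.removeNth 0 v) ![]]
        simp
      | succ n =>
        rw [pairSum_cons_succ]
        have h0 : pairSum (fun y z w => (B' x) y z (Fin.cons x w)) v = 0 := by
          unfold pairSum
          refine Finset.sum_eq_zero fun i _ => Finset.sum_eq_zero fun k _ => ?_
          split_ifs
          · dsimp only
            rw [hB'a, (B _ _).map_eq_zero_of_eq _ (i := 0) (j := 1) rfl (by simp), smul_zero]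
          · rfl
        rw [h0]
        simp [hB'a]
    · rw [← Fin.cons_self_tail v, uncurryAlt_cons]
      exact hG _ _

/-- `pairSum B` as an alternating map, for alternating `B`. -/
def pairSumAlt {n : ℕ} (B : L →ₗ[R] L →ₗ[R] L [⋀^Fin n]→ₗ[R] M) (hB : ∀ x, B x x = 0) :
    L [⋀^Fin (n + 2)]→ₗ[R] M where
  toFun v := pairSum (fun x y w => B x y w) v
  map_update_add' v i x y := by
    obtain ⟨F, hF⟩ := exists_pairSum B hB
    simp only [← hF]
    convert F.map_update_add v i x y
  map_update_smul' v i c x := by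
    obtain ⟨F, hF⟩ := exists_pairSum B hB
    simp only [← hF]
    convert F.map_update_smul v i c x
  map_eq_zero_of_eq' v i j hv hij := by
    obtain ⟨F, hF⟩ := exists_pairSum B hB
    change pairSum _ v = 0
    rw [← hF]
    exact F.map_eq_zero_of_eq v hv hij

theorem pairSumAlt_apply {n : ℕ} (B : L →ₗ[R] L →ₗ[R] L [⋀^Fin n]→ₗ[R] M) (hB : ∀ x, B x x = 0)
    (v : Fin (n + 2) → L) : pairSumAlt B hB v = pairSum (fun x y w => B x y w) v := rfl

end

section
variable {R A L M : Type*} [CommRing R] [CommRing A] [Algebra R A] [AddCommGroup L] [Module R L]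
  [Module A L] [IsScalarTower R A L] [AddCommGroup M] [Module R M] [Module A M]
  [IsScalarTower R A M]

/-- Restriction of scalars for alternating maps. -/
def restrict (R : Type*) {A L M : Type*} [CommRing R] [CommRing A] [Algebra R A] [AddCommGroup L]
    [Module R L] [Module A L] [IsScalarTower R A L] [AddCommGroup M] [Module R M] [Module A M]
    [IsScalarTower R A M] {n : ℕ} (f : L [⋀^Fin n]→ₗ[A] M) : L [⋀^Fin n]→ₗ[R] M where
  toMultilinearMap := f.toMultilinearMap.restrictScalars R
  map_eq_zero_of_eq' v i j hv hij := f.map_eq_zero_of_eq v hv hij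

theorem restrict_apply {n : ℕ} (f : L [⋀^Fin n]→ₗ[A] M) (v : Fin n → L) :
    restrict R f v = f v := rfl

/-- An `R`-multilinear alternating map which is `A`-homogeneous in the first variable is
`A`-multilinear. -/
def ofConsSmul {n : ℕ} (G : L [⋀^Fin (n + 1)]→ₗ[R] M)
    (h : ∀ (a : A) (x : L) (v : Fin n → L), G (Fin.cons (a • x) v) = a • G (Fin.cons x v)) :
    L [⋀^Fin (n + 1)]→ₗ[A] M where
  toFun := G
  map_update_add' v i x y := by convert G.map_update_add v i x y
  map_update_smul' v i a x := by
    have e : ‹DecidableEq (Fin (n + 1))› = instDecidableEqFin _ := Subsingleton.elim _ _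
    subst e
    have h0 : ∀ (w : Fin (n + 1) → L), G (Function.update w 0 (a • x)) =
        a • G (Function.update w 0 x) := fun w => by
      have : ∀ y, Function.update w 0 y = Fin.cons y (Fin.tail w) := fun y => by
        conv_lhs => rw [← Fin.cons_self_tail w, Fin.update_cons_zero]
      rw [this, this, h]
    by_cases hi : i = 0
    · subst hi; convert h0 v
    · have key : ∀ y, G (Function.update v i y) =
          - G (Function.update (v ∘ Equiv.swap 0 i) 0 y) := fun y => by
        rw [← neg_eq_iff_eq_neg, ← G.map_swap _ (Ne.symm hi)]
        congr 1
        ext k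
        rw [Function.comp_apply]
        by_cases hk0 : k = 0
        · subst hk0; simp
        · by_cases hki : k = i
          · subst hki; simp [Ne.symm hi, hi]
          · simp [Equiv.swap_apply_of_ne_of_ne hk0 hki, hk0, hki]
      have k1 := key (a • x)
      have k2 := key x
      rw [h0, ← smul_neg, ← k2] at k1
      convert k1
  map_eq_zero_of_eq' v i j hv hij := G.map_eq_zero_of_eq v hv hij

theorem ofConsSmul_apply {n : ℕ} (G : L [⋀^Fin (n + 1)]→ₗ[R] M)
    (h : ∀ (a : A) (x : L) (v : Fin n → L), G (Fin.cons (a • x) v) = a • G (Fin.cons x v))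
    (v : Fin (n + 1) → L) : ofConsSmul G h v = G v := rfl

end
end AltTools

/-- Data on the `A`-module `L` as required of a Lie-Rinehart algebra over the `R`-algebra `A`,
except for the Jacobi identity and the compatibility of the action on `A` with brackets: an
alternating `R`-bilinear bracket and an `A`-linear map to the `R`-derivations of `A`, with
`[x, a y] = x(a) y + a [x, y]`. -/
structure AlmostLieRinehart (R A L : Type*) [CommRing R] [CommRing A] [Algebra R A]
    [AddCommGroup L] [Module R L] [Module A L] [IsScalarTower R A L] where
  bracket : L →ₗ[R] L →ₗ[R] L
  bracket_self : ∀ x, bracket x x = 0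
  anchor : L →ₗ[A] Derivation R A A
  bracket_smul : ∀ (x : L) (a : A) (y : L),
    bracket x (a • y) = anchor x a • y + a • bracket x y

namespace AlmostLieRinehart

variable {R A L M : Type*} [CommRing R] [CommRing A] [Algebra R A] [AddCommGroup L] [Module R L]
  [Module A L] [IsScalarTower R A L] [AddCommGroup M] [Module R M] [Module A M]
  [IsScalarTower R A M]

theorem bracket_neg (S : AlmostLieRinehart R A L) (x y : L) :
    S.bracket x y = - S.bracket y x := by
  have h := S.bracket_self (x + y)
  simp only [map_add, LinearMap.add_apply, S.bracket_self, zero_add, add_zero] at h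
  exact eq_neg_of_add_eq_zero_right h

/-- `(A, L)` is a Lie-Rinehart algebra: the bracket satisfies the Jacobi identity and the action
on `A` is a morphism of Lie algebras. -/
structure IsLieRinehart (S : AlmostLieRinehart R A L) : Prop where
  jacobi : ∀ x y z : L, S.bracket x (S.bracket y z) + S.bracket y (S.bracket z x) +
    S.bracket z (S.bracket x y) = 0
  anchor_bracket : ∀ (x y : L) (a : A), S.anchor (S.bracket x y) a =
    S.anchor x (S.anchor y a) - S.anchor y (S.anchor x a)

/-- A generalized `L`-connection on the `A`-module `M` (no flatness is required). -/
structure Connection (S : AlmostLieRinehart R A L) (M : Type*) [AddCommGroup M] [Module R M]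
    [Module A M] [IsScalarTower R A M] where
  act : L →ₗ[A] M →ₗ[R] M
  act_smul : ∀ (x : L) (a : A) (m : M), act x (a • m) = S.anchor x a • m + a • act x m

variable {S : AlmostLieRinehart R A L}

/-- The part of the Cartan-Chevalley-Eilenberg formula which involves the bracket. -/
def bracketPart (S : AlmostLieRinehart R A L) : {q : ℕ} → (f : L [⋀^Fin q]→ₗ[A] M) →
    (Fin (q + 1) → L) → M
  | 0, _, _ => 0
  | _ + 1, f, v => AltTools.pairSum (fun x y w => f (Fin.cons (S.bracket x y) w)) v

/-- The Cartan-Chevalley-Eilenberg expression (without the sign in front):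
`∑ i, (-1)^i x_i (f (.. omit x_i ..)) + ∑_{i<j} (-1)^(i+j) f ([x_i, x_j], .. omit x_i, x_j ..)`,
the variables being numbered from `0`. -/
def ceFun (c : S.Connection M) {q : ℕ} (f : L [⋀^Fin q]→ₗ[A] M) (v : Fin (q + 1) → L) : M :=
  ∑ i : Fin (q + 1), (-1 : ℤ) ^ (i : ℕ) • c.act (v i) (f (i.removeNth v)) + S.bracketPart f v

/-- The Cartan-Chevalley-Eilenberg expression as an alternating `R`-multilinear map. -/
theorem exists_ceFun (c : S.Connection M) : ∀ {q : ℕ} (f : L [⋀^Fin q]→ₗ[A] M),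
    ∃ F : L [⋀^Fin (q + 1)]→ₗ[R] M, ∀ v, F v = ceFun c f v := by
  intro q f
  let g : L →ₗ[R] L [⋀^Fin q]→ₗ[R] M :=
    ⟨⟨fun x => (c.act x).compAlternatingMap (AltTools.restrict R f), fun x y => by ext; simp⟩,
      fun r x => by ext; simp⟩
  cases q with
  | zero =>
    refine ⟨AlternatingMap.alternatizeUncurryFin g, fun v => ?_⟩
    rw [AlternatingMap.alternatizeUncurryFin_apply, ceFun, bracketPart, add_zero]
    rfl
  | succ q =>
    let B : L →ₗ[R] L →ₗ[R] L [⋀^Fin q]→ₗ[R] M :=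
      S.bracket.compr₂ (AltTools.restrict R f).curryLeft
    refine ⟨AlternatingMap.alternatizeUncurryFin g + AltTools.pairSumAlt B fun x => ?_,
      fun v => ?_⟩
    · change (AltTools.restrict R f).curryLeft (S.bracket x x) = 0
      rw [S.bracket_self, map_zero]
    · rw [AlternatingMap.add_apply, AlternatingMap.alternatizeUncurryFin_apply, ceFun, bracketPart]
      rfl

theorem bracketPart_cons {q : ℕ} (f : L [⋀^Fin (q + 1)]→ₗ[A] M) (v : Fin (q + 1) → L) :
    ∃ P : L → M, (∀ (a : A) y, P (a • y) = a • P y) ∧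
      ∀ y, S.bracketPart f (Fin.cons y v) = P y - ∑ j : Fin (q + 1),
        (-1 : ℤ) ^ (j : ℕ) • f (Fin.cons (S.bracket y (v j)) (j.removeNth v)) := by
  cases q with
  | zero =>
    refine ⟨fun _ => 0, fun a y => by simp, fun y => ?_⟩
    simp only [bracketPart]
    rw [AltTools.pairSum_cons_zero]
    simp only [Fin.sum_univ_succ]
    rw [Subsingleton.elim (Fin.removeNth 0 v) ![]]
    simp
  | succ q =>
    refine ⟨fun x => AltTools.pairSum
      (fun y z w => f (Fin.cons (S.bracket y z) (Fin.cons x w))) v, fun a y => ?_, fun y => ?_⟩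
    · simp only [AltTools.pairSum, Finset.smul_sum]
      refine Finset.sum_congr rfl fun i _ => Finset.sum_congr rfl fun k _ => ?_
      split_ifs
      · rw [smul_comm a]
        congr 1
        exact (f.curryLeft _).toMultilinearMap.cons_smul _ _ _
      · simp
    · simp only [bracketPart]
      rw [AltTools.pairSum_cons_succ]
      abel

theorem ceFun_cons_smul (c : S.Connection M) {q : ℕ} (f : L [⋀^Fin q]→ₗ[A] M) (a : A) (x : L)
    (v : Fin q → L) : ceFun c f (Fin.cons (a • x) v) = a • ceFun c f (Fin.cons x v) := by
  cases q with
  | zero =>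
    simp only [ceFun, bracketPart, Fin.sum_univ_succ]
    simp [Fin.removeNth]
  | succ q =>
    obtain ⟨P, hP, hB⟩ := bracketPart_cons (S := S) f v
    simp only [ceFun, hB, Fin.sum_univ_succ (n := q + 1), hP, AltTools.removeNth_succ_cons,
      Fin.cons_succ, Fin.cons_zero, Fin.val_zero, Fin.val_succ]
    have h1 : ∀ (j : Fin (q + 1)), f (Fin.cons (a • x) (j.removeNth v)) =
        a • f (Fin.cons x (j.removeNth v)) := fun j => f.toMultilinearMap.cons_smul _ _ _
    have h2 : ∀ (j : Fin (q + 1)), f (Fin.cons (S.bracket (a • x) (v j)) (j.removeNth v)) =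
        a • f (Fin.cons (S.bracket x (v j)) (j.removeNth v)) -
          S.anchor (v j) a • f (Fin.cons x (j.removeNth v)) := fun j => by
      have e : S.bracket (a • x) (v j) =
          a • S.bracket x (v j) + (- S.anchor (v j) a) • x := by
        rw [S.bracket_neg, S.bracket_smul, S.bracket_neg (v j) x, smul_neg, neg_smul]
        abel
      rw [e]
      have e1 := f.toMultilinearMap.cons_add (j.removeNth v) (a • S.bracket x (v j))
        ((- S.anchor (v j) a) • x)
      have e2 := f.toMultilinearMap.cons_smul (j.removeNth v) a (S.bracket x (v j))
      have e3 := f.toMultilinearMap.cons_smul (j.removeNth v) (- S.anchor (v j) a) x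
      rw [e2, e3] at e1
      rw [sub_eq_add_neg, ← neg_smul]
      exact e1
    simp only [h1, h2, c.act_smul, map_smul, LinearMap.smul_apply, smul_add, smul_sub,
      Finset.sum_sub_distrib, Finset.sum_add_distrib, Finset.smul_sum, pow_succ, mul_neg_one,
      neg_smul, Finset.sum_neg_distrib, pow_zero, one_smul, smul_neg]
    simp only [smul_comm a ((-1 : ℤ) ^ _)]
    have h0 : (Fin.removeNth 0 (Fin.cons (a • x) v : Fin (q + 2) → L)) = v := by
      ext k; simp
    have h0' : (Fin.removeNth 0 (Fin.cons x v : Fin (q + 2) → L)) = v := by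
      ext k; simp
    rw [h0, h0']
    abel

/-- The operator `f ↦ ceFun c f` on `A`-multilinear alternating forms. -/
def ceAlt (c : S.Connection M) {q : ℕ} (f : L [⋀^Fin q]→ₗ[A] M) : L [⋀^Fin (q + 1)]→ₗ[A] M :=
  let G : L [⋀^Fin (q + 1)]→ₗ[R] M :=
    { toFun := ceFun c f
      map_update_add' := fun v i x y => by
        obtain ⟨F, hF⟩ := exists_ceFun c f
        simp only [← hF]
        convert F.map_update_add v i x y
      map_update_smul' := fun v i r x => by
        obtain ⟨F, hF⟩ := exists_ceFun c f
        simp only [← hF]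
        convert F.map_update_smul v i r x
      map_eq_zero_of_eq' := fun v i j hv hij => by
        obtain ⟨F, hF⟩ := exists_ceFun c f
        change ceFun c f v = 0
        rw [← hF]
        exact F.map_eq_zero_of_eq v hv hij }
  AltTools.ofConsSmul G (ceFun_cons_smul c f)

theorem ceAlt_apply (c : S.Connection M) {q : ℕ} (f : L [⋀^Fin q]→ₗ[A] M) (v : Fin (q + 1) → L) :
    ceAlt c f v = ceFun c f v := rfl

/-- The Cartan-Chevalley-Eilenberg operator (without signs) as an `R`-linear map. -/
def ce (c : S.Connection M) (q : ℕ) : (L [⋀^Fin q]→ₗ[A] M) →ₗ[R] (L [⋀^Fin (q + 1)]→ₗ[A] M) where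
  toFun f := ceAlt c f
  map_add' f g := by
    ext v
    rw [AlternatingMap.add_apply, ceAlt_apply, ceAlt_apply, ceAlt_apply]
    cases q with
    | zero => simp [ceFun, bracketPart]
    | succ q =>
      simp only [ceFun, bracketPart, AltTools.pairSum, AlternatingMap.add_apply, map_add, smul_add,
        Finset.sum_add_distrib]
      rw [add_add_add_comm]
      congr 1
      rw [← Finset.sum_add_distrib]
      refine Finset.sum_congr rfl fun i _ => ?_
      rw [← Finset.sum_add_distrib]
      refine Finset.sum_congr rfl fun k _ => ?_
      split_ifs <;> simp
  map_smul' r f := by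
    ext v
    rw [AlternatingMap.smul_apply, ceAlt_apply, ceAlt_apply]
    cases q with
    | zero => simp [ceFun, bracketPart]
    | succ q =>
      simp only [ceFun, bracketPart, AltTools.pairSum, AlternatingMap.smul_apply, map_smul,
        smul_add, Finset.smul_sum, RingHom.id_apply]
      congr 1
      · refine Finset.sum_congr rfl fun i _ => smul_comm _ _ _
      · refine Finset.sum_congr rfl fun i _ => Finset.sum_congr rfl fun k _ => ?_
        split_ifs
        · exact smul_comm _ _ _
        · simp

end AlmostLieRinehart

instance AltTools.isScalarTower {R A M N ι : Type*} [CommRing R] [CommRing A] [Algebra R A]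
    [AddCommGroup M] [Module A M] [AddCommGroup N] [Module R N] [Module A N]
    [IsScalarTower R A N] : IsScalarTower R A (M [⋀^ι]→ₗ[A] N) where
  smul_assoc r a f := by ext v; simp

/-! ### Almost pre-Lie-Rinehart triples -/

/-- The data `(A, H, Q)` of an almost pre-Lie-Rinehart triple. -/
structure AlmostPreLRTriple (R A H Q : Type*) [CommRing R] [CommRing A] [Algebra R A]
    [AddCommGroup H] [Module R H] [Module A H] [IsScalarTower R A H]
    [AddCommGroup Q] [Module R Q] [Module A Q] [IsScalarTower R A Q] where
  /-- bracket on `H` and operation `H ⊗ A → A` -/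
  strH : AlmostLieRinehart R A H
  /-- bracket on `Q` and operation `Q ⊗ A → A` -/
  strQ : AlmostLieRinehart R A Q
  /-- the operation `H ⊗ Q → Q`, `x ⊗ ξ ↦ x · ξ` -/
  actHQ : strH.Connection Q
  /-- the operation `Q ⊗ H → H`, `ξ ⊗ x ↦ ξ · x` -/
  actQH : strQ.Connection H
  /-- the skew-symmetric `A`-bilinear pairing `δ` -/
  delta : Q →ₗ[A] Q →ₗ[A] H
  delta_self : ∀ ξ, delta ξ ξ = 0

namespace AlmostPreLRTriple

variable {R A H Q : Type*} [CommRing R] [CommRing A] [Algebra R A]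
  [AddCommGroup H] [Module R H] [Module A H] [IsScalarTower R A H]
  [AddCommGroup Q] [Module R Q] [Module A Q] [IsScalarTower R A Q]

/-- The bracket on `L = H ⊕ Q`. -/
def totalBracket (T : AlmostPreLRTriple R A H Q) (u v : H × Q) : H × Q :=
  (T.strH.bracket u.1 v.1 + T.delta u.2 v.2 - T.actQH.act v.2 u.1 + T.actQH.act u.2 v.1,
    T.strQ.bracket u.2 v.2 + T.actHQ.act u.1 v.2 - T.actHQ.act v.1 u.2)

/-- The bracket and the action on `A` of the direct sum `L = H ⊕ Q`. -/
def total (T : AlmostPreLRTriple R A H Q) : AlmostLieRinehart R A (H × Q) where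
  bracket := LinearMap.mk₂ R T.totalBracket
    (fun u u' v => by
      ext <;> simp only [totalBracket, Prod.fst_add, Prod.snd_add, map_add,
        LinearMap.add_apply] <;> abel)
    (fun r u v => by
      have h : ∀ ξ η : Q, T.delta (r • ξ) η = r • T.delta ξ η := fun ξ η => by
        rw [← algebraMap_smul A r ξ, map_smul, LinearMap.smul_apply, algebraMap_smul]
      have h' : ∀ (ξ : Q) (x : H), T.actQH.act (r • ξ) x = r • T.actQH.act ξ x := fun ξ x => by
        rw [← algebraMap_smul A r ξ, map_smul, LinearMap.smul_apply, algebraMap_smul]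
      have h'' : ∀ (x : H) (ξ : Q), T.actHQ.act (r • x) ξ = r • T.actHQ.act x ξ := fun x ξ => by
        rw [← algebraMap_smul A r x, map_smul, LinearMap.smul_apply, algebraMap_smul]
      ext <;> simp only [totalBracket, Prod.smul_fst, Prod.smul_snd, map_smul,
        LinearMap.smul_apply, smul_add, smul_sub, h, h', h''])
    (fun u v v' => by
      ext <;> simp only [totalBracket, Prod.fst_add, Prod.snd_add, map_add,
        LinearMap.add_apply] <;> abel)
    (fun r u v => by
      have h : ∀ ξ η : Q, T.delta ξ (r • η) = r • T.delta ξ η := fun ξ η => by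
        rw [← algebraMap_smul A r η, map_smul, algebraMap_smul]
      have h' : ∀ (ξ : Q) (x : H), T.actQH.act (r • ξ) x = r • T.actQH.act ξ x := fun ξ x => by
        rw [← algebraMap_smul A r ξ, map_smul, LinearMap.smul_apply, algebraMap_smul]
      have h'' : ∀ (x : H) (ξ : Q), T.actHQ.act (r • x) ξ = r • T.actHQ.act x ξ := fun x ξ => by
        rw [← algebraMap_smul A r x, map_smul, LinearMap.smul_apply, algebraMap_smul]
      ext <;> simp only [totalBracket, Prod.smul_fst, Prod.smul_snd, map_smul,
        LinearMap.smul_apply, smul_add, smul_sub, h, h', h''])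
  bracket_self u := by
    ext <;> simp [totalBracket, T.strH.bracket_self, T.strQ.bracket_self, T.delta_self]
  anchor := T.strH.anchor.coprod T.strQ.anchor
  bracket_smul u a v := by
    ext <;> simp only [LinearMap.mk₂_apply, totalBracket, Prod.smul_fst, Prod.smul_snd, map_smul,
      LinearMap.smul_apply, smul_add, smul_sub, T.strH.bracket_smul, T.strQ.bracket_smul,
      T.actHQ.act_smul, T.actQH.act_smul, LinearMap.coprod_apply, Derivation.add_apply, add_smul,
      Prod.fst_add, Prod.snd_add] <;> abel

/-- A pre-Lie-Rinehart triple: `(A, H)` is a Lie-Rinehart algebra and `Q` is a left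
`(A, H)`-module. -/
structure IsPre (T : AlmostPreLRTriple R A H Q) : Prop where
  lieRinehart : T.strH.IsLieRinehart
  flat : ∀ (x y : H) (ξ : Q), T.actHQ.act (T.strH.bracket x y) ξ =
    T.actHQ.act x (T.actHQ.act y ξ) - T.actHQ.act y (T.actHQ.act x ξ)

/-- A (genuine) Lie-Rinehart triple: `(A, H ⊕ Q)` is a Lie-Rinehart algebra. -/
def IsGenuine (T : AlmostPreLRTriple R A H Q) : Prop := T.total.IsLieRinehart

/-! ### The action of `Q` on `Alt_A(H, A)` and the action of `H` on `Λ_A Q` -/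

/-- `ξ(α)(x_1, …, x_q) = ξ(α(x_1, …, x_q)) - ∑_k α(x_1, …, ξ · x_k, …, x_q)`. -/
def lieFun (T : AlmostPreLRTriple R A H Q) (ξ : Q) {q : ℕ} (α : H [⋀^Fin q]→ₗ[A] A)
    (x : Fin q → H) : A :=
  T.strQ.anchor ξ (α x) - ∑ k : Fin q, α (Function.update x k (T.actQH.act ξ (x k)))

theorem lieFun_update (T : AlmostPreLRTriple R A H Q) (ξ : Q) {q : ℕ} (α : H [⋀^Fin q]→ₗ[A] A)
    (x : Fin q → H) (i : Fin q) (y : H) : T.lieFun ξ α (Function.update x i y) =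
      T.strQ.anchor ξ (α (Function.update x i y)) -
        (α (Function.update x i (T.actQH.act ξ y)) + ∑ k ∈ Finset.univ.erase i,
          α (Function.update (Function.update x k (T.actQH.act ξ (x k))) i y)) := by
  rw [lieFun, ← Finset.add_sum_erase _ _ (Finset.mem_univ i)]
  congr 2
  · simp
  · refine Finset.sum_congr rfl fun k hk => ?_
    have hki : k ≠ i := Finset.ne_of_mem_erase hk
    rw [Function.update_of_ne hki, Function.update_comm hki]

/-- `lieFun T ξ α` is an alternating `A`-multilinear map. -/
def lieAlt (T : AlmostPreLRTriple R A H Q) (ξ : Q) {q : ℕ} (α : H [⋀^Fin q]→ₗ[A] A) :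
    H [⋀^Fin q]→ₗ[A] A where
  toFun := T.lieFun ξ α
  map_update_add' := fun {inst} x i y z => by
    obtain rfl : inst = instDecidableEqFin _ := Subsingleton.elim _ _
    simp only [lieFun_update, AlternatingMap.map_update_add, map_add, Finset.sum_add_distrib]
    abel
  map_update_smul' := fun {inst} x i a y => by
    obtain rfl : inst = instDecidableEqFin _ := Subsingleton.elim _ _
    simp only [lieFun_update, AlternatingMap.map_update_add, AlternatingMap.map_update_smul,
      T.actQH.act_smul, Derivation.leibniz, smul_eq_mul, ← Finset.mul_sum]
    ring
  map_eq_zero_of_eq' x i j hx hij := by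
    have h0 : α x = 0 := α.map_eq_zero_of_eq x hx hij
    rw [lieFun, h0, map_zero, zero_sub, neg_eq_zero,
      Fintype.sum_eq_add i j hij fun k ⟨hki, hkj⟩ => ?_]
    · have e : Function.update x j (T.actQH.act ξ (x j)) ∘ Equiv.swap i j =
          Function.update x i (T.actQH.act ξ (x i)) := by
        ext k
        rw [Function.comp_apply]
        by_cases hk : k = i
        · subst hk; simp [hx]
        · by_cases hk' : k = j
          · subst hk'; simp [hij, hk, hx]
          · simp [Equiv.swap_apply_of_ne_of_ne hk hk', hk, hk']
      rw [← e]
      exact AlternatingMap.map_swap_add _ _ hij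
    · refine α.map_eq_zero_of_eq _ (i := i) (j := j) ?_ hij
      rw [Function.update_of_ne (Ne.symm hki), Function.update_of_ne (Ne.symm hkj), hx]

theorem lieAlt_apply (T : AlmostPreLRTriple R A H Q) (ξ : Q) {q : ℕ} (α : H [⋀^Fin q]→ₗ[A] A)
    (x : Fin q → H) : T.lieAlt ξ α x = T.strQ.anchor ξ (α x) -
      ∑ k : Fin q, α (Function.update x k (T.actQH.act ξ (x k))) := rfl

/-- The generalized `Q`-connection on `Alt_A^q(H, A)`. -/
def lieConn (T : AlmostPreLRTriple R A H Q) (q : ℕ) : T.strQ.Connection (H [⋀^Fin q]→ₗ[A] A) where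
  act :=
    { toFun := fun ξ =>
        { toFun := fun α => T.lieAlt ξ α
          map_add' := fun α β => by
            ext x
            simp only [lieAlt_apply, AlternatingMap.add_apply, map_add, Finset.sum_add_distrib]
            ring
          map_smul' := fun r α => by
            ext x
            simp only [lieAlt_apply, AlternatingMap.smul_apply, Derivation.map_smul, smul_sub,
              Finset.smul_sum, RingHom.id_apply] }
      map_add' := fun ξ η => by
        ext α x
        simp only [LinearMap.coe_mk, AddHom.coe_mk, LinearMap.add_apply, AlternatingMap.add_apply,
          lieAlt_apply, map_add, Derivation.add_apply, AlternatingMap.map_update_add,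
          Finset.sum_add_distrib]
        ring
      map_smul' := fun a ξ => by
        ext α x
        simp only [LinearMap.coe_mk, AddHom.coe_mk, LinearMap.smul_apply,
          AlternatingMap.smul_apply, lieAlt_apply, map_smul, Derivation.smul_apply,
          AlternatingMap.map_update_smul, smul_sub, Finset.smul_sum, RingHom.id_apply] }
  act_smul ξ a α := by
    ext x
    simp only [LinearMap.coe_mk, AddHom.coe_mk, AlternatingMap.add_apply,
      AlternatingMap.smul_apply, lieAlt_apply, Derivation.leibniz, smul_eq_mul, mul_sub,
      Finset.mul_sum]
    ring

theorem lieConn_act (T : AlmostPreLRTriple R A H Q) (q : ℕ) (ξ : Q) (α : H [⋀^Fin q]→ₗ[A] A) :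
    (T.lieConn q).act ξ α = T.lieAlt ξ α := rfl

/-- The ring homomorphism `a ↦ a + ε x(a)`. -/
def dualBase (T : AlmostPreLRTriple R A H Q) (x : H) :
    A →+* DualNumber (ExteriorAlgebra A Q) where
  toFun a := TrivSqZeroExt.inl (algebraMap A _ a) +
    TrivSqZeroExt.inr (algebraMap A _ (T.strH.anchor x a))
  map_one' := by simp
  map_zero' := by simp
  map_add' a b := by
    ext
    · simp only [map_add, TrivSqZeroExt.fst_add, TrivSqZeroExt.fst_inl, TrivSqZeroExt.fst_inr]
      abel
    · simp only [map_add, TrivSqZeroExt.snd_add, TrivSqZeroExt.snd_inl, TrivSqZeroExt.snd_inr]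
      abel
  map_mul' a b := by
    ext
    · simp
    · simp only [TrivSqZeroExt.snd_add, TrivSqZeroExt.snd_inl, TrivSqZeroExt.snd_inr,
        TrivSqZeroExt.snd_mul, TrivSqZeroExt.fst_add, TrivSqZeroExt.fst_inl,
        TrivSqZeroExt.fst_inr, Derivation.leibniz, map_add, smul_eq_mul, map_mul, zero_add,
        add_zero, MulOpposite.smul_eq_mul_unop, MulOpposite.unop_op]
      rw [Algebra.commutes b]

theorem dualBase_commutes (T : AlmostPreLRTriple R A H Q) (x : H) (a : A)
    (u : DualNumber (ExteriorAlgebra A Q)) : T.dualBase x a * u = u * T.dualBase x a := by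
  ext
  · simp [dualBase, Algebra.commutes]
  · simp only [dualBase, RingHom.coe_mk, MonoidHom.coe_mk, OneHom.coe_mk,
      TrivSqZeroExt.snd_add, TrivSqZeroExt.snd_inl, TrivSqZeroExt.snd_inr,
      TrivSqZeroExt.snd_mul, TrivSqZeroExt.fst_add, TrivSqZeroExt.fst_inl,
      TrivSqZeroExt.fst_inr, zero_add, smul_eq_mul,
      add_zero, MulOpposite.smul_eq_mul_unop, MulOpposite.unop_op]
    rw [Algebra.commutes a, Algebra.commutes (T.strH.anchor x a)]
    abel

/-- The dual numbers over the exterior algebra, as an `A`-algebra by means of `dualBase`. -/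
def Twisted (_T : AlmostPreLRTriple R A H Q) (_x : H) : Type _ := DualNumber (ExteriorAlgebra A Q)

instance (T : AlmostPreLRTriple R A H Q) (x : H) : Ring (T.Twisted x) :=
  inferInstanceAs (Ring (DualNumber (ExteriorAlgebra A Q)))

instance (T : AlmostPreLRTriple R A H Q) (x : H) : Algebra A (T.Twisted x) :=
  (T.dualBase x).toAlgebra' (T.dualBase_commutes x)

/-- `ξ ↦ ξ + ε (x · ξ)`. -/
def dualLin (T : AlmostPreLRTriple R A H Q) (x : H) : Q →ₗ[A] T.Twisted x where
  toFun ξ := ((ExteriorAlgebra.ι A ξ, ExteriorAlgebra.ι A (T.actHQ.act x ξ)) :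
    DualNumber (ExteriorAlgebra A Q))
  map_add' ξ η := by
    refine TrivSqZeroExt.ext ?_ ?_
    · exact map_add (ExteriorAlgebra.ι A) ξ η
    · change ExteriorAlgebra.ι A (T.actHQ.act x (ξ + η)) =
        ExteriorAlgebra.ι A (T.actHQ.act x ξ) + ExteriorAlgebra.ι A (T.actHQ.act x η)
      rw [map_add, map_add]
  map_smul' a ξ := by
    refine Eq.trans ?_ (Algebra.smul_def a (_ : T.Twisted x)).symm
    change _ = T.dualBase x a * (_ : DualNumber (ExteriorAlgebra A Q))
    refine TrivSqZeroExt.ext ?_ ?_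
    · refine Eq.trans ?_ (TrivSqZeroExt.fst_mul (T.dualBase x a)
        (_ : DualNumber (ExteriorAlgebra A Q))).symm
      change ExteriorAlgebra.ι A (a • ξ) = (algebraMap A _ a + 0) * ExteriorAlgebra.ι A ξ
      rw [map_smul, Algebra.smul_def, add_zero]
    · refine Eq.trans ?_ (TrivSqZeroExt.snd_mul (T.dualBase x a)
        (_ : DualNumber (ExteriorAlgebra A Q))).symm
      change ExteriorAlgebra.ι A (T.actHQ.act x (a • ξ)) =
        (algebraMap A _ a + 0) * ExteriorAlgebra.ι A (T.actHQ.act x ξ) +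
        (0 + algebraMap A _ (T.strH.anchor x a)) * ExteriorAlgebra.ι A ξ
      rw [T.actHQ.act_smul, map_add, map_smul, map_smul, Algebra.smul_def, Algebra.smul_def,
        add_zero, zero_add, add_comm]

/-- The ring homomorphism `u ↦ u + ε (x · u)` determined by `a ↦ a + ε x(a)` on `A` and
`ξ ↦ ξ + ε (x · ξ)` on `Q`. -/
def dualHom (T : AlmostPreLRTriple R A H Q) (x : H) :
    ExteriorAlgebra A Q →ₐ[A] T.Twisted x :=
  ExteriorAlgebra.lift A ⟨T.dualLin x, fun ξ => by
    refine TrivSqZeroExt.ext ?_ ?_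
    · exact (TrivSqZeroExt.fst_mul (_ : DualNumber (ExteriorAlgebra A Q)) _).trans
        (ExteriorAlgebra.ι_sq_zero ξ)
    · refine (TrivSqZeroExt.snd_mul (_ : DualNumber (ExteriorAlgebra A Q)) _).trans ?_
      exact ExteriorAlgebra.ι_add_mul_swap ξ (T.actHQ.act x ξ)⟩

/-- The action `u ↦ x · u` of `x ∈ H` on `Λ_A Q`. -/
def lambdaFun (T : AlmostPreLRTriple R A H Q) (x : H) (u : ExteriorAlgebra A Q) :
    ExteriorAlgebra A Q :=
  TrivSqZeroExt.snd (show DualNumber (ExteriorAlgebra A Q) from T.dualHom x u)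

theorem dualHom_ι (T : AlmostPreLRTriple R A H Q) (x : H) (ξ : Q) :
    T.dualHom x (ExteriorAlgebra.ι A ξ) = T.dualLin x ξ :=
  ExteriorAlgebra.lift_ι_apply A (T.dualLin x) _ ξ

theorem fst_dualHom (T : AlmostPreLRTriple R A H Q) (x : H) (u : ExteriorAlgebra A Q) :
    TrivSqZeroExt.fst (show DualNumber (ExteriorAlgebra A Q) from T.dualHom x u) = u := by
  induction u using CliffordAlgebra.induction with
  | algebraMap a =>
    rw [AlgHom.commutes]
    change algebraMap A _ a + 0 = _
    rw [add_zero]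
  | ι ξ =>
    exact congrArg (TrivSqZeroExt.fst : DualNumber (ExteriorAlgebra A Q) → _) (T.dualHom_ι x ξ)
  | mul u v hu hv =>
    rw [map_mul]
    exact (TrivSqZeroExt.fst_mul (_ : DualNumber (ExteriorAlgebra A Q)) _).trans
      (congrArg₂ (· * ·) hu hv)
  | add u v hu hv =>
    rw [map_add]
    exact congrArg₂ (· + ·) hu hv

theorem lambdaFun_add (T : AlmostPreLRTriple R A H Q) (x : H) (u v : ExteriorAlgebra A Q) :
    T.lambdaFun x (u + v) = T.lambdaFun x u + T.lambdaFun x v :=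
  congrArg (TrivSqZeroExt.snd : DualNumber (ExteriorAlgebra A Q) → _) (map_add (T.dualHom x) u v)

theorem lambdaFun_mul (T : AlmostPreLRTriple R A H Q) (x : H) (u v : ExteriorAlgebra A Q) :
    T.lambdaFun x (u * v) = T.lambdaFun x u * v + u * T.lambdaFun x v := by
  have h := congrArg (TrivSqZeroExt.snd : DualNumber (ExteriorAlgebra A Q) → _)
    (map_mul (T.dualHom x) u v)
  refine h.trans ((TrivSqZeroExt.snd_mul (_ : DualNumber (ExteriorAlgebra A Q)) _).trans ?_)
  have hu := T.fst_dualHom x u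
  have hv := T.fst_dualHom x v
  change TrivSqZeroExt.fst (T.dualHom x u : DualNumber (ExteriorAlgebra A Q)) * T.lambdaFun x v +
    T.lambdaFun x u * TrivSqZeroExt.fst (T.dualHom x v : DualNumber (ExteriorAlgebra A Q)) = _
  rw [add_comm]
  exact congrArg₂ (· + ·) (congrArg _ hv) (congrArg (· * _) hu)

theorem lambdaFun_algebraMap (T : AlmostPreLRTriple R A H Q) (x : H) (a : A) :
    T.lambdaFun x (algebraMap A _ a) = algebraMap A _ (T.strH.anchor x a) := by
  have h := congrArg (TrivSqZeroExt.snd : DualNumber (ExteriorAlgebra A Q) → _)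
    (AlgHom.commutes (T.dualHom x) a)
  refine h.trans ?_
  change 0 + algebraMap A _ (T.strH.anchor x a) = _
  rw [zero_add]

theorem lambdaFun_ι (T : AlmostPreLRTriple R A H Q) (x : H) (ξ : Q) :
    T.lambdaFun x (ExteriorAlgebra.ι A ξ) = ExteriorAlgebra.ι A (T.actHQ.act x ξ) :=
  congrArg (TrivSqZeroExt.snd : DualNumber (ExteriorAlgebra A Q) → _)
    (T.dualHom_ι x ξ)

theorem lambdaFun_smul (T : AlmostPreLRTriple R A H Q) (x : H) (a : A) (u : ExteriorAlgebra A Q) :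
    T.lambdaFun x (a • u) = T.strH.anchor x a • u + a • T.lambdaFun x u := by
  rw [Algebra.smul_def, lambdaFun_mul, lambdaFun_algebraMap, ← Algebra.smul_def,
    ← Algebra.smul_def]

theorem lambdaFun_add_left (T : AlmostPreLRTriple R A H Q) (x y : H) (u : ExteriorAlgebra A Q) :
    T.lambdaFun (x + y) u = T.lambdaFun x u + T.lambdaFun y u := by
  induction u using CliffordAlgebra.induction with
  | algebraMap a =>
    have := fun x => T.lambdaFun_algebraMap x a
    simp only [ExteriorAlgebra] at this
    rw [this, this, this, map_add, Derivation.add_apply, map_add]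
  | ι ξ =>
    have := fun x => T.lambdaFun_ι x ξ
    simp only [ExteriorAlgebra.ι] at this
    rw [this, this, this, map_add, LinearMap.add_apply, map_add]
  | mul u v hu hv =>
    rw [lambdaFun_mul, lambdaFun_mul, lambdaFun_mul, hu, hv, add_mul, mul_add]
    abel
  | add u v hu hv =>
    rw [lambdaFun_add, lambdaFun_add, lambdaFun_add, hu, hv]
    abel

theorem lambdaFun_smul_left (T : AlmostPreLRTriple R A H Q) (a : A) (x : H)
    (u : ExteriorAlgebra A Q) : T.lambdaFun (a • x) u = a • T.lambdaFun x u := by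
  induction u using CliffordAlgebra.induction with
  | algebraMap b =>
    have := fun x => T.lambdaFun_algebraMap x b
    simp only [ExteriorAlgebra] at this
    rw [this, this, map_smul, Derivation.smul_apply, smul_eq_mul, map_mul, Algebra.smul_def]
  | ι ξ =>
    have := fun x => T.lambdaFun_ι x ξ
    simp only [ExteriorAlgebra.ι] at this
    rw [this, this, map_smul, LinearMap.smul_apply, map_smul]
  | mul u v hu hv =>
    rw [lambdaFun_mul, lambdaFun_mul, hu, hv, smul_add, smul_mul_assoc, mul_smul_comm]
  | add u v hu hv =>
    rw [lambdaFun_add, lambdaFun_add, hu, hv, smul_add]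

/-- The action of `H` on `Λ_A Q` by derivations. -/
def lambdaConn (T : AlmostPreLRTriple R A H Q) : T.strH.Connection (ExteriorAlgebra A Q) where
  act :=
    { toFun := fun x =>
        { toFun := T.lambdaFun x
          map_add' := T.lambdaFun_add x
          map_smul' := fun r u => by
            rw [← algebraMap_smul A r u, lambdaFun_smul, Derivation.map_algebraMap, zero_smul,
              zero_add, algebraMap_smul, RingHom.id_apply] }
      map_add' := fun x y => LinearMap.ext fun u => T.lambdaFun_add_left x y u
      map_smul' := fun a x => LinearMap.ext fun u => T.lambdaFun_smul_left a x u }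
  act_smul := T.lambdaFun_smul

theorem lambdaConn_act (T : AlmostPreLRTriple R A H Q) (x : H) (u : ExteriorAlgebra A Q) :
    T.lambdaConn.act x u = T.lambdaFun x u := rfl

end AlmostPreLRTriple

/-! ### Bigraded commutative algebras, differential operators and quasi-Batalin-Vilkovisky algebras -/

section BV

variable {R G : Type*} [CommRing R] [AddCommGroup G] [Module R G]

/-- `G` with the product `mul` and the unit `one` is a bigraded commutative `R`-algebra;
`comp q p` is the constituent `G^q_p`, and the signs are determined by the parity of `q + p`
(equivalently, of the total degree `p - q`). -/
structure IsBigradedCommAlgebra (mul : G →ₗ[R] G →ₗ[R] G) (one : G)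
    (comp : ℕ → ℕ → Submodule R G) : Prop where
  isInternal : DirectSum.IsInternal fun i : ℕ × ℕ => comp i.1 i.2
  one_mem : one ∈ comp 0 0
  mul_mem : ∀ q p q' p' : ℕ, ∀ a ∈ comp q p, ∀ b ∈ comp q' p', mul a b ∈ comp (q + q') (p + p')
  one_mul : ∀ a, mul one a = a
  mul_one : ∀ a, mul a one = a
  mul_assoc : ∀ a b c, mul (mul a b) c = mul a (mul b c)
  mul_comm : ∀ q p q' p' : ℕ, ∀ a ∈ comp q p, ∀ b ∈ comp q' p',
    mul a b = (-1 : ℤ) ^ ((q + p) * (q' + p')) • mul b a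

/-- The form `Φ²_D(a, b)`, for `a`, `b` homogeneous of degrees `i`, `j` modulo `2`. -/
def formTwo (mul : G →ₗ[R] G →ₗ[R] G) (one : G) (D : G →ₗ[R] G) (i j : ℕ) (a b : G) : G :=
  D (mul a b) - mul (D a) b - (-1 : ℤ) ^ (i * j) • mul (D b) a + mul (D one) (mul a b)

/-- The form `Φ³_D(a, b, c)`, for `a`, `b`, `c` homogeneous of degrees `i`, `j`, `k`
modulo `2`. -/
def formThree (mul : G →ₗ[R] G →ₗ[R] G) (one : G) (D : G →ₗ[R] G) (i j k : ℕ) (a b c : G) : G :=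
  D (mul (mul a b) c)
  - mul (D (mul a b)) c - (-1 : ℤ) ^ (i * (j + k)) • mul (D (mul b c)) a
  - (-1 : ℤ) ^ (k * (i + j)) • mul (D (mul c a)) b
  + mul (mul (D a) b) c + (-1 : ℤ) ^ (i * (j + k)) • mul (mul (D b) c) a
  + (-1 : ℤ) ^ (k * (i + j)) • mul (mul (D c) a) b
  - mul (mul (mul (D one) a) b) c

/-- The form `Φ⁴_D(a, b, c, e)`, for `a`, `b`, `c`, `e` homogeneous of degrees `i`, `j`, `k`, `l`
modulo `2`. -/
def formFour (mul : G →ₗ[R] G →ₗ[R] G) (one : G) (D : G →ₗ[R] G) (i j k l : ℕ)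
    (a b c e : G) : G :=
  formThree mul one D i j (k + l) a b (mul c e) - mul (formThree mul one D i j k a b c) e
  - (-1 : ℤ) ^ (k * l) • mul (formThree mul one D i j l a b e) c

/-- `D` is a differential operator of order `≤ 1`. -/
def OrderLeOne (mul : G →ₗ[R] G →ₗ[R] G) (one : G) (comp : ℕ → ℕ → Submodule R G)
    (D : G →ₗ[R] G) : Prop :=
  ∀ q p q' p' : ℕ, ∀ a ∈ comp q p, ∀ b ∈ comp q' p', formTwo mul one D (q + p) (q' + p') a b = 0

/-- `D` is a differential operator of order `≤ 2`. -/
def OrderLeTwo (mul : G →ₗ[R] G →ₗ[R] G) (one : G) (comp : ℕ → ℕ → Submodule R G)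
    (D : G →ₗ[R] G) : Prop :=
  ∀ q p q' p' q'' p'' : ℕ, ∀ a ∈ comp q p, ∀ b ∈ comp q' p', ∀ c ∈ comp q'' p'',
    formThree mul one D (q + p) (q' + p') (q'' + p'') a b c = 0

/-- `D` is a differential operator of order `≤ 3`. -/
def OrderLeThree (mul : G →ₗ[R] G →ₗ[R] G) (one : G) (comp : ℕ → ℕ → Submodule R G)
    (D : G →ₗ[R] G) : Prop :=
  ∀ q p q' p' q'' p'' s t : ℕ, ∀ a ∈ comp q p, ∀ b ∈ comp q' p', ∀ c ∈ comp q'' p'', ∀ e ∈ comp s t,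
    formFour mul one D (q + p) (q' + p') (q'' + p'') (s + t) a b c e = 0

/-- `(G; d, Δ, Ψ)` is a quasi-Batalin-Vilkovisky algebra. -/
structure IsQuasiBV (mul : G →ₗ[R] G →ₗ[R] G) (one : G) (comp : ℕ → ℕ → Submodule R G)
    (d Δ Ψ : G →ₗ[R] G) : Prop where
  algebra : IsBigradedCommAlgebra mul one comp
  d_mem : ∀ q p : ℕ, ∀ a ∈ comp q p, d a ∈ comp (q + 1) p
  delta_mem : ∀ q p : ℕ, ∀ a ∈ comp q (p + 1), Δ a ∈ comp q p
  delta_zero : ∀ q : ℕ, ∀ a ∈ comp q 0, Δ a = 0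
  psi_mem : ∀ q p : ℕ, ∀ a ∈ comp (q + 1) (p + 2), Ψ a ∈ comp q p
  psi_zero : ∀ q p : ℕ, q = 0 ∨ p ≤ 1 → ∀ a ∈ comp q p, Ψ a = 0
  d_order : OrderLeOne mul one comp d
  delta_order : OrderLeTwo mul one comp Δ
  psi_order : OrderLeThree mul one comp Ψ
  d_one : d one = 0
  delta_one : Δ one = 0
  psi_one : Ψ one = 0
  d_d : ∀ a, d (d a) = 0
  d_delta : ∀ a, d (Δ a) + Δ (d a) = 0
  d_psi : ∀ a, d (Ψ a) + Δ (Δ a) + Ψ (d a) = 0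
  delta_psi : ∀ a, Δ (Ψ a) + Ψ (Δ a) = 0
  psi_psi : ∀ a, Ψ (Ψ a) = 0

/-- The bracket `br` has bidegree `(0, -1)`. -/
def HasBracketBidegree (comp : ℕ → ℕ → Submodule R G) (br : G →ₗ[R] G →ₗ[R] G) : Prop :=
  ∀ q p q' p' : ℕ, ∀ a ∈ comp q p, ∀ b ∈ comp q' p',
    (∀ r : ℕ, p + p' = r + 1 → br a b ∈ comp (q + q') r) ∧ (p + p' = 0 → br a b = 0)

/-- The bracket `br` is graded skew-symmetric when the total degree is regraded down by one. -/
def IsGradedSkew (comp : ℕ → ℕ → Submodule R G) (br : G →ₗ[R] G →ₗ[R] G) : Prop :=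
  ∀ q p q' p' : ℕ, ∀ a ∈ comp q p, ∀ b ∈ comp q' p',
    br a b = - ((-1 : ℤ) ^ ((q + p + 1) * (q' + p' + 1)) • br b a)

/-- `Δ` is a strict generator of the bracket `br` (with respect to `d` and `Ψ`). -/
structure IsStrictGenerator (mul : G →ₗ[R] G →ₗ[R] G) (one : G) (comp : ℕ → ℕ → Submodule R G)
    (d Δ Ψ : G →ₗ[R] G) (br : G →ₗ[R] G →ₗ[R] G) : Prop where
  delta_mem : ∀ q p : ℕ, ∀ a ∈ comp q (p + 1), Δ a ∈ comp q p
  delta_zero : ∀ q : ℕ, ∀ a ∈ comp q 0, Δ a = 0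
  generates : ∀ q p q' p' : ℕ, ∀ a ∈ comp q p, ∀ b ∈ comp q' p',
    br a b = (-1 : ℤ) ^ (q + p) •
      (Δ (mul a b) - mul (Δ a) b - (-1 : ℤ) ^ (q + p) • mul a (Δ b))
  delta_one : Δ one = 0
  d_delta : ∀ a, d (Δ a) + Δ (d a) = 0
  d_psi : ∀ a, d (Ψ a) + Δ (Δ a) + Ψ (d a) = 0
  delta_psi : ∀ a, Δ (Ψ a) + Ψ (Δ a) = 0

end BV

/-- Property P of an `A`-module: the elements are separated by the linear forms. -/
def PropertyP (A M : Type*) [CommRing A] [AddCommGroup M] [Module A M] : Prop :=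
  ∀ x : M, (∀ f : M →ₗ[A] A, f x = 0) → x = 0

open Classical in
/-- The inverse of a bijective linear map (and `0` if the map is not bijective). -/
noncomputable def linInv {A M N : Type*} [CommSemiring A] [AddCommMonoid M] [Module A M]
    [AddCommMonoid N] [Module A N] (f : M →ₗ[A] N) : N →ₗ[A] M :=
  if h : Function.Bijective f then (LinearEquiv.ofBijective f h).symm.toLinearMap else 0

/-! ### The algebra `Alt_A(H, Λ_A Q)` -/

/-- `Alt_A^q(H, Λ_A Q)`. -/
abbrev FormDeg (A H Q : Type*) [CommRing A] [AddCommGroup H] [Module A H] [AddCommGroup Q]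
    [Module A Q] (q : ℕ) : Type _ := H [⋀^Fin q]→ₗ[A] ExteriorAlgebra A Q

/-- `Alt_A(H, Λ_A Q)`. -/
abbrev Form (A H Q : Type*) [CommRing A] [AddCommGroup H] [Module A H] [AddCommGroup Q]
    [Module A Q] : Type _ := DirectSum ℕ (FormDeg A H Q)

open scoped TensorProduct

namespace Form

section
variable {A H Q : Type*} [CommRing A] [AddCommGroup H] [Module A H] [AddCommGroup Q] [Module A Q]

/-- The operator on `Λ_A Q` which is `(-1)^(p k)` on `Λ^p_A Q`. -/
noncomputable def sgn (A Q : Type*) [CommRing A] [AddCommGroup Q] [Module A Q] (k : ℕ) :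
    ExteriorAlgebra A Q →ₗ[A] ExteriorAlgebra A Q :=
  (CliffordAlgebra.involute (Q := (0 : QuadraticForm A Q))).toLinearMap ^ k

/-- The product of forms of degrees `q` and `r`; for `f`, `g` with values in `Λ^p_A Q` and
`Λ^s_A Q`, it is `(-1)^(q (r + s))` times the shuffle product of `f` and `g`. -/
noncomputable def mulDeg (A H Q : Type*) [CommRing A] [AddCommGroup H] [Module A H]
    [AddCommGroup Q] [Module A Q] (q r : ℕ) :
    FormDeg A H Q q →ₗ[A] FormDeg A H Q r →ₗ[A] FormDeg A H Q (q + r) :=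
  LinearMap.mk₂ A (fun f g => (-1 : ℤ) ^ (q * r) •
      ((LinearMap.mul' A (ExteriorAlgebra A Q)).compAlternatingMap
        (f.domCoprod ((sgn A Q q).compAlternatingMap g))).domDomCongr finSumFinEquiv)
    (fun f f' g => by
      simp only [← AlternatingMap.domCoprod'_apply, TensorProduct.add_tmul, map_add]
      ext v
      simp)
    (fun a f g => by
      simp only [← AlternatingMap.domCoprod'_apply, ← TensorProduct.smul_tmul', map_smul]
      ext v
      simp [smul_comm a])
    (fun f g g' => by
      simp only [← AlternatingMap.domCoprod'_apply, LinearMap.compAlternatingMap_add,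
        TensorProduct.tmul_add, map_add]
      ext v
      simp)
    (fun a f g => by
      simp only [← AlternatingMap.domCoprod'_apply, LinearMap.compAlternatingMap_smul,
        TensorProduct.tmul_smul, map_smul]
      ext v
      simp [smul_comm a])

/-- The map `Λ_A Q → A` which is `ω` on `Λ^n_A Q` and zero on `Λ^p_A Q` for `p ≠ n`. -/
noncomputable def omegaExt {n : ℕ} (ω : ⋀[A]^n Q ≃ₗ[A] A) : ExteriorAlgebra A Q →ₗ[A] A :=
  ExteriorAlgebra.liftAlternating
    (Pi.single n (ω.toLinearMap.compAlternatingMap (exteriorPower.ιMulti A n)))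

/-- `φ^ω` in degree `q`, as a map to `∏ m, Alt_A^m(Q, Alt_A^q(H, A))`: for `f` with values in
`Λ^p_A Q`, the only nonzero component of `φ^ω(f)` is that for `m = n - p`, and
`φ^ω(f)(ξ_1, …, ξ_m)(x) = (-1)^(m q) ω(f(x) ∧ ξ_1 ∧ … ∧ ξ_m)`. -/
noncomputable def phi {n : ℕ} (ω : ⋀[A]^n Q ≃ₗ[A] A) (H : Type*) [AddCommGroup H] [Module A H]
    (q : ℕ) : FormDeg A H Q q →ₗ[A] ∀ m : ℕ, Q [⋀^Fin m]→ₗ[A] (H [⋀^Fin q]→ₗ[A] A) :=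
  LinearMap.pi fun m =>
    { toFun := fun f => (-1 : ℤ) ^ (m * q) •
        (({ toFun := fun u => (omegaExt ω ∘ₗ LinearMap.mulRight A u).compAlternatingMap f
            map_add' := fun u v => by ext; simp [mul_add]
            map_smul' := fun a u => by ext; simp } :
          ExteriorAlgebra A Q →ₗ[A] (H [⋀^Fin q]→ₗ[A] A)).compAlternatingMap
            (ExteriorAlgebra.ιMulti A m))
      map_add' := fun f g => by ext; simp
      map_smul' := fun a f => by ext; simp [smul_comm a] }

theorem phi_apply {n : ℕ} (ω : ⋀[A]^n Q ≃ₗ[A] A) (q m : ℕ) (f : FormDeg A H Q q) (ξ : Fin m → Q)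
    (x : Fin q → H) : phi ω H q f m ξ x =
      (-1 : ℤ) ^ (m * q) • omegaExt ω (f x * ExteriorAlgebra.ιMulti A m ξ) := rfl

/-- The canonical map `Alt_A^q(H, A) ⊗_A Λ_A Q → Alt_A^q(H, Λ_A Q)` sending `β ⊗ u` to the
product `β u`, that is, to `x ↦ (-1)^(q p) β(x) u` if `u ∈ Λ^p_A Q`. -/
noncomputable def canon (A H Q : Type*) [CommRing A] [AddCommGroup H] [Module A H]
    [AddCommGroup Q] [Module A Q] (q : ℕ) :
    TensorProduct A (H [⋀^Fin q]→ₗ[A] A) (ExteriorAlgebra A Q) →ₗ[A] FormDeg A H Q q :=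
  TensorProduct.lift (LinearMap.mk₂ A (fun β u => β.smulRight (sgn A Q q u))
    (fun β β' u => by ext; simp [add_smul])
    (fun a β u => by ext; simp [mul_smul])
    (fun β u v => by ext; simp)
    (fun a β u => by ext; simp [smul_comm a]))

theorem canon_tmul (q : ℕ) (β : H [⋀^Fin q]→ₗ[A] A) (u : ExteriorAlgebra A Q) (x : Fin q → H) :
    canon A H Q q (β ⊗ₜ u) x = β x • sgn A Q q u := rfl

end

section
variable {R A H Q : Type*} [CommRing R] [CommRing A] [Algebra R A]
  [AddCommGroup H] [Module A H] [AddCommGroup Q] [Module R Q] [Module A Q] [IsScalarTower R A Q]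

variable (R A H Q) in
/-- The product of `Alt_A(H, Λ_A Q)`. -/
noncomputable def mul : Form A H Q →ₗ[R] Form A H Q →ₗ[R] Form A H Q :=
  DirectSum.toModule R ℕ _ fun q => LinearMap.flip <| DirectSum.toModule R ℕ _ fun r =>
    LinearMap.flip <| LinearMap.mk₂ R
      (fun f g => DirectSum.lof R ℕ (FormDeg A H Q) (q + r) (mulDeg A H Q q r f g))
      (fun f f' g => by simp only [map_add, LinearMap.add_apply])
      (fun c f g => by
        rw [← algebraMap_smul A c f, map_smul, LinearMap.smul_apply, algebraMap_smul, map_smul])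
      (fun f g g' => by simp only [map_add])
      (fun c f g => by
        rw [← algebraMap_smul A c g, map_smul, algebraMap_smul, map_smul])

theorem mul_lof (q r : ℕ) (f : FormDeg A H Q q) (g : FormDeg A H Q r) :
    mul R A H Q (DirectSum.lof R ℕ (FormDeg A H Q) q f) (DirectSum.lof R ℕ (FormDeg A H Q) r g) =
      DirectSum.lof R ℕ (FormDeg A H Q) (q + r) (mulDeg A H Q q r f g) := by
  simp [mul, LinearMap.flip_apply]

variable (R A H Q) in
/-- The unit of `Alt_A(H, Λ_A Q)`. -/
noncomputable def one : Form A H Q :=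
  DirectSum.lof R ℕ (FormDeg A H Q) 0 (AlternatingMap.constOfIsEmpty A H (Fin 0) 1)

variable (R A H Q) in
/-- The constituent `Alt_A^q(H, Λ^p_A Q)` of `Alt_A(H, Λ_A Q)`. -/
noncomputable def comp (q p : ℕ) : Submodule R (Form A H Q) :=
  Submodule.map (DirectSum.lof R ℕ (FormDeg A H Q) q)
    { carrier := {f | ∀ x, f x ∈ ⋀[A]^p Q}
      add_mem' := fun hf hg x => Submodule.add_mem _ (hf x) (hg x)
      zero_mem' := fun _ => Submodule.zero_mem _
      smul_mem' := fun c f hf x => by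
        rw [← algebraMap_smul A c f]
        exact Submodule.smul_mem _ _ (hf x) }

variable (R A Q) in
/-- An element of `Alt_A^q(H, A)` as an element of `Alt_A(H, Λ_A Q)`. -/
noncomputable def ofForm {q : ℕ} (β : H [⋀^Fin q]→ₗ[A] A) : Form A H Q :=
  DirectSum.lof R ℕ (FormDeg A H Q) q ((Algebra.linearMap A _).compAlternatingMap β)

variable (R A H) in
/-- An element of `Q` as an element of `Alt_A^0(H, Λ^1_A Q)`. -/
noncomputable def ofQ (ξ : Q) : Form A H Q :=
  DirectSum.lof R ℕ (FormDeg A H Q) 0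
    (AlternatingMap.constOfIsEmpty A H (Fin 0) (ExteriorAlgebra.ι A ξ))

end

end Form

namespace AlmostPreLRTriple

variable {R A H Q : Type*} [CommRing R] [CommRing A] [Algebra R A]
  [AddCommGroup H] [Module R H] [Module A H] [IsScalarTower R A H]
  [AddCommGroup Q] [Module R Q] [Module A Q] [IsScalarTower R A Q]

/-- The isomorphism `ω` is invariant under `H`. -/
def IsInvariant (T : AlmostPreLRTriple R A H Q) {n : ℕ} (ω : ⋀[A]^n Q ≃ₗ[A] A) : Prop :=
  ∀ (x : H) (ξ : Fin n → Q), T.strH.anchor x (ω (exteriorPower.ιMulti A n ξ)) =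
    ∑ j, ω (exteriorPower.ιMulti A n (Function.update ξ j (T.actHQ.act x (ξ j))))

/-- The operator `d` on `Alt_A(H, Λ_A Q)`: on `Alt_A^q(H, Λ^p_A Q)`, it is `(-1)^(q + p + 1)` times
the Cartan-Chevalley-Eilenberg expression. -/
noncomputable def d (T : AlmostPreLRTriple R A H Q) : Form A H Q →ₗ[R] Form A H Q :=
  DirectSum.toModule R ℕ _ fun q => DirectSum.lof R ℕ (FormDeg A H Q) (q + 1) ∘ₗ
    ((-1 : ℤ) ^ (q + 1) • ((Form.sgn A Q 1).compAlternatingMapₗ R).comp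
      (AlmostLieRinehart.ce T.lambdaConn q))

/-- The operator `d_1` on `∏ m, Alt_A^m(Q, Alt_A^q(H, A))`: on `Alt_A^m(Q, Alt_A^q(H, A))`, it is
`(-1)^(m + q + 1)` times the Cartan-Chevalley-Eilenberg expression. -/
noncomputable def dOne (T : AlmostPreLRTriple R A H Q) (q : ℕ) :
    (∀ m : ℕ, Q [⋀^Fin m]→ₗ[A] (H [⋀^Fin q]→ₗ[A] A)) →ₗ[R]
      ∀ m : ℕ, Q [⋀^Fin m]→ₗ[A] (H [⋀^Fin q]→ₗ[A] A) :=
  LinearMap.pi fun m => match m with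
    | 0 => 0
    | m + 1 => (-1 : ℤ) ^ (m + q + 1) • (AlmostLieRinehart.ce (T.lieConn q) m).comp
        (LinearMap.proj m)

/-- The operator `Δ_ω`, with `φ^ω(Δ_ω(f)) = (-1)^(n + 1) d_1(φ^ω(f))`. -/
noncomputable def Delta (T : AlmostPreLRTriple R A H Q) {n : ℕ} (ω : ⋀[A]^n Q ≃ₗ[A] A) :
    Form A H Q →ₗ[R] Form A H Q :=
  DirectSum.toModule R ℕ _ fun q => DirectSum.lof R ℕ (FormDeg A H Q) q ∘ₗ
    (linInv (Form.phi ω H q)).restrictScalars R ∘ₗ ((-1 : ℤ) ^ (n + 1) • T.dOne q) ∘ₗ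
      (Form.phi ω H q).restrictScalars R

/-- The map `Λ_A Q → H ⊗_A Λ_A Q` sending `ξ_1 ∧ … ∧ ξ_p` to
`∑_{j<k} (-1)^(j+k) δ(ξ_j, ξ_k) ⊗ (ξ_1 ∧ … omit ξ_j, ξ_k … ∧ ξ_p)`. -/
noncomputable def kappa (T : AlmostPreLRTriple R A H Q) :
    ExteriorAlgebra A Q →ₗ[A] TensorProduct A H (ExteriorAlgebra A Q) :=
  ExteriorAlgebra.liftAlternating fun m => match m with
    | 0 => 0
    | 1 => 0
    | p + 2 => AltTools.pairSumAlt (LinearMap.mk₂ A (fun ξ η =>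
        (TensorProduct.mk A H (ExteriorAlgebra A Q) (T.delta ξ η)).compAlternatingMap
          (ExteriorAlgebra.ιMulti A p))
        (fun ξ ξ' η => by ext; simp [TensorProduct.add_tmul])
        (fun a ξ η => by ext; simp [TensorProduct.smul_tmul'])
        (fun ξ η η' => by ext; simp)
        (fun a ξ η => by ext; simp [TensorProduct.smul_tmul']))
      (fun ξ => by ext; simp [T.delta_self])

theorem kappa_ιMulti (T : AlmostPreLRTriple R A H Q) (p : ℕ) (ξ : Fin (p + 2) → Q) :
    T.kappa (ExteriorAlgebra.ιMulti A (p + 2) ξ) = AltTools.pairSum (fun η ζ w =>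
      T.delta η ζ ⊗ₜ[A] ExteriorAlgebra.ιMulti A p w) ξ := by
  rw [kappa, ExteriorAlgebra.liftAlternating_apply_ιMulti]
  rfl

/-- The contraction `x ↦ (-1)^q β(x, …) = β(…, x)`, for `β` of degree `q + 1`. -/
noncomputable def contr {A H : Type*} [CommRing A] [AddCommGroup H]
    [Module A H] {q : ℕ} (β : H [⋀^Fin (q + 1)]→ₗ[A] A) :
    H →ₗ[A] (H [⋀^Fin q]→ₗ[A] A) := (-1 : ℤ) ^ q • β.curryLeft

/-- The operator
`β ⊗ (ξ_1 ∧ … ∧ ξ_p) ↦ ∑_{j<k} (-1)^(j+k) ⟨ξ_j, ξ_k; β⟩ ⊗ (ξ_1 ∧ … omit ξ_j, ξ_k … ∧ ξ_p)`, where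
`⟨ξ, η; β⟩ = β(…, δ(ξ, η))`. -/
noncomputable def psiTensor (T : AlmostPreLRTriple R A H Q) (q : ℕ) :
    TensorProduct A (H [⋀^Fin (q + 1)]→ₗ[A] A) (ExteriorAlgebra A Q) →ₗ[A]
      TensorProduct A (H [⋀^Fin q]→ₗ[A] A) (ExteriorAlgebra A Q) :=
  TensorProduct.lift (LinearMap.mk₂ A
    (fun β u => (contr β).rTensor (ExteriorAlgebra A Q) (T.kappa u))
    (fun β β' u => by
      rw [show contr (β + β') = contr β + contr β' by ext; simp [contr], LinearMap.rTensor_add,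
        LinearMap.add_apply])
    (fun a β u => by
      rw [show contr (a • β) = a • contr β by ext; simp [contr, smul_comm a],
        LinearMap.rTensor_smul, LinearMap.smul_apply])
    (fun β u v => by rw [map_add, map_add])
    (fun a β u => by rw [map_smul, map_smul]))

theorem psiTensor_tmul_ιMulti (T : AlmostPreLRTriple R A H Q) (q p : ℕ)
    (β : H [⋀^Fin (q + 1)]→ₗ[A] A) (ξ : Fin (p + 2) → Q) :
    T.psiTensor q (β ⊗ₜ ExteriorAlgebra.ιMulti A (p + 2) ξ) = AltTools.pairSum (fun η ζ w =>
      contr β (T.delta η ζ) ⊗ₜ[A] ExteriorAlgebra.ιMulti A p w) ξ := by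
  change (contr β).rTensor (ExteriorAlgebra A Q) (T.kappa _) = _
  rw [kappa_ιMulti]
  simp only [AltTools.pairSum, map_sum]
  refine Finset.sum_congr rfl fun i _ => Finset.sum_congr rfl fun k _ => ?_
  split_ifs
  · rw [map_zsmul, LinearMap.rTensor_tmul]
  · rw [map_zero]

/-- The operator `Ψ_δ`: it corresponds to `psiTensor` under the isomorphism `canon`, and it
vanishes on forms of degree `0`. -/
noncomputable def Psi (T : AlmostPreLRTriple R A H Q) : Form A H Q →ₗ[R] Form A H Q :=
  DirectSum.toModule R ℕ _ fun q => match q with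
    | 0 => 0
    | q + 1 => DirectSum.lof R ℕ (FormDeg A H Q) q ∘ₗ
        (Form.canon A H Q q ∘ₗ T.psiTensor q ∘ₗ linInv (Form.canon A H Q (q + 1))).restrictScalars R

/-- `br` is the extension to `Alt_A(H, Λ_A Q)` of the bracket on `Q` and the action of `Q` on
`Alt_A(H, A)`. -/
structure IsExtendedBracket (T : AlmostPreLRTriple R A H Q)
    (br : Form A H Q →ₗ[R] Form A H Q →ₗ[R] Form A H Q) : Prop where
  bidegree : HasBracketBidegree (G := Form A H Q) (Form.comp R A H Q) br
  skew : IsGradedSkew (G := Form A H Q) (Form.comp R A H Q) br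
  derivation : ∀ q p q' p' : ℕ, ∀ a ∈ Form.comp R A H Q q p, ∀ b ∈ Form.comp R A H Q q' p', ∀ c,
    br (Form.mul R A H Q a b) c = Form.mul R A H Q a (br b c) +
      (-1 : ℤ) ^ ((q + p) * (q' + p')) • Form.mul R A H Q b (br a c)
  bracket_form : ∀ (ξ : Q) (q : ℕ) (β : H [⋀^Fin q]→ₗ[A] A),
    br (Form.ofQ R A H ξ) (Form.ofForm R A Q β) = Form.ofForm R A Q (T.lieAlt ξ β)
  bracket_bracket : ∀ ξ η : Q,
    br (Form.ofQ R A H ξ) (Form.ofQ R A H η) = Form.ofQ R A H (T.strQ.bracket ξ η)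

end AlmostPreLRTriple

/-!
# Lie-Rinehart triples and quasi-Batalin-Vilkovisky algebras

Write `𝒢 = Alt_A(H, Λ_A Q)`. The functional `omegaExt ω : Λ_A Q → A` gives the pairing
`(u, w) ↦ ω(u ∧ w)`, which is perfect: the operators `w ↦ ω(a ∧ w) b` span a module which is stable
under composition with contractions on either side, because `Λ^{n+1} Q = 0`, and which contains
`ω(v_1 ∧ … ∧ v_n)` times the multiplication by `v_1 ∧ … ∧ v_n`; contracting with the cofactors of
the `v_i`, one obtains a power of `ω(v_1 ∧ … ∧ v_n)` times the identity, and these powers generate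
the unit ideal. The resulting dual systems (`Form.exists_dualBasis`) invert `φ^ω` and the canonical
map (`Form.phi_bijective`, `Form.canon_bijective`).

For `u = (x, ξ)` in `H ⊕ Q` let `i_u` be the sum of the contraction with `x` (`Form.iH`) and the
product with `- ξ` (`Form.iQ`). These are odd operators which anticommute, and an element of `𝒢` is
determined by the values of `eps` on its iterated images under them, where `eps` is `ω` applied to
the component of degree `0` in `H` (`Form.vanish_of_iH_iQ`). The operators satisfy Cartan formulas:
the supercommutator of `d` with a contraction is the Lie derivative along `x`; under the pairing,
`Δ_ω` is the Cartan-Chevalley-Eilenberg operator of `Q`, whence its supercommutator with `ξ` is the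
Lie derivative along `ξ`; and the double supercommutators of `Ψ_δ` are the contractions with the
`δ(ξ, η)`. Together, `D = d + Δ_ω + Ψ_δ` satisfies `[[i_u, D], i_v] = i_{[u, v]}` for the total
bracket of `H ⊕ Q`, and `eps ∘ [i_u, D] = u ∘ eps` (`AlmostPreLRTriple.isCalculus`).

By the vanishing principle, the Jacobi identity and the compatibility of the action with the bracket
imply `D² = 0` (`CartanCalculus.IsCalculus.D_mul_D`). Conversely, `D² = 0` implies that the
Jacobiator has zero contraction and that the action is compatible with the bracket
(`CartanCalculus.IsCalculus.jacobi_of_D_mul_D`), and property P says that an element of `H ⊕ Q` is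
determined by its contraction (`Form.eq_zero_of_iH_add_iQ`). The five relations between `d`, `Δ_ω`
and `Ψ_δ` are the components of `D² = 0` (`AlmostPreLRTriple.relations_of_D_D`).

The orders of the operators do not depend on the Jacobi identity. The forms `Φ^{r+1}` are iterated
defects of the product rule, and it suffices to take the defects along the generators
(`DiffOp.IsGeneratedBy.hasOrder_succ`), that is, along `Q`, as `Δ_ω` and `Ψ_δ` vanish on
`Alt_A(H, A)`. The defect of `Δ_ω` along `ξ` is a derivation, up to the sign the one by which `ξ`
acts on `𝒢` (`AlmostPreLRTriple.derQ_mul`), and the defect of `Ψ_δ` along `ξ` and `η` is the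
contraction with `δ(ξ, η)`. The bracket is the defect of `Δ_ω`, up to signs: it is a derivation in
each variable as `Δ_ω` has order `2`, and it takes the prescribed values on generators, which
determine it (`AlmostPreLRTriple.IsExtendedBracket.unique`).
-/

theorem AltTools.sum_apply {A M N ι κ : Type*} [CommRing A] [AddCommGroup M] [Module A M]
    [AddCommGroup N] [Module A N] (s : Finset κ) (f : κ → M [⋀^ι]→ₗ[A] N) (v : ι → M) :
    (∑ j ∈ s, f j) v = ∑ j ∈ s, f j v :=
  map_sum (⟨⟨fun g : M [⋀^ι]→ₗ[A] N => g v, rfl⟩, fun _ _ => rfl⟩ :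
    (M [⋀^ι]→ₗ[A] N) →+ N) f s

/-! ### The exterior algebra: signs, contractions and graded commutativity -/

namespace Form

section Exterior

variable {A Q : Type*} [CommRing A] [AddCommGroup Q] [Module A Q]

theorem sgn_add (k l : ℕ) (u : ExteriorAlgebra A Q) :
    sgn A Q (k + l) u = sgn A Q k (sgn A Q l u) := by
  rw [sgn, pow_add]; rfl

theorem sgn_mul (k : ℕ) (u v : ExteriorAlgebra A Q) :
    sgn A Q k (u * v) = sgn A Q k u * sgn A Q k v := by
  induction k generalizing u v with
  | zero => rfl
  | succ k ih =>
    rw [sgn_add, sgn_add, sgn_add, ← ih]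
    congr 1
    exact map_mul (CliffordAlgebra.involute (Q := (0 : QuadraticForm A Q))) u v

theorem sgn_algebraMap (k : ℕ) (a : A) :
    sgn A Q k (algebraMap A _ a) = algebraMap A _ a := by
  induction k with
  | zero => rfl
  | succ k ih =>
    rw [sgn_add]
    refine Eq.trans ?_ ih
    congr 1
    exact AlgHom.commutes (CliffordAlgebra.involute (Q := (0 : QuadraticForm A Q))) a

theorem sgn_one (k : ℕ) : sgn A Q k 1 = 1 := by
  simpa using sgn_algebraMap (Q := Q) k (1 : A)

theorem sgn_ι (k : ℕ) (ξ : Q) :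
    sgn A Q k (ExteriorAlgebra.ι A ξ) = (-1 : ℤ) ^ k • ExteriorAlgebra.ι A ξ := by
  induction k with
  | zero => simp [sgn]
  | succ k ih =>
    rw [sgn_add]
    have h : sgn A Q 1 (ExteriorAlgebra.ι A ξ) = - ExteriorAlgebra.ι A ξ :=
      CliffordAlgebra.involute_ι (Q := (0 : QuadraticForm A Q)) ξ
    rw [h, map_neg, ih, pow_succ]
    simp

theorem sgn_ιMulti (k m : ℕ) (v : Fin m → Q) : sgn A Q k (ExteriorAlgebra.ιMulti A m v) =
    (-1 : ℤ) ^ (k * m) • ExteriorAlgebra.ιMulti A m v := by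
  induction m with
  | zero => simp [sgn_one]
  | succ m ih =>
    rw [ExteriorAlgebra.ιMulti_succ_apply, sgn_mul, ih, sgn_ι, smul_mul_smul_comm, ← pow_add]
    congr 2; ring

theorem mem_exteriorPower_induction {p : ℕ} {P : ExteriorAlgebra A Q → Prop}
    (mul : ∀ v : Fin p → Q, P (ExteriorAlgebra.ιMulti A p v)) (zero : P 0)
    (add : ∀ u v, P u → P v → P (u + v)) (smul : ∀ (a : A) u, P u → P (a • u))
    {u : ExteriorAlgebra A Q} (hu : u ∈ ⋀[A]^p Q) : P u := by
  rw [← ExteriorAlgebra.ιMulti_span_fixedDegree] at hu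
  induction hu using Submodule.span_induction with
  | mem x hx => obtain ⟨v, rfl⟩ := hx; exact mul v
  | zero => exact zero
  | add u v _ _ hu hv => exact add u v hu hv
  | smul a u _ hu => exact smul a u hu

theorem sgn_of_mem {p : ℕ} (k : ℕ) {u : ExteriorAlgebra A Q} (hu : u ∈ ⋀[A]^p Q) :
    sgn A Q k u = (-1 : ℤ) ^ (k * p) • u := by
  refine mem_exteriorPower_induction (P := fun u => sgn A Q k u = (-1 : ℤ) ^ (k * p) • u)
    (fun v => sgn_ιMulti k p v) (by simp) ?_ ?_ hu
  · intro u v hu hv; rw [map_add, hu, hv, smul_add]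
  · intro a u hu; rw [map_smul, hu, smul_comm]

theorem sgn_sgn (k : ℕ) (u : ExteriorAlgebra A Q) : sgn A Q k (sgn A Q k u) = u := by
  rw [← sgn_add]
  induction u using CliffordAlgebra.induction with
  | algebraMap a => exact sgn_algebraMap _ a
  | ι ξ =>
    refine (sgn_ι _ ξ).trans ?_
    rw [← two_mul, pow_mul, neg_one_sq, one_pow, one_smul]
  | mul u v hu hv => rw [sgn_mul, hu, hv]
  | add u v hu hv => rw [map_add, hu, hv]

theorem sgn_add_two (k : ℕ) (u : ExteriorAlgebra A Q) : sgn A Q (k + 2) u = sgn A Q k u := by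
  rw [sgn_add, show 2 = 1 + 1 from rfl, sgn_add, sgn_sgn]

theorem sgn_injective (k : ℕ) : Function.Injective (sgn A Q k) :=
  Function.LeftInverse.injective (sgn_sgn k)

theorem sgn_mem {p : ℕ} (k : ℕ) {u : ExteriorAlgebra A Q} (hu : u ∈ ⋀[A]^p Q) :
    sgn A Q k u ∈ ⋀[A]^p Q := by
  rw [sgn_of_mem k hu, ← Int.cast_smul_eq_zsmul A]
  exact Submodule.smul_mem _ _ hu

theorem ι_mul_eq (ξ : Q) (u : ExteriorAlgebra A Q) :
    ExteriorAlgebra.ι A ξ * u = sgn A Q 1 u * ExteriorAlgebra.ι A ξ := by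
  induction u using CliffordAlgebra.induction with
  | algebraMap a => rw [sgn_algebraMap]; exact (Algebra.commutes a _).symm
  | ι η =>
    refine Eq.trans ?_ (congrArg (· * _) (sgn_ι 1 η).symm)
    rw [pow_one, neg_one_smul, neg_mul]
    exact eq_neg_of_add_eq_zero_left (ExteriorAlgebra.ι_add_mul_swap ξ η)
  | mul u v hu hv => rw [← mul_assoc, hu, mul_assoc, hv, sgn_mul, mul_assoc]
  | add u v hu hv => rw [mul_add, hu, hv, map_add, add_mul]

/-- Graded commutativity of the exterior algebra. -/
theorem mul_eq_mul_sgn {r : ℕ} (u : ExteriorAlgebra A Q) {v : ExteriorAlgebra A Q}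
    (hv : v ∈ ⋀[A]^r Q) : u * v = v * sgn A Q r u := by
  induction u using CliffordAlgebra.induction with
  | algebraMap a => rw [sgn_algebraMap]; exact Algebra.commutes a _
  | ι ξ =>
    refine (ι_mul_eq ξ v).trans ?_
    refine Eq.trans ?_ (congrArg (v * ·) (sgn_ι r ξ).symm)
    rw [sgn_of_mem 1 hv, one_mul, smul_mul_assoc, mul_smul_comm]
  | mul u w hu hw => rw [mul_assoc, hw, ← mul_assoc, hu, sgn_mul, mul_assoc]
  | add u w hu hw => rw [add_mul, hu, hw, map_add, mul_add]

/-- The contraction of `Λ_A Q` with a linear form on `Q`. -/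
noncomputable def contraction (α : Module.Dual A Q) :
    ExteriorAlgebra A Q →ₗ[A] ExteriorAlgebra A Q :=
  CliffordAlgebra.contractLeft (Q := (0 : QuadraticForm A Q)) α

theorem contraction_ι_mul (α : Module.Dual A Q) (ξ : Q) (u : ExteriorAlgebra A Q) :
    contraction α (ExteriorAlgebra.ι A ξ * u) =
      α ξ • u - ExteriorAlgebra.ι A ξ * contraction α u :=
  CliffordAlgebra.contractLeft_ι_mul α ξ u

theorem contraction_one (α : Module.Dual A Q) : contraction α (1 : ExteriorAlgebra A Q) = 0 :=
  CliffordAlgebra.contractLeft_one (Q := (0 : QuadraticForm A Q)) α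

theorem contraction_ι (α : Module.Dual A Q) (ξ : Q) :
    contraction α (ExteriorAlgebra.ι A ξ) = algebraMap A _ (α ξ) :=
  CliffordAlgebra.contractLeft_ι (Q := (0 : QuadraticForm A Q)) α ξ

theorem contraction_algebraMap (α : Module.Dual A Q) (a : A) :
    contraction α (algebraMap A (ExteriorAlgebra A Q) a) = 0 :=
  CliffordAlgebra.contractLeft_algebraMap (Q := (0 : QuadraticForm A Q)) α a

theorem contraction_mul (α : Module.Dual A Q) (u v : ExteriorAlgebra A Q) :
    contraction α (u * v) = contraction α u * v + sgn A Q 1 u * contraction α v := by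
  induction u using CliffordAlgebra.induction generalizing v with
  | algebraMap a =>
    rw [sgn_algebraMap, show contraction α ((algebraMap A (CliffordAlgebra 0)) a) = 0 from
      contraction_algebraMap α a, zero_mul, zero_add]
    refine (congrArg _ (Algebra.smul_def a v).symm).trans ?_
    rw [map_smul, Algebra.smul_def]
  | ι ξ =>
    refine (contraction_ι_mul α ξ v).trans ?_
    have h1 : contraction α ((CliffordAlgebra.ι 0) ξ) = algebraMap A (ExteriorAlgebra A Q) (α ξ) :=
      contraction_ι α ξ
    have h2 : sgn A Q 1 ((CliffordAlgebra.ι 0) ξ) = (-1 : ℤ) ^ 1 • ExteriorAlgebra.ι A ξ :=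
      sgn_ι 1 ξ
    rw [h1, h2, ← Algebra.smul_def, pow_one, neg_one_smul, neg_mul, sub_eq_add_neg]
  | mul u w hu hw => rw [mul_assoc, hu, hw, hu, sgn_mul]; noncomm_ring
  | add u w hu hw => rw [add_mul, map_add, hu, hw, map_add, map_add]; noncomm_ring

theorem ιMulti_mem (m : ℕ) (v : Fin m → Q) : ExteriorAlgebra.ιMulti A m v ∈ ⋀[A]^m Q := by
  rw [← ExteriorAlgebra.ιMulti_span_fixedDegree]
  exact Submodule.subset_span ⟨_, rfl⟩

theorem ι_mem (ξ : Q) : ExteriorAlgebra.ι A ξ ∈ ⋀[A]^1 Q := by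
  have h := ιMulti_mem (A := A) 1 ![ξ]
  rwa [ExteriorAlgebra.ιMulti_succ_apply, ExteriorAlgebra.ιMulti_zero_apply, mul_one] at h

theorem mul_mem_exteriorPower {p r : ℕ} {u v : ExteriorAlgebra A Q} (hu : u ∈ ⋀[A]^p Q)
    (hv : v ∈ ⋀[A]^r Q) : u * v ∈ ⋀[A]^(p + r) Q := by
  exact SetLike.mul_mem_graded (A := fun i : ℕ => ⋀[A]^i Q) hu hv

theorem contraction_mem {p : ℕ} (α : Module.Dual A Q) {u : ExteriorAlgebra A Q}
    (hu : u ∈ ⋀[A]^(p + 1) Q) : contraction α u ∈ ⋀[A]^p Q := by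
  refine mem_exteriorPower_induction (P := fun u => contraction α u ∈ ⋀[A]^p Q) ?_ ?_ ?_ ?_ hu
  · clear hu
    induction p with
    | zero =>
      intro v
      rw [ExteriorAlgebra.ιMulti_succ_apply, contraction_ι_mul]
      simp only [ExteriorAlgebra.ιMulti_zero_apply, contraction_one, mul_zero, sub_zero]
      exact Submodule.smul_mem _ _ (SetLike.one_mem_graded fun i : ℕ => ⋀[A]^i Q)
    | succ p ih =>
      intro v
      rw [ExteriorAlgebra.ιMulti_succ_apply, contraction_ι_mul]
      refine Submodule.sub_mem _ (Submodule.smul_mem _ _ (ιMulti_mem _ _)) ?_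
      have h := mul_mem_exteriorPower (ι_mem (v 0)) (ih (Matrix.vecTail v))
      rwa [add_comm 1 p] at h
  · rw [map_zero]; exact Submodule.zero_mem _
  · intro u v hu hv; rw [map_add]; exact Submodule.add_mem _ hu hv
  · intro a u hu; rw [map_smul]; exact Submodule.smul_mem _ _ hu

/-! ### The functional `omegaExt` -/

variable {n : ℕ} (ω : ⋀[A]^n Q ≃ₗ[A] A)

theorem omegaExt_ιMulti (v : Fin n → Q) :
    omegaExt ω (ExteriorAlgebra.ιMulti A n v) = ω (exteriorPower.ιMulti A n v) := by
  rw [omegaExt, ExteriorAlgebra.liftAlternating_apply_ιMulti, Pi.single_eq_same]; rfl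

theorem omegaExt_ιMulti_of_ne {m : ℕ} (hm : m ≠ n) (v : Fin m → Q) :
    omegaExt ω (ExteriorAlgebra.ιMulti A m v) = 0 := by
  rw [omegaExt, ExteriorAlgebra.liftAlternating_apply_ιMulti, Pi.single_eq_of_ne hm]; rfl

theorem omegaExt_of_mem_of_ne {m : ℕ} (hm : m ≠ n) {u : ExteriorAlgebra A Q}
    (hu : u ∈ ⋀[A]^m Q) : omegaExt ω u = 0 := by
  refine mem_exteriorPower_induction (P := fun u => omegaExt ω u = 0)
    (omegaExt_ιMulti_of_ne ω hm) (map_zero _) ?_ ?_ hu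
  · intro u v hu hv; rw [map_add, hu, hv, add_zero]
  · intro a u hu; rw [map_smul, hu, smul_zero]

theorem omegaExt_coe (u : ⋀[A]^n Q) : omegaExt ω (u : ExteriorAlgebra A Q) = ω u := by
  have : omegaExt ω ∘ₗ (⋀[A]^n Q).subtype = ω.toLinearMap :=
    exteriorPower.linearMap_ext (AlternatingMap.ext fun v => omegaExt_ιMulti ω v)
  exact LinearMap.congr_fun this u

theorem lhom_eq_of_ιMulti {M : Type*} [AddCommGroup M] [Module A M]
    {f g : ExteriorAlgebra A Q →ₗ[A] M}
    (h : ∀ (m : ℕ) (v : Fin m → Q), f (ExteriorAlgebra.ιMulti A m v) =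
      g (ExteriorAlgebra.ιMulti A m v)) : f = g :=
  ExteriorAlgebra.lhom_ext fun m => AlternatingMap.ext fun v => h m v

theorem omegaExt_sgn (k : ℕ) (u : ExteriorAlgebra A Q) :
    omegaExt ω (sgn A Q k u) = (-1 : ℤ) ^ (k * n) • omegaExt ω u := by
  have : omegaExt ω ∘ₗ sgn A Q k = (-1 : ℤ) ^ (k * n) • omegaExt ω := by
    refine lhom_eq_of_ιMulti fun m v => ?_
    rw [LinearMap.comp_apply, sgn_ιMulti, LinearMap.smul_apply, map_zsmul]
    by_cases hm : m = n
    · subst hm; rfl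
    · rw [omegaExt_ιMulti_of_ne ω hm, smul_zero, smul_zero]
  exact LinearMap.congr_fun this u

end Exterior
end Form

/-! ### Nondegeneracy of the pairing on the exterior algebra -/

namespace Form

section Nondegenerate

variable {A Q : Type*} [CommRing A] [AddCommGroup Q] [Module A Q]

/-- A finitely generated projective module of constant rank `n` has `Λ^{n+1} Q = 0`. -/
theorem ιMulti_eq_zero_of_rank [Module.Finite A Q] [Module.Projective A Q] {n : ℕ}
    (hn : ∀ 𝔭 : PrimeSpectrum A, Module.rankAtStalk Q 𝔭 = n) (v : Fin (n + 1) → Q) :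
    ExteriorAlgebra.ιMulti A (n + 1) v = 0 := by
  -- The annihilator of `Λ^{n+1} Q` is not contained in any maximal ideal.
  let I : Ideal A :=
    LinearMap.ker (LinearMap.toSpanSingleton A _ (ExteriorAlgebra.ιMulti A (n + 1) v))
  suffices h : I = ⊤ by
    have h1 : (1 : A) ∈ I := h ▸ Submodule.mem_top
    simpa [I] using h1
  by_contra hne
  obtain ⟨𝔪, hmax, hle⟩ := Ideal.exists_le_maximal I hne
  have hp : 𝔪.IsPrime := hmax.isPrime
  let Am := Localization.AtPrime 𝔪
  let Qm := LocalizedModule 𝔪.primeCompl Q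
  have hfree : Module.Free Am Qm := Module.free_of_flat_of_isLocalRing
  have hrank : Module.finrank Am Qm = n := hn ⟨𝔪, hp⟩
  -- A basis of the localization consisting of images of elements `q i` of `Q`.
  let b : Module.Basis (Fin n) Am Qm := Module.finBasisOfFinrankEq Am Qm hrank
  have hb : ∀ i, ∃ (q : Q) (s : 𝔪.primeCompl), s • b i =
      LocalizedModule.mkLinearMap 𝔪.primeCompl Q q := by
    intro i
    obtain ⟨⟨q, s⟩, h⟩ := IsLocalizedModule.surj 𝔪.primeCompl
      (LocalizedModule.mkLinearMap 𝔪.primeCompl Q) (b i)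
    exact ⟨q, s, h⟩
  choose q s hqs using hb
  let b' : Module.Basis (Fin n) Am Qm := b.isUnitSMul (w := fun i => algebraMap A Am (s i))
    fun i => IsLocalization.map_units Am (s i)
  have hb' : ∀ i, b' i = LocalizedModule.mkLinearMap 𝔪.primeCompl Q (q i) := by
    intro i
    rw [Module.Basis.isUnitSMul_apply, ← hqs, algebraMap_smul]; rfl
  have key : ∀ ξ : Q, ∃ t : 𝔪.primeCompl, ∃ c : Fin n → A, (t : A) • ξ = ∑ i, c i • q i := by
    intro ξ
    obtain ⟨t, ht⟩ := IsLocalization.exist_integer_multiples_of_finite 𝔪.primeCompl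
      fun i => b'.repr (LocalizedModule.mkLinearMap 𝔪.primeCompl Q ξ) i
    choose c hc using ht
    have h1 : LocalizedModule.mkLinearMap 𝔪.primeCompl Q ((t : A) • ξ) =
        LocalizedModule.mkLinearMap 𝔪.primeCompl Q (∑ i, c i • q i) := by
      rw [map_smul, map_sum]
      conv_lhs => rw [← b'.sum_repr (LocalizedModule.mkLinearMap 𝔪.primeCompl Q ξ)]
      rw [Finset.smul_sum]
      refine Finset.sum_congr rfl fun i _ => ?_
      rw [map_smul, ← hb', ← smul_assoc, ← algebraMap_smul Am (c i)]
      exact congrArg (· • b' i) (hc i).symm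
    obtain ⟨e, he⟩ := IsLocalizedModule.exists_of_eq (S := 𝔪.primeCompl) h1
    refine ⟨e * t, fun i => e * c i, ?_⟩
    rw [Submonoid.coe_mul, mul_smul]
    refine he.trans ?_
    rw [Submonoid.smul_def, Finset.smul_sum]
    exact Finset.sum_congr rfl fun i _ => (mul_smul _ _ _).symm
  choose t c htc using fun i => key (v i)
  have hmem : ∏ i, (t i : A) ∈ I := by
    have h1 : ExteriorAlgebra.ιMulti A (n + 1) (fun i => (t i : A) • v i) =
        (∏ i, (t i : A)) • ExteriorAlgebra.ιMulti A (n + 1) v :=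
      (ExteriorAlgebra.ιMulti A (n + 1)).toMultilinearMap.map_smul_univ _ v
    have h2 : (ExteriorAlgebra.ιMulti A (n + 1)).compLinearMap
        (Fintype.linearCombination A q) = 0 := by
      refine (Pi.basisFun A (Fin n)).ext_alternating fun w hw => ?_
      exact absurd (Fintype.card_le_of_injective w hw) (by simp)
    have h3 := DFunLike.congr_fun h2 c
    rw [AlternatingMap.compLinearMap_apply] at h3
    simp only [Fintype.linearCombination_apply, AlternatingMap.zero_apply] at h3
    rw [LinearMap.mem_ker, LinearMap.toSpanSingleton_apply, ← h1, ← h3]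
    congr 1
    exact funext htc
  exact (Submonoid.prod_mem 𝔪.primeCompl fun i _ => (t i).2) (hle hmem)

variable {n : ℕ} (ω : ⋀[A]^n Q ≃ₗ[A] A)
  (hQ : ∀ v : Fin (n + 1) → Q, ExteriorAlgebra.ιMulti A (n + 1) v = 0)

include hQ in
theorem eq_zero_of_mem_of_lt {m : ℕ} (hm : n < m) {u : ExteriorAlgebra A Q}
    (hu : u ∈ ⋀[A]^m Q) : u = 0 := by
  obtain ⟨k, rfl⟩ := Nat.exists_eq_add_of_lt hm
  refine mem_exteriorPower_induction (P := fun u' : ExteriorAlgebra A Q => u' = 0) ?_ rfl ?_ ?_ hu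
  · intro v
    clear hu hm
    induction k with
    | zero => exact hQ v
    | succ k ih =>
      have := ExteriorAlgebra.ιMulti_succ_apply (R := A) v
      exact this.trans ((congrArg _ (ih (Matrix.vecTail v))).trans (mul_zero _))
  · rintro u v rfl rfl; exact add_zero _
  · rintro a u rfl; exact smul_zero _

include hQ in
/-- The functional `ω` kills contractions, so that contractions are skew-adjoint, up to a sign, for
the pairing `(a, w) ↦ ω(a w)`: a contraction of an element of degree `m` has degree `n` only for `m
= n + 1`, and `Λ^{n+1} Q = 0`. -/
theorem omegaExt_contraction (α : Module.Dual A Q) (u : ExteriorAlgebra A Q) :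
    omegaExt ω (contraction α u) = 0 := by
  have : omegaExt ω ∘ₗ contraction α = 0 := by
    refine lhom_eq_of_ιMulti fun m v => ?_
    rw [LinearMap.comp_apply, LinearMap.zero_apply]
    cases m with
    | zero => rw [ExteriorAlgebra.ιMulti_zero_apply, contraction_one, map_zero]
    | succ m =>
      by_cases hm : m = n
      · subst hm; rw [hQ, map_zero, map_zero]
      · exact omegaExt_of_mem_of_ne ω hm (contraction_mem α (ιMulti_mem _ v))
  exact LinearMap.congr_fun this u

/-- The endomorphisms of `Λ_A Q` spanned by the `w ↦ ω(a w) b`. -/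
noncomputable def rankOne : Submodule A (Module.End A (ExteriorAlgebra A Q)) :=
  Submodule.span A (Set.range fun ab : ExteriorAlgebra A Q × ExteriorAlgebra A Q =>
    (omegaExt ω ∘ₗ LinearMap.mulLeft A ab.1).smulRight ab.2)

theorem contraction_comp_mem_rankOne (α : Module.Dual A Q)
    {X : Module.End A (ExteriorAlgebra A Q)} (hX : X ∈ rankOne ω) :
    contraction α ∘ₗ X ∈ rankOne ω := by
  induction hX using Submodule.span_induction with
  | mem X hX =>
    obtain ⟨⟨a, b⟩, rfl⟩ := hX
    refine Submodule.subset_span ⟨(a, contraction α b), ?_⟩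
    ext w; simp
  | zero => rw [LinearMap.comp_zero]; exact Submodule.zero_mem _
  | add X Y _ _ hX hY => rw [LinearMap.comp_add]; exact Submodule.add_mem _ hX hY
  | smul a X _ hX => rw [LinearMap.comp_smul]; exact Submodule.smul_mem _ _ hX

include hQ in
theorem comp_contraction_mem_rankOne (α : Module.Dual A Q)
    {X : Module.End A (ExteriorAlgebra A Q)} (hX : X ∈ rankOne ω) :
    X ∘ₗ contraction α ∈ rankOne ω := by
  induction hX using Submodule.span_induction with
  | mem X hX =>
    obtain ⟨⟨a, b⟩, rfl⟩ := hX
    refine Submodule.subset_span ⟨(- contraction α (sgn A Q 1 a), b), ?_⟩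
    refine LinearMap.ext fun w => ?_
    have h := omegaExt_contraction ω hQ α (sgn A Q 1 a * w)
    rw [contraction_mul, sgn_sgn, map_add] at h
    simp only [LinearMap.smulRight_apply, LinearMap.comp_apply, LinearMap.mulLeft_apply, neg_mul,
      map_neg]
    rw [eq_neg_of_add_eq_zero_right h]
  | zero => rw [LinearMap.zero_comp]; exact Submodule.zero_mem _
  | add X Y _ _ hX hY => rw [LinearMap.add_comp]; exact Submodule.add_mem _ hX hY
  | smul a X _ hX => rw [LinearMap.smul_comp]; exact Submodule.smul_mem _ _ hX

/-- The linear form `ξ ↦ ω(v_1 ∧ … ξ … ∧ v_n)`, with `ξ` in place of `v_i`. -/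
noncomputable def cofactor (v : Fin n → Q) (i : Fin n) : Module.Dual A Q :=
  (ω.toLinearMap.compAlternatingMap (exteriorPower.ιMulti A n)).toMultilinearMap.toLinearMap v i

theorem cofactor_self (v : Fin n → Q) (i : Fin n) :
    cofactor ω v i (v i) = ω (exteriorPower.ιMulti A n v) := by
  rw [cofactor, MultilinearMap.toLinearMap_apply, Function.update_eq_self]; rfl

theorem cofactor_of_ne (v : Fin n → Q) {i j : Fin n} (hij : i ≠ j) :
    cofactor ω v i (v j) = 0 := by
  rw [cofactor, MultilinearMap.toLinearMap_apply]
  exact AlternatingMap.map_update_self _ _ hij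

/-- The contraction with the cofactor of `v_k` passes through all `v_i` with `i ≠ k`. -/
theorem contraction_prod_mul (v : Fin n → Q) (k : Fin n) (l : List (Fin n)) (hk : k ∉ l)
    (w : ExteriorAlgebra A Q) :
    contraction (cofactor ω v k) ((l.map fun i => ExteriorAlgebra.ι A (v i)).prod * w) =
      (-1 : ℤ) ^ l.length • ((l.map fun i => ExteriorAlgebra.ι A (v i)).prod *
        contraction (cofactor ω v k) w) := by
  induction l with
  | nil => simp
  | cons j l ih =>
    rw [List.mem_cons, not_or] at hk
    rw [List.map_cons, List.prod_cons, mul_assoc, contraction_ι_mul, cofactor_of_ne ω v hk.1,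
      zero_smul, zero_sub, ih hk.2, List.length_cons, pow_succ, mul_neg_one, neg_smul,
      mul_smul_comm, mul_assoc]

include hQ in
/-- Contracting with the cofactors strips the multiplication by a product of some `v_i` of its
first factors, at the price of a power of `ω(v_1 ∧ … ∧ v_n)`. -/
theorem mulLeft_prod_mem_rankOne (v : Fin n → Q) (l l' : List (Fin n)) (h : (l ++ l').Nodup)
    (r : ℕ) (hr : ω (exteriorPower.ιMulti A n v) ^ r •
      LinearMap.mulLeft A ((l ++ l').map fun i => ExteriorAlgebra.ι A (v i)).prod ∈ rankOne ω) :
    ω (exteriorPower.ιMulti A n v) ^ (r + l.length) •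
      LinearMap.mulLeft A (l'.map fun i => ExteriorAlgebra.ι A (v i)).prod ∈ rankOne ω := by
  induction l generalizing r with
  | nil => exact hr
  | cons k l ih =>
    rw [List.cons_append, List.nodup_cons] at h
    rw [List.length_cons, add_comm l.length, ← add_assoc]
    refine ih h.2 (r + 1) ?_
    have h1 := contraction_comp_mem_rankOne ω (cofactor ω v k) hr
    have h2 := comp_contraction_mem_rankOne ω hQ (cofactor ω v k) hr
    -- The supercommutator of the contraction with the multiplication by `v_k ∧ …` is
    -- `ω(v_1 ∧ … ∧ v_n)` times the multiplication by the remaining factors.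
    convert Submodule.add_mem _ h1 (Submodule.smul_mem _ ((-1 : A) ^ (l ++ l').length) h2) using 1
    refine LinearMap.ext fun w => ?_
    simp only [LinearMap.smul_apply, LinearMap.mulLeft_apply, LinearMap.add_apply,
      LinearMap.comp_apply, List.cons_append, List.map_cons, List.prod_cons, map_smul, mul_assoc,
      contraction_ι_mul, cofactor_self]
    rw [contraction_prod_mul ω v k _ h.1, pow_succ, mul_smul, mul_smul_comm, smul_sub,
      ← Int.cast_smul_eq_zsmul A, smul_comm ((-1 : A) ^ _)]
    push_cast
    rw [sub_add_cancel]

include hQ in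
theorem ιMulti_mul_eq (v : Fin n → Q) (w : ExteriorAlgebra A Q) :
    ExteriorAlgebra.ιMulti A n v * w =
      ExteriorAlgebra.algebraMapInv w • ExteriorAlgebra.ιMulti A n v := by
  have : LinearMap.mulLeft A (ExteriorAlgebra.ιMulti A n v) =
      (ExteriorAlgebra.algebraMapInv (R := A) (M := Q)).toLinearMap.smulRight
        (ExteriorAlgebra.ιMulti A n v) := by
    refine lhom_eq_of_ιMulti fun m w => ?_
    rw [LinearMap.mulLeft_apply, LinearMap.smulRight_apply, AlgHom.toLinearMap_apply]
    cases m with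
    | zero => simp
    | succ m =>
      have h0 : ExteriorAlgebra.algebraMapInv (ExteriorAlgebra.ι A (w 0)) = 0 :=
        ExteriorAlgebra.lift_ι_apply A _ _ _
      rw [eq_zero_of_mem_of_lt hQ (by omega)
          (mul_mem_exteriorPower (ιMulti_mem n v) (ιMulti_mem (m + 1) w)),
        ExteriorAlgebra.ιMulti_succ_apply, map_mul, h0, zero_mul, zero_smul]
  exact LinearMap.congr_fun this w

include hQ in
/-- A power of each value of `ω` carries the identity of `Λ_A Q` into the span of the operators `w
↦ ω(a w) b`: the multiplication by `v_1 ∧ … ∧ v_n` factors through the augmentation, so that `ω(v_1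
∧ … ∧ v_n)` times it is of that form, and its `n` factors are stripped one by one. -/
theorem smul_id_mem_rankOne (v : Fin n → Q) :
    ω (exteriorPower.ιMulti A n v) ^ (1 + n) • LinearMap.id ∈ rankOne ω := by
  have h := mulLeft_prod_mem_rankOne ω hQ v (List.finRange n) []
    (by simpa using List.nodup_finRange n) 1 ?_
  · simpa using h
  · refine Submodule.subset_span ⟨(ExteriorAlgebra.ιMulti A n v, ExteriorAlgebra.ιMulti A n v), ?_⟩
    refine LinearMap.ext fun w => ?_
    rw [List.append_nil, ← List.ofFn_eq_map, ← ExteriorAlgebra.ιMulti_apply]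
    simp only [LinearMap.smulRight_apply, LinearMap.comp_apply, LinearMap.mulLeft_apply,
      LinearMap.smul_apply]
    rw [ιMulti_mul_eq hQ, map_smul, omegaExt_ιMulti, pow_one, smul_smul, smul_eq_mul, mul_comm]

include hQ in
/-- The pairing `(a, w) ↦ ω(a w)` on `Λ_A Q` is perfect, with finite dual systems `a`, `b`. -/
theorem exists_dualBasis : ∃ (κ : Type) (_ : Fintype κ) (a b : κ → ExteriorAlgebra A Q),
    ∀ w, ∑ j, omegaExt ω (a j * w) • b j = w := by
  have h1 : LinearMap.id ∈ rankOne ω := by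
    -- The values of `ω` generate the unit ideal, hence so do their `(n + 1)`-st powers.
    let I : Ideal A := (rankOne ω).comap (LinearMap.toSpanSingleton A _ LinearMap.id)
    suffices h : I = ⊤ by
      have : (1 : A) ∈ I := h ▸ Submodule.mem_top
      simpa [I] using this
    have hspan :
        Ideal.span (Set.range fun v : Fin n → Q => ω (exteriorPower.ιMulti A n v)) = ⊤ := by
      have := exteriorPower.ιMulti_span A n Q
      rw [Ideal.span, Set.range_comp' ω, ← LinearEquiv.coe_coe, Submodule.span_image]
      rw [show Submodule.span A (Set.range fun v => (exteriorPower.ιMulti A n) v) = ⊤ from this,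
        Submodule.map_top, LinearEquiv.range]
    rw [eq_top_iff, ← Ideal.span_pow_eq_top _ hspan (1 + n), Ideal.span_le]
    rintro _ ⟨_, ⟨v, rfl⟩, rfl⟩
    exact smul_id_mem_rankOne ω hQ v
  have h2 : ∀ X ∈ rankOne ω, ∃ (κ : Type) (_ : Fintype κ) (a b : κ → ExteriorAlgebra A Q),
      ∀ w, ∑ j, omegaExt ω (a j * w) • b j = X w := by
    intro X hX
    induction hX using Submodule.span_induction with
    | mem X hX =>
      obtain ⟨⟨a, b⟩, rfl⟩ := hX
      exact ⟨Unit, inferInstance, fun _ => a, fun _ => b, fun w => by simp⟩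
    | zero => exact ⟨Empty, inferInstance, Empty.elim, Empty.elim, fun w => by simp⟩
    | add X Y _ _ hX hY =>
      obtain ⟨κ, _, a, b, h⟩ := hX
      obtain ⟨κ', _, a', b', h'⟩ := hY
      refine ⟨κ ⊕ κ', inferInstance, Sum.elim a a', Sum.elim b b', fun w => ?_⟩
      simp [h, h']
    | smul c X _ hX =>
      obtain ⟨κ, _, a, b, h⟩ := hX
      refine ⟨κ, inferInstance, a, fun j => c • b j, fun w => ?_⟩
      rw [LinearMap.smul_apply, ← h, Finset.smul_sum]
      exact Finset.sum_congr rfl fun j _ => smul_comm _ _ _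
  exact h2 _ h1

theorem omegaExt_mul_comm {m : ℕ} (u : ExteriorAlgebra A Q) {w : ExteriorAlgebra A Q}
    (hw : w ∈ ⋀[A]^m Q) :
    omegaExt ω (u * w) = (-1 : ℤ) ^ (m * n + m) • omegaExt ω (w * u) := by
  have h : u * w = (-1 : ℤ) ^ (m * m) • sgn A Q m (w * u) := by
    rw [mul_eq_mul_sgn u hw, sgn_mul, sgn_of_mem m hw, smul_mul_assoc, smul_smul, ← mul_pow]
    simp
  rw [h, map_zsmul, omegaExt_sgn, smul_smul, ← pow_add]
  obtain hm | hm := neg_one_pow_eq_or ℤ m <;> simp [pow_add, pow_mul, hm]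

include hQ in
theorem eq_zero_of_omegaExt_mul_right {u : ExteriorAlgebra A Q}
    (h : ∀ (m : ℕ) (v : Fin m → Q), omegaExt ω (ExteriorAlgebra.ιMulti A m v * u) = 0) :
    u = 0 := by
  obtain ⟨κ, _, a, b, hab⟩ := exists_dualBasis ω hQ
  rw [← hab u]
  refine Finset.sum_eq_zero fun j _ => ?_
  have h0 : omegaExt ω ∘ₗ LinearMap.mulRight A u = 0 := lhom_eq_of_ιMulti h
  rw [show omegaExt ω (a j * u) = 0 from LinearMap.congr_fun h0 (a j), zero_smul]

include hQ in
theorem eq_zero_of_omegaExt_mul_left {u : ExteriorAlgebra A Q}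
    (h : ∀ (m : ℕ) (v : Fin m → Q), omegaExt ω (u * ExteriorAlgebra.ιMulti A m v) = 0) :
    u = 0 := by
  refine eq_zero_of_omegaExt_mul_right ω hQ fun m v => ?_
  have h1 := h m v
  rw [omegaExt_mul_comm ω u (ιMulti_mem m v)] at h1
  obtain h2 | h2 := neg_one_pow_eq_or ℤ (m * n + m) <;> rw [h2] at h1 <;> simpa using h1

variable {H : Type*} [AddCommGroup H] [Module A H]

include hQ in
/-- The inverse of `φ^ω` is built from dual systems for the pairing `(a, w) ↦ ω(a w)`. -/
theorem phi_bijective (q : ℕ) : Function.Bijective (phi ω H q) := by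
  refine ⟨(injective_iff_map_eq_zero _).2 fun f hf => ?_, fun F => ?_⟩
  · ext x
    refine eq_zero_of_omegaExt_mul_left ω hQ fun m v => ?_
    have h : phi ω H q f m v x = 0 := by rw [hf]; rfl
    rw [phi_apply] at h
    obtain h2 | h2 := neg_one_pow_eq_or ℤ (m * q) <;> rw [h2] at h <;> simpa using h
  · obtain ⟨κ, _, a, b, hab⟩ := exists_dualBasis ω hQ
    let Λ : ExteriorAlgebra A Q →ₗ[A] (H [⋀^Fin q]→ₗ[A] A) :=
      ExteriorAlgebra.liftAlternating fun m => (-1 : ℤ) ^ (m * q) • F m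
    refine ⟨∑ j, (Λ (b j)).smulRight (a j), ?_⟩
    ext m v x
    rw [phi_apply]
    have h : omegaExt ω ((∑ j, (Λ (b j)).smulRight (a j)) x * ExteriorAlgebra.ιMulti A m v) =
        Λ (ExteriorAlgebra.ιMulti A m v) x := by
      conv_rhs => rw [← hab (ExteriorAlgebra.ιMulti A m v)]
      rw [AltTools.sum_apply, Finset.sum_mul, map_sum, map_sum, AltTools.sum_apply]
      refine Finset.sum_congr rfl fun j _ => ?_
      rw [AlternatingMap.smulRight_apply, smul_mul_assoc, map_smul, map_smul,
        AlternatingMap.smul_apply, smul_eq_mul, smul_eq_mul, mul_comm]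
    rw [h]
    simp only [Λ, ExteriorAlgebra.liftAlternating_apply_ιMulti, AlternatingMap.smul_apply,
      smul_smul, ← mul_pow]
    simp

include ω hQ in
/-- The inverse of the canonical map expands the values of a form by dual systems for the pairing
`(a, w) ↦ ω(a w)`. -/
theorem canon_bijective (q : ℕ) : Function.Bijective (canon A H Q q) := by
  obtain ⟨κ, _, a, b, hab⟩ := exists_dualBasis ω hQ
  let g : FormDeg A H Q q →ₗ[A] (H [⋀^Fin q]→ₗ[A] A) ⊗[A] ExteriorAlgebra A Q :=
    ∑ j, (TensorProduct.mk A _ _).flip (sgn A Q q (b j)) ∘ₗ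
      (omegaExt ω ∘ₗ LinearMap.mulLeft A (a j)).compAlternatingMapₗ A
  have hg : ∀ f, g f = ∑ j, ((omegaExt ω ∘ₗ LinearMap.mulLeft A (a j)).compAlternatingMap f) ⊗ₜ
      sgn A Q q (b j) := fun f => by simp [g]
  refine ⟨Function.LeftInverse.injective (g := g) fun t => ?_,
    Function.RightInverse.surjective (g := g) fun f => ?_⟩
  · induction t using TensorProduct.induction_on with
    | zero => rw [map_zero, map_zero]
    | add s t hs ht => rw [map_add, map_add, hs, ht]
    | tmul β u =>
      have h : ∀ j, (omegaExt ω ∘ₗ LinearMap.mulLeft A (a j)).compAlternatingMap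
          (canon A H Q q (β ⊗ₜ u)) = omegaExt ω (a j * sgn A Q q u) • β := fun j => by
        ext x
        simp [canon_tmul, mul_comm]
      simp only [hg, h, TensorProduct.smul_tmul, ← TensorProduct.tmul_sum, ← map_smul, ← map_sum,
        hab, sgn_sgn]
  · ext x
    rw [hg, map_sum, AltTools.sum_apply]
    simp only [canon_tmul, sgn_sgn]
    exact hab (f x)

end Nondegenerate
end Form

/-! ### The contraction rule for the shuffle product -/

namespace AltTools

open Equiv AlternatingMap

section Shuffle

variable {ιa ιb α β : Type*}

/-- A class of permutations, that is, a shuffle, is determined by the image of the first block. -/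
theorem modSumCongr_mk_eq_iff [Finite ιa] [Finite ιb] {σ τ : Perm (ιa ⊕ ιb)} :
    ((Quotient.mk'' σ : Perm.ModSumCongr ιa ιb) = Quotient.mk'' τ) ↔
      ∀ i, ∃ j, τ (Sum.inl i) = σ (Sum.inl j) := by
  rw [Quotient.eq'', QuotientGroup.leftRel_apply]
  constructor
  · rintro ⟨⟨s, t⟩, h⟩ i
    refine ⟨s i, ?_⟩
    have := Equiv.congr_fun h (Sum.inl i)
    rw [Perm.mul_apply, eq_comm, Perm.inv_eq_iff_eq] at this
    simpa using this
  · intro h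
    refine Perm.mem_sumCongrHom_range_of_perm_mapsTo_inl ?_
    rintro _ ⟨i, rfl⟩
    obtain ⟨j, hj⟩ := h i
    refine ⟨j, ?_⟩
    simp [hj]

/-- The class of `σ` puts the index `x` into the first block. -/
def InLeft (x : ιa ⊕ ιb) (z : Perm.ModSumCongr ιa ιb) : Prop :=
  ∃ σ : Perm (ιa ⊕ ιb), Quotient.mk'' σ = z ∧ ∃ i, σ (Sum.inl i) = x

theorem inLeft_mk [Finite ιa] [Finite ιb] (x : ιa ⊕ ιb) (σ : Perm (ιa ⊕ ιb)) :
    InLeft x (Quotient.mk'' σ) ↔ ∃ i, σ (Sum.inl i) = x := by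
  refine ⟨?_, fun h => ⟨σ, rfl, h⟩⟩
  rintro ⟨τ, h, i, hi⟩
  obtain ⟨j, hj⟩ := modSumCongr_mk_eq_iff.1 h.symm i
  exact ⟨j, hj ▸ hi⟩

/-- Splitting off a point of the first block. -/
def optionSumLeft (p : Option α ≃ ιa) : Option (α ⊕ ιb) ≃ ιa ⊕ ιb where
  toFun o := o.elim (Sum.inl (p none)) (Sum.elim (fun i => Sum.inl (p (some i))) Sum.inr)
  invFun := Sum.elim (fun i => (p.symm i).map Sum.inl) fun j => some (Sum.inr j)
  left_inv o := by rcases o with _ | _ | _ <;> simp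
  right_inv s := by
    rcases s with i | j
    · obtain ⟨o, rfl⟩ := p.surjective i
      rcases o with _ | _ <;> simp
    · simp

variable (p : Option α ≃ ιa) (c : Option (α ⊕ ιb) ≃ ιa ⊕ ιb)

/-- The permutation induced by `σ` which sends the split off point to `c none`. -/
def liftPerm (σ : Perm (α ⊕ ιb)) : Perm (ιa ⊕ ιb) :=
  (optionSumLeft p).symm.trans ((optionCongr σ).trans c)

theorem liftPerm_none (σ : Perm (α ⊕ ιb)) : liftPerm p c σ (Sum.inl (p none)) = c none := by
  simp [liftPerm, optionSumLeft]

theorem liftPerm_some (σ : Perm (α ⊕ ιb)) (i : α) :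
    liftPerm p c σ (Sum.inl (p (some i))) = c (some (σ (Sum.inl i))) := by
  simp [liftPerm, optionSumLeft]

/-- Lifting is well defined and injective on shuffles. -/
theorem liftPerm_mk_eq_iff [Finite ιa] [Finite ιb] [Finite α] {σ τ : Perm (α ⊕ ιb)} :
    ((Quotient.mk'' (liftPerm p c σ) : Perm.ModSumCongr ιa ιb) = Quotient.mk'' (liftPerm p c τ)) ↔
      (Quotient.mk'' σ : Perm.ModSumCongr α ιb) = Quotient.mk'' τ := by
  rw [modSumCongr_mk_eq_iff, modSumCongr_mk_eq_iff]
  constructor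
  · intro h i
    obtain ⟨j, hj⟩ := h (p (some i))
    obtain ⟨o, rfl⟩ := p.surjective j
    rcases o with _ | j
    · rw [liftPerm_none, liftPerm_some] at hj
      exact absurd (c.injective hj) (by simp)
    · rw [liftPerm_some, liftPerm_some] at hj
      exact ⟨j, Option.some_injective _ (c.injective hj)⟩
  · intro h i
    obtain ⟨o, rfl⟩ := p.surjective i
    rcases o with _ | i
    · exact ⟨p none, by rw [liftPerm_none, liftPerm_none]⟩
    · obtain ⟨j, hj⟩ := h i
      exact ⟨p (some j), by rw [liftPerm_some, liftPerm_some, hj]⟩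

/-- Every shuffle which puts `c none` into the first block is a lift. -/
theorem exists_liftPerm_eq [DecidableEq ιa] [Finite ιa] [Finite ιb] (σ : Perm (ιa ⊕ ιb)) (i : ιa)
    (hi : σ (Sum.inl i) = c none) : ∃ τ : Perm (α ⊕ ιb),
      (Quotient.mk'' (liftPerm p c τ) : Perm.ModSumCongr ιa ιb) = Quotient.mk'' σ := by
  -- Modify `σ` by a permutation of the first block so that `p none` is sent to `c none`.
  let σ' : Perm (ιa ⊕ ιb) := σ * Perm.sumCongr (swap i (p none)) 1
  have h0 : σ' (Sum.inl (p none)) = c none := by simp [σ', hi]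
  let μ : Perm (Option (α ⊕ ιb)) := (optionSumLeft p).trans (σ'.trans c.symm)
  have hμ : μ none = none := by
    simp [μ, optionSumLeft, h0]
  have hμ' : optionCongr (removeNone μ) = μ := by
    ext1 o
    rcases o with _ | o
    · simp [hμ]
    · rw [optionCongr_apply, Option.map_some]
      refine removeNone_some _ (Option.ne_none_iff_exists'.1 fun h => ?_)
      exact absurd (μ.injective (h.trans hμ.symm)) (by simp)
  refine ⟨removeNone μ, modSumCongr_mk_eq_iff.2 fun k => ⟨swap i (p none) k, ?_⟩⟩
  rw [liftPerm, hμ']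
  simp [μ, σ']

variable {R M N₁ N₂ : Type*} [CommRing R] [AddCommGroup M] [Module R M] [AddCommGroup N₁]
  [Module R N₁] [AddCommGroup N₂] [Module R N₂]

theorem summand_mk_apply [Fintype ιa] [Fintype ιb] [DecidableEq ιa] [DecidableEq ιb]
    (f : M [⋀^ιa]→ₗ[R] N₁) (g : M [⋀^ιb]→ₗ[R] N₂) (σ : Perm (ιa ⊕ ιb)) (v : ιa ⊕ ιb → M) :
    domCoprod.summand f g (Quotient.mk'' σ) v =
      Perm.sign σ • (f (fun i => v (σ (Sum.inl i))) ⊗ₜ[R] g fun j => v (σ (Sum.inr j))) := rfl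

/-- Exchanging the two blocks. -/
def swapPerm (σ : Perm (ιa ⊕ ιb)) : Perm (ιb ⊕ ιa) :=
  (Equiv.sumComm ιb ιa).trans (σ.trans (Equiv.sumComm ιa ιb))

theorem swapPerm_mk_eq {σ τ : Perm (ιa ⊕ ιb)}
    (h : (Quotient.mk'' σ : Perm.ModSumCongr ιa ιb) = Quotient.mk'' τ) :
    (Quotient.mk'' (swapPerm σ) : Perm.ModSumCongr ιb ιa) = Quotient.mk'' (swapPerm τ) := by
  rw [Quotient.eq'', QuotientGroup.leftRel_apply] at h ⊢
  obtain ⟨⟨s, t⟩, h⟩ := h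
  refine ⟨⟨t, s⟩, ?_⟩
  ext x
  have h1 := Equiv.congr_fun h x.swap
  rw [Perm.mul_apply, eq_comm, Perm.inv_eq_iff_eq] at h1
  rw [Perm.mul_apply, eq_comm, Perm.inv_eq_iff_eq]
  rcases x with x | x <;> simpa [swapPerm] using congrArg Sum.swap h1

/-- Exchanging the two blocks, on classes of permutations. -/
def swapMod : Perm.ModSumCongr ιa ιb ≃ Perm.ModSumCongr ιb ιa where
  toFun := Quotient.map' swapPerm fun _ _ h => Quotient.exact' (swapPerm_mk_eq (Quotient.sound' h))
  invFun := Quotient.map' swapPerm fun _ _ h => Quotient.exact' (swapPerm_mk_eq (Quotient.sound' h))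
  left_inv z := by
    induction z using Quotient.inductionOn' with | _ σ
    rw [Quotient.map'_mk'', Quotient.map'_mk'']
    congr 1
    ext y
    simp [swapPerm]
  right_inv z := by
    induction z using Quotient.inductionOn' with | _ σ
    rw [Quotient.map'_mk'', Quotient.map'_mk'']
    congr 1
    ext y
    simp [swapPerm]

theorem inLeft_swap [Finite ιa] [Finite ιb] (x : ιa ⊕ ιb) (z : Perm.ModSumCongr ιa ιb) :
    InLeft x.swap (swapMod z) ↔ ¬ InLeft x z := by
  induction z using Quotient.inductionOn' with | _ σ
  change InLeft x.swap (Quotient.mk'' (swapPerm σ)) ↔ _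
  rw [inLeft_mk, inLeft_mk]
  constructor
  · rintro ⟨j, hj⟩ ⟨i, hi⟩
    have h1 : σ (Sum.inr j) = x := by simpa [swapPerm] using congrArg Sum.swap hj
    exact absurd (σ.injective (h1.trans hi.symm)) (by simp)
  · intro h
    obtain ⟨y, hy⟩ := σ.surjective x
    rcases y with i | j
    · exact absurd ⟨i, hy⟩ h
    · exact ⟨j, by simp [swapPerm, hy]⟩

variable [Fintype ιa] [Fintype ιb] [Fintype α] [DecidableEq ιa] [DecidableEq ιb] [DecidableEq α]

open Classical in
/-- The part of the shuffle product of `f` and `g` in which the entry with the index `c none` is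
inserted into `f`. -/
theorem sum_inLeft_summand (f : M [⋀^ιa]→ₗ[R] N₁) (g : M [⋀^ιb]→ₗ[R] N₂) (v : ιa ⊕ ιb → M)
    (f' : M [⋀^α]→ₗ[R] N₁)
    (hf' : ∀ w : α → M, f' w = f fun i => (p.symm i).elim (v (c none)) w) :
    ∑ z : Perm.ModSumCongr ιa ιb with InLeft (c none) z, domCoprod.summand f g z v =
      Perm.sign ((optionSumLeft p).symm.trans c) •
        domCoprod f' g fun i => v (c (some i)) := by
  have hsum : domCoprod f' g (fun i => v (c (some i))) =
      ∑ z : Perm.ModSumCongr α ιb, domCoprod.summand f' g z fun i => v (c (some i)) := by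
    rw [domCoprod_apply, _root_.sum_apply]
  rw [hsum, Finset.smul_sum]
  symm
  refine Finset.sum_nbij (Quotient.map' (liftPerm p c) fun σ τ h => ?_) ?_ ?_ ?_ ?_
  · exact Quotient.exact' ((liftPerm_mk_eq_iff p c).2 (Quotient.sound' h))
  · intro z _
    induction z using Quotient.inductionOn' with | _ σ
    rw [Quotient.map'_mk'']
    exact Finset.mem_filter.2 ⟨Finset.mem_univ _, (inLeft_mk _ _).2 ⟨p none, liftPerm_none p c σ⟩⟩
  · intro z _ z' _ h
    induction z using Quotient.inductionOn' with | _ σ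
    induction z' using Quotient.inductionOn' with | _ τ
    exact (liftPerm_mk_eq_iff p c).1 h
  · intro z hz
    induction z using Quotient.inductionOn' with | _ σ
    obtain ⟨i, hi⟩ := (inLeft_mk _ _).1 (Finset.mem_filter.1 hz).2
    obtain ⟨τ, hτ⟩ := exists_liftPerm_eq p c σ i hi
    exact ⟨Quotient.mk'' τ, Finset.mem_coe.2 (Finset.mem_univ _), hτ⟩
  · intro z _
    induction z using Quotient.inductionOn' with | _ σ
    rw [Quotient.map'_mk'', summand_mk_apply, summand_mk_apply, smul_smul, hf']
    have hs : Perm.sign (liftPerm p c σ) =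
        Perm.sign ((optionSumLeft p).symm.trans c) * Perm.sign σ := by
      have : liftPerm p c σ = ((optionSumLeft p).symm.trans c) *
          ((optionSumLeft p).symm.trans ((optionCongr σ).trans (optionSumLeft p))) := by
        ext; simp [liftPerm]
      rw [this, Perm.sign_mul, ← Equiv.trans_assoc, Perm.sign_symm_trans_trans, optionCongr_sign]
    rw [hs]
    congr 2
    · congr 1
      ext i
      obtain ⟨o, rfl⟩ := p.surjective i
      rcases o with _ | i
      · rw [liftPerm_none]; simp
      · rw [liftPerm_some]; simp

theorem summand_swap (f : M [⋀^ιa]→ₗ[R] N₁) (g : M [⋀^ιb]→ₗ[R] N₂) (v : ιa ⊕ ιb → M)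
    (z : Perm.ModSumCongr ιa ιb) : domCoprod.summand f g z v =
      TensorProduct.comm R N₂ N₁ (domCoprod.summand g f (swapMod z) (v ∘ Sum.swap)) := by
  induction z using Quotient.inductionOn' with | _ σ
  change _ = TensorProduct.comm R N₂ N₁
    (domCoprod.summand g f (Quotient.mk'' (swapPerm σ)) (v ∘ Sum.swap))
  rw [summand_mk_apply, summand_mk_apply]
  have hs : Perm.sign (swapPerm σ) = Perm.sign σ := by
    have : swapPerm σ = (Equiv.sumComm ιa ιb).symm.trans (σ.trans (Equiv.sumComm ιa ιb)) := rfl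
    rw [this, ← Equiv.trans_assoc, Perm.sign_symm_trans_trans]
  rw [hs, Units.smul_def, Units.smul_def, map_zsmul, TensorProduct.comm_tmul]
  simp [swapPerm]

theorem domCoprod_swap (f : M [⋀^ιa]→ₗ[R] N₁) (g : M [⋀^ιb]→ₗ[R] N₂) (v : ιa ⊕ ιb → M) :
    domCoprod f g v = TensorProduct.comm R N₂ N₁ (domCoprod g f (v ∘ Sum.swap)) := by
  rw [domCoprod_apply, domCoprod_apply, _root_.sum_apply, _root_.sum_apply, map_sum]
  exact Fintype.sum_equiv swapMod _ _ fun z => summand_swap f g v z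

open Classical in
/-- The shuffle product of `f` and `g`, split according to whether the entry with the index `x` is
inserted into `f` or into `g`. -/
theorem domCoprod_eq_add (f : M [⋀^ιa]→ₗ[R] N₁) (g : M [⋀^ιb]→ₗ[R] N₂) (v : ιa ⊕ ιb → M)
    (x : ιa ⊕ ιb) :
    domCoprod f g v =
      ∑ z : Perm.ModSumCongr ιa ιb with InLeft x z, domCoprod.summand f g z v +
      TensorProduct.comm R N₂ N₁ (∑ z : Perm.ModSumCongr ιb ιa with InLeft x.swap z,
        domCoprod.summand g f z (v ∘ Sum.swap)) := by
  rw [domCoprod_apply, _root_.sum_apply, ← Finset.sum_filter_add_sum_filter_not _ (InLeft x),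
    map_sum]
  congr 1
  exact Finset.sum_equiv swapMod (fun z => by simp [inLeft_swap])
    fun z _ => summand_swap f g v z

end Shuffle

section ShuffleFin

variable {R M N₁ N₂ : Type*} [CommRing R] [AddCommGroup M] [Module R M] [AddCommGroup N₁]
  [Module R N₁] [AddCommGroup N₂] [Module R N₂]

open Classical in
/-- The terms of the shuffle product in which the first entry goes into `f`. -/
theorem sum_inLeft_zero {q r : ℕ} (f : M [⋀^Fin (q + 1)]→ₗ[R] N₁) (g : M [⋀^Fin r]→ₗ[R] N₂)
    (v : Fin (q + 1) ⊕ Fin r → M) :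
    ∑ z : Equiv.Perm.ModSumCongr (Fin (q + 1)) (Fin r) with InLeft (Sum.inl 0) z,
      domCoprod.summand f g z v =
        domCoprod (f.curryLeft (v (Sum.inl 0))) g fun s => v (s.map Fin.succ id) := by
  have h := sum_inLeft_summand (finSuccEquiv q).symm (optionSumLeft (finSuccEquiv q).symm) f g v
    (f.curryLeft (v (Sum.inl 0))) fun w => ?_
  · rw [Equiv.symm_trans_self, Equiv.Perm.sign_refl, one_smul] at h
    convert h using 3 with s
    rcases s with i | j
    · simp [optionSumLeft]
    · rfl
  · rw [AlternatingMap.curryLeft_apply_apply]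
    congr 1
    ext i
    refine Fin.cases ?_ (fun i => ?_) i <;> simp [optionSumLeft]

/-- The index `0` of `Fin (q + (r + 1))` is split off, and the remaining indices are shifted. -/
def shiftSplit (q r : ℕ) : Option (Fin r ⊕ Fin q) ≃ Fin (r + 1) ⊕ Fin q :=
  (optionCongr ((Equiv.sumComm _ _).trans finSumFinEquiv)).trans
    ((finSuccEquiv (q + r)).symm.trans
      ((finSumFinEquiv (m := q) (n := r + 1)).symm.trans (Equiv.sumComm _ _)))

theorem sign_shiftSplit (q r : ℕ) :
    Equiv.Perm.sign ((optionSumLeft (finSuccEquiv r).symm).symm.trans (shiftSplit q r)) =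
      (-1) ^ q := by
  let E : Fin (r + 1) ⊕ Fin q ≃ Fin (q + (r + 1)) := (Equiv.sumComm _ _).trans finSumFinEquiv
  let k : Fin (q + (r + 1)) := Fin.natAdd q 0
  have h : (optionSumLeft (finSuccEquiv r).symm).symm.trans (shiftSplit q r) =
      (E.trans k.cycleRange).trans E.symm := by
    ext1 y
    obtain ⟨o, rfl⟩ := (optionSumLeft (finSuccEquiv r).symm).surjective y
    rw [Equiv.trans_apply, Equiv.symm_apply_apply, Equiv.trans_apply, Equiv.trans_apply,
      Equiv.eq_symm_apply]
    rcases o with _ | j | i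
    · have h1 : E (optionSumLeft (finSuccEquiv r).symm none) = k := by
        simp [E, optionSumLeft, k]
      rw [h1, Fin.cycleRange_self]
      simp [E, shiftSplit]
    · have h1 : E (optionSumLeft (finSuccEquiv r).symm (some (Sum.inl j))) =
          Fin.natAdd q j.succ := by
        simp [E, optionSumLeft]
      rw [h1, Fin.cycleRange_of_gt (by simp [k, Fin.lt_def])]
      simp [E, shiftSplit]
      rfl
    · have h1 : E (optionSumLeft (finSuccEquiv r).symm (some (Sum.inr i))) =
          Fin.castAdd (r + 1) i := by
        simp [E, optionSumLeft]
      rw [h1]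
      refine Fin.ext ?_
      rw [Fin.coe_cycleRange_of_lt (by simp [k, Fin.lt_def])]
      simp [E, shiftSplit]
  rw [h, Equiv.Perm.sign_trans_trans_symm, Fin.sign_cycleRange]
  simp [k]

open Classical in
/-- The terms of the shuffle product in which the first entry goes into `g`; moving it past the `q`
entries of `f` costs the sign `(-1)^q`. -/
theorem sum_not_inLeft_zero {q r : ℕ} (f : M [⋀^Fin q]→ₗ[R] N₁)
    (g : M [⋀^Fin (r + 1)]→ₗ[R] N₂) (v : Fin (q + (r + 1)) → M) :
    TensorProduct.comm R N₂ N₁ (∑ z : Equiv.Perm.ModSumCongr (Fin (r + 1)) (Fin q) with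
      InLeft (finSumFinEquiv.symm (0 : Fin (q + (r + 1)))).swap z,
        domCoprod.summand g f z (v ∘ finSumFinEquiv ∘ Sum.swap)) =
      (-1 : ℤ) ^ q • domCoprod f (g.curryLeft (v 0)) fun s => v (finSumFinEquiv s).succ := by
  have hc : shiftSplit q r none = (finSumFinEquiv.symm (0 : Fin (q + (r + 1)))).swap := rfl
  have hc' : ∀ s, finSumFinEquiv (shiftSplit q r (some s)).swap = (finSumFinEquiv s.swap).succ := by
    intro s
    simp [shiftSplit]
  have h := sum_inLeft_summand (finSuccEquiv r).symm (shiftSplit q r) g f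
    (v ∘ finSumFinEquiv ∘ Sum.swap) (g.curryLeft (v 0)) fun w => ?_
  · rw [hc, sign_shiftSplit] at h
    rw [h, Units.smul_def, map_zsmul]
    have h2 : (fun i => (v ∘ finSumFinEquiv ∘ Sum.swap) (shiftSplit q r (some i))) =
        (fun s => v (finSumFinEquiv s).succ) ∘ Sum.swap := by
      ext s
      simp only [Function.comp_apply, hc']
    rw [h2, domCoprod_swap f]
    simp
  · rw [AlternatingMap.curryLeft_apply_apply]
    congr 1
    ext i
    refine Fin.cases ?_ (fun i => ?_) i
    · rw [hc]
      simp
    · simp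

/-- The shuffle product `f ∧ g`, with values in the tensor product. -/
def wedge {q r : ℕ} (f : M [⋀^Fin q]→ₗ[R] N₁) (g : M [⋀^Fin r]→ₗ[R] N₂) :
    M [⋀^Fin (q + r)]→ₗ[R] TensorProduct R N₁ N₂ :=
  (f.domCoprod g).domDomCongr finSumFinEquiv

theorem wedge_apply {q r : ℕ} (f : M [⋀^Fin q]→ₗ[R] N₁) (g : M [⋀^Fin r]→ₗ[R] N₂)
    (v : Fin (q + r) → M) : wedge f g v = domCoprod f g (v ∘ finSumFinEquiv) := rfl

open Classical in
theorem wedge_succ_left {q r : ℕ} (f : M [⋀^Fin (q + 1)]→ₗ[R] N₁) (g : M [⋀^Fin r]→ₗ[R] N₂)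
    (v : Fin (q + 1 + r) → M) (h : q + 1 + r = q + r + 1) :
    ∑ z : Equiv.Perm.ModSumCongr (Fin (q + 1)) (Fin r) with InLeft (Sum.inl 0) z,
      domCoprod.summand f g z (v ∘ finSumFinEquiv) =
    wedge (f.curryLeft (v (Fin.cast h.symm 0))) g fun i => v (Fin.cast h.symm i.succ) := by
  rw [sum_inLeft_zero, wedge_apply]
  congr 1
  ext s
  simp only [Function.comp_apply]
  congr 1
  rcases s with i | j
  · rfl
  · refine Fin.ext ?_
    simp; omega

/-- The insertion of a first entry is an antiderivation for the shuffle product. -/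
theorem wedge_succ_succ {q r : ℕ} (f : M [⋀^Fin (q + 1)]→ₗ[R] N₁)
    (g : M [⋀^Fin (r + 1)]→ₗ[R] N₂) (x : M) (v : Fin (q + 1 + r) → M)
    (h : q + (r + 1) = q + 1 + r) :
    wedge f g (Fin.cons x v) = wedge (f.curryLeft x) g (fun i => v (Fin.cast h i)) +
      (-1 : ℤ) ^ (q + 1) • wedge f (g.curryLeft x) v := by
  classical
  rw [wedge_apply, domCoprod_eq_add f g _ (Sum.inl 0)]
  congr 1
  · rw [wedge_succ_left f g _ (by omega)]
    rfl
  · exact sum_not_inLeft_zero f g (Fin.cons x v : Fin (q + 1 + r + 1) → M)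

theorem wedge_succ_zero {q : ℕ} (f : M [⋀^Fin (q + 1)]→ₗ[R] N₁)
    (g : M [⋀^Fin 0]→ₗ[R] N₂) (x : M) (v : Fin q → M) :
    wedge f g (Fin.cons x v : Fin (q + 1) → M) = wedge (f.curryLeft x) g v := by
  classical
  rw [wedge_apply]
  refine (domCoprod_eq_add f g _ (Sum.inl 0)).trans ?_
  rw [Finset.sum_eq_zero (s := Finset.filter (InLeft (Sum.inl 0).swap) _), _root_.map_zero,
    add_zero]
  · exact wedge_succ_left f g _ rfl
  · rintro z hz
    obtain ⟨σ, -, i, -⟩ := (Finset.mem_filter.1 hz).2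
    exact i.elim0

theorem wedge_zero_succ {r : ℕ} (f : M [⋀^Fin 0]→ₗ[R] N₁)
    (g : M [⋀^Fin (r + 1)]→ₗ[R] N₂) (x : M) (v : Fin (0 + r) → M) :
    wedge f g (Fin.cons x v : Fin (0 + r + 1) → M) = wedge f (g.curryLeft x) v := by
  classical
  rw [wedge_apply]
  refine (domCoprod_eq_add f g _ (finSumFinEquiv.symm (0 : Fin (0 + (r + 1))))).trans ?_
  rw [Finset.sum_eq_zero, zero_add]
  · refine (sum_not_inLeft_zero f g (Fin.cons x v : Fin (0 + r + 1) → M)).trans ?_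
    rw [pow_zero, one_smul]
    rfl
  · rintro z hz
    obtain ⟨σ, -, i, -⟩ := (Finset.mem_filter.1 hz).2
    exact i.elim0

theorem wedge_zero_zero (f : M [⋀^Fin 0]→ₗ[R] N₁) (g : M [⋀^Fin 0]→ₗ[R] N₂) (v : Fin 0 → M) :
    wedge f g v = f ![] ⊗ₜ g ![] := by
  classical
  rw [wedge_apply, domCoprod_apply, _root_.sum_apply]
  have : ∀ z : Equiv.Perm.ModSumCongr (Fin 0) (Fin 0), z = Quotient.mk'' 1 := fun z => by
    induction z using Quotient.inductionOn' with | _ σ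
    congr 1
    exact Subsingleton.elim _ _
  refine (Finset.sum_eq_single (Quotient.mk'' 1) (fun z _ hz => absurd (this z) hz)
    fun h => absurd (Finset.mem_univ _) h).trans ?_
  rw [summand_mk_apply]
  rw [Equiv.Perm.sign_one, one_smul]
  congr 2 <;> exact Subsingleton.elim _ _

theorem map_wedge {N₁' N₂' : Type*} [AddCommGroup N₁'] [Module R N₁'] [AddCommGroup N₂']
    [Module R N₂'] (h : N₁ →ₗ[R] N₁') (k : N₂ →ₗ[R] N₂') {q r : ℕ} (f : M [⋀^Fin q]→ₗ[R] N₁)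
    (g : M [⋀^Fin r]→ₗ[R] N₂) (v : Fin (q + r) → M) :
    TensorProduct.map h k (wedge f g v) =
      wedge (h.compAlternatingMap f) (k.compAlternatingMap g) v := by
  rw [wedge_apply, wedge_apply, domCoprod_apply, domCoprod_apply, _root_.sum_apply,
    _root_.sum_apply, map_sum]
  refine Finset.sum_congr rfl fun z _ => ?_
  induction z using Quotient.inductionOn' with | _ σ
  rw [summand_mk_apply, summand_mk_apply, Units.smul_def, map_zsmul]
  rfl

theorem wedge_zsmul_left (c : ℤ) {q r : ℕ} (f : M [⋀^Fin q]→ₗ[R] N₁)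
    (g : M [⋀^Fin r]→ₗ[R] N₂) (v : Fin (q + r) → M) : wedge (c • f) g v = c • wedge f g v := by
  rw [wedge_apply, wedge_apply, ← domCoprod'_apply, ← TensorProduct.smul_tmul', map_zsmul]
  rfl

theorem wedge_zsmul_right (c : ℤ) {q r : ℕ} (f : M [⋀^Fin q]→ₗ[R] N₁)
    (g : M [⋀^Fin r]→ₗ[R] N₂) (v : Fin (q + r) → M) : wedge f (c • g) v = c • wedge f g v := by
  rw [wedge_apply, wedge_apply, ← domCoprod'_apply, TensorProduct.tmul_smul, map_zsmul]
  rfl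

end ShuffleFin
end AltTools

/-! ### Contractions of `Alt_A(H, Λ_A Q)` -/

namespace AltTools

variable {A L M : Type*} [CommRing A] [AddCommGroup L] [Module A L] [AddCommGroup M] [Module A M]

theorem cons_cons_swap {q : ℕ} (f : L [⋀^Fin (q + 1 + 1)]→ₗ[A] M) (x y : L) (v : Fin q → L) :
    f (Fin.cons y (Fin.cons x v)) = - f (Fin.cons x (Fin.cons y v)) := by
  rw [← AlternatingMap.map_swap f (Fin.cons x (Fin.cons y v) : Fin (q + 2) → L)
    (i := 0) (j := 1) (by simp)]
  congr 1
  ext i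
  refine Fin.cases ?_ (fun i => Fin.cases ?_ (fun i => ?_) i) i
  · simp
  · rw [show Fin.succ (0 : Fin (q + 1)) = 1 from rfl]
    simp
  · rw [Function.comp_apply, Equiv.swap_apply_of_ne_of_ne (by simp)
      (by rw [← Fin.succ_zero_eq_one, Ne, Fin.succ_inj]; simp)]
    rfl

end AltTools

namespace Form

section Contractions

variable {R A H Q : Type*} [CommRing R] [CommRing A] [Algebra R A]
  [AddCommGroup H] [Module A H] [AddCommGroup Q] [Module R Q] [Module A Q] [IsScalarTower R A Q]

theorem lof_congr {q r : ℕ} (h : r = q) (f : FormDeg A H Q q) :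
    DirectSum.lof R ℕ (FormDeg A H Q) q f =
      DirectSum.lof R ℕ (FormDeg A H Q) r (f.domDomCongr (finCongr h.symm)) := by
  subst h
  rfl

theorem lof_apply_self (q : ℕ) (f : FormDeg A H Q q) :
    DirectSum.lof R ℕ (FormDeg A H Q) q f q = f := DirectSum.lof_apply ..

theorem lof_apply_ne {q k : ℕ} (h : q ≠ k) (f : FormDeg A H Q q) :
    DirectSum.lof R ℕ (FormDeg A H Q) q f k = 0 := DirectSum.of_eq_of_ne _ _ _ h.symm

theorem hom_ext {M : Type*} [AddCommGroup M] [Module R M] {X Y : Form A H Q →ₗ[R] M}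
    (h : ∀ q f, X (DirectSum.lof R ℕ (FormDeg A H Q) q f) =
      Y (DirectSum.lof R ℕ (FormDeg A H Q) q f)) : X = Y :=
  DirectSum.linearMap_ext R fun q => LinearMap.ext (h q)

variable (R) in
@[elab_as_elim]
theorem form_induction {P : Form A H Q → Prop} (F : Form A H Q)
    (lof : ∀ q f, P (DirectSum.lof R ℕ (FormDeg A H Q) q f))
    (add : ∀ F G, P F → P G → P (F + G)) : P F := by
  refine DirectSum.induction_on F ?_ lof add
  have h := lof 0 0
  rwa [map_zero] at h

theorem form_ext {F G : Form A H Q} (h : ∀ k v, F k v = G k v) : F = G :=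
  DFinsupp.ext fun k => AlternatingMap.ext (h k)

variable (R) in
/-- The value of a form at a tuple of elements of `H`. -/
noncomputable def evalAt (k : ℕ) (v : Fin k → H) : Form A H Q →ₗ[R] ExteriorAlgebra A Q where
  toFun F := F k v
  map_add' _ _ := rfl
  map_smul' _ _ := rfl

theorem evalAt_apply (k : ℕ) (v : Fin k → H) (F : Form A H Q) : evalAt R k v F = F k v := rfl

theorem apply_add (F G : Form A H Q) (k : ℕ) (v : Fin k → H) : (F + G) k v = F k v + G k v := rfl

theorem apply_sub (F G : Form A H Q) (k : ℕ) (v : Fin k → H) : (F - G) k v = F k v - G k v := rfl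

theorem apply_neg (F : Form A H Q) (k : ℕ) (v : Fin k → H) : (- F) k v = - F k v := rfl

theorem apply_zsmul (c : ℤ) (F : Form A H Q) (k : ℕ) (v : Fin k → H) :
    (c • F) k v = c • F k v := map_zsmul (evalAt ℤ k v) c F

theorem apply_zero (k : ℕ) (v : Fin k → H) : (0 : Form A H Q) k v = 0 := rfl

variable (R A H Q) in
/-- The operator which is `(-1)^(q + p)` on `Alt_A^q(H, Λ^p_A Q)`. -/
noncomputable def tau : Module.End R (Form A H Q) :=
  DirectSum.toModule R ℕ _ fun q => DirectSum.lof R ℕ (FormDeg A H Q) q ∘ₗ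
    ((-1 : ℤ) ^ q • (sgn A Q 1).compAlternatingMapₗ R)

theorem tau_lof (q : ℕ) (f : FormDeg A H Q q) :
    tau R A H Q (DirectSum.lof R ℕ (FormDeg A H Q) q f) =
      DirectSum.lof R ℕ (FormDeg A H Q) q ((-1 : ℤ) ^ q • (sgn A Q 1).compAlternatingMap f) := by
  rw [tau, DirectSum.toModule_lof]; rfl

theorem tau_apply (F : Form A H Q) (k : ℕ) (v : Fin k → H) :
    tau R A H Q F k v = (-1 : ℤ) ^ k • sgn A Q 1 (F k v) := by
  have : evalAt R k v ∘ₗ tau R A H Q =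
      (-1 : ℤ) ^ k • ((sgn A Q 1).restrictScalars R ∘ₗ evalAt R k v) := by
    refine hom_ext fun q f => ?_
    rw [LinearMap.comp_apply, tau_lof, LinearMap.smul_apply, LinearMap.comp_apply,
      evalAt_apply, evalAt_apply]
    by_cases h : q = k
    · subst h
      rw [lof_apply_self, lof_apply_self]; rfl
    · rw [lof_apply_ne h, lof_apply_ne h]
      simp
  exact LinearMap.congr_fun this F

variable (R A Q) in
/-- The contraction with `x ∈ H`, an odd operator: on `Alt_A^(q+1)(H, Λ^p_A Q)`, it is
`(-1)^(q + 1 + p)` times the insertion of `x` as the first argument. -/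
noncomputable def iH (x : H) : Module.End R (Form A H Q) :=
  DirectSum.toModule R ℕ _ fun q => match q with
    | 0 => 0
    | q + 1 => DirectSum.lof R ℕ (FormDeg A H Q) q ∘ₗ ((-1 : ℤ) ^ (q + 1) •
        ((sgn A Q 1).compAlternatingMapₗ R ∘ₗ
          ((AlternatingMap.curryLeftLinearMap (R := A) (M := H) (N := ExteriorAlgebra A Q)
            (n := q)).flip x).restrictScalars R))

theorem iH_lof_zero (x : H) (f : FormDeg A H Q 0) :
    iH R A Q x (DirectSum.lof R ℕ (FormDeg A H Q) 0 f) = 0 := by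
  rw [iH, DirectSum.toModule_lof]; rfl

theorem iH_lof_succ (x : H) (q : ℕ) (f : FormDeg A H Q (q + 1)) :
    iH R A Q x (DirectSum.lof R ℕ (FormDeg A H Q) (q + 1) f) =
      DirectSum.lof R ℕ (FormDeg A H Q) q
        ((-1 : ℤ) ^ (q + 1) • (sgn A Q 1).compAlternatingMap (f.curryLeft x)) := by
  rw [iH, DirectSum.toModule_lof]; rfl

theorem iH_apply (x : H) (F : Form A H Q) (k : ℕ) (v : Fin k → H) :
    iH R A Q x F k v = (-1 : ℤ) ^ (k + 1) • sgn A Q 1 (F (k + 1) (Fin.cons x v)) := by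
  have : evalAt R k v ∘ₗ iH R A Q x = (-1 : ℤ) ^ (k + 1) •
      ((sgn A Q 1).restrictScalars R ∘ₗ evalAt R (k + 1) (Fin.cons x v)) := by
    refine hom_ext fun q f => ?_
    rw [LinearMap.comp_apply, LinearMap.smul_apply, LinearMap.comp_apply, evalAt_apply,
      evalAt_apply]
    cases q with
    | zero =>
      rw [iH_lof_zero, lof_apply_ne (by omega)]
      simp
    | succ q =>
      rw [iH_lof_succ]
      by_cases h : q = k
      · subst h
        rw [lof_apply_self, lof_apply_self]; rfl
      · rw [lof_apply_ne h, lof_apply_ne (by omega)]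
        simp
  exact LinearMap.congr_fun this F

variable (R A H) in
/-- The operator `- ξ ∧ -` for `ξ ∈ Q`. -/
noncomputable def iQ (ξ : Q) : Module.End R (Form A H Q) :=
  DirectSum.lmap fun _ => - (LinearMap.mulLeft A (ExteriorAlgebra.ι A ξ)).compAlternatingMapₗ R

theorem iQ_lof (ξ : Q) (q : ℕ) (f : FormDeg A H Q q) :
    iQ R A H ξ (DirectSum.lof R ℕ (FormDeg A H Q) q f) = DirectSum.lof R ℕ (FormDeg A H Q) q
      (- (LinearMap.mulLeft A (ExteriorAlgebra.ι A ξ)).compAlternatingMap f) := by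
  rw [iQ, DirectSum.lmap_lof]; rfl

theorem iQ_apply (ξ : Q) (F : Form A H Q) (k : ℕ) (v : Fin k → H) :
    iQ R A H ξ F k v = - (ExteriorAlgebra.ι A ξ * F k v) := rfl

theorem iH_iH (x y : H) (F : Form A H Q) :
    iH R A Q x (iH R A Q y F) = - iH R A Q y (iH R A Q x F) := by
  refine form_ext fun k v => ?_
  simp only [iH_apply, apply_neg, AltTools.cons_cons_swap _ x y, map_neg, map_zsmul, smul_neg]

theorem iQ_iQ (ξ η : Q) (F : Form A H Q) :
    iQ R A H ξ (iQ R A H η F) = - iQ R A H η (iQ R A H ξ F) := by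
  refine form_ext fun k v => ?_
  rw [apply_neg, iQ_apply, iQ_apply, iQ_apply, iQ_apply, mul_neg, mul_neg, neg_neg, neg_neg,
    ← mul_assoc, ← mul_assoc, ← neg_mul]
  congr 1
  exact eq_neg_of_add_eq_zero_left (ExteriorAlgebra.ι_add_mul_swap ξ η)

theorem iH_iQ (x : H) (ξ : Q) (F : Form A H Q) :
    iH R A Q x (iQ R A H ξ F) = - iQ R A H ξ (iH R A Q x F) := by
  refine form_ext fun k v => ?_
  rw [apply_neg, iQ_apply, iH_apply, iH_apply, iQ_apply, map_neg, sgn_mul, sgn_ι, pow_one,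
    neg_one_smul, neg_mul, neg_neg, neg_neg, mul_smul_comm]

/-! ### Vanishing principles -/

/-- A form of positive degree in `H` is determined by its contractions. -/
theorem eq_zero_of_iH {F : Form A H Q} {k : ℕ} (h : ∀ x, iH R A Q x F k = 0) : F (k + 1) = 0 := by
  ext v
  have h1 := congrArg (fun f => f (Fin.tail v)) (h (v 0))
  simp only [iH_apply, Fin.cons_self_tail] at h1
  refine sgn_injective 1 ?_
  rw [AlternatingMap.zero_apply, map_zero]
  obtain h2 | h2 := neg_one_pow_eq_or ℤ (k + 1) <;> rw [h2] at h1 <;> simpa using h1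

/-- Forms are determined by their iterated contractions with elements of `H`. -/
theorem vanish_of_iH (S : Set (Form A H Q)) (h0 : ∀ F ∈ S, F 0 ![] = 0)
    (hS : ∀ F ∈ S, ∀ x, iH R A Q x F ∈ Submodule.span R S) : ∀ F ∈ S, F = 0 := by
  have key : ∀ k, ∀ F ∈ S, F k = 0 := by
    intro k
    induction k with
    | zero =>
      intro F hF
      ext v
      rw [Subsingleton.elim v ![], h0 F hF]; rfl
    | succ k ih =>
      intro F hF
      refine eq_zero_of_iH (R := R) fun x => ?_
      have h1 : Submodule.span R S ≤ LinearMap.ker (DirectSum.component R ℕ (FormDeg A H Q) k) :=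
        Submodule.span_le.2 fun G hG => ih G hG
      exact h1 (hS F hF x)
  intro F hF
  exact DFinsupp.ext fun k => key k F hF

/-- The functional `eps F = ω(F_0)`, where `F_0 ∈ Λ_A Q` is the component of `F` of degree `0`
in `H`. -/
noncomputable def eps (R) {A H Q : Type*} [CommRing R] [CommRing A] [Algebra R A]
    [AddCommGroup H] [Module A H] [AddCommGroup Q] [Module R Q] [Module A Q] [IsScalarTower R A Q]
    {n : ℕ} (ω : ⋀[A]^n Q ≃ₗ[A] A) : Form A H Q →ₗ[R] A :=
  (omegaExt ω).restrictScalars R ∘ₗ evalAt R 0 ![]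

theorem eps_apply {n : ℕ} (ω : ⋀[A]^n Q ≃ₗ[A] A) (F : Form A H Q) :
    eps R ω F = omegaExt ω (F 0 ![]) := rfl

/-- Forms are determined by the values of `eps` on their iterated contractions with elements of `H`
and products with elements of `Q`. -/
theorem vanish_of_iH_iQ {n : ℕ} (ω : ⋀[A]^n Q ≃ₗ[A] A)
    (hQ : ∀ v : Fin (n + 1) → Q, ExteriorAlgebra.ιMulti A (n + 1) v = 0) (S : Set (Form A H Q))
    (h0 : ∀ F ∈ S, eps R ω F = 0)
    (hS : ∀ F ∈ S, ∀ x, iH R A Q x F ∈ Submodule.span R S)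
    (hS' : ∀ F ∈ S, ∀ ξ, iQ R A H ξ F ∈ Submodule.span R S) : ∀ F ∈ S, F = 0 := by
  refine vanish_of_iH (R := R) S (fun F hF => ?_) hS
  refine eq_zero_of_omegaExt_mul_right ω hQ fun m v => ?_
  have hspan : ∀ F ∈ Submodule.span R S, ∀ ξ, iQ R A H ξ F ∈ Submodule.span R S := by
    intro F hF ξ
    have h1 : Submodule.span R S ≤ (Submodule.span R S).comap (iQ R A H ξ) :=
      Submodule.span_le.2 fun G hG => hS' G hG ξ
    exact h1 hF
  have key : ∀ m (v : Fin m → Q), ∃ G ∈ Submodule.span R S,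
      G 0 ![] = ExteriorAlgebra.ιMulti A m v * F 0 ![] := by
    intro m
    induction m with
    | zero => exact fun v => ⟨F, Submodule.subset_span hF, by simp⟩
    | succ m ih =>
      intro v
      obtain ⟨G, hG, hG'⟩ := ih (Matrix.vecTail v)
      refine ⟨(-1 : R) • iQ R A H (v 0) G, Submodule.smul_mem _ _ (hspan G hG _), ?_⟩
      rw [← evalAt_apply (R := R), map_smul, neg_one_smul, evalAt_apply, iQ_apply, hG', neg_neg,
        ExteriorAlgebra.ιMulti_succ_apply, mul_assoc]
  obtain ⟨G, hG, hG'⟩ := key m v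
  have h1 : Submodule.span R S ≤ LinearMap.ker (eps R ω) := Submodule.span_le.2 fun F hF => h0 F hF
  rw [← hG']
  exact h1 hG

end Contractions
end Form

/-! ### The product of `Alt_A(H, Λ_A Q)` -/

namespace Form

section Product

theorem neg_one_pow_eq {i j : ℕ} (h : Even (i + j)) : (-1 : ℤ) ^ i = (-1 : ℤ) ^ j :=
  neg_one_pow_congr (Nat.even_add.1 h)

theorem smul_pow_congr {M : Type*} [AddCommGroup M] {i j : ℕ} (h : Even (i + j)) (x : M) :
    (-1 : ℤ) ^ i • x = (-1 : ℤ) ^ j • x := by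
  rw [neg_one_pow_eq h]

section Wedge

variable {A H Q : Type*} [CommRing A] [AddCommGroup H] [Module A H] [AddCommGroup Q] [Module A Q]

/-- The shuffle product of forms with values in `Λ_A Q`, without signs. -/
noncomputable def shuffle {q r : ℕ} (f : FormDeg A H Q q) (g : FormDeg A H Q r) :
    FormDeg A H Q (q + r) :=
  (LinearMap.mul' A (ExteriorAlgebra A Q)).compAlternatingMap (AltTools.wedge f g)

theorem shuffle_apply {q r : ℕ} (f : FormDeg A H Q q) (g : FormDeg A H Q r)
    (v : Fin (q + r) → H) :
    shuffle f g v = LinearMap.mul' A (ExteriorAlgebra A Q) (AltTools.wedge f g v) := rfl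

theorem mulDeg_apply (q r : ℕ) (f : FormDeg A H Q q) (g : FormDeg A H Q r) (v : Fin (q + r) → H) :
    mulDeg A H Q q r f g v = (-1 : ℤ) ^ (q * r) •
      shuffle f ((sgn A Q q).compAlternatingMap g) v := rfl

theorem sgn_shuffle (k : ℕ) {q r : ℕ} (f : FormDeg A H Q q) (g : FormDeg A H Q r)
    (v : Fin (q + r) → H) : sgn A Q k (shuffle f g v) =
      shuffle ((sgn A Q k).compAlternatingMap f) ((sgn A Q k).compAlternatingMap g) v := by
  rw [shuffle_apply, shuffle_apply, ← AltTools.map_wedge]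
  generalize AltTools.wedge f g v = t
  induction t with
  | zero => simp
  | tmul u v => simp [sgn_mul]
  | add t t' h h' => simp only [map_add, h, h']

theorem shuffle_zsmul_left (c : ℤ) {q r : ℕ} (f : FormDeg A H Q q) (g : FormDeg A H Q r)
    (v : Fin (q + r) → H) : shuffle (c • f) g v = c • shuffle f g v := by
  rw [shuffle_apply, shuffle_apply, AltTools.wedge_zsmul_left, map_zsmul]

theorem shuffle_zsmul_right (c : ℤ) {q r : ℕ} (f : FormDeg A H Q q) (g : FormDeg A H Q r)
    (v : Fin (q + r) → H) : shuffle f (c • g) v = c • shuffle f g v := by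
  rw [shuffle_apply, shuffle_apply, AltTools.wedge_zsmul_right, map_zsmul]

theorem sgn_comp_sgn (k l : ℕ) {q : ℕ} (f : FormDeg A H Q q) :
    (sgn A Q k).compAlternatingMap ((sgn A Q l).compAlternatingMap f) =
      (sgn A Q (k + l)).compAlternatingMap f := by
  ext v
  exact (sgn_add k l _).symm

theorem sgn_comp_congr {k l : ℕ} (h : Even (k + l)) {q : ℕ} (f : FormDeg A H Q q) :
    (sgn A Q k).compAlternatingMap f = (sgn A Q l).compAlternatingMap f := by
  ext v
  have key : ∀ k : ℕ, ∀ u : ExteriorAlgebra A Q, sgn A Q (k + k) u = u := fun k u => by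
    rw [sgn_add, sgn_sgn]
  change sgn A Q k (f v) = sgn A Q l (f v)
  obtain ⟨c, hc⟩ := h
  rw [← sgn_sgn l (sgn A Q k (f v)), ← sgn_add l k, add_comm l k, hc, key]

theorem sgn_zsmul_comp (k : ℕ) (c : ℤ) {q : ℕ} (f : FormDeg A H Q q) :
    (sgn A Q k).compAlternatingMap (c • f) = c • (sgn A Q k).compAlternatingMap f := by
  ext v
  exact map_zsmul (sgn A Q k) c (f v)

theorem shuffle_cons_zero_succ {r : ℕ} (f : FormDeg A H Q 0) (g : FormDeg A H Q (r + 1)) (x : H)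
    (v : Fin (0 + r) → H) : shuffle f g (Fin.cons x v : Fin (0 + r + 1) → H) =
      shuffle f (g.curryLeft x) v :=
  congrArg (LinearMap.mul' A (ExteriorAlgebra A Q)) (AltTools.wedge_zero_succ f g x v)

theorem shuffle_cons_succ_zero {q : ℕ} (f : FormDeg A H Q (q + 1)) (g : FormDeg A H Q 0) (x : H)
    (v : Fin q → H) : shuffle f g (Fin.cons x v : Fin (q + 1) → H) =
      shuffle (f.curryLeft x) g v :=
  congrArg (LinearMap.mul' A (ExteriorAlgebra A Q)) (AltTools.wedge_succ_zero f g x v)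

theorem shuffle_cons_succ_succ {q r : ℕ} (f : FormDeg A H Q (q + 1)) (g : FormDeg A H Q (r + 1))
    (x : H) (v : Fin (q + 1 + r) → H) (h : q + (r + 1) = q + 1 + r) :
    shuffle f g (Fin.cons x v : Fin (q + 1 + r + 1) → H) =
      shuffle (f.curryLeft x) g (fun i => v (Fin.cast h i)) +
        (-1 : ℤ) ^ (q + 1) • shuffle f (g.curryLeft x) v := by
  refine (congrArg (LinearMap.mul' A (ExteriorAlgebra A Q))
    (AltTools.wedge_succ_succ f g x v h)).trans ?_
  rw [map_add, map_zsmul]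
  rfl

theorem shuffle_zero_zero (f g : FormDeg A H Q 0) (v : Fin 0 → H) :
    shuffle f g v = f ![] * g ![] :=
  congrArg (LinearMap.mul' A (ExteriorAlgebra A Q)) (AltTools.wedge_zero_zero f g v)

end Wedge

variable {R A H Q : Type*} [CommRing R] [CommRing A] [Algebra R A]
  [AddCommGroup H] [Module A H] [AddCommGroup Q] [Module R Q] [Module A Q] [IsScalarTower R A Q]

theorem neg_mul' (F G : Form A H Q) : mul R A H Q (-F) G = - mul R A H Q F G :=
  map_neg ((mul R A H Q).flip G) F

theorem sub_mul' (F F' G : Form A H Q) :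
    mul R A H Q (F - F') G = mul R A H Q F G - mul R A H Q F' G :=
  map_sub ((mul R A H Q).flip G) F F'

theorem zsmul_mul' (c : ℤ) (F G : Form A H Q) :
    mul R A H Q (c • F) G = c • mul R A H Q F G :=
  map_zsmul ((mul R A H Q).flip G) c F

/-- The contraction with `x ∈ H` is an odd derivation. -/
theorem iH_mul (x : H) (F G : Form A H Q) :
    iH R A Q x (mul R A H Q F G) = mul R A H Q (iH R A Q x F) G +
      mul R A H Q (tau R A H Q F) (iH R A Q x G) := by
  refine form_induction R F (fun q f => ?_) fun F F' h h' => ?_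
  swap
  · simp only [map_add, LinearMap.add_apply, h, h']; abel
  refine form_induction R G (fun r g => ?_) fun G G' h h' => ?_
  swap
  · simp only [map_add, h, h']; abel
  · rw [mul_lof, tau_lof]
    rcases q with _ | q <;> rcases r with _ | r
    · rw [iH_lof_zero, iH_lof_zero, iH_lof_zero, map_zero, map_zero, LinearMap.zero_apply,
        add_zero]
    · rw [iH_lof_zero, iH_lof_succ, mul_lof, map_zero, LinearMap.zero_apply]
      refine Eq.trans ?_ (zero_add _).symm
      refine (iH_lof_succ x (0 + r) _).trans ?_
      congr 1
      ext v
      change (-1 : ℤ) ^ (0 + r + 1) • sgn A Q 1 (mulDeg A H Q 0 (r + 1) f g (Fin.cons x v)) =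
        mulDeg A H Q 0 r _ _ v
      rw [mulDeg_apply, mulDeg_apply]
      erw [shuffle_cons_zero_succ]
      rw [map_zsmul, sgn_shuffle, sgn_zsmul_comp, shuffle_zsmul_left, shuffle_zsmul_right,
        sgn_comp_sgn, AlternatingMap.curryLeft_compAlternatingMap, sgn_comp_sgn, smul_smul,
        smul_smul, smul_smul, ← pow_add, ← pow_add, ← pow_add]
      exact smul_pow_congr ⟨r + 1, by ring⟩ _
    · rw [iH_lof_zero, map_zero]
      refine Eq.trans ?_ (add_zero _).symm
      refine (iH_lof_succ x q _).trans ?_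
      rw [iH_lof_succ, mul_lof]
      congr 1
      ext v
      change (-1 : ℤ) ^ (q + 1) • sgn A Q 1 (mulDeg A H Q (q + 1) 0 f g (Fin.cons x v)) =
        mulDeg A H Q q 0 _ _ v
      rw [mulDeg_apply, mulDeg_apply]
      erw [shuffle_cons_succ_zero]
      rw [map_zsmul, sgn_shuffle, shuffle_zsmul_left, sgn_comp_sgn, smul_smul, smul_smul,
        ← pow_add, ← pow_add, sgn_comp_congr (k := 1 + (q + 1)) (l := q) ⟨q + 1, by ring⟩]
      exact smul_pow_congr ⟨q + 1, by ring⟩ _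
    · rw [iH_lof_succ, iH_lof_succ, mul_lof, mul_lof,
        lof_congr (show q + 1 + r = q + (r + 1) by ring),
        ← map_add]
      refine (iH_lof_succ x (q + 1 + r) _).trans ?_
      congr 1
      ext v
      change (-1 : ℤ) ^ (q + 1 + r + 1) •
        sgn A Q 1 (mulDeg A H Q (q + 1) (r + 1) f g (Fin.cons x v)) =
        mulDeg A H Q q (r + 1) _ _
            (fun i => v (Fin.cast (show q + (r + 1) = q + 1 + r by ring) i)) +
          mulDeg A H Q (q + 1) r _ _ v
      rw [mulDeg_apply, mulDeg_apply, mulDeg_apply]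
      erw [shuffle_cons_succ_succ _ _ x v (by ring)]
      simp only [map_zsmul, map_add, sgn_shuffle, sgn_zsmul_comp, shuffle_zsmul_left,
        shuffle_zsmul_right, sgn_comp_sgn, AlternatingMap.curryLeft_compAlternatingMap, smul_smul,
        smul_add, ← pow_add]
      rw [sgn_comp_congr (k := 1 + (q + 1)) (l := q) ⟨q + 1, by ring⟩,
        sgn_comp_congr (k := 1 + (q + 1)) (l := q + 1 + 1) ⟨q + 2, by ring⟩]
      congr 1
      · exact smul_pow_congr ⟨q * r + 2 * q + r + 2, by ring⟩ _
      · exact smul_pow_congr ⟨q * r + 2 * q + 2 * r + 3, by ring⟩ _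

theorem mul_apply_zero (F G : Form A H Q) :
    mul R A H Q F G 0 ![] = F 0 ![] * G 0 ![] := by
  refine form_induction R F (fun q f => ?_) fun F F' h h' => ?_
  swap
  · rw [map_add, LinearMap.add_apply, apply_add, h, h', apply_add, add_mul]
  refine form_induction R G (fun r g => ?_) fun G G' h h' => ?_
  swap
  · rw [map_add, apply_add, h, h', apply_add, mul_add]
  · rw [mul_lof]
    by_cases h : q = 0 ∧ r = 0
    · obtain ⟨rfl, rfl⟩ := h
      erw [lof_apply_self]
      rw [lof_apply_self, lof_apply_self, mulDeg_apply, shuffle_zero_zero]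
      rw [zero_mul, pow_zero, one_smul]
      rfl
    · rw [lof_apply_ne (by omega)]
      rcases Nat.eq_zero_or_pos q with hq | hq
      · rw [lof_apply_ne (q := r) (by omega)]; simp
      · rw [lof_apply_ne (q := q) (by omega)]; simp

theorem iH_tau (x : H) (F : Form A H Q) :
    iH R A Q x (tau R A H Q F) = - tau R A H Q (iH R A Q x F) := by
  refine form_ext fun k v => ?_
  rw [apply_neg, iH_apply, tau_apply, tau_apply, iH_apply, map_zsmul, smul_smul,
    smul_smul, ← neg_smul]
  congr 1
  ring

theorem tau_tau (F : Form A H Q) : tau R A H Q (tau R A H Q F) = F := by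
  refine form_ext fun k v => ?_
  rw [tau_apply, tau_apply, map_zsmul, sgn_sgn, smul_smul, ← mul_pow]
  simp

theorem tau_iQ (ξ : Q) (F : Form A H Q) :
    tau R A H Q (iQ R A H ξ F) = - iQ R A H ξ (tau R A H Q F) := by
  refine form_ext fun k v => ?_
  rw [apply_neg, tau_apply, iQ_apply, iQ_apply, tau_apply, map_neg, sgn_mul, sgn_ι, mul_smul_comm]
  simp

theorem tau_mul (F G : Form A H Q) :
    tau R A H Q (mul R A H Q F G) = mul R A H Q (tau R A H Q F) (tau R A H Q G) := by
  refine sub_eq_zero.1 (vanish_of_iH (R := R) {E : Form A H Q | ∃ F G,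
    E = tau R A H Q (mul R A H Q F G) - mul R A H Q (tau R A H Q F) (tau R A H Q G)} ?_ ?_ _
    ⟨F, G, rfl⟩)
  · rintro _ ⟨F, G, rfl⟩
    rw [apply_sub, tau_apply, mul_apply_zero, mul_apply_zero, tau_apply, tau_apply, sgn_mul]
    simp
  · rintro _ ⟨F, G, rfl⟩ x
    have :
        iH R A Q x (tau R A H Q (mul R A H Q F G) - mul R A H Q (tau R A H Q F) (tau R A H Q G)) =
      (-1 : R) • (tau R A H Q (mul R A H Q (iH R A Q x F) G) -
        mul R A H Q (tau R A H Q (iH R A Q x F)) (tau R A H Q G)) +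
      (-1 : R) • (tau R A H Q (mul R A H Q (tau R A H Q F) (iH R A Q x G)) -
        mul R A H Q (tau R A H Q (tau R A H Q F)) (tau R A H Q (iH R A Q x G))) := by
      simp only [map_sub, map_add, iH_tau, iH_mul, map_neg, neg_mul']
      module
    rw [this]
    exact Submodule.add_mem _ (Submodule.smul_mem _ _ (Submodule.subset_span ⟨_, _, rfl⟩))
      (Submodule.smul_mem _ _ (Submodule.subset_span ⟨_, _, rfl⟩))

/-- Associativity is checked on the components of degree `0` in `H`, since the associator is
compatible with contractions. -/
theorem mul_assoc' (F G K : Form A H Q) : mul R A H Q (mul R A H Q F G) K =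
    mul R A H Q F (mul R A H Q G K) := by
  refine sub_eq_zero.1 (vanish_of_iH (R := R) {E : Form A H Q | ∃ F G K,
    E = mul R A H Q (mul R A H Q F G) K - mul R A H Q F (mul R A H Q G K)} ?_ ?_ _
    ⟨F, G, K, rfl⟩)
  · rintro _ ⟨F, G, K, rfl⟩
    rw [apply_sub, mul_apply_zero, mul_apply_zero, mul_apply_zero, mul_apply_zero, mul_assoc,
      sub_self]
  · rintro _ ⟨F, G, K, rfl⟩ x
    have : iH R A Q x (mul R A H Q (mul R A H Q F G) K - mul R A H Q F (mul R A H Q G K)) =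
      (mul R A H Q (mul R A H Q (iH R A Q x F) G) K -
        mul R A H Q (iH R A Q x F) (mul R A H Q G K)) +
      (mul R A H Q (mul R A H Q (tau R A H Q F) (iH R A Q x G)) K -
        mul R A H Q (tau R A H Q F) (mul R A H Q (iH R A Q x G) K)) +
      (mul R A H Q (mul R A H Q (tau R A H Q F) (tau R A H Q G)) (iH R A Q x K) -
        mul R A H Q (tau R A H Q F) (mul R A H Q (tau R A H Q G) (iH R A Q x K))) := by
      simp only [map_sub, map_add, iH_mul, LinearMap.add_apply, tau_mul]
      abel
    rw [this]
    exact Submodule.add_mem _ (Submodule.add_mem _ (Submodule.subset_span ⟨_, _, _, rfl⟩)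
      (Submodule.subset_span ⟨_, _, _, rfl⟩)) (Submodule.subset_span ⟨_, _, _, rfl⟩)

variable (R H) in
/-- An element of `Λ_A Q` as an element of `Alt_A^0(H, Λ_A Q)`. -/
noncomputable def const (u : ExteriorAlgebra A Q) : Form A H Q :=
  DirectSum.lof R ℕ (FormDeg A H Q) 0 (AlternatingMap.constOfIsEmpty A H (Fin 0) u)

theorem const_apply_zero (u : ExteriorAlgebra A Q) : const R H u 0 ![] = u := by
  rw [const, lof_apply_self]; rfl

theorem const_one : const R H (1 : ExteriorAlgebra A Q) = one R A H Q := rfl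

theorem const_ι (ξ : Q) : const R H (ExteriorAlgebra.ι A ξ) = ofQ R A H ξ := rfl

theorem iH_const (x : H) (u : ExteriorAlgebra A Q) : iH R A Q x (const R H u) = 0 :=
  iH_lof_zero x _

theorem tau_const (u : ExteriorAlgebra A Q) :
    tau R A H Q (const R H u) = const R H (sgn A Q 1 u) := by
  rw [const, tau_lof, pow_zero, one_smul]; rfl

/-- The product with an element of `Λ_A Q` from the left is computed pointwise. -/
theorem const_mul_apply (u : ExteriorAlgebra A Q) (F : Form A H Q) (k : ℕ) (v : Fin k → H) :
    mul R A H Q (const R H u) F k v = u * F k v := by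
  let L (u : ExteriorAlgebra A Q) : Form A H Q →ₗ[R] Form A H Q :=
    DirectSum.lmap fun _ => (LinearMap.mulLeft A u).compAlternatingMapₗ R
  have hL : ∀ u F k v, L u F k v = u * F k v := fun u F k v => rfl
  suffices h : mul R A H Q (const R H u) F = L u F by rw [h, hL]
  refine sub_eq_zero.1 (vanish_of_iH (R := R) {E : Form A H Q | ∃ u F,
    E = mul R A H Q (const R H u) F - L u F} ?_ ?_ _ ⟨u, F, rfl⟩)
  · rintro _ ⟨u, F, rfl⟩
    rw [apply_sub, mul_apply_zero, const_apply_zero, hL, sub_self]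
  · rintro _ ⟨u, F, rfl⟩ x
    refine Submodule.subset_span ⟨sgn A Q 1 u, iH R A Q x F, ?_⟩
    have : iH R A Q x (L u F) = L (sgn A Q 1 u) (iH R A Q x F) := by
      refine form_ext fun k v => ?_
      rw [hL, iH_apply, iH_apply, hL, sgn_mul, mul_smul_comm]
    rw [map_sub, iH_mul, iH_const, map_zero, LinearMap.zero_apply, zero_add, tau_const, this]

theorem iQ_eq (ξ : Q) (F : Form A H Q) : iQ R A H ξ F = - mul R A H Q (ofQ R A H ξ) F := by
  refine form_ext fun k v => ?_
  rw [apply_neg, iQ_apply, ← const_ι, const_mul_apply]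

theorem one_mul' (F : Form A H Q) : mul R A H Q (one R A H Q) F = F := by
  refine form_ext fun k v => ?_
  rw [← const_one, const_mul_apply, one_mul]

theorem mul_one' (F : Form A H Q) : mul R A H Q F (one R A H Q) = F := by
  refine sub_eq_zero.1 (vanish_of_iH (R := R) {E : Form A H Q | ∃ F : Form A H Q,
    E = mul R A H Q F (one R A H Q) - F} ?_ ?_ _ ⟨F, rfl⟩)
  · rintro _ ⟨F, rfl⟩
    rw [apply_sub, mul_apply_zero, ← const_one, const_apply_zero, mul_one, sub_self]
  · rintro _ ⟨F, rfl⟩ x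
    refine Submodule.subset_span ⟨iH R A Q x F, ?_⟩
    rw [map_sub, iH_mul, ← const_one, iH_const, map_zero, add_zero]

end Product
end Form

/-! ### Bidegrees, parity and graded commutativity -/

namespace Form

section Parity

variable {A Q : Type*} [CommRing A] [AddCommGroup Q] [Module A Q]

variable (A Q) in
/-- The sum of the `Λ^p_A Q` with `p` congruent to `j` modulo `2`. -/
def parityPart (j : ℕ) : Submodule A (ExteriorAlgebra A Q) :=
  Submodule.span A {u | ∃ p, Even (p + j) ∧ u ∈ ⋀[A]^p Q}

theorem mem_parityPart {p j : ℕ} (h : Even (p + j)) {u : ExteriorAlgebra A Q}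
    (hu : u ∈ ⋀[A]^p Q) : u ∈ parityPart A Q j := Submodule.subset_span ⟨p, h, hu⟩

theorem parityPart_congr {i j : ℕ} (h : Even (i + j)) : parityPart A Q i = parityPart A Q j := by
  unfold parityPart
  congr 1
  ext u
  refine exists_congr fun p => and_congr_left fun _ => ?_
  rw [Nat.even_add] at h ⊢
  rw [Nat.even_add, h]

theorem parityPart_induction {j : ℕ} {P : ExteriorAlgebra A Q → Prop}
    (mem : ∀ p, Even (p + j) → ∀ u ∈ ⋀[A]^p Q, P u) (zero : P 0)
    (add : ∀ u v, P u → P v → P (u + v)) {u : ExteriorAlgebra A Q} (hu : u ∈ parityPart A Q j) :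
    P u := by
  refine Submodule.closure_induction (p := fun u _ => P u) zero
    (fun u v _ _ => add u v) ?_ hu
  rintro a u ⟨p, hp, hu⟩
  exact mem p hp _ (Submodule.smul_mem _ a hu)

theorem sgn_of_mem_parityPart {j : ℕ} (k : ℕ) {u : ExteriorAlgebra A Q}
    (hu : u ∈ parityPart A Q j) : sgn A Q k u = (-1 : ℤ) ^ (k * j) • u := by
  refine parityPart_induction (P := fun u => sgn A Q k u = (-1 : ℤ) ^ (k * j) • u) ?_ ?_ ?_ hu
  · intro p hp u hu
    rw [sgn_of_mem k hu]
    refine smul_pow_congr ?_ u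
    rw [← mul_add]
    exact hp.mul_left k
  · simp
  · intro u v hu hv; rw [map_add, hu, hv, smul_add]

theorem sgn_mem_parityPart {j : ℕ} (k : ℕ) {u : ExteriorAlgebra A Q}
    (hu : u ∈ parityPart A Q j) : sgn A Q k u ∈ parityPart A Q j := by
  rw [sgn_of_mem_parityPart k hu]
  exact zsmul_mem hu _

theorem eq_zsmul_sgn (k : ℕ) (u : ExteriorAlgebra A Q) :
    u = (-1 : ℤ) ^ k • sgn A Q 1 ((-1 : ℤ) ^ k • sgn A Q 1 u) := by
  rw [map_zsmul, sgn_sgn, smul_smul, ← mul_pow]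
  simp

theorem mul_comm_of_mem_parityPart {i j : ℕ} {u v : ExteriorAlgebra A Q}
    (hu : u ∈ parityPart A Q i) (hv : v ∈ parityPart A Q j) :
    u * v = (-1 : ℤ) ^ (i * j) • (v * u) := by
  refine parityPart_induction (P := fun v => u * v = (-1 : ℤ) ^ (i * j) • (v * u)) ?_ ?_ ?_ hv
  · intro r hr v hv
    rw [mul_eq_mul_sgn u hv, sgn_of_mem_parityPart r hu, mul_smul_comm]
    refine smul_pow_congr ?_ _
    rw [mul_comm i j, ← add_mul]
    exact hr.mul_right i
  · simp
  · intro v w hv hw; rw [mul_add, add_mul, hv, hw, smul_add]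

end Parity

section Bidegree

variable {R A H Q : Type*} [CommRing R] [CommRing A] [Algebra R A]
  [AddCommGroup H] [Module A H] [AddCommGroup Q] [Module R Q] [Module A Q] [IsScalarTower R A Q]

/-- `F` is a sum of elements of the constituents `Alt_A^q(H, Λ^p_A Q)` with `q + p` congruent to
`j` modulo `2`. -/
def HasParity (j : ℕ) (F : Form A H Q) : Prop := ∀ k v, F k v ∈ parityPart A Q (j + k)

theorem mem_comp_iff {q p : ℕ} {F : Form A H Q} : F ∈ comp R A H Q q p ↔
    (∀ k, k ≠ q → F k = 0) ∧ ∀ v, F q v ∈ ⋀[A]^p Q := by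
  constructor
  · rintro ⟨f, hf, rfl⟩
    refine ⟨fun k hk => lof_apply_ne hk.symm f, fun v => ?_⟩
    rw [lof_apply_self]
    exact hf v
  · rintro ⟨h0, h⟩
    refine ⟨F q, h, form_ext fun k v => ?_⟩
    by_cases hk : k = q
    · subst hk; rw [lof_apply_self]
    · rw [lof_apply_ne (Ne.symm hk), h0 k hk]

theorem apply_mem_of_mem_comp {q p : ℕ} {F : Form A H Q} (hF : F ∈ comp R A H Q q p) (k : ℕ)
    (v : Fin k → H) : F k v ∈ ⋀[A]^p Q := by
  rw [mem_comp_iff] at hF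
  by_cases hk : k = q
  · subst hk; exact hF.2 v
  · rw [hF.1 k hk]; exact Submodule.zero_mem _

theorem hasParity_of_mem {q p : ℕ} {F : Form A H Q} (hF : F ∈ comp R A H Q q p) :
    HasParity (q + p) F := by
  rw [mem_comp_iff] at hF
  intro k v
  by_cases hk : k = q
  · subst hk; exact mem_parityPart ⟨k + p, by ring⟩ (hF.2 v)
  · rw [hF.1 k hk]; exact Submodule.zero_mem _

theorem HasParity.congr {i j : ℕ} {F : Form A H Q} (hF : HasParity i F) (h : Even (i + j)) :
    HasParity j F := fun k v => by
  rw [parityPart_congr (j := i + k)]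
  · exact hF k v
  · rw [show j + k + (i + k) = i + j + (k + k) by ring]
    exact h.add ⟨k, rfl⟩

theorem HasParity.tau_eq {j : ℕ} {F : Form A H Q} (hF : HasParity j F) :
    tau R A H Q F = (-1 : ℤ) ^ j • F := by
  refine form_ext fun k v => ?_
  rw [tau_apply, sgn_of_mem_parityPart 1 (hF k v), smul_smul, ← pow_add, apply_zsmul]
  exact smul_pow_congr ⟨j + k, by ring⟩ _

theorem HasParity.iH {j : ℕ} {F : Form A H Q} (hF : HasParity j F) (x : H) :
    HasParity (j + 1) (iH R A Q x F) := fun k v => by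
  rw [iH_apply, add_assoc, add_comm 1 k]
  exact zsmul_mem (sgn_mem_parityPart 1 (hF _ _)) _

theorem HasParity.zsmul {j : ℕ} {F : Form A H Q} (hF : HasParity j F) (c : ℤ) :
    HasParity j (c • F) := fun k v => by
  rw [apply_zsmul]
  exact zsmul_mem (hF k v) c

/-- Graded commutativity, reduced to that of `Λ_A Q` by contractions. -/
theorem mul_comm' {i j : ℕ} {F G : Form A H Q} (hF : HasParity i F) (hG : HasParity j G) :
    Form.mul R A H Q F G = (-1 : ℤ) ^ (i * j) • Form.mul R A H Q G F := by
  refine sub_eq_zero.1 (vanish_of_iH (R := R) {E : Form A H Q | ∃ i j F G, HasParity i F ∧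
    HasParity j G ∧ E = Form.mul R A H Q F G - (-1 : ℤ) ^ (i * j) • Form.mul R A H Q G F} ?_ ?_ _
    ⟨i, j, F, G, hF, hG, rfl⟩)
  · rintro _ ⟨i, j, F, G, hF, hG, rfl⟩
    rw [apply_sub, apply_zsmul, mul_apply_zero, mul_apply_zero,
      mul_comm_of_mem_parityPart (hF 0 _) (hG 0 _), add_zero, add_zero, sub_self]
  · rintro _ ⟨i, j, F, G, hF, hG, rfl⟩ x
    have : Form.iH R A Q x (Form.mul R A H Q F G - (-1 : ℤ) ^ (i * j) • Form.mul R A H Q G F) =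
      (Form.mul R A H Q (Form.iH R A Q x F) G -
        (-1 : ℤ) ^ ((i + 1) * j) • Form.mul R A H Q G (Form.iH R A Q x F)) +
      (Form.mul R A H Q ((-1 : ℤ) ^ i • F) (Form.iH R A Q x G) -
        (-1 : ℤ) ^ (i * (j + 1)) • Form.mul R A H Q (Form.iH R A Q x G) ((-1 : ℤ) ^ i • F)) := by
      rw [map_sub, map_zsmul, iH_mul, iH_mul, hF.tau_eq, hG.tau_eq]
      simp only [zsmul_mul', map_zsmul, smul_add, smul_smul, ← pow_add]
      rw [neg_one_pow_eq (i := i * j + j) (j := (i + 1) * j) ⟨i * j + j, by ring⟩,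
        neg_one_pow_eq (i := i * (j + 1) + i) (j := i * j) ⟨i * j + i, by ring⟩]
      abel
    rw [this]
    exact Submodule.add_mem _ (Submodule.subset_span ⟨_, _, _, _, hF.iH x, hG, rfl⟩)
      (Submodule.subset_span ⟨_, _, _, _, hF.zsmul _, hG.iH x, rfl⟩)

/-- All values of `F` lie in `Λ^p_A Q`. -/
def HasValues (p : ℕ) (F : Form A H Q) : Prop := ∀ k v, F k v ∈ ⋀[A]^p Q

theorem HasValues.mul {p r : ℕ} {F G : Form A H Q} (hF : HasValues p F) (hG : HasValues r G) :
    HasValues (p + r) (mul R A H Q F G) := by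
  intro k
  induction k generalizing F G with
  | zero =>
    intro v
    rw [Subsingleton.elim v ![], mul_apply_zero]
    exact mul_mem_exteriorPower (hF 0 _) (hG 0 _)
  | succ k ih =>
    have hiH : ∀ {p : ℕ} {F : Form A H Q}, HasValues p F → ∀ x, HasValues p (iH R A Q x F) :=
      fun hF x k v => by
        rw [iH_apply]; exact zsmul_mem (sgn_mem 1 (hF _ _)) _
    have htau : HasValues p (tau R A H Q F) := fun k v => by
        rw [tau_apply]; exact zsmul_mem (sgn_mem 1 (hF _ _)) _
    intro v
    have h1 : iH R A Q (v 0) (Form.mul R A H Q F G) k (Fin.tail v) ∈ ⋀[A]^(p + r) Q := by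
      rw [iH_mul, apply_add]
      exact Submodule.add_mem _ (ih (hiH hF _) hG _) (ih htau (hiH hG _) _)
    rw [iH_apply, Fin.cons_self_tail] at h1
    rw [eq_zsmul_sgn (k + 1) (Form.mul R A H Q F G (k + 1) v)]
    exact zsmul_mem (sgn_mem 1 h1) _

theorem mul_mem_comp {q p q' p' : ℕ} {F G : Form A H Q} (hF : F ∈ comp R A H Q q p)
    (hG : G ∈ comp R A H Q q' p') : mul R A H Q F G ∈ comp R A H Q (q + q') (p + p') := by
  have hv : HasValues (p + p') (mul R A H Q F G) :=
    HasValues.mul (apply_mem_of_mem_comp hF) (apply_mem_of_mem_comp hG)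
  refine mem_comp_iff.2 ⟨fun k hk => ?_, fun v => hv _ v⟩
  obtain ⟨f, -, rfl⟩ := hF
  obtain ⟨g, -, rfl⟩ := hG
  rw [mul_lof, lof_apply_ne (Ne.symm hk)]

theorem one_mem_comp : one R A H Q ∈ comp R A H Q 0 0 :=
  ⟨_, fun _ => SetLike.one_mem_graded fun i : ℕ => ⋀[A]^i Q, rfl⟩

theorem iH_mem_comp {q p : ℕ} {F : Form A H Q} (hF : F ∈ comp R A H Q (q + 1) p) (x : H) :
    iH R A Q x F ∈ comp R A H Q q p := by
  rw [mem_comp_iff] at hF ⊢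
  refine ⟨fun k hk => ?_, fun v => ?_⟩
  · ext v
    rw [iH_apply, hF.1 _ (by omega)]
    simp
  · rw [iH_apply]
    exact zsmul_mem (sgn_mem 1 (hF.2 _)) _

theorem iQ_mem_comp {q p : ℕ} {F : Form A H Q} (hF : F ∈ comp R A H Q q p) (ξ : Q) :
    iQ R A H ξ F ∈ comp R A H Q q (p + 1) := by
  rw [mem_comp_iff] at hF ⊢
  refine ⟨fun k hk => ?_, fun v => ?_⟩
  · ext v
    rw [iQ_apply, hF.1 _ hk]
    simp
  · rw [iQ_apply, add_comm]
    exact neg_mem (mul_mem_exteriorPower (ι_mem ξ) (hF.2 _))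

theorem ofQ_mem_comp (ξ : Q) : ofQ R A H ξ ∈ comp R A H Q 0 1 := ⟨_, fun _ => ι_mem ξ, rfl⟩

theorem ofForm_mem_comp {q : ℕ} (β : H [⋀^Fin q]→ₗ[A] A) :
    ofForm R A Q β ∈ comp R A H Q q 0 := by
  refine ⟨_, fun v => ?_, rfl⟩
  have h := SetLike.one_mem_graded fun i : ℕ => ⋀[A]^i Q
  have h2 := Submodule.smul_mem _ (β v) h
  rwa [Algebra.smul_def, mul_one] at h2

/-- The projection of `Λ_A Q` onto `Λ^p_A Q`. -/
noncomputable def extProj (A Q : Type*) [CommRing A] [AddCommGroup Q] [Module A Q] (p : ℕ) :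
    ExteriorAlgebra A Q →ₗ[A] ExteriorAlgebra A Q :=
  GradedAlgebra.proj (fun i : ℕ => ⋀[A]^i Q) p

theorem extProj_of_mem {p : ℕ} {u : ExteriorAlgebra A Q} (hu : u ∈ ⋀[A]^p Q) :
    extProj A Q p u = u := by
  rw [extProj, GradedAlgebra.proj_apply]
  exact DirectSum.decompose_of_mem_same (fun i : ℕ => ⋀[A]^i Q) hu

theorem extProj_of_mem_ne {p r : ℕ} (h : p ≠ r) {u : ExteriorAlgebra A Q} (hu : u ∈ ⋀[A]^p Q) :
    extProj A Q r u = 0 := by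
  rw [extProj, GradedAlgebra.proj_apply]
  exact DirectSum.decompose_of_mem_ne (fun i : ℕ => ⋀[A]^i Q) hu h

theorem extProj_mem (p : ℕ) (u : ExteriorAlgebra A Q) : extProj A Q p u ∈ ⋀[A]^p Q := by
  rw [extProj, GradedAlgebra.proj_apply]
  exact SetLike.coe_mem _

theorem sum_extProj {n : ℕ} (hQ : ∀ v : Fin (n + 1) → Q, ExteriorAlgebra.ιMulti A (n + 1) v = 0)
    (u : ExteriorAlgebra A Q) : ∑ p ∈ Finset.range (n + 1), extProj A Q p u = u := by
  have : ∑ p ∈ Finset.range (n + 1), extProj A Q p = LinearMap.id := by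
    refine lhom_eq_of_ιMulti fun m v => ?_
    rw [LinearMap.sum_apply, LinearMap.id_apply]
    by_cases hm : m < n + 1
    · rw [Finset.sum_eq_single_of_mem m (Finset.mem_range.2 hm) fun p _ hp =>
        extProj_of_mem_ne (Ne.symm hp) (ιMulti_mem m v), extProj_of_mem (ιMulti_mem m v)]
    · rw [eq_zero_of_mem_of_lt hQ (by omega) (ιMulti_mem m v)]
      simp
  rw [← LinearMap.sum_apply, this, LinearMap.id_apply]

/-- Induction on the elements of the constituents. -/
theorem comp_induction {n : ℕ} (hQ : ∀ v : Fin (n + 1) → Q, ExteriorAlgebra.ιMulti A (n + 1) v = 0)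
    {P : Form A H Q → Prop} (mem : ∀ q p, ∀ F ∈ comp R A H Q q p, P F)
    (add : ∀ F G, P F → P G → P (F + G)) (F : Form A H Q) : P F := by
  refine form_induction R F (fun q f => ?_) add
  have hf : f = ∑ p ∈ Finset.range (n + 1), (extProj A Q p).compAlternatingMap f := by
    ext v
    rw [AltTools.sum_apply]
    exact (sum_extProj hQ (f v)).symm
  rw [hf, map_sum]
  refine Finset.sum_induction _ P add (mem 0 0 0 (Submodule.zero_mem _)) fun p _ => ?_
  exact mem q p _ ⟨_, fun v => extProj_mem p _, rfl⟩

theorem isInternal_comp {n : ℕ}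
    (hQ : ∀ v : Fin (n + 1) → Q, ExteriorAlgebra.ιMulti A (n + 1) v = 0) :
    DirectSum.IsInternal fun i : ℕ × ℕ => comp R A H Q i.1 i.2 := by
  let π (i : ℕ × ℕ) : Form A H Q →ₗ[R] Form A H Q :=
    DirectSum.lof R ℕ (FormDeg A H Q) i.1 ∘ₗ (extProj A Q i.2).compAlternatingMapₗ R ∘ₗ
      DirectSum.component R ℕ (FormDeg A H Q) i.1
  have hπ : ∀ i F, π i F = DirectSum.lof R ℕ (FormDeg A H Q) i.1
    ((extProj A Q i.2).compAlternatingMap (F i.1)) := fun i F => rfl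
  refine (DirectSum.isInternal_submodule_iff_iSupIndep_and_iSup_eq_top
    (R := R) (M := Form A H Q) _).2 ⟨fun i => ?_, ?_⟩
  · rw [Submodule.disjoint_def]
    intro F hF hF'
    have h1 : π i F = F := by
      obtain ⟨f, hf, rfl⟩ := hF
      rw [hπ, lof_apply_self]
      congr 1
      ext v
      exact extProj_of_mem (hf v)
    have h2 : (⨆ j, ⨆ (_ : j ≠ i), comp R A H Q j.1 j.2) ≤ LinearMap.ker (π i) := by
      refine iSup₂_le fun j hj => ?_
      rintro _ ⟨f, hf, rfl⟩
      rw [LinearMap.mem_ker, hπ]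
      by_cases h : j.1 = i.1
      · have h' : j.2 ≠ i.2 := fun h' => hj (Prod.ext h h')
        obtain ⟨j1, j2⟩ := j
        obtain ⟨i1, i2⟩ := i
        obtain rfl : j1 = i1 := h
        rw [lof_apply_self]
        refine (congrArg _ ?_).trans (map_zero _)
        ext v
        exact extProj_of_mem_ne h' (hf v)
      · rw [lof_apply_ne h]
        refine (congrArg _ ?_).trans (map_zero _)
        ext v
        exact map_zero (extProj A Q i.2)
    rw [← h1]
    exact h2 hF'
  · refine Submodule.eq_top_iff'.2 fun F => comp_induction (R := R) hQ (fun q p F hF => ?_)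
      (fun F G => Submodule.add_mem _) F
    exact le_iSup (fun i : ℕ × ℕ => comp R A H Q i.1 i.2) (q, p) hF

/-- `Alt_A(H, Λ_A Q)` is a bigraded commutative algebra. -/
theorem isBigradedCommAlgebra {n : ℕ}
    (hQ : ∀ v : Fin (n + 1) → Q, ExteriorAlgebra.ιMulti A (n + 1) v = 0) :
    IsBigradedCommAlgebra (mul R A H Q) (one R A H Q) (comp R A H Q) where
  isInternal := isInternal_comp hQ
  one_mem := one_mem_comp
  mul_mem _ _ _ _ _ ha _ hb := mul_mem_comp ha hb
  one_mul := one_mul'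
  mul_one := mul_one'
  mul_assoc := mul_assoc'
  mul_comm _ _ _ _ _ ha _ hb := mul_comm' (hasParity_of_mem ha) (hasParity_of_mem hb)

end Bidegree
end Form

/-! ### The Cartan formula and the operator `d` -/

namespace AltTools

variable {A L M : Type*} [CommRing A] [AddCommGroup L] [Module A L] [AddCommGroup M] [Module A M]

theorem cons_removeNth {q : ℕ} (f : L [⋀^Fin (q + 1)]→ₗ[A] M) (v : Fin (q + 1) → L)
    (j : Fin (q + 1)) (y : L) :
    (-1 : ℤ) ^ (j : ℕ) • f (Fin.cons y (j.removeNth v)) = f (Function.update v j y) := by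
  have h := AlternatingMap.map_insertNth f j y (j.removeNth v)
  rw [Fin.insertNth_removeNth] at h
  rw [h]
  rfl

theorem curryLeft_apply_cons {q : ℕ} (f : L [⋀^Fin (q + 1)]→ₗ[A] M) (x : L) (v : Fin q → L) :
    f.curryLeft x v = f (Fin.cons x v) := rfl

end AltTools

namespace AlmostLieRinehart

variable {R A L M : Type*} [CommRing R] [CommRing A] [Algebra R A] [AddCommGroup L] [Module R L]
  [Module A L] [IsScalarTower R A L] [AddCommGroup M] [Module R M] [Module A M]
  [IsScalarTower R A M] {S : AlmostLieRinehart R A L}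

/-- Cartan's formula `x ⌟ ∂f = x · f - ∂(x ⌟ f)` in positive degree. -/
theorem ceFun_cons_succ (c : S.Connection M) {q : ℕ} (f : L [⋀^Fin (q + 1)]→ₗ[A] M) (x : L)
    (v : Fin (q + 1) → L) : ceFun c f (Fin.cons x v) =
      c.act x (f v) - ∑ j, f (Function.update v j (S.bracket x (v j))) -
        ceFun c (f.curryLeft x) v := by
  have hb : S.bracketPart f (Fin.cons x v) =
      - ∑ j, f (Function.update v j (S.bracket x (v j))) - S.bracketPart (f.curryLeft x) v := by
    cases q with
    | zero =>
      simp only [bracketPart]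
      rw [AltTools.pairSum_cons_zero, Fin.sum_univ_one, sub_zero, ← AltTools.cons_removeNth]
      rw [Subsingleton.elim (Fin.removeNth 0 v) ![]]
      simp
    | succ q =>
      simp only [bracketPart]
      rw [AltTools.pairSum_cons_succ, sub_eq_add_neg]
      simp only [← AltTools.cons_removeNth]
      congr 1
      simp only [AltTools.pairSum, ← Finset.sum_neg_distrib]
      refine Finset.sum_congr rfl fun i _ => Finset.sum_congr rfl fun k _ => ?_
      split_ifs
      · rw [AltTools.curryLeft_apply_cons, AltTools.cons_cons_swap f x, smul_neg]
      · simp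
  rw [ceFun, Fin.sum_univ_succ, hb, ceFun]
  simp only [AltTools.removeNth_succ_cons, Fin.cons_succ, Fin.cons_zero, Fin.val_zero, Fin.val_succ,
    pow_zero, one_smul, pow_succ, mul_neg_one, neg_smul, Finset.sum_neg_distrib,
    AltTools.curryLeft_apply_cons]
  rw [show Fin.removeNth 0 (Fin.cons x v : Fin (q + 2) → L) = v by ext k; simp]
  abel

theorem ceFun_cons_zero (c : S.Connection M) (f : L [⋀^Fin 0]→ₗ[A] M) (x : L)
    (v : Fin 0 → L) : ceFun c f (Fin.cons x v : Fin 1 → L) = c.act x (f v) := by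
  rw [ceFun, bracketPart, add_zero, Fin.sum_univ_one]
  simp only [Fin.val_zero, pow_zero, one_smul, Fin.cons_zero]
  congr 2

theorem ceFun_comp (c : S.Connection M) {q : ℕ} (h : M →ₗ[A] M)
    (hc : ∀ x m, c.act x (h m) = h (c.act x m)) (f : L [⋀^Fin q]→ₗ[A] M) (v : Fin (q + 1) → L) :
    ceFun c (h.compAlternatingMap f) v = h (ceFun c f v) := by
  rw [ceFun, ceFun, map_add, map_sum]
  congr 1
  · refine Finset.sum_congr rfl fun i _ => ?_
    rw [map_zsmul, LinearMap.compAlternatingMap_apply, hc]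
  · cases q with
    | zero => simp [bracketPart]
    | succ q =>
      simp only [bracketPart, AltTools.pairSum, map_sum]
      refine Finset.sum_congr rfl fun i _ => Finset.sum_congr rfl fun k _ => ?_
      split_ifs
      · rw [map_zsmul]; rfl
      · simp

theorem ceFun_zsmul (c : S.Connection M) {q : ℕ} (k : ℤ) (f : L [⋀^Fin q]→ₗ[A] M)
    (v : Fin (q + 1) → L) : ceFun c (k • f) v = k • ceFun c f v := by
  have := ceFun_comp c (k • LinearMap.id) (fun x m => by simp) f v
  exact this

theorem ceFun_zero (c : S.Connection M) {q : ℕ} (v : Fin (q + 1) → L) :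
    ceFun c (0 : L [⋀^Fin q]→ₗ[A] M) v = 0 := by
  have := ceFun_zsmul c 0 (0 : L [⋀^Fin q]→ₗ[A] M) v
  rwa [zero_smul, zero_smul] at this

theorem ce_apply (c : S.Connection M) {q : ℕ} (f : L [⋀^Fin q]→ₗ[A] M) (v : Fin (q + 1) → L) :
    ce c q f v = ceFun c f v := rfl

end AlmostLieRinehart

namespace AlmostPreLRTriple

open Form AlmostLieRinehart

variable {R A H Q : Type*} [CommRing R] [CommRing A] [Algebra R A]
  [AddCommGroup H] [Module R H] [Module A H] [IsScalarTower R A H]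
  [AddCommGroup Q] [Module R Q] [Module A Q] [IsScalarTower R A Q] (T : AlmostPreLRTriple R A H Q)

theorem lambdaFun_zsmul (x : H) (c : ℤ) (u : ExteriorAlgebra A Q) :
    T.lambdaFun x (c • u) = c • T.lambdaFun x u := map_zsmul (T.lambdaConn.act x) c u

theorem lambdaFun_neg (x : H) (u : ExteriorAlgebra A Q) :
    T.lambdaFun x (- u) = - T.lambdaFun x u := map_neg (T.lambdaConn.act x) u

theorem lambdaFun_zero (x : H) : T.lambdaFun x 0 = 0 := map_zero (T.lambdaConn.act x)

theorem lambdaFun_sgn (x : H) (k : ℕ) (u : ExteriorAlgebra A Q) :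
    T.lambdaFun x (sgn A Q k u) = sgn A Q k (T.lambdaFun x u) := by
  induction u using CliffordAlgebra.induction with
  | algebraMap a =>
    have h1 := T.lambdaFun_algebraMap x a
    have h2 := sgn_algebraMap (Q := Q) k a
    have h3 := sgn_algebraMap (Q := Q) k (T.strH.anchor x a)
    exact (congrArg _ h2).trans (h1.trans (h3.symm.trans (congrArg _ h1.symm)))
  | ι ξ =>
    have h1 := T.lambdaFun_ι x ξ
    have h2 := sgn_ι (A := A) k ξ
    have h3 := sgn_ι (A := A) k (T.actHQ.act x ξ)
    refine (congrArg _ h2).trans ((T.lambdaFun_zsmul x _ _).trans ?_)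
    exact (congrArg _ h1).trans (h3.symm.trans (congrArg _ h1.symm))
  | mul u v hu hv =>
    rw [sgn_mul, lambdaFun_mul, lambdaFun_mul, map_add, sgn_mul, sgn_mul, hu, hv]
  | add u v hu hv => rw [map_add, lambdaFun_add, lambdaFun_add, map_add, hu, hv]

theorem lambdaFun_ιMulti (x : H) (m : ℕ) (v : Fin m → Q) :
    T.lambdaFun x (ExteriorAlgebra.ιMulti A m v) =
      ∑ j, ExteriorAlgebra.ιMulti A m (Function.update v j (T.actHQ.act x (v j))) := by
  induction m with
  | zero =>
    rw [ExteriorAlgebra.ιMulti_zero_apply, ← map_one (algebraMap A (ExteriorAlgebra A Q)),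
      lambdaFun_algebraMap]
    simp
  | succ m ih =>
    rw [ExteriorAlgebra.ιMulti_succ_apply, lambdaFun_mul, lambdaFun_ι, ih, Fin.sum_univ_succ,
      Finset.mul_sum]
    congr 1
    · rw [ExteriorAlgebra.ιMulti_succ_apply]
      simp [Matrix.vecTail, Function.comp_def]
    · refine Finset.sum_congr rfl fun j _ => ?_
      rw [ExteriorAlgebra.ιMulti_succ_apply]
      congr 2
      · ext i
        by_cases h : i = j
        · subst h; simp [Matrix.vecTail]
        · simp [Matrix.vecTail, h]

theorem omegaExt_lambdaFun {n : ℕ} (ω : ⋀[A]^n Q ≃ₗ[A] A) (hω : T.IsInvariant ω) (x : H)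
    (u : ExteriorAlgebra A Q) :
    omegaExt ω (T.lambdaFun x u) = T.strH.anchor x (omegaExt ω u) := by
  have hu : u ∈ Submodule.span A (Set.range fun x : Σ p, (Fin p → Q) =>
      ExteriorAlgebra.ιMulti A x.1 x.2) := by
    rw [ExteriorAlgebra.ιMulti_span]; exact Submodule.mem_top
  induction hu using Submodule.span_induction with
  | mem u hu =>
    obtain ⟨⟨m, v⟩, rfl⟩ := hu
    dsimp only
    rw [lambdaFun_ιMulti, map_sum]
    by_cases hm : m = n
    · subst hm
      simp only [omegaExt_ιMulti]
      exact (hω x v).symm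
    · simp [omegaExt_ιMulti_of_ne ω hm]
  | zero => rw [lambdaFun_zero]; simp
  | add u v _ _ hu hv => rw [lambdaFun_add, map_add, map_add, map_add, hu, hv]
  | smul a u _ hu =>
    rw [lambdaFun_smul, map_add, map_smul, map_smul, map_smul, hu, smul_eq_mul, smul_eq_mul,
      smul_eq_mul, Derivation.leibniz, smul_eq_mul, smul_eq_mul]
    ring

/-- The Lie derivative along `x ∈ H`, as the supercommutator of `d` with the contraction. -/
noncomputable def lieH (x : H) (F : Form A H Q) : Form A H Q :=
  iH R A Q x (T.d F) + T.d (iH R A Q x F)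

theorem d_lof (q : ℕ) (f : FormDeg A H Q q) :
    T.d (DirectSum.lof R ℕ (FormDeg A H Q) q f) = DirectSum.lof R ℕ (FormDeg A H Q) (q + 1)
      ((-1 : ℤ) ^ (q + 1) • (sgn A Q 1).compAlternatingMap (ce T.lambdaConn q f)) := by
  rw [d, DirectSum.toModule_lof]; rfl

theorem d_apply_zero (F : Form A H Q) : T.d F 0 = 0 := by
  refine form_induction R F (fun q f => ?_) fun F G hF hG => ?_
  · rw [d_lof, lof_apply_ne (by omega)]
  · rw [map_add]
    exact (congrArg₂ (· + ·) hF hG).trans (add_zero _)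

theorem d_apply_succ (F : Form A H Q) (k : ℕ) (v : Fin (k + 1) → H) :
    T.d F (k + 1) v = (-1 : ℤ) ^ (k + 1) • sgn A Q 1 (ceFun T.lambdaConn (F k) v) := by
  refine form_induction R F (fun q f => ?_) fun F G hF hG => ?_
  · rw [d_lof]
    by_cases h : q = k
    · subst h
      rw [lof_apply_self, lof_apply_self]; rfl
    · rw [lof_apply_ne h, lof_apply_ne (by omega), ceFun_zero]
      simp
  · rw [map_add, apply_add, hF, hG, ← smul_add, ← map_add]
    congr 2
    have := map_add (ce T.lambdaConn k) (F k) (G k)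
    exact (congrArg (fun f => f v) this).symm

/-- Cartan's formula: the signs in `d` and in the contraction combine to the usual Lie
derivative. -/
theorem lieH_apply (x : H) (F : Form A H Q) (k : ℕ) (v : Fin k → H) :
    T.lieH x F k v = T.lambdaFun x (F k v) -
      ∑ j, F k (Function.update v j (T.strH.bracket x (v j))) := by
  rw [lieH, apply_add, iH_apply, d_apply_succ, ← eq_zsmul_sgn]
  cases k with
  | zero =>
    rw [ceFun_cons_zero, d_apply_zero]
    simp [lambdaConn_act]
  | succ k =>
    rw [ceFun_cons_succ, d_apply_succ]
    have h : iH R A Q x F k = (-1 : ℤ) ^ (k + 1) •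
        (sgn A Q 1).compAlternatingMap ((F (k + 1)).curryLeft x) := by
      ext w
      rw [iH_apply]; rfl
    rw [h, ceFun_zsmul, ceFun_comp _ _ (fun x m => T.lambdaFun_sgn x 1 m), ← eq_zsmul_sgn]
    simp [lambdaConn_act]

/-- Cartan formula: `[L_x, i_y] = i_{[x, y]}`. -/
theorem lieH_iH (x y : H) (F : Form A H Q) :
    T.lieH x (iH R A Q y F) - iH R A Q y (T.lieH x F) = iH R A Q (T.strH.bracket x y) F := by
  refine form_ext fun k v => ?_
  rw [apply_sub, lieH_apply, iH_apply, iH_apply, iH_apply, lieH_apply, Fin.sum_univ_succ]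
  simp only [iH_apply, Fin.cons_zero, Fin.cons_succ, Fin.update_cons_zero, ← Fin.cons_update,
    map_sub, map_add, map_sum, smul_sub, smul_add, Finset.smul_sum, lambdaFun_zsmul, lambdaFun_sgn]
  abel

/-- Cartan formula: the Lie derivative along `x` acts on the products with `ξ ∈ Q` through `x ·
ξ`. -/
theorem lieH_iQ (x : H) (ξ : Q) (F : Form A H Q) :
    T.lieH x (iQ R A H ξ F) - iQ R A H ξ (T.lieH x F) = iQ R A H (T.actHQ.act x ξ) F := by
  refine form_ext fun k v => ?_
  rw [apply_sub, lieH_apply]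
  simp only [iQ_apply, lieH_apply, lambdaFun_neg, lambdaFun_mul, lambdaFun_ι, mul_sub,
    Finset.mul_sum, Finset.sum_neg_distrib]
  abel

/-- The augmentation `eps` is compatible with the actions of `x`; this is the invariance of `ω`. -/
theorem eps_lieH {n : ℕ} (ω : ⋀[A]^n Q ≃ₗ[A] A) (hω : T.IsInvariant ω) (x : H) (F : Form A H Q) :
    eps R ω (T.lieH x F) = T.strH.anchor x (eps R ω F) := by
  rw [eps_apply, lieH_apply, eps_apply]
  simp [T.omegaExt_lambdaFun ω hω]

theorem eps_d {n : ℕ} (ω : ⋀[A]^n Q ≃ₗ[A] A) (F : Form A H Q) : eps R ω (T.d F) = 0 := by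
  rw [eps_apply, d_apply_zero]
  exact map_zero _

end AlmostPreLRTriple

/-! ### The operator `Δ_ω` -/

namespace Form

section Pair

variable {R A H Q : Type*} [CommRing R] [CommRing A] [Algebra R A]
  [AddCommGroup H] [Module A H] [AddCommGroup Q] [Module R Q] [Module A Q] [IsScalarTower R A Q]
  {n : ℕ} (ω : ⋀[A]^n Q ≃ₗ[A] A)

/-- The map `(ξ_1, …, ξ_m) ↦ (x ↦ ω(F(x) ∧ ξ_1 ∧ … ∧ ξ_m))`, for the component of degree `k` of
`F`. -/
noncomputable def pair (k m : ℕ) (F : Form A H Q) : Q [⋀^Fin m]→ₗ[A] (H [⋀^Fin k]→ₗ[A] A) :=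
  (-1 : ℤ) ^ (m * k) • phi ω H k (F k) m

theorem pair_apply (k m : ℕ) (F : Form A H Q) (ξ : Fin m → Q) (v : Fin k → H) :
    pair ω k m F ξ v = omegaExt ω (F k v * ExteriorAlgebra.ιMulti A m ξ) := by
  change (-1 : ℤ) ^ (m * k) • (phi ω H k (F k) m ξ v) = _
  rw [phi_apply, smul_smul, ← mul_pow]
  simp

/-- By the nondegeneracy of `(a, w) ↦ ω(a w)`, identities between operators can be checked on the
pairings with the elements of `Λ_A Q`. -/
theorem ext_of_pair (hQ : ∀ v : Fin (n + 1) → Q, ExteriorAlgebra.ιMulti A (n + 1) v = 0)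
    {F G : Form A H Q} (h : ∀ k m ξ v, pair ω k m F ξ v = pair ω k m G ξ v) : F = G := by
  refine form_ext fun k v => sub_eq_zero.1 (eq_zero_of_omegaExt_mul_left ω hQ fun m ξ => ?_)
  have h1 := h k m ξ v
  rw [pair_apply, pair_apply] at h1
  rw [sub_mul, map_sub, h1, sub_self]

theorem pair_add (k m : ℕ) (F G : Form A H Q) (ξ : Fin m → Q) (v : Fin k → H) :
    pair ω k m (F + G) ξ v = pair ω k m F ξ v + pair ω k m G ξ v := by
  simp only [pair_apply, apply_add, add_mul, map_add]

theorem pair_sub (k m : ℕ) (F G : Form A H Q) (ξ : Fin m → Q) (v : Fin k → H) :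
    pair ω k m (F - G) ξ v = pair ω k m F ξ v - pair ω k m G ξ v := by
  simp only [pair_apply, apply_sub, sub_mul, map_sub]

/-- Under the pairing, the product with `η` becomes the insertion of `η`. -/
theorem pair_iQ (k m : ℕ) (F : Form A H Q) (η : Q) (ξ : Fin m → Q) :
    pair ω k m (iQ R A H η F) ξ = (-1 : ℤ) ^ (n + m) • pair ω k (m + 1) F (Fin.cons η ξ) := by
  ext v
  change _ = (-1 : ℤ) ^ (n + m) • (pair ω k (m + 1) F (Fin.cons η ξ) v)
  rw [pair_apply, pair_apply, iQ_apply, ExteriorAlgebra.ιMulti_succ_apply]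
  change _ = (-1 : ℤ) ^ (n + m) • omegaExt ω
    (F k v * (ExteriorAlgebra.ι A η * ExteriorAlgebra.ιMulti A m ξ))
  rw [ι_mul_eq η (ExteriorAlgebra.ιMulti A m ξ), sgn_ιMulti, ← mul_assoc,
    omegaExt_mul_comm ω _ (ι_mem η), mul_smul_comm, mul_smul_comm, map_zsmul, smul_smul, smul_smul,
    ← pow_add, ← pow_add, neg_mul, map_neg, mul_assoc, ← neg_one_smul ℤ, ← pow_one (-1 : ℤ),
    ← pow_mul]
  exact smul_pow_congr ⟨n + m + 1, by ring⟩ _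

theorem pair_iH (k m : ℕ) (F : Form A H Q) (x : H) (ξ : Fin m → Q) (v : Fin k → H) :
    pair ω k m (iH R A Q x F) ξ v =
      (-1 : ℤ) ^ (k + 1 + m + n) • pair ω (k + 1) m F ξ (Fin.cons x v) := by
  rw [pair_apply, pair_apply, iH_apply]
  have h := sgn_ιMulti (A := A) 1 m ξ
  have h1 : sgn A Q 1 (F (k + 1) (Fin.cons x v)) * ExteriorAlgebra.ιMulti A m ξ =
      (-1 : ℤ) ^ m • sgn A Q 1 (F (k + 1) (Fin.cons x v) * ExteriorAlgebra.ιMulti A m ξ) := by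
    rw [sgn_mul, h, one_mul, mul_smul_comm, smul_smul, ← mul_pow]
    simp
  rw [smul_mul_assoc, h1, map_zsmul, map_zsmul, omegaExt_sgn, smul_smul, smul_smul, one_mul,
    ← pow_add, ← pow_add]

/-- An element which is orthogonal to all `Λ^m_A Q` with `m ≠ n - p` has degree `p`. -/
theorem mem_exteriorPower_of_omegaExt
    (hQ : ∀ v : Fin (n + 1) → Q, ExteriorAlgebra.ιMulti A (n + 1) v = 0)
    {p : ℕ} {u : ExteriorAlgebra A Q} (h : ∀ m, m + p ≠ n → ∀ v : Fin m → Q,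
      omegaExt ω (u * ExteriorAlgebra.ιMulti A m v) = 0) : u ∈ ⋀[A]^p Q := by
  have h0 : ∀ r ≠ p, extProj A Q r u = 0 := by
    intro r hr
    refine eq_zero_of_omegaExt_mul_left ω hQ fun m v => ?_
    by_cases hm : m + r = n
    · have h1 := h m (by omega) v
      have h2 : ∀ s ≠ r, omegaExt ω (extProj A Q s u * ExteriorAlgebra.ιMulti A m v) = 0 :=
        fun s hs => omegaExt_of_mem_of_ne ω (m := s + m) (by omega)
          (mul_mem_exteriorPower (extProj_mem s u) (ιMulti_mem m v))
      rw [← sum_extProj hQ u, Finset.sum_mul, map_sum, Finset.sum_eq_single_of_mem r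
        (Finset.mem_range.2 (by omega)) fun s _ hs => h2 s hs] at h1
      exact h1
    · exact omegaExt_of_mem_of_ne ω (by omega)
        (mul_mem_exteriorPower (extProj_mem r u) (ιMulti_mem m v))
  rw [← sum_extProj hQ u]
  refine Submodule.sum_mem _ fun r _ => ?_
  by_cases hr : r = p
  · rw [hr]; exact extProj_mem p u
  · rw [h0 r hr]; exact Submodule.zero_mem _

theorem pair_eq_zero_of_mem {q p m k : ℕ} (h : p + m ≠ n) {F : Form A H Q}
    (hF : F ∈ comp R A H Q q p) : pair ω k m F = 0 := by
  ext ξ v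
  rw [pair_apply]
  exact omegaExt_of_mem_of_ne ω h
    (mul_mem_exteriorPower (apply_mem_of_mem_comp hF k v) (ιMulti_mem m ξ))

end Pair
end Form

namespace AlmostPreLRTriple

open Form AlmostLieRinehart

variable {R A H Q : Type*} [CommRing R] [CommRing A] [Algebra R A]
  [AddCommGroup H] [Module R H] [Module A H] [IsScalarTower R A H]
  [AddCommGroup Q] [Module R Q] [Module A Q] [IsScalarTower R A Q] (T : AlmostPreLRTriple R A H Q)
  {n : ℕ} {ω : ⋀[A]^n Q ≃ₗ[A] A}

theorem Delta_lof (hφ : ∀ q, Function.Bijective (phi ω H q)) (q : ℕ) (f : FormDeg A H Q q) :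
    ∃ g, T.Delta ω (DirectSum.lof R ℕ (FormDeg A H Q) q f) =
      DirectSum.lof R ℕ (FormDeg A H Q) q g ∧
      phi ω H q g = (-1 : ℤ) ^ (n + 1) • T.dOne q (phi ω H q f) := by
  refine ⟨linInv (phi ω H q) ((-1 : ℤ) ^ (n + 1) • T.dOne q (phi ω H q f)), ?_, ?_⟩
  · rw [Delta, DirectSum.toModule_lof]; rfl
  · rw [linInv, dif_pos (hφ q)]
    exact LinearEquiv.apply_symm_apply (LinearEquiv.ofBijective (phi ω H q) (hφ q)) _

/-- Under the pairing, `Δ_ω` becomes, up to signs, the Cartan-Chevalley-Eilenberg operator of `Q`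
with coefficients in `Alt_A(H, A)`. As the latter raises the degree, the pairing with degree `0`
vanishes. -/
theorem pair_Delta (hφ : ∀ q, Function.Bijective (phi ω H q)) (k : ℕ) (F : Form A H Q) :
    (∀ ξ, pair ω k 0 (T.Delta ω F) ξ = 0) ∧
    ∀ m ξ, pair ω k (m + 1) (T.Delta ω F) ξ =
      (-1 : ℤ) ^ (n + m) • ceFun (T.lieConn k) (pair ω k m F) ξ := by
  refine form_induction R F (fun q f => ?_) fun F G hF hG => ?_
  · obtain ⟨g, hg, hgf⟩ := T.Delta_lof hφ q f
    rw [hg]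
    by_cases h : q = k
    · subst h
      constructor
      · intro ξ
        rw [pair, lof_apply_self, hgf]
        change (-1 : ℤ) ^ (0 * q) • (-1 : ℤ) ^ (n + 1) •
          (0 : Q [⋀^Fin 0]→ₗ[A] (H [⋀^Fin q]→ₗ[A] A)) ξ = 0
        simp
      · intro m ξ
        rw [pair, lof_apply_self, hgf, pair, lof_apply_self, ceFun_zsmul]
        change (-1 : ℤ) ^ ((m + 1) * q) • (-1 : ℤ) ^ (n + 1) • (-1 : ℤ) ^ (m + q + 1) •
          ceFun (T.lieConn q) (phi ω H q f m) ξ = _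
        rw [smul_smul, smul_smul, smul_smul, ← pow_add, ← pow_add, ← pow_add]
        exact smul_pow_congr ⟨n + m + m * q + q + 1, by ring⟩ _
    · have h0 : ∀ (m : ℕ) (g : FormDeg A H Q q),
          pair ω k m (DirectSum.lof R ℕ (FormDeg A H Q) q g) = 0 := fun m g => by
        rw [pair, lof_apply_ne h, map_zero]
        exact smul_zero _
      simp only [h0, ceFun_zero]
      simp
  · constructor
    · intro ξ
      ext v
      rw [map_add, pair_add, hF.1, hG.1]
      simp
    · intro m ξ
      have h1 : pair ω k m (F + G) = pair ω k m F + pair ω k m G := by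
        ext ξ v; exact pair_add ω k m F G ξ v
      have h2 := map_add (ce (T.lieConn k) m) (pair ω k m F) (pair ω k m G)
      ext v
      rw [map_add, pair_add, hF.2, hG.2, h1, ← ce_apply _ (pair ω k m F + pair ω k m G), h2]
      rw [AlternatingMap.add_apply, smul_add]
      rfl

theorem eps_Delta (hφ : ∀ q, Function.Bijective (phi ω H q)) (F : Form A H Q) :
    eps R ω (T.Delta ω F) = 0 := by
  have h := congrArg (fun f => f ![]) ((T.pair_Delta hφ 0 F).1 ![])
  simp only [pair_apply, ExteriorAlgebra.ιMulti_zero_apply, mul_one] at h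
  exact h

variable (ω) in
/-- The supercommutator of `Δ_ω` with the product with `- ξ`. -/
noncomputable def lieQ (ξ : Q) (F : Form A H Q) : Form A H Q :=
  iQ R A H ξ (T.Delta ω F) + T.Delta ω (iQ R A H ξ F)

/-- Under the pairing, `lieQ` becomes the Lie derivative on `Alt_A(Q, Alt_A(H, A))`, by Cartan's
formula. -/
theorem pair_lieQ (hφ : ∀ q, Function.Bijective (phi ω H q)) (ξ : Q) (F : Form A H Q) (k m : ℕ)
    (w : Fin m → Q) (v : Fin k → H) : pair ω k m (T.lieQ ω ξ F) w v =
      T.lieAlt ξ (pair ω k m F w) v -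
        ∑ j, pair ω k m F (Function.update w j (T.strQ.bracket ξ (w j))) v := by
  rw [lieQ, pair_add, pair_iQ, (T.pair_Delta hφ k F).2, smul_smul, ← mul_pow]
  cases m with
  | zero =>
    rw [ceFun_cons_zero, (T.pair_Delta hφ k _).1]
    simp [lieConn_act]
  | succ m =>
    rw [ceFun_cons_succ, (T.pair_Delta hφ k _).2]
    have h : pair ω k m (iQ R A H ξ F) = (-1 : ℤ) ^ (n + m) •
        (pair ω k (m + 1) F).curryLeft ξ := by
      ext w' v'
      rw [pair_iQ]; rfl
    rw [h, ceFun_zsmul, smul_smul, ← mul_pow]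
    simp [lieConn_act, AlternatingMap.sub_apply, AltTools.sum_apply]

/-- Cartan formula: `lieQ ξ` acts on the products with `η ∈ Q` through `[ξ, η]_Q`. -/
theorem lieQ_iQ (hφ : ∀ q, Function.Bijective (phi ω H q))
    (hQ : ∀ v : Fin (n + 1) → Q, ExteriorAlgebra.ιMulti A (n + 1) v = 0) (ξ η : Q)
    (F : Form A H Q) : T.lieQ ω ξ (iQ R A H η F) - iQ R A H η (T.lieQ ω ξ F) =
      iQ R A H (T.strQ.bracket ξ η) F := by
  refine ext_of_pair ω hQ fun k m w v => ?_
  have hz : ∀ (c : ℤ) (f : H [⋀^Fin k]→ₗ[A] A) , (c • f) v = c • f v := fun c f => rfl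
  have hl : ∀ (c : ℤ) (f : H [⋀^Fin k]→ₗ[A] A) , T.lieAlt ξ (c • f) v = c • T.lieAlt ξ f v :=
    fun c f => congrArg (fun g => g v) (map_zsmul ((T.lieConn k).act ξ) c f)
  rw [pair_sub, T.pair_lieQ hφ, pair_iQ, pair_iQ, pair_iQ, hz, T.pair_lieQ hφ, Fin.sum_univ_succ]
  simp only [pair_iQ, hz, hl, Fin.cons_zero, Fin.cons_succ, Fin.update_cons_zero, ← Fin.cons_update,
    smul_sub, smul_add, Finset.smul_sum]
  abel

/-- Cartan formula: `lieQ ξ` acts on the contractions with `x ∈ H` through `ξ · x`. -/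
theorem lieQ_iH (hφ : ∀ q, Function.Bijective (phi ω H q))
    (hQ : ∀ v : Fin (n + 1) → Q, ExteriorAlgebra.ιMulti A (n + 1) v = 0) (ξ : Q) (x : H)
    (F : Form A H Q) : T.lieQ ω ξ (iH R A Q x F) - iH R A Q x (T.lieQ ω ξ F) =
      iH R A Q (T.actQH.act ξ x) F := by
  refine ext_of_pair ω hQ fun k m w v => ?_
  rw [pair_sub, T.pair_lieQ hφ, pair_iH, pair_iH, T.pair_lieQ hφ, lieAlt_apply, lieAlt_apply,
    Fin.sum_univ_succ]
  simp only [pair_iH, Fin.cons_zero, Fin.cons_succ, Fin.update_cons_zero, ← Fin.cons_update,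
    smul_sub, smul_add, Finset.smul_sum, map_zsmul]
  abel

theorem eps_lieQ (hφ : ∀ q, Function.Bijective (phi ω H q)) (ξ : Q) (F : Form A H Q) :
    eps R ω (T.lieQ ω ξ F) = T.strQ.anchor ξ (eps R ω F) := by
  have h : ∀ F : Form A H Q, eps R ω F = pair ω 0 0 F ![] ![] := fun F => by
    rw [pair_apply, eps_apply]; simp
  rw [h, h, T.pair_lieQ hφ, lieAlt_apply]
  simp

theorem Delta_apply_eq_zero (hφ : ∀ q, Function.Bijective (phi ω H q))
    (hQ : ∀ v : Fin (n + 1) → Q, ExteriorAlgebra.ιMulti A (n + 1) v = 0) {F : Form A H Q} {k : ℕ}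
    (h : F k = 0) : T.Delta ω F k = 0 := by
  ext v
  refine eq_zero_of_omegaExt_mul_left ω hQ fun m ξ => ?_
  rw [← pair_apply]
  cases m with
  | zero => rw [(T.pair_Delta hφ k F).1]; rfl
  | succ m =>
    rw [(T.pair_Delta hφ k F).2, pair, h, map_zero]
    rw [show (-1 : ℤ) ^ (m * k) • (0 : ∀ m : ℕ, Q [⋀^Fin m]→ₗ[A] (H [⋀^Fin k]→ₗ[A] A)) m = 0 from
      smul_zero _, ceFun_zero, smul_zero]
    rfl

theorem Delta_mem (hφ : ∀ q, Function.Bijective (phi ω H q))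
    (hQ : ∀ v : Fin (n + 1) → Q, ExteriorAlgebra.ιMulti A (n + 1) v = 0) {q p : ℕ}
    {F : Form A H Q} (hF : F ∈ comp R A H Q q (p + 1)) : T.Delta ω F ∈ comp R A H Q q p := by
  refine mem_comp_iff.2 ⟨fun k hk => T.Delta_apply_eq_zero hφ hQ ((mem_comp_iff.1 hF).1 k hk),
    fun v => mem_exteriorPower_of_omegaExt ω hQ fun m hm ξ => ?_⟩
  rw [← pair_apply]
  cases m with
  | zero => rw [(T.pair_Delta hφ q F).1]; rfl
  | succ m =>
    rw [(T.pair_Delta hφ q F).2, pair_eq_zero_of_mem ω (by omega) hF, ceFun_zero, smul_zero]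
    rfl

theorem Delta_eq_zero (hφ : ∀ q, Function.Bijective (phi ω H q))
    (hQ : ∀ v : Fin (n + 1) → Q, ExteriorAlgebra.ιMulti A (n + 1) v = 0) {q : ℕ}
    {F : Form A H Q} (hF : F ∈ comp R A H Q q 0) : T.Delta ω F = 0 := by
  refine ext_of_pair ω hQ fun k m ξ v => ?_
  have h0 : pair ω k m (0 : Form A H Q) ξ v = 0 := by
    rw [pair_apply, apply_zero, zero_mul, map_zero]
  rw [h0]
  cases m with
  | zero => rw [(T.pair_Delta hφ k F).1]; rfl
  | succ m =>
    by_cases hm : m = n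
    · subst hm
      rw [pair_apply, hQ, mul_zero, map_zero]
    · rw [(T.pair_Delta hφ k F).2, pair_eq_zero_of_mem ω (by omega) hF, ceFun_zero, smul_zero]
      rfl

end AlmostPreLRTriple

/-! ### The operator `Ψ_δ` -/

namespace AlmostPreLRTriple

open Form AlmostLieRinehart

section Kappa

variable {R A H Q : Type*} [CommRing R] [CommRing A] [Algebra R A]
  [AddCommGroup H] [Module R H] [Module A H] [IsScalarTower R A H]
  [AddCommGroup Q] [Module R Q] [Module A Q] [IsScalarTower R A Q] (T : AlmostPreLRTriple R A H Q)

variable (A H) in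
/-- The left multiplication by `ξ ∈ Q` on `H ⊗ Λ_A Q`. -/
noncomputable def leftMul (ξ : Q) : H ⊗[A] ExteriorAlgebra A Q →ₗ[A] H ⊗[A] ExteriorAlgebra A Q :=
  (LinearMap.mulLeft A (ExteriorAlgebra.ι A ξ)).lTensor H

theorem leftMul_tmul (ξ : Q) (x : H) (u : ExteriorAlgebra A Q) :
    leftMul A H ξ (x ⊗ₜ u) = x ⊗ₜ (ExteriorAlgebra.ι A ξ * u) := rfl

theorem kappa_one : T.kappa (1 : ExteriorAlgebra A Q) = 0 := by
  have h := ExteriorAlgebra.ιMulti_zero_apply (R := A) (M := Q) ![]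
  rw [← h, kappa, ExteriorAlgebra.liftAlternating_apply_ιMulti]
  rfl

theorem kappa_ι (ξ : Q) : T.kappa (ExteriorAlgebra.ι A ξ) = 0 := by
  have h : ExteriorAlgebra.ιMulti A 1 ![ξ] = ExteriorAlgebra.ι A ξ := by
    rw [ExteriorAlgebra.ιMulti_succ_apply, ExteriorAlgebra.ιMulti_zero_apply, mul_one]; rfl
  rw [← h, kappa, ExteriorAlgebra.liftAlternating_apply_ιMulti]
  rfl

theorem ι_mul_ιMulti (ξ : Q) (m : ℕ) (v : Fin m → Q) :
    ExteriorAlgebra.ι A ξ * ExteriorAlgebra.ιMulti A m v =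
      ExteriorAlgebra.ιMulti A (m + 1) (Fin.cons ξ v) := by
  rw [ExteriorAlgebra.ιMulti_succ_apply]; rfl

theorem kappa_ι_mul_ιMulti (ξ : Q) (m : ℕ) (v : Fin (m + 1) → Q) :
    T.kappa (ExteriorAlgebra.ι A ξ * ExteriorAlgebra.ιMulti A (m + 1) v) =
      leftMul A H ξ (T.kappa (ExteriorAlgebra.ιMulti A (m + 1) v)) -
        ∑ j : Fin (m + 1), (-1 : ℤ) ^ (j : ℕ) •
          T.delta ξ (v j) ⊗ₜ[A] ExteriorAlgebra.ιMulti A m (j.removeNth v) := by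
  rw [ι_mul_ιMulti, kappa_ιMulti]
  cases m with
  | zero =>
    rw [AltTools.pairSum_cons_zero]
    have h : ExteriorAlgebra.ιMulti A 1 v = ExteriorAlgebra.ι A (v 0) := by
      rw [ExteriorAlgebra.ιMulti_succ_apply, ExteriorAlgebra.ιMulti_zero_apply, mul_one]
    rw [show ExteriorAlgebra.ιMulti A (0 + 1) v = ExteriorAlgebra.ι A (v 0) from h, kappa_ι,
      map_zero, zero_sub, Fin.sum_univ_one]
    simp only [Fin.val_zero, pow_zero, one_smul]
    rw [Subsingleton.elim (Fin.removeNth 0 v) ![]]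
  | succ m =>
    rw [AltTools.pairSum_cons_succ, kappa_ιMulti, sub_eq_add_neg, add_comm]
    congr 1
    simp only [AltTools.pairSum, map_sum]
    refine Finset.sum_congr rfl fun i _ => Finset.sum_congr rfl fun k _ => ?_
    split_ifs
    · rw [map_zsmul, leftMul_tmul, ι_mul_ιMulti]
    · simp

/-- The operator `κ` has order `2` with respect to the products with elements of `Q`. -/
theorem kappa_ι_mul_ι_mul (ξ η : Q) (u : ExteriorAlgebra A Q) :
    T.kappa (ExteriorAlgebra.ι A ξ * (ExteriorAlgebra.ι A η * u)) =
      leftMul A H ξ (T.kappa (ExteriorAlgebra.ι A η * u)) -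
      leftMul A H η (T.kappa (ExteriorAlgebra.ι A ξ * u)) +
      leftMul A H η (leftMul A H ξ (T.kappa u)) - T.delta ξ η ⊗ₜ u := by
  let l (ξ : Q) := LinearMap.mulLeft A (ExteriorAlgebra.ι A ξ)
  have : T.kappa ∘ₗ l ξ ∘ₗ l η = leftMul A H ξ ∘ₗ T.kappa ∘ₗ l η -
      leftMul A H η ∘ₗ T.kappa ∘ₗ l ξ + leftMul A H η ∘ₗ leftMul A H ξ ∘ₗ T.kappa -
      TensorProduct.mk A H _ (T.delta ξ η) := by
    refine lhom_eq_of_ιMulti fun m v => ?_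
    change
      T.kappa (ExteriorAlgebra.ι A ξ * (ExteriorAlgebra.ι A η * ExteriorAlgebra.ιMulti A m v)) =
      leftMul A H ξ (T.kappa (ExteriorAlgebra.ι A η * ExteriorAlgebra.ιMulti A m v)) -
      leftMul A H η (T.kappa (ExteriorAlgebra.ι A ξ * ExteriorAlgebra.ιMulti A m v)) +
      leftMul A H η (leftMul A H ξ (T.kappa (ExteriorAlgebra.ιMulti A m v))) -
      T.delta ξ η ⊗ₜ ExteriorAlgebra.ιMulti A m v
    rw [ι_mul_ιMulti η, kappa_ι_mul_ιMulti, Fin.sum_univ_succ]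
    have h0 : Fin.removeNth 0 (Fin.cons η v : Fin (m + 1) → Q) = v := by ext k; simp
    rw [h0, Fin.cons_zero, Fin.val_zero, pow_zero, one_smul]
    cases m with
    | zero =>
      rw [ExteriorAlgebra.ιMulti_zero_apply, mul_one, kappa_ι, kappa_one]
      simp
    | succ m =>
      rw [kappa_ι_mul_ιMulti]
      simp only [AltTools.removeNth_succ_cons, Fin.cons_succ, Fin.val_succ, map_sub, map_sum,
        map_zsmul, leftMul_tmul, ι_mul_ιMulti, pow_succ, mul_neg_one, neg_smul,
        Finset.sum_neg_distrib]
      abel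
  exact LinearMap.congr_fun this u

end Kappa

end AlmostPreLRTriple

namespace Form

open AlmostPreLRTriple

variable {R A H Q : Type*} [CommRing R] [CommRing A] [Algebra R A]
  [AddCommGroup H] [Module A H]
  [AddCommGroup Q] [Module R Q] [Module A Q] [IsScalarTower R A Q]

variable (R) in
/-- The element of `Alt_A(H, Λ_A Q)` which corresponds to a tensor. -/
noncomputable def ofTensor (q : ℕ) :
    (H [⋀^Fin q]→ₗ[A] A) ⊗[A] ExteriorAlgebra A Q →ₗ[R] Form A H Q :=
  DirectSum.lof R ℕ (FormDeg A H Q) q ∘ₗ (canon A H Q q).restrictScalars R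

theorem neg_one_zsmul_form (F : Form A H Q) : (-1 : ℤ) • F = - F :=
  form_ext fun k v => by rw [apply_zsmul, apply_neg, neg_one_smul]

theorem iQ_ofTensor (ξ : Q) (q : ℕ) (t : (H [⋀^Fin q]→ₗ[A] A) ⊗[A] ExteriorAlgebra A Q) :
    iQ R A H ξ (ofTensor R q t) = (-1 : ℤ) ^ (q + 1) •
      ofTensor R q ((LinearMap.mulLeft A (ExteriorAlgebra.ι A ξ)).lTensor _ t) := by
  induction t with
  | zero => simp
  | add t t' h h' => simp only [map_add, h, h', smul_add]
  | tmul β u =>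
    change iQ R A H ξ (DirectSum.lof R ℕ (FormDeg A H Q) q (canon A H Q q (β ⊗ₜ u))) =
      (-1 : ℤ) ^ (q + 1) • DirectSum.lof R ℕ (FormDeg A H Q) q (canon A H Q q
        (β ⊗ₜ (ExteriorAlgebra.ι A ξ * u)))
    rw [iQ_lof]
    refine Eq.trans ?_ (map_zsmul (DirectSum.lof R ℕ (FormDeg A H Q) q) _ _)
    congr 1
    ext x
    change - (ExteriorAlgebra.ι A ξ * canon A H Q q _ x) = (-1 : ℤ) ^ (q + 1) • canon A H Q q _ x
    rw [canon_tmul, canon_tmul, sgn_mul, sgn_ι, mul_smul_comm, smul_mul_assoc, smul_comm (β x),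
      smul_smul, ← pow_add, (show Odd (q + 1 + q) from ⟨q, by ring⟩).neg_one_pow, neg_one_smul]

theorem iH_ofTensor (x : H) (q : ℕ) (β : H [⋀^Fin (q + 1)]→ₗ[A] A) (u : ExteriorAlgebra A Q) :
    iH R A Q x (ofTensor R (q + 1) (β ⊗ₜ u)) = - ofTensor R q (contr β x ⊗ₜ u) := by
  change iH R A Q x (DirectSum.lof R ℕ (FormDeg A H Q) (q + 1) (canon A H Q (q + 1) (β ⊗ₜ u))) =
    - DirectSum.lof R ℕ (FormDeg A H Q) q (canon A H Q q (contr β x ⊗ₜ u))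
  rw [iH_lof_succ, ← map_neg]
  congr 1
  ext v
  change (-1 : ℤ) ^ (q + 1) • sgn A Q 1 (canon A H Q (q + 1) (β ⊗ₜ u) (Fin.cons x v)) =
    - canon A H Q q (contr β x ⊗ₜ u) v
  rw [canon_tmul, canon_tmul, map_smul, ← sgn_add, show 1 + (q + 1) = q + 2 by ring, sgn_add_two]
  change _ = - (((-1 : ℤ) ^ q • β (Fin.cons x v)) • sgn A Q q u)
  rw [pow_succ, mul_neg_one, neg_smul, smul_assoc]

theorem iH_ofTensor_zero (x : H) (t : (H [⋀^Fin 0]→ₗ[A] A) ⊗[A] ExteriorAlgebra A Q) :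
    iH R A Q x (ofTensor R 0 t) = 0 := iH_lof_zero x _

theorem form_induction_ofTensor (hc : ∀ q, Function.Bijective (canon A H Q q))
    {P : Form A H Q → Prop} (tmul : ∀ q β u, P (ofTensor R q (β ⊗ₜ u)))
    (add : ∀ F G, P F → P G → P (F + G)) (F : Form A H Q) : P F := by
  refine form_induction R F (fun q f => ?_) add
  obtain ⟨t, rfl⟩ := (hc q).2 f
  change P (ofTensor R q t)
  induction t with
  | zero => have h := tmul q 0 0; rwa [TensorProduct.zero_tmul] at h
  | add t t' h h' => rw [map_add]; exact add _ _ h h'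
  | tmul β u => exact tmul q β u

/-- Every element of bidegree `(q, p)` corresponds to a tensor whose second factors have degree
`p`. -/
theorem exists_ofTensor (hc : ∀ q, Function.Bijective (canon A H Q q)) {q p : ℕ} {F : Form A H Q}
    (hF : F ∈ comp R A H Q q p) : ∃ t, F = ofTensor R q ((extProj A Q p).lTensor _ t) := by
  obtain ⟨f, hf, rfl⟩ := hF
  obtain ⟨t, rfl⟩ := (hc q).2 f
  refine ⟨t, congrArg (DirectSum.lof R ℕ (FormDeg A H Q) q) ?_⟩
  have h : ∀ t v, canon A H Q q ((extProj A Q p).lTensor _ t) v =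
      extProj A Q p (canon A H Q q t v) := by
    intro t v
    induction t with
    | zero => simp
    | add t t' h h' => rw [map_add, map_add, map_add, AlternatingMap.add_apply, h, h',
        AlternatingMap.add_apply, map_add]
    | tmul β u =>
      rw [LinearMap.lTensor_tmul, canon_tmul, canon_tmul, map_smul]
      congr 1
      refine LinearMap.congr_fun (f := sgn A Q q ∘ₗ extProj A Q p)
        (g := extProj A Q p ∘ₗ sgn A Q q) (lhom_eq_of_ιMulti fun m v => ?_) u
      rw [LinearMap.comp_apply, LinearMap.comp_apply]
      by_cases hm : m = p
      · subst hm
        rw [extProj_of_mem (ιMulti_mem m v), extProj_of_mem (sgn_mem q (ιMulti_mem m v))]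
      · rw [extProj_of_mem_ne hm (ιMulti_mem m v), extProj_of_mem_ne hm
          (sgn_mem q (ιMulti_mem m v)), map_zero]
  ext v
  exact ((h t v).trans (extProj_of_mem (hf v))).symm

/-- `Alt_A(H, Λ_A Q)` is generated by `Alt_A(H, A)` under the products with elements of `Q`. -/
theorem comp_generator_induction (hc : ∀ q, Function.Bijective (canon A H Q q))
    {P : ℕ → ℕ → Form A H Q → Prop}
    (form : ∀ (q : ℕ) (β : H [⋀^Fin q]→ₗ[A] A), P q 0 (ofForm R A Q β))
    (iQ : ∀ ξ q p, ∀ F ∈ comp R A H Q q p, P q p F → P q (p + 1) (iQ R A H ξ F))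
    (add : ∀ q p F G, P q p F → P q p G → P q p (F + G)) {q p : ℕ} {F : Form A H Q}
    (hF : F ∈ comp R A H Q q p) : P q p F := by
  have hz : ∀ p, P q p 0 := by
    intro p
    induction p with
    | zero =>
      have h := form q 0
      rwa [ofForm, LinearMap.compAlternatingMap_zero, map_zero] at h
    | succ p ih =>
      have h := iQ 0 q p 0 (Submodule.zero_mem _) ih
      rwa [map_zero] at h
  have hmem : ∀ (p : ℕ) (v : Fin p → Q) (β : H [⋀^Fin q]→ₗ[A] A),
      ofTensor R q (β ⊗ₜ ExteriorAlgebra.ιMulti A p v) ∈ comp R A H Q q p := fun p v β =>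
    ⟨_, fun x => Submodule.smul_mem _ _ (sgn_mem q (ιMulti_mem p v)), rfl⟩
  have key : ∀ (p : ℕ) (v : Fin p → Q) (β : H [⋀^Fin q]→ₗ[A] A),
      P q p (ofTensor R q (β ⊗ₜ ExteriorAlgebra.ιMulti A p v)) := by
    intro p
    induction p with
    | zero =>
      intro v β
      have h : ofTensor R q (β ⊗ₜ ExteriorAlgebra.ιMulti A 0 v) = ofForm R A Q β := by
        refine congrArg (DirectSum.lof R ℕ (FormDeg A H Q) q) ?_
        ext x
        change canon A H Q q (β ⊗ₜ ExteriorAlgebra.ιMulti A 0 v) x = algebraMap A _ (β x)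
        rw [canon_tmul, ExteriorAlgebra.ιMulti_zero_apply, sgn_one,
          ← Algebra.algebraMap_eq_smul_one]
      rw [h]
      exact form q β
    | succ p ih =>
      intro v β
      have h : ofTensor R q (β ⊗ₜ ExteriorAlgebra.ιMulti A (p + 1) v) = Form.iQ R A H (v 0)
          (ofTensor R q (((-1 : ℤ) ^ (q + 1) • β) ⊗ₜ
            ExteriorAlgebra.ιMulti A p (Matrix.vecTail v))) := by
        rw [iQ_ofTensor, LinearMap.lTensor_tmul, ExteriorAlgebra.ιMulti_succ_apply]
        have e : ∀ u : ExteriorAlgebra A Q, ((-1 : ℤ) ^ (q + 1) • β) ⊗ₜ[A] u =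
            (-1 : ℤ) ^ (q + 1) • (β ⊗ₜ[A] u) := fun u => rfl
        rw [e, map_zsmul]
        refine form_ext fun k w => ?_
        rw [apply_zsmul, apply_zsmul, smul_smul, ← mul_pow, neg_one_mul, neg_neg, one_pow, one_smul]
        rfl
      rw [h]
      exact iQ _ q p _ (hmem p _ _) (ih _ _)
  obtain ⟨t, rfl⟩ := exists_ofTensor hc hF
  clear hF
  induction t with
  | zero => simp only [map_zero]; exact hz p
  | add t t' h h' => simp only [map_add]; exact add _ _ _ _ h h'
  | tmul β u =>
    rw [LinearMap.lTensor_tmul]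
    refine mem_exteriorPower_induction (P := fun u => ∀ β, P q p (ofTensor R q (β ⊗ₜ u)))
      (fun v β => key p v β) (fun β => ?_) (fun u v hu hv β => ?_) (fun a u hu β => ?_)
      (extProj_mem p u) β
    · rw [TensorProduct.tmul_zero, map_zero]; exact hz p
    · rw [TensorProduct.tmul_add, map_add]; exact add _ _ _ _ (hu β) (hv β)
    · rw [← TensorProduct.smul_tmul]; exact hu (a • β)

theorem generator_induction {n : ℕ} (ω : ⋀[A]^n Q ≃ₗ[A] A)
    (hQ : ∀ v : Fin (n + 1) → Q, ExteriorAlgebra.ιMulti A (n + 1) v = 0) {P : Form A H Q → Prop}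
    (form : ∀ (q : ℕ) (β : H [⋀^Fin q]→ₗ[A] A), P (ofForm R A Q β))
    (iQ : ∀ ξ q p, ∀ F ∈ comp R A H Q q p, P F → P (iQ R A H ξ F))
    (add : ∀ F G, P F → P G → P (F + G)) (F : Form A H Q) : P F :=
  comp_induction (R := R) hQ (fun _ _ _ hF => comp_generator_induction (R := R)
    (canon_bijective ω hQ) (P := fun _ _ F => P F) form iQ (fun _ _ => add) hF) add F

theorem mem_ofTensor {q p : ℕ} (t : (H [⋀^Fin q]→ₗ[A] A) ⊗[A] ExteriorAlgebra A Q) :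
    ofTensor R q ((extProj A Q p).lTensor _ t) ∈ comp R A H Q q p := by
  induction t with
  | zero => simp only [map_zero]; exact Submodule.zero_mem _
  | add t t' h h' => simp only [map_add]; exact Submodule.add_mem _ h h'
  | tmul β u =>
    exact ⟨_, fun v => Submodule.smul_mem _ _ (sgn_mem q (extProj_mem p u)), rfl⟩

end Form

namespace AlmostPreLRTriple

open Form AlmostLieRinehart

variable {R A H Q : Type*} [CommRing R] [CommRing A] [Algebra R A]
  [AddCommGroup H] [Module R H] [Module A H] [IsScalarTower R A H]
  [AddCommGroup Q] [Module R Q] [Module A Q] [IsScalarTower R A Q] (T : AlmostPreLRTriple R A H Q)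

theorem Psi_ofTensor (hc : ∀ q, Function.Bijective (canon A H Q q)) (q : ℕ)
    (t : (H [⋀^Fin (q + 1)]→ₗ[A] A) ⊗[A] ExteriorAlgebra A Q) :
    T.Psi (ofTensor R (q + 1) t) = ofTensor R q (T.psiTensor q t) := by
  change T.Psi (DirectSum.lof R ℕ (FormDeg A H Q) (q + 1) (canon A H Q (q + 1) t)) = _
  rw [Psi, DirectSum.toModule_lof]
  change DirectSum.lof R ℕ (FormDeg A H Q) q (canon A H Q q (T.psiTensor q
    (linInv (canon A H Q (q + 1)) (canon A H Q (q + 1) t)))) = _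
  rw [linInv, dif_pos (hc (q + 1))]
  have h := LinearEquiv.symm_apply_apply (LinearEquiv.ofBijective _ (hc (q + 1))) t
  exact congrArg (fun t => DirectSum.lof R ℕ (FormDeg A H Q) q (canon A H Q q (T.psiTensor q t))) h

theorem Psi_lof_zero (f : FormDeg A H Q 0) : T.Psi (DirectSum.lof R ℕ (FormDeg A H Q) 0 f) = 0 := by
  rw [Psi, DirectSum.toModule_lof]; rfl

theorem Psi_ofTensor_zero (t : (H [⋀^Fin 0]→ₗ[A] A) ⊗[A] ExteriorAlgebra A Q) :
    T.Psi (ofTensor R 0 t) = 0 := T.Psi_lof_zero _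

/-- The supercommutator of `Ψ_δ` with the product with `- ξ`. -/
noncomputable def liePsi (ξ : Q) (F : Form A H Q) : Form A H Q :=
  iQ R A H ξ (T.Psi F) + T.Psi (iQ R A H ξ F)

/-- Cartan formula: the double supercommutator of `Ψ_δ` with the products by `ξ` and `η` is the
contraction with `δ(ξ, η)`. -/
theorem liePsi_iQ (hc : ∀ q, Function.Bijective (canon A H Q q)) (ξ η : Q) (F : Form A H Q) :
    T.liePsi ξ (iQ R A H η F) - iQ R A H η (T.liePsi ξ F) = iH R A Q (T.delta ξ η) F := by
  refine form_induction_ofTensor (R := R) hc (P := fun F =>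
    T.liePsi ξ (iQ R A H η F) - iQ R A H η (T.liePsi ξ F) = iH R A Q (T.delta ξ η) F)
    (fun q β u => ?_) (fun F G hF hG => ?_) F
  swap
  · rw [map_add (iH R A Q (T.delta ξ η)), ← hF, ← hG]
    simp only [liePsi, map_add]
    abel
  simp only [liePsi, map_add]
  cases q with
  | zero =>
    rw [iH_ofTensor_zero]
    simp only [iQ_ofTensor, map_zsmul, Psi_ofTensor_zero, map_zero, smul_zero]
    simp
  | succ q =>
    let c := (contr β).rTensor (ExteriorAlgebra A Q)
    let L : H ⊗[A] ExteriorAlgebra A Q →+ Form A H Q :=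
      (ofTensor R q).toAddMonoidHom.comp c.toAddMonoidHom
    have h1 : ∀ u, T.Psi (ofTensor R (q + 1) (β ⊗ₜ u)) = L (T.kappa u) := fun u =>
      T.Psi_ofTensor hc q (β ⊗ₜ u)
    have h4 : ∀ (ξ : Q) t, (LinearMap.mulLeft A (ExteriorAlgebra.ι A ξ)).lTensor _ (c t) =
        c (leftMul A H ξ t) := fun ξ t => by
      have h := LinearMap.congr_fun ((LinearMap.lTensor_comp_rTensor H (contr β)
        (LinearMap.mulLeft A (ExteriorAlgebra.ι A ξ))).trans
        (LinearMap.rTensor_comp_lTensor H (contr β)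
          (LinearMap.mulLeft A (ExteriorAlgebra.ι A ξ))).symm) t
      exact h
    rw [show iH R A Q (T.delta ξ η) (ofTensor R (q + 1) (β ⊗ₜ u)) =
      - L (T.delta ξ η ⊗ₜ u) from iH_ofTensor _ _ _ _]
    rcases neg_one_pow_eq_or ℤ q with h | h
    · have h2 : ∀ (ξ : Q) u, iQ R A H ξ (ofTensor R (q + 1) (β ⊗ₜ[A] u)) =
          ofTensor R (q + 1) (β ⊗ₜ (ExteriorAlgebra.ι A ξ * u)) := fun ξ u => by
        rw [iQ_ofTensor, neg_one_pow_eq (i := q + 1 + 1) (j := q) ⟨q + 1, by ring⟩, h]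
        exact one_zsmul _
      have h3 : ∀ (ξ : Q) t, iQ R A H ξ (L t) = - L (leftMul A H ξ t) := fun ξ t => by
        change iQ R A H ξ (ofTensor R q (c t)) = _
        rw [iQ_ofTensor, h4, pow_succ, mul_neg_one, h]
        exact neg_one_zsmul_form _
      simp only [h1, h2, h3, map_neg]
      rw [T.kappa_ι_mul_ι_mul ξ η u, map_sub, map_add, map_sub]
      abel
    · have h2 : ∀ (ξ : Q) u, iQ R A H ξ (ofTensor R (q + 1) (β ⊗ₜ[A] u)) =
          - ofTensor R (q + 1) (β ⊗ₜ (ExteriorAlgebra.ι A ξ * u)) := fun ξ u => by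
        rw [iQ_ofTensor, neg_one_pow_eq (i := q + 1 + 1) (j := q) ⟨q + 1, by ring⟩, h]
        exact neg_one_zsmul_form _
      have h3 : ∀ (ξ : Q) t, iQ R A H ξ (L t) = L (leftMul A H ξ t) := fun ξ t => by
        change iQ R A H ξ (ofTensor R q (c t)) = _
        rw [iQ_ofTensor, h4, pow_succ, mul_neg_one, h, neg_neg]
        exact one_zsmul _
      simp only [h1, h2, h3, map_neg]
      rw [T.kappa_ι_mul_ι_mul ξ η u, map_sub, map_add, map_sub]
      abel

theorem Psi_mem (hc : ∀ q, Function.Bijective (canon A H Q q)) {q p : ℕ} {F : Form A H Q}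
    (hF : F ∈ comp R A H Q (q + 1) (p + 2)) : T.Psi F ∈ comp R A H Q q p := by
  obtain ⟨t, rfl⟩ := exists_ofTensor hc hF
  rw [Psi_ofTensor T hc]
  induction t with
  | zero => simp only [map_zero]; exact Submodule.zero_mem _
  | add t t' h h' =>
    simp only [map_add]
    exact Submodule.add_mem _ (h (mem_ofTensor _)) (h' (mem_ofTensor _))
  | tmul β u =>
    rw [LinearMap.lTensor_tmul]
    refine ⟨_, ?_, rfl⟩
    refine mem_exteriorPower_induction (P := fun u => ∀ v, canon A H Q q (T.psiTensor q (β ⊗ₜ u)) v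
      ∈ ⋀[A]^p Q) (fun ξ v => ?_) (fun v => ?_) (fun u u' hu hu' v => ?_) (fun a u hu v => ?_)
      (extProj_mem (p + 2) u)
    · rw [psiTensor_tmul_ιMulti, AltTools.pairSum, map_sum, AltTools.sum_apply]
      refine Submodule.sum_mem _ fun i _ => ?_
      rw [map_sum, AltTools.sum_apply]
      refine Submodule.sum_mem _ fun k _ => ?_
      split_ifs
      · rw [map_zsmul]
        exact zsmul_mem (Submodule.smul_mem _ _ (sgn_mem q (ιMulti_mem p _))) _
      · rw [map_zero]; exact Submodule.zero_mem _
    · rw [TensorProduct.tmul_zero, map_zero, map_zero]; exact Submodule.zero_mem _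
    · rw [TensorProduct.tmul_add, map_add, map_add]; exact Submodule.add_mem _ (hu v) (hu' v)
    · rw [TensorProduct.tmul_smul, map_smul, map_smul]
      exact Submodule.smul_mem _ a (hu v)

theorem Psi_eq_zero (hc : ∀ q, Function.Bijective (canon A H Q q)) {q p : ℕ}
    (h : q = 0 ∨ p ≤ 1) {F : Form A H Q} (hF : F ∈ comp R A H Q q p) : T.Psi F = 0 := by
  cases q with
  | zero => obtain ⟨f, -, rfl⟩ := hF; exact T.Psi_lof_zero f
  | succ q =>
    obtain ⟨t, rfl⟩ := exists_ofTensor hc hF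
    rw [Psi_ofTensor T hc]
    suffices h0 : ∀ u, T.kappa (extProj A Q p u) = 0 by
      induction t with
      | zero => simp only [map_zero]
      | add t t' h h' =>
        simp only [map_add]
        rw [h (mem_ofTensor _), h' (mem_ofTensor _), add_zero]
      | tmul β u =>
        change ofTensor R q ((contr β).rTensor (ExteriorAlgebra A Q) (T.kappa _)) = 0
        rw [h0, map_zero, map_zero]
    intro u
    refine mem_exteriorPower_induction (P := fun u => T.kappa u = 0) (fun v => ?_) (map_zero _)
      (fun u v hu hv => ?_) (fun a u hu => ?_) (extProj_mem p u)
    · obtain rfl | rfl : p = 0 ∨ p = 1 := by omega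
      · rw [ExteriorAlgebra.ιMulti_zero_apply, kappa_one]
      · rw [ExteriorAlgebra.ιMulti_succ_apply, ExteriorAlgebra.ιMulti_zero_apply, mul_one, kappa_ι]
    · rw [map_add, hu, hv, add_zero]
    · rw [map_smul, hu, smul_zero]

theorem Psi_apply_eq_zero {k : ℕ} {F : Form A H Q} (hF : F (k + 1) = 0) :
    T.Psi F k = 0 := by
  have key : T.Psi F k = T.Psi (DirectSum.lof R ℕ (FormDeg A H Q) (k + 1) (F (k + 1))) k := by
    refine form_induction R F (P := fun F => T.Psi F k =
      T.Psi (DirectSum.lof R ℕ (FormDeg A H Q) (k + 1) (F (k + 1))) k) (fun q f => ?_)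
      fun F G hF hG => ?_
    · by_cases hq : q = k + 1
      · subst hq; rw [lof_apply_self]
      · rw [lof_apply_ne hq, map_zero, map_zero]
        cases q with
        | zero => rw [T.Psi_lof_zero]
        | succ q =>
          rw [Psi, DirectSum.toModule_lof]
          exact lof_apply_ne (R := R) (by omega) _
    · rw [map_add, DirectSum.add_apply, DirectSum.add_apply, map_add, map_add, DirectSum.add_apply,
        hF, hG]
  rw [key, hF, map_zero, map_zero]
  rfl

end AlmostPreLRTriple

/-! ### The abstract Cartan calculus -/

namespace CartanCalculus

section Ring

variable {E : Type*} [Ring E]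

theorem commutator_swap {a b : E} (D : E) (h : a * b = - (b * a)) :
    (a * D + D * a) * b - b * (a * D + D * a) = -((b * D + D * b) * a - a * (b * D + D * b)) := by
  have h1 : D * (a * b) = - (D * (b * a)) := by rw [h, mul_neg]
  have h2 : a * b * D = - (b * a * D) := by rw [h, neg_mul]
  linear_combination (norm := noncomm_ring) h1 - h2

/-- The contractions with the elements of `H ⊕ Q` and the operator `d + Δ + Ψ` satisfy the Cartan
formula with the total bracket. -/
theorem total_commutator {a b a' b' d Δ Ψ hh hq qh qq del qh' hq' : E}
    (hab' : a * b' = - (b' * a)) (hba' : b * a' = - (a' * b))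
    (h1 : (a * d + d * a) * a' - a' * (a * d + d * a) = hh)
    (h2 : (a * d + d * a) * b' - b' * (a * d + d * a) = hq)
    (h3 : (b * Δ + Δ * b) * a' - a' * (b * Δ + Δ * b) = qh)
    (h4 : (b * Δ + Δ * b) * b' - b' * (b * Δ + Δ * b) = qq)
    (h5 : (b * Ψ + Ψ * b) * b' - b' * (b * Ψ + Ψ * b) = del)
    (h6 : (b' * Δ + Δ * b') * a - a * (b' * Δ + Δ * b') = qh')
    (h7 : (a' * d + d * a') * b - b * (a' * d + d * a') = hq')
    (h8 : a * Ψ + Ψ * a = 0) (h9 : a' * Ψ + Ψ * a' = 0)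
    (h10 : (a * Δ + Δ * a) * a' - a' * (a * Δ + Δ * a) = 0)
    (h11 : (b * d + d * b) * b' - b' * (b * d + d * b) = 0) :
    ((a + b) * (d + Δ + Ψ) + (d + Δ + Ψ) * (a + b)) * (a' + b') -
      (a' + b') * ((a + b) * (d + Δ + Ψ) + (d + Δ + Ψ) * (a + b)) =
      (hh + del + qh - qh') + (qq + hq - hq') := by
  have e1 := commutator_swap Δ hab'
  have e2 := commutator_swap d hba'
  have e3 := commutator_swap Ψ hba'
  rw [h9, zero_mul, mul_zero, sub_zero, neg_zero] at e3
  rw [h6] at e1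
  rw [h7] at e2
  have e4 : (a * Ψ + Ψ * a) * (a' + b') - (a' + b') * (a * Ψ + Ψ * a) = 0 := by
    rw [h8, zero_mul, mul_zero, sub_zero]
  rw [← h1, ← h2, ← h3, ← h4, ← h5]
  linear_combination (norm := noncomm_ring) e1 + e2 + e3 + e4 + h10 + h11

theorem lie_commutator {l l' m a b c e f g : E} (h1 : l * a - a * l = b) (h2 : l' * a - a * l' = c)
    (h3 : m * a - a * m = e) (h4 : l * c - c * l = f) (h5 : l' * b - b * l' = g) :
    (l * l' - l' * l - m) * a - a * (l * l' - l' * l - m) = f - g - e := by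
  rw [← h3, ← h4, ← h5, ← h1, ← h2]
  noncomm_ring

theorem commutator_anticommutator {l D a b l' m : E} (ha : a * D + D * a = l')
    (h1 : l * a - a * l = b) (hb : b * D + D * b = m) :
    (l * D - D * l) * a + a * (l * D - D * l) = l * l' - l' * l - m := by
  rw [← hb, ← ha, ← h1]
  noncomm_ring

end Ring

variable {R G A L : Type*} [CommRing R] [AddCommGroup G] [Module R G] [AddCommGroup A] [Module R A]
  [AddCommGroup L]

/-- The operator `i u ∘ D + D ∘ i u`. -/
def lie (i : L →+ Module.End R G) (D : Module.End R G) (u : L) : Module.End R G :=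
  i u * D + D * i u

/-- Contractions `i u`, an operator `D` and an augmentation `eps` which satisfy the Cartan
formulas for the bracket `br` and the action `ρ`; an element of `G` is determined by the
augmentations of its iterated contractions. -/
structure IsCalculus (i : L →+ Module.End R G) (D : Module.End R G) (eps : G →ₗ[R] A)
    (br : L → L → L) (ρ : L → A →+ A) : Prop where
  lie_i : ∀ u v, lie i D u * i v - i v * lie i D u = i (br u v)
  eps_D : ∀ F, eps (D F) = 0
  eps_lie : ∀ u F, eps (lie i D u F) = ρ u (eps F)
  separating : ∀ S : Set G, (∀ F ∈ S, eps F = 0) →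
    (∀ u, ∀ F ∈ S, i u F ∈ Submodule.span R S) → ∀ F ∈ S, F = 0

namespace IsCalculus

variable {i : L →+ Module.End R G} {D : Module.End R G} {eps : G →ₗ[R] A}
    {br : L → L → L} {ρ : L → A →+ A}

/-- An operator is zero if it commutes or anticommutes with the contractions and has values in the
kernel of the augmentation. -/
theorem eq_zero (h : IsCalculus i D eps br ρ) {X : Module.End R G} (c : ℤ) (h0 : ∀ F, eps (X F) = 0)
    (h1 : ∀ u, i u * X = c • (X * i u)) : X = 0 := by
  refine LinearMap.ext fun F => h.separating (Set.range X) ?_ ?_ (X F) (Set.mem_range_self F)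
  · rintro _ ⟨F, rfl⟩; exact h0 F
  · rintro u _ ⟨F, rfl⟩
    have e : i u (X F) = c • X (i u F) := LinearMap.congr_fun (h1 u) F
    rw [e]
    exact zsmul_mem (Submodule.subset_span (Set.mem_range_self (i u F))) c

/-- The failure of `lie` to be compatible with the brackets acts on the contractions by the
Jacobiator. -/
theorem lie_lie_i (h : IsCalculus i D eps br ρ) (u v w : L) :
    (lie i D u * lie i D v - lie i D v * lie i D u - lie i D (br u v)) * i w -
      i w * (lie i D u * lie i D v - lie i D v * lie i D u - lie i D (br u v)) =
      i (br u (br v w) - br v (br u w) - br (br u v) w) := by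
  rw [map_sub, map_sub]
  exact lie_commutator (h.lie_i u w) (h.lie_i v w) (h.lie_i _ w) (h.lie_i u _) (h.lie_i v _)

/-- The failure of `D` to commute with `lie` is detected by the failure of `lie` to be compatible
with the brackets. -/
theorem lie_D_i (h : IsCalculus i D eps br ρ) (u v : L) :
    (lie i D u * D - D * lie i D u) * i v + i v * (lie i D u * D - D * lie i D u) =
      lie i D u * lie i D v - lie i D v * lie i D u - lie i D (br u v) :=
  commutator_anticommutator rfl (h.lie_i u v) rfl

/-- The Jacobi identity and the compatibility of the action with the brackets imply `D² = 0`: the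
vanishing principle is applied to `[L_u, L_v] - L_{[u, v]}`, then to `[L_u, D]` and finally to
`D²`, where `L_u` is `lie u`. -/
theorem D_mul_D (h : IsCalculus i D eps br ρ)
    (hj : ∀ u v w, br u (br v w) - br v (br u w) - br (br u v) w = 0)
    (hρ : ∀ u v a, ρ (br u v) a = ρ u (ρ v a) - ρ v (ρ u a)) : D * D = 0 := by
  have hY : ∀ u v, lie i D u * lie i D v - lie i D v * lie i D u - lie i D (br u v) = 0 := by
    intro u v
    refine h.eq_zero 1 (fun F => ?_) fun w => ?_
    · change eps (lie i D u (lie i D v F) - lie i D v (lie i D u F) - lie i D (br u v) F) = 0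
      simp only [map_sub, h.eps_lie, hρ, sub_self]
    · have e := h.lie_lie_i u v w
      rw [hj, map_zero, sub_eq_zero] at e
      rw [one_smul]
      exact e.symm
  have hZ : ∀ u, lie i D u * D - D * lie i D u = 0 := by
    intro u
    refine h.eq_zero (-1) (fun F => ?_) fun w => ?_
    · change eps (lie i D u (D F) - D (lie i D u F)) = 0
      rw [map_sub, h.eps_lie, h.eps_D, h.eps_D, map_zero, sub_zero]
    · have e := h.lie_D_i u w
      rw [hY] at e
      rw [neg_one_smul]
      exact eq_neg_of_add_eq_zero_right e
  refine h.eq_zero 1 (fun F => h.eps_D _) fun u => ?_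
  have e := hZ u
  rw [lie] at e
  rw [one_smul, ← sub_eq_zero, ← e]
  noncomm_ring

/-- Conversely, `D² = 0` implies that `D` commutes with every `lie u`; hence the Jacobiator has
zero contraction, and the action is compatible with the brackets on the values of the
augmentation. -/
theorem jacobi_of_D_mul_D (h : IsCalculus i D eps br ρ) (hD : D * D = 0) (u v w : L) :
    i (br u (br v w) - br v (br u w) - br (br u v) w) = 0 ∧
    ∀ F, ρ (br u v) (eps F) = ρ u (ρ v (eps F)) - ρ v (ρ u (eps F)) := by
  have hZ : ∀ u, lie i D u * D - D * lie i D u = 0 := by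
    intro u
    have e : lie i D u * D - D * lie i D u = i u * (D * D) - D * D * i u := by
      rw [lie]; noncomm_ring
    rw [e, hD, mul_zero, zero_mul, sub_zero]
  have hY : ∀ u v, lie i D u * lie i D v - lie i D v * lie i D u - lie i D (br u v) = 0 := by
    intro u v
    rw [← h.lie_D_i, hZ, zero_mul, mul_zero, add_zero]
  constructor
  · rw [← h.lie_lie_i, hY, zero_mul, mul_zero, sub_zero]
  · intro F
    have e := congrArg eps (LinearMap.congr_fun (hY u v) F)
    change eps (lie i D u (lie i D v F) - lie i D v (lie i D u F) - lie i D (br u v) F) = eps 0 at e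
    simp only [map_sub, h.eps_lie, map_zero] at e
    exact (sub_eq_zero.1 e).symm

end IsCalculus

section Total

variable {R G A H Q : Type*} [CommRing R] [AddCommGroup G] [Module R G] [AddCommGroup A]
  [Module R A] [AddCommGroup H] [AddCommGroup Q]

/-- The contractions `(x, ξ) ↦ a x + b ξ`. -/
def contractions (a : H → G →ₗ[R] G) (b : Q → G →ₗ[R] G)
    (ha : ∀ x y F, a (x + y) F = a x F + a y F) (hb : ∀ x y F, b (x + y) F = b x F + b y F) :
    H × Q →+ Module.End R G :=
  AddMonoidHom.mk' (fun u => a u.1 + b u.2) fun u v => LinearMap.ext fun F => by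
    change a (u.1 + v.1) F + b (u.2 + v.2) F = (a u.1 F + b u.2 F) + (a v.1 F + b v.2 F)
    rw [ha, hb]
    abel

/-- Cartan formulas for `H`, `Q` and the three operators separately combine to those for the sum `d
+ Δ + Ψ` and the total bracket on `H × Q`. -/
theorem isCalculus_contractions {a : H → G →ₗ[R] G} {b : Q → G →ₗ[R] G}
    (ha : ∀ x y F, a (x + y) F = a x F + a y F) (hb : ∀ x y F, b (x + y) F = b x F + b y F)
    {d Δ Ψ : G →ₗ[R] G} {eps : G →ₗ[R] A} {brH : H → H → H} {brQ : Q → Q → Q}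
    {actHQ : H → Q → Q} {actQH : Q → H → H} {δ : Q → Q → H} {ρH : H → A →+ A} {ρQ : Q → A →+ A}
    (hab : ∀ x y F, a x (b y F) = - b y (a x F))
    (h1 : ∀ x y F, (a x (d (a y F)) + d (a x (a y F))) - a y (a x (d F) + d (a x F)) =
      a (brH x y) F)
    (h2 : ∀ x η F, (a x (d (b η F)) + d (a x (b η F))) - b η (a x (d F) + d (a x F)) =
      b (actHQ x η) F)
    (h3 : ∀ ξ y F, (b ξ (Δ (a y F)) + Δ (b ξ (a y F))) - a y (b ξ (Δ F) + Δ (b ξ F)) =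
      a (actQH ξ y) F)
    (h4 : ∀ ξ η F, (b ξ (Δ (b η F)) + Δ (b ξ (b η F))) - b η (b ξ (Δ F) + Δ (b ξ F)) =
      b (brQ ξ η) F)
    (h5 : ∀ ξ η F, (b ξ (Ψ (b η F)) + Ψ (b ξ (b η F))) - b η (b ξ (Ψ F) + Ψ (b ξ F)) =
      a (δ ξ η) F)
    (h6 : ∀ x F, a x (Ψ F) + Ψ (a x F) = 0)
    (h7 : ∀ x y F, (a x (Δ (a y F)) + Δ (a x (a y F))) - a y (a x (Δ F) + Δ (a x F)) = 0)
    (h8 : ∀ ξ η F, (b ξ (d (b η F)) + d (b ξ (b η F))) - b η (b ξ (d F) + d (b ξ F)) = 0)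
    (e1 : ∀ F, eps (d F) = 0) (e2 : ∀ F, eps (Δ F) = 0) (e3 : ∀ F, eps (Ψ F) = 0)
    (e4 : ∀ x F, eps (a x (d F) + d (a x F)) = ρH x (eps F))
    (e5 : ∀ ξ F, eps (b ξ (Δ F) + Δ (b ξ F)) = ρQ ξ (eps F))
    (e6 : ∀ x F, eps (a x (Δ F)) = 0) (e7 : ∀ ξ F, eps (b ξ (d F)) = 0)
    (e8 : ∀ ξ F, eps (b ξ (Ψ F)) = 0)
    (hsep : ∀ S : Set G, (∀ F ∈ S, eps F = 0) → (∀ F ∈ S, ∀ x, a x F ∈ Submodule.span R S) →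
      (∀ F ∈ S, ∀ ξ, b ξ F ∈ Submodule.span R S) → ∀ F ∈ S, F = 0) :
    IsCalculus (contractions a b ha hb) (d + Δ + Ψ) eps
      (fun u v => (brH u.1 v.1 + δ u.2 v.2 - actQH v.2 u.1 + actQH u.2 v.1,
        brQ u.2 v.2 + actHQ u.1 v.2 - actHQ v.1 u.2)) (fun u => ρH u.1 + ρQ u.2) where
  lie_i u v := by
    have hsub : ∀ x y : H, a (x - y) = a x - a y := fun x y => eq_sub_of_add_eq
      (LinearMap.ext fun F => by
        rw [LinearMap.add_apply, ← ha, sub_add_cancel])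
    have hsub' : ∀ x y : Q, b (x - y) = b x - b y := fun x y => eq_sub_of_add_eq
      (LinearMap.ext fun F => by
        rw [LinearMap.add_apply, ← hb, sub_add_cancel])
    have hadd : ∀ x y : H, a (x + y) = a x + a y := fun x y => LinearMap.ext fun F => ha x y F
    have hadd' : ∀ x y : Q, b (x + y) = b x + b y := fun x y => LinearMap.ext fun F => hb x y F
    refine (total_commutator (E := Module.End R G) (a := a u.1) (b := b u.2) (a' := a v.1)
      (b' := b v.2) (d := d) (Δ := Δ) (Ψ := Ψ) (LinearMap.ext fun F => hab _ _ F)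
      (LinearMap.ext fun F => ?_)
      (LinearMap.ext fun F => h1 _ _ F) (LinearMap.ext fun F => h2 _ _ F)
      (LinearMap.ext fun F => h3 _ _ F) (LinearMap.ext fun F => h4 _ _ F)
      (LinearMap.ext fun F => h5 _ _ F) (LinearMap.ext fun F => h3 _ _ F)
      (LinearMap.ext fun F => h2 _ _ F) (LinearMap.ext fun F => h6 _ F)
      (LinearMap.ext fun F => h6 _ F) (LinearMap.ext fun F => h7 _ _ F)
      (LinearMap.ext fun F => h8 _ _ F)).trans ?_
    · change b u.2 (a v.1 F) = - a v.1 (b u.2 F)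
      rw [hab, neg_neg]
    · change _ = a (brH u.1 v.1 + δ u.2 v.2 - actQH v.2 u.1 + actQH u.2 v.1) +
        b (brQ u.2 v.2 + actHQ u.1 v.2 - actHQ v.1 u.2)
      rw [hadd, hsub, hadd, hsub', hadd']
      abel
  eps_D F := by
    change eps (d F + Δ F + Ψ F) = 0
    rw [map_add, map_add, e1, e2, e3, add_zero, add_zero]
  eps_lie u F := by
    change eps ((a u.1 (d F + Δ F + Ψ F) + b u.2 (d F + Δ F + Ψ F)) +
      (d (a u.1 F + b u.2 F) + Δ (a u.1 F + b u.2 F) + Ψ (a u.1 F + b u.2 F))) =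
      ρH u.1 (eps F) + ρQ u.2 (eps F)
    have e9 : eps (a u.1 (Ψ F)) = 0 := by
      rw [eq_neg_of_add_eq_zero_left (h6 u.1 F), map_neg, e3, neg_zero]
    rw [← e4, ← e5]
    simp only [map_add, e1, e2, e3, e6, e7, e8, e9]
    abel
  separating S h0 hS := by
    refine hsep S h0 (fun F hF x => ?_) (fun F hF ξ => ?_)
    · have h := hS (x, 0) F hF
      have hb0 : b 0 F = 0 := by simpa using hb 0 0 F
      change a x F + b 0 F ∈ _ at h
      rwa [hb0, add_zero] at h
    · have h := hS (0, ξ) F hF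
      have ha0 : a 0 F = 0 := by simpa using ha 0 0 F
      change a 0 F + b ξ F ∈ _ at h
      rwa [ha0, zero_add] at h

end Total

end CartanCalculus

/-! ### The Cartan calculus of a triple -/

namespace Form

variable {R A H Q : Type*} [CommRing R] [CommRing A] [Algebra R A]
  [AddCommGroup H] [Module A H]
  [AddCommGroup Q] [Module R Q] [Module A Q] [IsScalarTower R A Q]

theorem iH_ofForm_mem (x : H) {q : ℕ} (β : H [⋀^Fin q]→ₗ[A] A) :
    ∃ r, iH R A Q x (ofForm R A Q β) ∈ comp R A H Q r 0 := by
  cases q with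
  | zero => exact ⟨0, by rw [ofForm, iH_lof_zero]; exact Submodule.zero_mem _⟩
  | succ q => exact ⟨q, iH_mem_comp (ofForm_mem_comp β) x⟩

theorem iH_mem_comp_zero (x : H) {q : ℕ} {F : Form A H Q} (hF : F ∈ comp R A H Q q 0) :
    ∃ r, iH R A Q x F ∈ comp R A H Q r 0 := by
  cases q with
  | zero =>
    obtain ⟨f, -, rfl⟩ := hF
    exact ⟨0, by rw [iH_lof_zero]; exact Submodule.zero_mem _⟩
  | succ q => exact ⟨q, iH_mem_comp hF x⟩

end Form

namespace AlmostPreLRTriple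

open Form AlmostLieRinehart

variable {R A H Q : Type*} [CommRing R] [CommRing A] [Algebra R A]
  [AddCommGroup H] [Module R H] [Module A H] [IsScalarTower R A H]
  [AddCommGroup Q] [Module R Q] [Module A Q] [IsScalarTower R A Q] (T : AlmostPreLRTriple R A H Q)
  {n : ℕ} {ω : ⋀[A]^n Q ≃ₗ[A] A}

theorem liePsi_eq_zero (hc : ∀ q, Function.Bijective (canon A H Q q)) (ξ : Q) {q : ℕ}
    {F : Form A H Q} (hF : F ∈ comp R A H Q q 0) : T.liePsi ξ F = 0 := by
  rw [liePsi, T.Psi_eq_zero hc (Or.inr zero_le_one) hF,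
    T.Psi_eq_zero hc (Or.inr le_rfl) (iQ_mem_comp hF ξ), map_zero, add_zero]

theorem liePsi_add (ξ : Q) (F G : Form A H Q) :
    T.liePsi ξ (F + G) = T.liePsi ξ F + T.liePsi ξ G := by
  simp only [liePsi, map_add]; abel

theorem liePsi_neg (ξ : Q) (F : Form A H Q) : T.liePsi ξ (- F) = - T.liePsi ξ F := by
  simp only [liePsi, map_neg]; abel

theorem liePsi_iH (ω : ⋀[A]^n Q ≃ₗ[A] A)
    (hQ : ∀ v : Fin (n + 1) → Q, ExteriorAlgebra.ιMulti A (n + 1) v = 0)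
    (hc : ∀ q, Function.Bijective (canon A H Q q)) (ξ : Q) (x : H) (F : Form A H Q) :
    T.liePsi ξ (iH R A Q x F) = iH R A Q x (T.liePsi ξ F) := by
  refine generator_induction (R := R) ω hQ (P := fun F => T.liePsi ξ (iH R A Q x F) =
    iH R A Q x (T.liePsi ξ F)) (fun q β => ?_) (fun η q p F _ hF => ?_) (fun F G hF hG => ?_) F
  · obtain ⟨r, hr⟩ := iH_ofForm_mem (R := R) (Q := Q) x β
    rw [T.liePsi_eq_zero hc ξ hr, T.liePsi_eq_zero hc ξ (ofForm_mem_comp β), map_zero]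
  · rw [iH_iQ, liePsi_neg, eq_add_of_sub_eq (T.liePsi_iQ hc ξ η _),
      eq_add_of_sub_eq (T.liePsi_iQ hc ξ η _), hF, map_add, iH_iQ, iH_iH _ x]
    abel
  · rw [map_add, liePsi_add, hF, hG, liePsi_add, map_add]

/-- `Ψ_δ` anticommutes with the contractions with elements of `H`, since `Alt_A(H, Λ_A Q)` is
generated by `Alt_A(H, A)`, on which both sides vanish, and the products with elements of `Q`. -/
theorem iH_Psi (ω : ⋀[A]^n Q ≃ₗ[A] A)
    (hQ : ∀ v : Fin (n + 1) → Q, ExteriorAlgebra.ιMulti A (n + 1) v = 0)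
    (hc : ∀ q, Function.Bijective (canon A H Q q)) (x : H) (F : Form A H Q) :
    iH R A Q x (T.Psi F) + T.Psi (iH R A Q x F) = 0 := by
  refine generator_induction (R := R) ω hQ
    (P := fun F => iH R A Q x (T.Psi F) + T.Psi (iH R A Q x F) = 0)
    (fun q β => ?_) (fun ξ q p F _ hF => ?_) (fun F G hF hG => ?_) F
  · obtain ⟨r, hr⟩ := iH_ofForm_mem (R := R) (Q := Q) x β
    rw [T.Psi_eq_zero hc (Or.inr zero_le_one) hr,
      T.Psi_eq_zero hc (Or.inr zero_le_one) (ofForm_mem_comp β), map_zero, add_zero]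
  · have h : ∀ F, T.Psi (iQ R A H ξ F) = T.liePsi ξ F - iQ R A H ξ (T.Psi F) := fun F => by
      rw [liePsi]; abel
    rw [h, iH_iQ, map_neg, h, T.liePsi_iH ω hQ hc, map_sub, iH_iQ]
    have h0 : iQ R A H ξ (iH R A Q x (T.Psi F)) + iQ R A H ξ (T.Psi (iH R A Q x F)) = 0 := by
      rw [← map_add, hF, map_zero]
    refine Eq.trans ?_ h0
    abel
  · simp only [map_add]
    rw [add_add_add_comm, hF, hG, add_zero]

variable (ω) in
/-- The supercommutator of `Δ_ω` with the contraction with `x`. -/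
noncomputable def iHDelta (x : H) (F : Form A H Q) : Form A H Q :=
  iH R A Q x (T.Delta ω F) + T.Delta ω (iH R A Q x F)

/-- The mixed Cartan formula for `Δ_ω` follows from `lieQ_iH` by exchanging the two
contractions. -/
theorem iHDelta_iQ (hφ : ∀ q, Function.Bijective (phi ω H q))
    (hQ : ∀ v : Fin (n + 1) → Q, ExteriorAlgebra.ιMulti A (n + 1) v = 0) (x : H) (ξ : Q)
    (F : Form A H Q) : T.iHDelta ω x (iQ R A H ξ F) =
      iQ R A H ξ (T.iHDelta ω x F) - iH R A Q (T.actQH.act ξ x) F := by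
  have h : ∀ F, T.Delta ω (iQ R A H ξ F) = T.lieQ ω ξ F - iQ R A H ξ (T.Delta ω F) := fun F => by
    rw [lieQ]; abel
  rw [← T.lieQ_iH hφ hQ, iHDelta, iHDelta, h, iH_iQ, map_neg, h, map_sub, iH_iQ, map_add]
  abel

theorem iHDelta_iH (hφ : ∀ q, Function.Bijective (phi ω H q))
    (hQ : ∀ v : Fin (n + 1) → Q, ExteriorAlgebra.ιMulti A (n + 1) v = 0) (x y : H)
    (F : Form A H Q) : T.iHDelta ω x (iH R A Q y F) = iH R A Q y (T.iHDelta ω x F) := by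
  have h0 : ∀ {q} {F : Form A H Q}, F ∈ comp R A H Q q 0 → T.iHDelta ω x F = 0 := by
    intro q F hF
    obtain ⟨r, hr⟩ := iH_mem_comp_zero (R := R) x hF
    rw [iHDelta, T.Delta_eq_zero hφ hQ hF, T.Delta_eq_zero hφ hQ hr, map_zero, add_zero]
  have hadd : ∀ F G, T.iHDelta ω x (F + G) = T.iHDelta ω x F + T.iHDelta ω x G := fun F G => by
    simp only [iHDelta, map_add]; abel
  have hneg : ∀ F, T.iHDelta ω x (- F) = - T.iHDelta ω x F := fun F => by
    simp only [iHDelta, map_neg]; abel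
  refine generator_induction (R := R) ω hQ (P := fun F => T.iHDelta ω x (iH R A Q y F) =
    iH R A Q y (T.iHDelta ω x F)) (fun q β => ?_) (fun ξ q p F _ hF => ?_) (fun F G hF hG => ?_) F
  · obtain ⟨r, hr⟩ := iH_ofForm_mem (R := R) (Q := Q) y β
    rw [h0 hr, h0 (ofForm_mem_comp β), map_zero]
  · rw [iH_iQ, hneg, T.iHDelta_iQ hφ hQ, T.iHDelta_iQ hφ hQ, hF, map_sub, iH_iQ, iH_iH _ y]
    abel
  · rw [map_add, hadd, hF, hG, hadd, map_add]

/-- The supercommutator of `d` with the product with `- ξ`. -/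
noncomputable def iQd (ξ : Q) (F : Form A H Q) : Form A H Q :=
  iQ R A H ξ (T.d F) + T.d (iQ R A H ξ F)

/-- The mixed Cartan formula for `d` follows from `lieH_iQ` by exchanging the two contractions. -/
theorem iQd_iH (ξ : Q) (x : H) (F : Form A H Q) : T.iQd ξ (iH R A Q x F) =
      iH R A Q x (T.iQd ξ F) - iQ R A H (T.actHQ.act x ξ) F := by
  have h : ∀ F, T.d (iH R A Q x F) = T.lieH x F - iH R A Q x (T.d F) := fun F => by
    rw [lieH]; abel
  have h' : ∀ F, iQ R A H ξ (iH R A Q x F) = - iH R A Q x (iQ R A H ξ F) := fun F => by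
    rw [iH_iQ]; abel
  rw [← T.lieH_iQ, iQd, iQd, h, h', map_neg, h, map_sub, h', map_add]
  abel

theorem iQd_iQ (ξ η : Q) (F : Form A H Q) :
    T.iQd ξ (iQ R A H η F) - iQ R A H η (T.iQd ξ F) = 0 := by
  have h' : ∀ x ξ (F : Form A H Q), iQ R A H ξ (iH R A Q x F) = - iH R A Q x (iQ R A H ξ F) :=
    fun x ξ F => by rw [iH_iQ]; abel
  have hneg : ∀ F, T.iQd ξ (- F) = - T.iQd ξ F := fun F => by
    simp only [iQd, map_neg]; abel
  refine vanish_of_iH (R := R) (Set.range fun F => T.iQd ξ (iQ R A H η F) - iQ R A H η (T.iQd ξ F))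
    ?_ ?_ _ (Set.mem_range_self F)
  · rintro _ ⟨F, rfl⟩
    have h0 : ∀ ξ (F : Form A H Q), F 0 ![] = 0 → iQ R A H ξ F 0 ![] = 0 := fun ξ F h => by
      rw [iQ_apply, h, mul_zero, neg_zero]
    have h1 : ∀ F, T.iQd ξ F 0 ![] = 0 := fun F => by
      rw [iQd, apply_add, h0 _ _ (by rw [d_apply_zero]; rfl), d_apply_zero]
      simp
    dsimp only
    rw [apply_sub, h1, h0 _ _ (h1 F), sub_zero]
  · rintro _ ⟨F, rfl⟩ x
    have e : iH R A Q x (T.iQd ξ (iQ R A H η F) - iQ R A H η (T.iQd ξ F)) =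
        T.iQd ξ (iQ R A H η (-(iH R A Q x F))) - iQ R A H η (T.iQd ξ (-(iH R A Q x F))) := by
      rw [map_neg, hneg, hneg, map_neg, h', hneg, T.iQd_iH, T.iQd_iH, map_sub, map_sub,
        h', iQ_iQ _ η]
      abel
    dsimp only
    rw [e]
    exact Submodule.subset_span (Set.mem_range_self (-(iH R A Q x F)))

end AlmostPreLRTriple

/-! ### Square zero and the Jacobi identity -/

namespace Form

variable {R A H Q : Type*} [CommRing R] [CommRing A] [Algebra R A]
  [AddCommGroup H] [Module A H]
  [AddCommGroup Q] [Module R Q] [Module A Q] [IsScalarTower R A Q]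

theorem eps_eq_zero_of_mem {n : ℕ} (ω : ⋀[A]^n Q ≃ₗ[A] A) {q p : ℕ} (hp : p ≠ n)
    {F : Form A H Q} (hF : F ∈ comp R A H Q q p) : eps R ω F = 0 := by
  rw [eps_apply]
  exact omegaExt_of_mem_of_ne ω hp (apply_mem_of_mem_comp hF 0 ![])

theorem eq_zero_of_mem_comp {n : ℕ}
    (hQ : ∀ v : Fin (n + 1) → Q, ExteriorAlgebra.ιMulti A (n + 1) v = 0) {q p : ℕ} (hp : n < p)
    {F : Form A H Q} (hF : F ∈ comp R A H Q q p) : F = 0 :=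
  form_ext fun k v => eq_zero_of_mem_of_lt hQ hp (apply_mem_of_mem_comp hF k v)

theorem iH_add_left (x y : H) (F : Form A H Q) :
    iH R A Q (x + y) F = iH R A Q x F + iH R A Q y F := by
  refine form_ext fun k v => ?_
  rw [apply_add, iH_apply, iH_apply, iH_apply, ← smul_add, ← map_add]
  congr 2
  exact (F (k + 1)).toMultilinearMap.cons_add v x y

theorem iQ_add_left (ξ η : Q) (F : Form A H Q) :
    iQ R A H (ξ + η) F = iQ R A H ξ F + iQ R A H η F := by
  refine form_ext fun k v => ?_
  rw [apply_add, iQ_apply, iQ_apply, iQ_apply, map_add, add_mul, neg_add]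

theorem exists_eps_eq {n : ℕ} (ω : ⋀[A]^n Q ≃ₗ[A] A) (a : A) :
    ∃ F : Form A H Q, eps R ω F = a := by
  refine ⟨const R H (ω.symm a : ExteriorAlgebra A Q), ?_⟩
  rw [eps_apply, const_apply_zero, omegaExt_coe, LinearEquiv.apply_symm_apply]

/-- The element `ξ` is recovered from the operator by its value on the unit, and then `f(x)`, for a
linear form `f` on `H`, by its value on `f`; property P says that these determine `x`. -/
theorem eq_zero_of_iH_add_iQ (hP : PropertyP A H) {x : H} {ξ : Q}
    (h : ∀ F : Form A H Q, iH R A Q x F + iQ R A H ξ F = 0) : x = 0 ∧ ξ = 0 := by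
  have hξ : ξ = 0 := by
    have h1 := congrArg (fun F : Form A H Q => F 0 ![]) (h (one R A H Q))
    rw [apply_add, one, iH_lof_zero, iQ_apply, lof_apply_self] at h1
    change 0 + -(ExteriorAlgebra.ι A ξ * 1) = 0 at h1
    rw [mul_one, zero_add, neg_eq_zero, ExteriorAlgebra.ι_eq_zero_iff] at h1
    exact h1
  refine ⟨hP x fun f => ?_, hξ⟩
  have h1 := congrArg (fun F : Form A H Q => F 0 ![])
    (h (ofForm R A Q (AlternatingMap.ofSubsingleton A H A (0 : Fin 1) f)))
  rw [apply_add, iH_apply, iQ_apply, ofForm, lof_apply_self, lof_apply_ne (by omega)] at h1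
  change (-1 : ℤ) ^ (0 + 1) • sgn A Q 1 (algebraMap A (ExteriorAlgebra A Q) (f x)) +
    -(ExteriorAlgebra.ι A ξ * 0) = 0 at h1
  rw [sgn_algebraMap, mul_zero, neg_zero, add_zero, zero_add, pow_one, neg_one_smul, neg_eq_zero,
    ExteriorAlgebra.algebraMap_eq_zero_iff] at h1
  exact h1

end Form

namespace AlmostPreLRTriple

open Form AlmostLieRinehart

variable {R A H Q : Type*} [CommRing R] [CommRing A] [Algebra R A]
  [AddCommGroup H] [Module R H] [Module A H] [IsScalarTower R A H]
  [AddCommGroup Q] [Module R Q] [Module A Q] [IsScalarTower R A Q] (T : AlmostPreLRTriple R A H Q)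
  {n : ℕ} {ω : ⋀[A]^n Q ≃ₗ[A] A}

theorem eps_Psi (ω : ⋀[A]^n Q ≃ₗ[A] A)
    (hQ : ∀ v : Fin (n + 1) → Q, ExteriorAlgebra.ιMulti A (n + 1) v = 0)
    (hc : ∀ q, Function.Bijective (canon A H Q q)) (F : Form A H Q) : eps R ω (T.Psi F) = 0 := by
  refine comp_induction (R := R) hQ (P := fun F => eps R ω (T.Psi F) = 0) (fun q p F hF => ?_)
    (fun F G hF hG => by rw [map_add, map_add, hF, hG, add_zero]) F
  by_cases h : q = 0 ∨ p ≤ 1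
  · rw [T.Psi_eq_zero hc h hF, map_zero]
  · obtain ⟨q, rfl⟩ : ∃ r, q = r + 1 := ⟨q - 1, by omega⟩
    obtain ⟨p, rfl⟩ : ∃ r, p = r + 2 := ⟨p - 2, by omega⟩
    by_cases hp : n < p + 2
    · rw [eq_zero_of_mem_comp hQ hp hF, map_zero, map_zero]
    · exact eps_eq_zero_of_mem ω (by omega) (T.Psi_mem hc hF)

theorem eps_iQ_Psi (ω : ⋀[A]^n Q ≃ₗ[A] A)
    (hQ : ∀ v : Fin (n + 1) → Q, ExteriorAlgebra.ιMulti A (n + 1) v = 0)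
    (hc : ∀ q, Function.Bijective (canon A H Q q)) (ξ : Q) (F : Form A H Q) :
    eps R ω (iQ R A H ξ (T.Psi F)) = 0 := by
  refine comp_induction (R := R) hQ (P := fun F => eps R ω (iQ R A H ξ (T.Psi F)) = 0)
    (fun q p F hF => ?_) (fun F G hF hG => by rw [map_add, map_add, map_add, hF, hG, add_zero]) F
  by_cases h : q = 0 ∨ p ≤ 1
  · rw [T.Psi_eq_zero hc h hF, map_zero, map_zero]
  · obtain ⟨q, rfl⟩ : ∃ r, q = r + 1 := ⟨q - 1, by omega⟩
    obtain ⟨p, rfl⟩ : ∃ r, p = r + 2 := ⟨p - 2, by omega⟩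
    by_cases hp : n < p + 2
    · rw [eq_zero_of_mem_comp hQ hp hF, map_zero, map_zero, map_zero]
    · exact eps_eq_zero_of_mem ω (by omega) (iQ_mem_comp (T.Psi_mem hc hF) ξ)

theorem eps_iH_Delta (hφ : ∀ q, Function.Bijective (phi ω H q))
    (hQ : ∀ v : Fin (n + 1) → Q, ExteriorAlgebra.ιMulti A (n + 1) v = 0) (x : H)
    (F : Form A H Q) : eps R ω (iH R A Q x (T.Delta ω F)) = 0 := by
  refine comp_induction (R := R) hQ (P := fun F => eps R ω (iH R A Q x (T.Delta ω F)) = 0)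
    (fun q p F hF => ?_) (fun F G hF hG => by rw [map_add, map_add, map_add, hF, hG, add_zero]) F
  cases p with
  | zero => rw [T.Delta_eq_zero hφ hQ hF, map_zero, map_zero]
  | succ p =>
    by_cases hp : n < p + 1
    · rw [eq_zero_of_mem_comp hQ hp hF, map_zero, map_zero, map_zero]
    · have h := T.Delta_mem hφ hQ hF
      cases q with
      | zero =>
        obtain ⟨f, -, hf⟩ := h
        rw [← hf, iH_lof_zero, map_zero]
      | succ q => exact eps_eq_zero_of_mem ω (by omega) (iH_mem_comp h x)

theorem eps_iQ_d (ω : ⋀[A]^n Q ≃ₗ[A] A) (ξ : Q) (F : Form A H Q) :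
    eps R ω (iQ R A H ξ (T.d F)) = 0 := by
  rw [eps_apply, iQ_apply, d_apply_zero]
  simp

/-- The Cartan calculus of a triple with respect to the total bracket on `H ⊕ Q`. -/
theorem isCalculus (hφ : ∀ q, Function.Bijective (phi ω H q))
    (hc : ∀ q, Function.Bijective (canon A H Q q))
    (hQ : ∀ v : Fin (n + 1) → Q, ExteriorAlgebra.ιMulti A (n + 1) v = 0)
    (hω : T.IsInvariant ω) :
    CartanCalculus.IsCalculus (G := Form A H Q)
      (CartanCalculus.contractions (G := Form A H Q) (iH R A Q) (iQ R A H) iH_add_left iQ_add_left)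
      (T.d + T.Delta ω + T.Psi) (eps R ω) T.totalBracket
      (fun u => ((T.strH.anchor u.1 : A →ₗ[R] A) : A →+ A) +
        ((T.strQ.anchor u.2 : A →ₗ[R] A) : A →+ A)) := by
  exact CartanCalculus.isCalculus_contractions (G := Form A H Q) iH_add_left iQ_add_left
    (brH := fun x y => T.strH.bracket x y) (brQ := fun x y => T.strQ.bracket x y)
    (actHQ := fun x ξ => T.actHQ.act x ξ) (actQH := fun ξ x => T.actQH.act ξ x)
    (δ := fun ξ η => T.delta ξ η) (ρH := fun x => ((T.strH.anchor x : A →ₗ[R] A) : A →+ A))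
    (ρQ := fun ξ => ((T.strQ.anchor ξ : A →ₗ[R] A) : A →+ A))
    iH_iQ T.lieH_iH T.lieH_iQ (T.lieQ_iH hφ hQ) (T.lieQ_iQ hφ hQ)
    (T.liePsi_iQ hc) (T.iH_Psi ω hQ hc)
    (fun x y F => sub_eq_zero.2 (T.iHDelta_iH hφ hQ x y F)) T.iQd_iQ
    (T.eps_d ω) (T.eps_Delta hφ) (T.eps_Psi ω hQ hc) (T.eps_lieH ω hω) (T.eps_lieQ hφ)
    (T.eps_iH_Delta hφ hQ) (T.eps_iQ_d ω) (T.eps_iQ_Psi ω hQ hc) (vanish_of_iH_iQ ω hQ)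

theorem isGenuine_of_D_D (hφ : ∀ q, Function.Bijective (phi ω H q))
    (hc : ∀ q, Function.Bijective (canon A H Q q))
    (hQ : ∀ v : Fin (n + 1) → Q, ExteriorAlgebra.ιMulti A (n + 1) v = 0)
    (hω : T.IsInvariant ω) (hP : PropertyP A H)
    (hD : ∀ F, T.d (T.d F + T.Delta ω F + T.Psi F) + T.Delta ω (T.d F + T.Delta ω F + T.Psi F) +
      T.Psi (T.d F + T.Delta ω F + T.Psi F) = 0) : T.IsGenuine := by
  have h := fun u v w => (T.isCalculus hφ hc hQ hω).jacobi_of_D_mul_D (LinearMap.ext fun F => hD F)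
    u v w
  constructor
  · intro u v w
    have h1 : T.totalBracket u (T.totalBracket v w) - T.totalBracket v (T.totalBracket u w) -
        T.totalBracket (T.totalBracket u v) w = 0 := by
      obtain ⟨h2, h3⟩ := eq_zero_of_iH_add_iQ (R := R) hP fun F => LinearMap.congr_fun (h u v w).1 F
      exact Prod.ext h2 h3
    have h2 : T.totalBracket v (T.totalBracket w u) = - T.totalBracket v (T.totalBracket u w) := by
      have e : T.totalBracket w u = - T.totalBracket u w := T.total.bracket_neg w u
      rw [e]
      exact map_neg (T.total.bracket v) _
    have h3 : T.totalBracket w (T.totalBracket u v) = - T.totalBracket (T.totalBracket u v) w :=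
      T.total.bracket_neg _ _
    change T.totalBracket u (T.totalBracket v w) + T.totalBracket v (T.totalBracket w u) +
      T.totalBracket w (T.totalBracket u v) = 0
    rw [h2, h3, ← h1]
    abel
  · intro u v a
    obtain ⟨F, rfl⟩ := exists_eps_eq (R := R) (H := H) ω a
    exact (h u v 0).2 F

theorem D_D_of_isGenuine (hφ : ∀ q, Function.Bijective (phi ω H q))
    (hc : ∀ q, Function.Bijective (canon A H Q q))
    (hQ : ∀ v : Fin (n + 1) → Q, ExteriorAlgebra.ιMulti A (n + 1) v = 0)
    (hω : T.IsInvariant ω) (hG : T.IsGenuine) (F : Form A H Q) :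
    T.d (T.d F + T.Delta ω F + T.Psi F) + T.Delta ω (T.d F + T.Delta ω F + T.Psi F) +
      T.Psi (T.d F + T.Delta ω F + T.Psi F) = 0 := by
  refine LinearMap.congr_fun ((T.isCalculus hφ hc hQ hω).D_mul_D (fun u v w => ?_)
    fun u v a => hG.anchor_bracket u v a) F
  have h1 := hG.jacobi u v w
  change T.totalBracket u (T.totalBracket v w) + T.totalBracket v (T.totalBracket w u) +
      T.totalBracket w (T.totalBracket u v) = 0 at h1
  have h2 : T.totalBracket v (T.totalBracket w u) = - T.totalBracket v (T.totalBracket u w) := by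
    have e : T.totalBracket w u = - T.totalBracket u w := T.total.bracket_neg w u
    rw [e]
    exact map_neg (T.total.bracket v) _
  have h3 : T.totalBracket w (T.totalBracket u v) = - T.totalBracket (T.totalBracket u v) w :=
    T.total.bracket_neg _ _
  rw [h2, h3] at h1
  rw [← h1]
  abel

end AlmostPreLRTriple

/-! ### The components of the square -/

namespace Form

variable {A H Q : Type*} [CommRing A] [AddCommGroup H] [Module A H] [AddCommGroup Q] [Module A Q]

/-- `F` is concentrated in degree `q ∈ ℤ` with respect to `H`. -/
def InDegree (q : ℤ) (F : Form A H Q) : Prop := ∀ k : ℕ, (k : ℤ) ≠ q → F k = 0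

theorem InDegree.add {q : ℤ} {F G : Form A H Q} (hF : InDegree q F) (hG : InDegree q G) :
    InDegree q (F + G) := fun k hk => by
  rw [DirectSum.add_apply, hF k hk, hG k hk, add_zero]

theorem InDegree.of_eq {q r : ℤ} {F : Form A H Q} (hF : InDegree q F) (h : q = r) :
    InDegree r F := h ▸ hF

theorem InDegree.eq_zero {q r s t u : ℤ} {F F₁ F₂ F₃ F₄ : Form A H Q} (hF : InDegree q F)
    (h₁ : InDegree r F₁) (h₂ : InDegree s F₂) (h₃ : InDegree t F₃) (h₄ : InDegree u F₄)
    (h : F + F₁ + F₂ + F₃ + F₄ = 0) (hr : q ≠ r) (hs : q ≠ s) (ht : q ≠ t) (hu : q ≠ u) :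
    F = 0 := by
  refine form_ext fun k v => ?_
  by_cases hk : (k : ℤ) = q
  · have e := congrArg (fun F : Form A H Q => F k v) h
    simp only [apply_add] at e
    rw [h₁ k (hk ▸ hr), h₂ k (hk ▸ hs), h₃ k (hk ▸ ht), h₄ k (hk ▸ hu)] at e
    simpa using e
  · rw [hF k hk]; rfl

end Form

namespace AlmostPreLRTriple

open Form AlmostLieRinehart

variable {R A H Q : Type*} [CommRing R] [CommRing A] [Algebra R A]
  [AddCommGroup H] [Module R H] [Module A H] [IsScalarTower R A H]
  [AddCommGroup Q] [Module R Q] [Module A Q] [IsScalarTower R A Q] (T : AlmostPreLRTriple R A H Q)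
  {n : ℕ} {ω : ⋀[A]^n Q ≃ₗ[A] A}

theorem inDegree_d {q : ℤ} {F : Form A H Q} (hF : InDegree q F) : InDegree (q + 1) (T.d F) := by
  intro k hk
  cases k with
  | zero => exact T.d_apply_zero F
  | succ k =>
    ext v
    rw [d_apply_succ, hF k (by push_cast at hk; omega), ceFun_zero]
    simp

theorem inDegree_Delta (hφ : ∀ q, Function.Bijective (phi ω H q))
    (hQ : ∀ v : Fin (n + 1) → Q, ExteriorAlgebra.ιMulti A (n + 1) v = 0) {q : ℤ} {F : Form A H Q}
    (hF : InDegree q F) : InDegree q (T.Delta ω F) :=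
  fun k hk => T.Delta_apply_eq_zero hφ hQ (hF k hk)

theorem inDegree_Psi {q : ℤ} {F : Form A H Q} (hF : InDegree q F) :
    InDegree (q - 1) (T.Psi F) :=
  fun k hk => T.Psi_apply_eq_zero (hF (k + 1) (by push_cast; omega))

/-- The five relations are the components of `(d + Δ + Ψ)² = 0`: they change the degree in `H` by
`2`, `1`, `0`, `-1` and `-2`. -/
theorem relations_of_D_D (hφ : ∀ q, Function.Bijective (phi ω H q))
    (hQ : ∀ v : Fin (n + 1) → Q, ExteriorAlgebra.ιMulti A (n + 1) v = 0)
    (hD : ∀ F, T.d (T.d F + T.Delta ω F + T.Psi F) + T.Delta ω (T.d F + T.Delta ω F + T.Psi F) +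
      T.Psi (T.d F + T.Delta ω F + T.Psi F) = 0) (F : Form A H Q) :
    T.d (T.d F) = 0 ∧ T.d (T.Delta ω F) + T.Delta ω (T.d F) = 0 ∧
    T.d (T.Psi F) + T.Delta ω (T.Delta ω F) + T.Psi (T.d F) = 0 ∧
    T.Delta ω (T.Psi F) + T.Psi (T.Delta ω F) = 0 ∧ T.Psi (T.Psi F) = 0 := by
  refine form_induction R F (P := fun F =>
    T.d (T.d F) = 0 ∧ T.d (T.Delta ω F) + T.Delta ω (T.d F) = 0 ∧
    T.d (T.Psi F) + T.Delta ω (T.Delta ω F) + T.Psi (T.d F) = 0 ∧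
    T.Delta ω (T.Psi F) + T.Psi (T.Delta ω F) = 0 ∧ T.Psi (T.Psi F) = 0)
    (fun q f => ?_) fun F G hF hG => ?_
  · have hf : InDegree (q : ℤ) (DirectSum.lof R ℕ (FormDeg A H Q) q f) := fun k hk =>
      lof_apply_ne (fun e => hk (by rw [e])) f
    have h0 := hD (DirectSum.lof R ℕ (FormDeg A H Q) q f)
    generalize DirectSum.lof R ℕ (FormDeg A H Q) q f = F at hf h0
    have hd := T.inDegree_d hf
    have hΔ := T.inDegree_Delta hφ hQ hf
    have hΨ := T.inDegree_Psi hf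
    have k1 := T.inDegree_d hd
    have k2 := (T.inDegree_d hΔ).add (T.inDegree_Delta hφ hQ hd)
    have k3 := (((T.inDegree_d hΨ).of_eq (by ring)).add (T.inDegree_Delta hφ hQ hΔ)).add
      ((T.inDegree_Psi hd).of_eq (by ring))
    have k4 := (T.inDegree_Delta hφ hQ hΨ).add (T.inDegree_Psi hΔ)
    have k5 := T.inDegree_Psi hΨ
    simp only [map_add] at h0
    refine ⟨k1.eq_zero k2 k3 k4 k5 ?_ ?_ ?_ ?_ ?_, k2.eq_zero k1 k3 k4 k5 ?_ ?_ ?_ ?_ ?_,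
      k3.eq_zero k1 k2 k4 k5 ?_ ?_ ?_ ?_ ?_, k4.eq_zero k1 k2 k3 k5 ?_ ?_ ?_ ?_ ?_,
      k5.eq_zero k1 k2 k3 k4 ?_ ?_ ?_ ?_ ?_⟩
    all_goals first | omega | (refine Eq.trans ?_ h0; abel)
  · obtain ⟨h1, h2, h3, h4, h5⟩ := hF
    obtain ⟨g1, g2, g3, g4, g5⟩ := hG
    simp only [map_add]
    refine ⟨?_, ?_, ?_, ?_, ?_⟩
    · rw [h1, g1, add_zero]
    · refine Eq.trans ?_ ((congrArg₂ (· + ·) h2 g2).trans (add_zero _)); abel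
    · refine Eq.trans ?_ ((congrArg₂ (· + ·) h3 g3).trans (add_zero _)); abel
    · refine Eq.trans ?_ ((congrArg₂ (· + ·) h4 g4).trans (add_zero _)); abel
    · rw [h5, g5, add_zero]

theorem lambdaFun_mem (x : H) {p : ℕ} {u : ExteriorAlgebra A Q} (hu : u ∈ ⋀[A]^p Q) :
    T.lambdaFun x u ∈ ⋀[A]^p Q := by
  suffices h : u ∈ ⋀[A]^p Q ∧ T.lambdaFun x u ∈ ⋀[A]^p Q from h.2
  refine mem_exteriorPower_induction (P := fun u => u ∈ ⋀[A]^p Q ∧ T.lambdaFun x u ∈ ⋀[A]^p Q)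
    (fun v => ⟨ιMulti_mem p v, ?_⟩) ⟨Submodule.zero_mem _, ?_⟩ (fun u v hu hv => ?_)
    (fun a u hu => ?_) hu
  · rw [lambdaFun_ιMulti]
    exact Submodule.sum_mem _ fun j _ => ιMulti_mem p _
  · rw [lambdaFun_zero]; exact Submodule.zero_mem _
  · rw [lambdaFun_add]
    exact ⟨Submodule.add_mem _ hu.1 hv.1, Submodule.add_mem _ hu.2 hv.2⟩
  · rw [lambdaFun_smul]
    exact ⟨Submodule.smul_mem _ a hu.1, Submodule.add_mem _ (Submodule.smul_mem _ _ hu.1)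
      (Submodule.smul_mem _ a hu.2)⟩

theorem d_mem {q p : ℕ} {F : Form A H Q} (hF : F ∈ comp R A H Q q p) :
    T.d F ∈ comp R A H Q (q + 1) p := by
  rw [mem_comp_iff] at hF
  refine mem_comp_iff.2 ⟨fun k hk => ?_, fun v => ?_⟩
  · exact T.inDegree_d (q := q) (fun k hk => hF.1 k (by exact_mod_cast hk)) k
      (by exact_mod_cast hk)
  · rw [d_apply_succ]
    refine zsmul_mem (sgn_mem 1 (Submodule.add_mem _ (Submodule.sum_mem _ fun i _ =>
      zsmul_mem (T.lambdaFun_mem _ (hF.2 _)) _) ?_)) _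
    cases q with
    | zero => exact Submodule.zero_mem _
    | succ q =>
      rw [bracketPart, AltTools.pairSum]
      refine Submodule.sum_mem _ fun i _ => Submodule.sum_mem _ fun k _ => ?_
      split_ifs
      · exact zsmul_mem (hF.2 _) _
      · exact Submodule.zero_mem _

theorem Delta_one (hφ : ∀ q, Function.Bijective (phi ω H q))
    (hQ : ∀ v : Fin (n + 1) → Q, ExteriorAlgebra.ιMulti A (n + 1) v = 0) :
    T.Delta ω (one R A H Q) = 0 := T.Delta_eq_zero hφ hQ one_mem_comp

theorem Psi_one : T.Psi (one R A H Q) = 0 := T.Psi_lof_zero _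

end AlmostPreLRTriple

/-! ### Differential operators on graded commutative algebras -/

namespace DiffOp

variable {R G : Type*} [CommRing R] [AddCommGroup G] [Module R G]

/-- The failure `b ↦ X(ab) - X(a)b - (-1)^(xi) a X(b)` of `X` to be a derivation, for an operator
`X` of parity `x` and an element `a` of parity `i`. -/
def defect (m : G →ₗ[R] G →ₗ[R] G) (x i : ℕ) (X : G →ₗ[R] G) (a : G) : G →ₗ[R] G :=
  X ∘ₗ m a - m (X a) - (-1 : ℤ) ^ (x * i) • (m a ∘ₗ X)

theorem defect_apply (m : G →ₗ[R] G →ₗ[R] G) (x i : ℕ) (X : G →ₗ[R] G) (a b : G) :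
    defect m x i X a b = X (m a b) - m (X a) b - (-1 : ℤ) ^ (x * i) • m a (X b) := rfl

/-- A graded commutative algebra: `P i a` says that `a` is homogeneous of parity `i`. -/
structure IsGradedComm (m : G →ₗ[R] G →ₗ[R] G) (P : ℕ → G → Prop) : Prop where
  assoc : ∀ a b c, m (m a b) c = m a (m b c)
  comm : ∀ i a j b, P i a → P j b → m a b = (-1 : ℤ) ^ (i * j) • m b a
  mul : ∀ i a j b, P i a → P j b → P (i + j) (m a b)

/-- The differential operators of order `≤ k` and parity `x` which vanish on `1`, if `k > 0`. -/
def HasOrder (m : G →ₗ[R] G →ₗ[R] G) (P : ℕ → G → Prop) : ℕ → ℕ → (G →ₗ[R] G) → Prop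
  | 0, _, X => X = 0
  | k + 1, x, X => ∀ i a, P i a → HasOrder m P k (x + i) (defect m x i X a)

/-- The values of `X` commute with the homogeneous elements as if `X` had parity `x`. -/
def HasOpParity (m : G →ₗ[R] G →ₗ[R] G) (P : ℕ → G → Prop) (x : ℕ) (X : G →ₗ[R] G) : Prop :=
  ∀ i a j b, P i a → P j b → m (X a) b = (-1 : ℤ) ^ ((x + i) * j) • m b (X a)

variable {m : G →ₗ[R] G →ₗ[R] G} {P : ℕ → G → Prop}

theorem defect_zero (x i : ℕ) (a : G) : defect m x i 0 a = 0 := by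
  ext b; simp [defect_apply]

theorem defect_add (x i : ℕ) (X Y : G →ₗ[R] G) (a : G) :
    defect m x i (X + Y) a = defect m x i X a + defect m x i Y a := by
  ext b
  simp only [defect_apply, LinearMap.add_apply, map_add, smul_add]
  abel

theorem defect_zsmul (x i : ℕ) (c : ℤ) (X : G →ₗ[R] G) (a : G) :
    defect m x i (c • X) a = c • defect m x i X a := by
  ext b
  simp only [defect_apply, LinearMap.smul_apply, map_zsmul, smul_sub, smul_comm c]

theorem defect_add_right (x i : ℕ) (X : G →ₗ[R] G) (a b : G) :
    defect m x i X (a + b) = defect m x i X a + defect m x i X b := by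
  ext c
  simp only [defect_apply, LinearMap.add_apply, map_add, smul_add]
  abel

theorem HasOrder.add {k x : ℕ} {X Y : G →ₗ[R] G} (hX : HasOrder m P k x X)
    (hY : HasOrder m P k x Y) : HasOrder m P k x (X + Y) := by
  induction k generalizing x X Y with
  | zero => rw [HasOrder] at *; rw [hX, hY, add_zero]
  | succ k ih =>
    intro i a ha
    rw [defect_add]
    exact ih (hX i a ha) (hY i a ha)

theorem HasOrder.zsmul {k x : ℕ} {X : G →ₗ[R] G} (hX : HasOrder m P k x X) (c : ℤ) :
    HasOrder m P k x (c • X) := by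
  induction k generalizing x X with
  | zero => rw [HasOrder] at *; rw [hX, smul_zero]
  | succ k ih =>
    intro i a ha
    rw [defect_zsmul]
    exact ih (hX i a ha)

theorem HasOrder.zero (k x : ℕ) : HasOrder m P k x 0 := by
  induction k generalizing x with
  | zero => rfl
  | succ k ih => intro i a _; rw [defect_zero]; exact ih _

theorem HasOrder.succ {k x : ℕ} {X : G →ₗ[R] G} (hX : HasOrder m P k x X) :
    HasOrder m P (k + 1) x X := by
  induction k generalizing x X with
  | zero => rw [HasOrder] at hX; rw [hX]; exact HasOrder.zero _ _
  | succ k ih => exact fun i a ha => ih (hX i a ha)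

theorem HasOrder.defect {k x : ℕ} {X : G →ₗ[R] G} (hX : HasOrder m P k x X) {j : ℕ} {b : G}
    (hb : P j b) : HasOrder m P k (x + j) (defect m x j X b) := by
  cases k with
  | zero => rw [HasOrder] at *; rw [hX, defect_zero]
  | succ k => exact (hX j b hb).succ

theorem HasOrder.mulLeft (h : IsGradedComm m P) {k x : ℕ} {X : G →ₗ[R] G}
    (hX : HasOrder m P k x X) {j : ℕ} {b : G} (hb : P j b) :
    HasOrder m P k (x + j) (m b ∘ₗ X) := by
  induction k generalizing x X with
  | zero => rw [HasOrder] at *; rw [hX, LinearMap.comp_zero]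
  | succ k ih =>
    intro i a ha
    have e : DiffOp.defect m (x + j) i (m b ∘ₗ X) a = m b ∘ₗ DiffOp.defect m x i X a := by
      ext c
      simp only [defect_apply, LinearMap.comp_apply, map_sub, map_zsmul, ← h.assoc]
      rw [h.comm i a j b ha hb, map_zsmul, LinearMap.smul_apply, smul_smul, add_mul, pow_add,
        mul_assoc, mul_comm j i, ← pow_add, Even.neg_one_pow (⟨i * j, rfl⟩), mul_one]
    rw [e, add_right_comm]
    exact ih (hX i a ha)

/-- The defect is compatible with products up to a defect of higher order. -/
theorem defect_mul (h : IsGradedComm m P) (x : ℕ) (X : G →ₗ[R] G) (i j : ℕ) (a b : G) :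
    defect m x (i + j) X (m a b) =
      defect m (x + i) j (defect m x i X a) b +
      (-1 : ℤ) ^ ((x + i) * j) • (m b ∘ₗ defect m x i X a) +
      (-1 : ℤ) ^ (x * i) • (m a ∘ₗ defect m x j X b) := by
  ext c
  simp only [defect_apply, LinearMap.add_apply, LinearMap.smul_apply, LinearMap.comp_apply,
    map_sub, map_zsmul, smul_sub, LinearMap.sub_apply, h.assoc, smul_smul, mul_add, pow_add]
  abel

/-- Iterated defects are symmetric in the graded sense. -/
theorem defect_defect_comm (h : IsGradedComm m P) (x : ℕ) (X : G →ₗ[R] G) {i j : ℕ} {a b : G}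
    (ha : P i a) (hb : P j b) : defect m (x + i) j (defect m x i X a) b =
      (-1 : ℤ) ^ (i * j) • defect m (x + j) i (defect m x j X b) a := by
  ext c
  have e1 : m b a = (-1 : ℤ) ^ (i * j) • m a b := by rw [h.comm j b i a hb ha, mul_comm]
  have e2 : ∀ Y, m b (m a Y) = (-1 : ℤ) ^ (i * j) • m a (m b Y) := fun Y => by
    rw [← h.assoc, e1, map_zsmul, LinearMap.smul_apply, h.assoc]
  simp only [defect_apply, LinearMap.smul_apply, map_sub, map_zsmul, smul_sub,
    LinearMap.sub_apply, h.assoc, smul_smul, add_mul, pow_add, e1, e2, mul_comm j i]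
  rcases neg_one_pow_eq_or ℤ (x * i) with h1 | h1 <;>
  rcases neg_one_pow_eq_or ℤ (x * j) with h2 | h2 <;>
  rcases neg_one_pow_eq_or ℤ (i * j) with h3 | h3 <;>
  simp only [h1, h2, h3, one_smul, neg_smul, mul_one, neg_neg, mul_neg] <;> abel

/-- The defect is symmetric in its two arguments, in the graded sense. -/
theorem defect_comm (h : IsGradedComm m P) {x : ℕ} {X : G →ₗ[R] G} (hX : HasOpParity m P x X)
    {i j : ℕ} {a b : G} (ha : P i a) (hb : P j b) :
    defect m x i X a b = (-1 : ℤ) ^ (i * j) • defect m x j X b a := by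
  simp only [defect_apply, smul_sub]
  rw [hX i a j b ha hb, hX j b i a hb ha, h.comm i a j b ha hb, map_zsmul]
  simp only [add_mul, pow_add, mul_comm j i, smul_smul]
  rcases neg_one_pow_eq_or ℤ (x * i) with h1 | h1 <;>
  rcases neg_one_pow_eq_or ℤ (x * j) with h2 | h2 <;>
  rcases neg_one_pow_eq_or ℤ (i * j) with h3 | h3 <;>
  simp only [h1, h2, h3, one_smul, neg_smul, mul_one, neg_neg, mul_neg] <;> abel

theorem HasOpParity.defect (h : IsGradedComm m P) {x : ℕ} {X : G →ₗ[R] G}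
    (hX : HasOpParity m P x X) {i : ℕ} {a : G} (ha : P i a) :
    HasOpParity m P (x + i) (defect m x i X a) := by
  intro j b k c hb hc
  have e1 : ∀ Y, m c (m a Y) = (-1 : ℤ) ^ (i * k) • m a (m c Y) := fun Y => by
    rw [← h.assoc, h.comm k c i a hc ha, map_zsmul, LinearMap.smul_apply, h.assoc, mul_comm]
  have e2 : m b c = (-1 : ℤ) ^ (j * k) • m c b := h.comm j b k c hb hc
  have e3 : ∀ Y, m (X a) (m c Y) = (-1 : ℤ) ^ ((x + i) * k) • m c (m (X a) Y) := fun Y => by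
    rw [← h.assoc, hX i a k c ha hc, map_zsmul, LinearMap.smul_apply, h.assoc]
  simp only [defect_apply, map_sub, map_zsmul, LinearMap.sub_apply, LinearMap.smul_apply, smul_sub,
    hX _ _ _ _ (h.mul i a j b ha hb) hc, h.assoc, hX j b k c hb hc, e1, e2, e3, smul_smul]
  simp only [add_mul, pow_add]
  rcases neg_one_pow_eq_or ℤ (x * i) with h1 | h1 <;>
  rcases neg_one_pow_eq_or ℤ (x * k) with h2 | h2 <;>
  rcases neg_one_pow_eq_or ℤ (i * k) with h3 | h3 <;>
  rcases neg_one_pow_eq_or ℤ (j * k) with h4 | h4 <;>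
  simp only [h1, h2, h3, h4, one_smul, neg_smul, mul_one, neg_neg, mul_neg]

/-- `G` is generated by the elements with the property `K` and by the odd elements `g ξ`. -/
structure IsGeneratedBy {Q : Type*} (m : G →ₗ[R] G →ₗ[R] G) (P K : ℕ → G → Prop) (g : Q → G) :
    Prop where
  toP : ∀ i b, K i b → P i b
  mul : ∀ i b j c, K i b → K j c → K (i + j) (m b c)
  gen : ∀ ξ, P 1 (g ξ)
  induction : ∀ Pr : ℕ → G → Prop, (∀ i b, K i b → Pr i b) →
    (∀ ξ i F, P i F → Pr i F → Pr (1 + i) (m (g ξ) F)) →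
    (∀ i F F', Pr i F → Pr i F' → Pr i (F + F')) → ∀ i F, P i F → Pr i F
  ext : ∀ X : G →ₗ[R] G, (∀ i F, P i F → X F = 0) → X = 0

theorem IsGeneratedBy.eq_zero {Q : Type*} {K : ℕ → G → Prop} {g : Q → G}
    (hg : IsGeneratedBy m P K g) {x : ℕ} {X : G →ₗ[R] G} (hK : ∀ i b, K i b → X b = 0)
    (h0 : ∀ ξ, X (g ξ) = 0) (h1 : ∀ ξ, defect m x 1 X (g ξ) = 0) : X = 0 := by
  refine hg.ext X (hg.induction (fun _ F => X F = 0) hK (fun ξ i F _ hF => ?_)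
    fun i F F' hF hF' => by rw [map_add, hF, hF', add_zero])
  have e := LinearMap.congr_fun (h1 ξ) F
  rw [defect_apply, h0, hF] at e
  simpa using e

/-- An operator which vanishes on the even generators is a differential operator of order `≤ k + 1`
as soon as its defects with respect to the odd generators have order `≤ k`. -/
theorem IsGeneratedBy.hasOrder_succ {Q : Type*} {K : ℕ → G → Prop} {g : Q → G}
    (hg : IsGeneratedBy m P K g) (h : IsGradedComm m P) {k x : ℕ} {X : G →ₗ[R] G}
    (hX : HasOpParity m P x X) (hK : ∀ i b, K i b → X b = 0)
    (hQ : ∀ ξ, HasOrder m P k (x + 1) (defect m x 1 X (g ξ))) : HasOrder m P (k + 1) x X := by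
  induction k generalizing x X with
  | zero =>
    refine hg.induction (fun i a => defect m x i X a = 0) (fun i b hb => ?_)
      (fun ξ i F hF hF' => ?_) fun i F F' hF hF' => by rw [defect_add_right, hF, hF', add_zero]
    · refine hg.eq_zero (x := x + i) (fun j c hc => ?_) (fun ξ => ?_) fun ξ => ?_
      · rw [defect_apply, hK _ _ (hg.mul i b j c hb hc), hK _ _ hb, hK _ _ hc]
        simp
      · rw [defect_comm h hX (hg.toP i b hb) (hg.gen ξ), hQ ξ]
        simp
      · rw [defect_defect_comm h x X (hg.toP i b hb) (hg.gen ξ), hQ ξ, defect_zero, smul_zero]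
    · have e := hQ ξ
      rw [HasOrder] at e
      rw [defect_mul h x X 1 i, e, hF', defect_zero]
      simp
  | succ k ih =>
    refine hg.induction (fun i a => HasOrder m P (k + 1) (x + i) (defect m x i X a))
      (fun i b hb => ?_) (fun ξ i F hF hF' => ?_)
      fun i F F' hF hF' => by rw [defect_add_right]; exact hF.add hF'
    · refine ih (hX.defect h (hg.toP i b hb)) (fun j c hc => ?_) fun ξ => ?_
      · rw [defect_apply, hK _ _ (hg.mul i b j c hb hc), hK _ _ hb, hK _ _ hc]
        simp
      · rw [defect_defect_comm h x X (hg.toP i b hb) (hg.gen ξ), add_right_comm]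
        exact (hQ ξ i b (hg.toP i b hb)).zsmul _
    · rw [defect_mul h x X 1 i, ← add_assoc]
      refine HasOrder.add (HasOrder.add ((hQ ξ).defect hF) (((hQ ξ).mulLeft h hF).zsmul _)) ?_
      rw [add_right_comm]
      exact (hF'.mulLeft h (hg.gen ξ)).zsmul _

theorem formTwo_eq {D : G →ₗ[R] G} (hD : HasOpParity m P 1 D) {one : G}
    (h1 : D one = 0) {i j : ℕ} {a b : G} (ha : P i a) (hb : P j b) :
    formTwo m one D i j a b = defect m 1 i D a b := by
  rw [formTwo, defect_apply, h1, hD j b i a hb ha]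
  simp only [map_zero, LinearMap.zero_apply, add_zero, smul_smul, add_mul, one_mul, pow_add,
    mul_comm j i]
  rcases neg_one_pow_eq_or ℤ i with h1 | h1 <;>
  rcases neg_one_pow_eq_or ℤ (i * j) with h2 | h2 <;>
  simp only [h1, h2, one_smul, neg_smul, mul_one, neg_neg, mul_neg]

/-- For an operator which vanishes on the unit, the form `Φ³` is an iterated defect, since the
product is graded commutative. -/
theorem formThree_eq (h : IsGradedComm m P) {D : G →ₗ[R] G} (hD : HasOpParity m P 1 D) {one : G}
    (h1 : D one = 0) {i j k : ℕ} {a b c : G} (ha : P i a) (hb : P j b) (hc : P k c) :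
    formThree m one D i j k a b c = defect m (1 + i) j (defect m 1 i D a) b c := by
  have e1 : m (D (m b c)) a = (-1 : ℤ) ^ ((1 + (j + k)) * i) • m a (D (m b c)) :=
    hD _ _ i a (h.mul j b k c hb hc) ha
  have e2 : m c a = (-1 : ℤ) ^ (k * i) • m a c := h.comm k c i a hc ha
  have e3 : m (D (m a c)) b = (-1 : ℤ) ^ ((1 + (i + k)) * j) • m b (D (m a c)) :=
    hD _ _ j b (h.mul i a k c ha hc) hb
  have e4 : m (m (D b) c) a = (-1 : ℤ) ^ (((1 + j) + k) * i) • m a (m (D b) c) := by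
    rw [h.assoc, e2, map_zsmul, ← h.assoc, hD j b i a hb ha, map_zsmul, LinearMap.smul_apply,
      smul_smul, ← pow_add, h.assoc, ← add_mul, add_comm k]
  have e5 : m (m (D c) a) b = (-1 : ℤ) ^ ((1 + k) * (i + j)) • m a (m b (D c)) := by
    rw [h.assoc, hD k c _ _ hc (h.mul i a j b ha hb), h.assoc]
  have e6 : m (D a) (m b c) = (-1 : ℤ) ^ ((1 + i) * j) • m b (m (D a) c) := by
    rw [← h.assoc, hD i a j b ha hb, map_zsmul, LinearMap.smul_apply, h.assoc]
  have e7 : ∀ Y, m b (m a Y) = (-1 : ℤ) ^ (i * j) • m a (m b Y) := fun Y => by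
    rw [← h.assoc, h.comm j b i a hb ha, map_zsmul, LinearMap.smul_apply, h.assoc, mul_comm]
  simp only [formThree, defect_apply, map_sub, map_zsmul, LinearMap.sub_apply,
    LinearMap.smul_apply, smul_sub]
  rw [e1, e2, e4, e5]
  simp only [map_zsmul, LinearMap.smul_apply, e3, h.assoc, h1, map_zero, LinearMap.zero_apply,
    sub_zero, e6, e7, smul_smul]
  simp only [add_mul, mul_add, one_mul, pow_add, mul_comm k i, mul_comm j i, mul_comm k j]
  rcases neg_one_pow_eq_or ℤ i with h1 | h1 <;>
  rcases neg_one_pow_eq_or ℤ j with h2 | h2 <;>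
  rcases neg_one_pow_eq_or ℤ (i * j) with h3 | h3 <;>
  rcases neg_one_pow_eq_or ℤ (i * k) with h4 | h4 <;>
  rcases neg_one_pow_eq_or ℤ (j * k) with h5 | h5 <;>
  simp only [h1, h2, h3, h4, h5, one_smul, neg_smul, mul_one, neg_neg, mul_neg] <;> abel

/-- For an operator which vanishes on the unit, the form `Φ⁴` is an iterated defect, since the
product is graded commutative. -/
theorem formFour_eq (h : IsGradedComm m P) {D : G →ₗ[R] G} (hD : HasOpParity m P 1 D) {one : G}
    (h1 : D one = 0) {i j k l : ℕ} {a b c e : G} (ha : P i a) (hb : P j b) (hc : P k c)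
    (he : P l e) : formFour m one D i j k l a b c e =
      defect m (1 + i + j) k (defect m (1 + i) j (defect m 1 i D a) b) c e := by
  have hW := (hD.defect h ha).defect h hb
  rw [formFour, formThree_eq h hD h1 ha hb (h.mul k c l e hc he), formThree_eq h hD h1 ha hb hc,
    formThree_eq h hD h1 ha hb he, defect_apply m _ k, hW l e k c he hc, smul_smul, ← pow_add]
  congr 2
  have e : (-1 : ℤ) ^ (k * l + (1 + i + j + l) * k) = (-1 : ℤ) ^ ((1 + i + j) * k) :=
    Form.neg_one_pow_eq ⟨k * l + (1 + i + j) * k, by ring⟩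
  exact e

theorem defect_one_one (X : G →ₗ[R] G) (a b : G) :
    defect m 1 1 X a b = X (m a b) - m (X a) b + m a (X b) := by
  rw [defect_apply]; simp

theorem defect_two (i : ℕ) (X : G →ₗ[R] G) (a b : G) :
    defect m 2 i X a b = X (m a b) - m (X a) b - m a (X b) := by
  rw [defect_apply]; simp

theorem hasOrder_one {x : ℕ} {X : G →ₗ[R] G}
    (h0 : ∀ i a, Even (x * i) → P i a → ∀ b, X (m a b) = m (X a) b + m a (X b))
    (h1 : ∀ i a, Odd (x * i) → P i a → ∀ b, X (m a b) = m (X a) b - m a (X b)) :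
    HasOrder m P 1 x X := by
  intro i a ha
  refine LinearMap.ext fun b => ?_
  rw [defect_apply, LinearMap.zero_apply]
  rcases Nat.even_or_odd (x * i) with h | h
  · rw [h0 i a h ha, h.neg_one_pow, one_smul]; abel
  · rw [h1 i a h ha, h.neg_one_pow, neg_one_smul]; abel

end DiffOp

/-! ### Derivations of `Alt_A(H, Λ_A Q)` -/

namespace Form

variable {R A H Q : Type*} [CommRing R] [CommRing A] [Algebra R A]
  [AddCommGroup H] [Module A H]
  [AddCommGroup Q] [Module R Q] [Module A Q] [IsScalarTower R A Q]

theorem HasParity.tau_even {j : ℕ} {F : Form A H Q} (hF : HasParity j F) (hj : Even j) :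
    Form.tau R A H Q F = F := by
  refine form_ext fun k v => ?_
  rw [hF.tau_eq, apply_zsmul, hj.neg_one_pow, one_smul]

theorem HasParity.tau_odd {j : ℕ} {F : Form A H Q} (hF : HasParity j F) (hj : Odd j) :
    Form.tau R A H Q F = - F := by
  refine form_ext fun k v => ?_
  rw [hF.tau_eq, apply_zsmul, hj.neg_one_pow, neg_one_smul, apply_neg]

/-- A criterion for derivations: an operator which is compatible with the contractions, up to
contractions, is a derivation if it is one in degree `0` with respect to `H`. -/
theorem derivation_of_apply_zero {X : Form A H Q → Form A H Q} {c : H → H}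
    (htau : ∀ F, X (tau R A H Q F) = tau R A H Q (X F)) (hadd : ∀ F G, X (F + G) = X F + X G)
    (hiH : ∀ x F, X (iH R A Q x F) - iH R A Q x (X F) = iH R A Q (c x) F)
    (h0 : ∀ F G, X (mul R A H Q F G) 0 ![] = X F 0 ![] * G 0 ![] + F 0 ![] * X G 0 ![])
    (F G : Form A H Q) :
    X (mul R A H Q F G) = mul R A H Q (X F) G + mul R A H Q F (X G) := by
  let S : Set (Form A H Q) := {E | ∃ F G,
    E = X (mul R A H Q F G) - mul R A H Q (X F) G - mul R A H Q F (X G)}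
  have h : ∀ E ∈ S, E = 0 := by
    refine vanish_of_iH (R := R) S ?_ ?_
    · rintro _ ⟨F, G, rfl⟩
      rw [apply_sub, apply_sub, h0, mul_apply_zero, mul_apply_zero]
      abel
    · rintro _ ⟨F, G, rfl⟩ x
      have hiH' : ∀ F, iH R A Q x (X F) = X (iH R A Q x F) - iH R A Q (c x) F := fun F => by
        rw [← hiH]; abel
      have e : iH R A Q x (X (mul R A H Q F G) - mul R A H Q (X F) G - mul R A H Q F (X G)) =
          (X (mul R A H Q (iH R A Q x F) G) - mul R A H Q (X (iH R A Q x F)) G -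
            mul R A H Q (iH R A Q x F) (X G)) +
          (X (mul R A H Q (tau R A H Q F) (iH R A Q x G)) -
            mul R A H Q (X (tau R A H Q F)) (iH R A Q x G) -
            mul R A H Q (tau R A H Q F) (X (iH R A Q x G))) := by
        rw [map_sub, map_sub, hiH', iH_mul (R := R) x F G, iH_mul (R := R) (c x) F G,
          iH_mul (R := R) x (X F) G, iH_mul (R := R) x F (X G), hadd, hiH', hiH', htau]
        simp only [map_sub, sub_mul']
        abel
      rw [e]
      exact Submodule.add_mem _ (Submodule.subset_span ⟨_, _, rfl⟩)
        (Submodule.subset_span ⟨_, _, rfl⟩)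
  have e := h _ ⟨F, G, rfl⟩
  refine sub_eq_zero.1 (Eq.trans ?_ e)
  abel

theorem const_add (u v : ExteriorAlgebra A Q) : const R H (u + v) = const R H u + const R H v := by
  rw [const, const, const, ← map_add]; rfl

theorem const_mul_const (u v : ExteriorAlgebra A Q) :
    mul R A H Q (const R H u) (const R H v) = const R H (u * v) := by
  refine form_ext fun k w => ?_
  rw [const_mul_apply]
  cases k with
  | zero => rw [Subsingleton.elim w ![], const_apply_zero, const_apply_zero]
  | succ k =>
    rw [const, const, lof_apply_ne (by omega), lof_apply_ne (by omega)]
    exact mul_zero u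

theorem mul_comm_of_mem_zero {z : Form A H Q} (hz : z ∈ comp R A H Q 0 0) {q p : ℕ}
    {F : Form A H Q} (hF : F ∈ comp R A H Q q p) : mul R A H Q z F = mul R A H Q F z := by
  refine form_ext fun k v => ?_
  rw [mul_comm' (hasParity_of_mem hz) (hasParity_of_mem hF), apply_zsmul]
  simp

end Form

namespace AlmostPreLRTriple

open Form AlmostLieRinehart

variable {R A H Q : Type*} [CommRing R] [CommRing A] [Algebra R A]
  [AddCommGroup H] [Module R H] [Module A H] [IsScalarTower R A H]
  [AddCommGroup Q] [Module R Q] [Module A Q] [IsScalarTower R A Q] (T : AlmostPreLRTriple R A H Q)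
  {n : ℕ} {ω : ⋀[A]^n Q ≃ₗ[A] A}

theorem lieH_tau (x : H) (F : Form A H Q) :
    T.lieH x (tau R A H Q F) = tau R A H Q (T.lieH x F) := by
  refine form_ext fun k v => ?_
  rw [lieH_apply, tau_apply, tau_apply, lieH_apply, lambdaFun_zsmul, lambdaFun_sgn, map_sub,
    smul_sub, map_sum, Finset.smul_sum]
  simp only [tau_apply]

/-- The Lie derivative along `x ∈ H` is an even derivation, by the criterion
`derivation_of_apply_zero`. -/
theorem lieH_mul (x : H) (F G : Form A H Q) : T.lieH x (mul R A H Q F G) =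
    mul R A H Q (T.lieH x F) G + mul R A H Q F (T.lieH x G) := by
  refine derivation_of_apply_zero (R := R) (X := T.lieH x) (c := fun y => T.strH.bracket x y)
    (T.lieH_tau x) (fun F G => ?_) (fun y F => T.lieH_iH x y F) (fun F G => ?_) F G
  · simp only [lieH, map_add]; abel
  · simp only [lieH_apply, Finset.univ_eq_empty, Finset.sum_empty, sub_zero, mul_apply_zero,
      lambdaFun_mul]

theorem d_tau (F : Form A H Q) : T.d (tau R A H Q F) = - tau R A H Q (T.d F) := by
  refine form_ext fun k v => ?_
  cases k with
  | zero => rw [apply_neg, tau_apply, d_apply_zero, d_apply_zero]; simp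
  | succ k =>
    have h : tau R A H Q F k = (-1 : ℤ) ^ k • (sgn A Q 1).compAlternatingMap (F k) := by
      ext w
      rw [tau_apply]; rfl
    rw [apply_neg, tau_apply, d_apply_succ, d_apply_succ, h, ceFun_zsmul,
      ceFun_comp _ _ (fun x m => T.lambdaFun_sgn x 1 m), map_zsmul, map_zsmul,
      pow_succ (-1 : ℤ) k, mul_neg_one, neg_smul, neg_smul, neg_smul, smul_neg, neg_neg]

/-- The operator `d` is an odd derivation: contracting its defect with `x` leads to defects of `d`
again, because the Lie derivative is a derivation. -/
theorem d_mul (F G : Form A H Q) : T.d (mul R A H Q F G) =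
    mul R A H Q (T.d F) G + mul R A H Q (tau R A H Q F) (T.d G) := by
  let S : Set (Form A H Q) := {E | ∃ F G, E = T.d (mul R A H Q F G) - mul R A H Q (T.d F) G -
    mul R A H Q (tau R A H Q F) (T.d G)}
  have h : ∀ E ∈ S, E = 0 := by
    refine vanish_of_iH (R := R) S ?_ ?_
    · rintro _ ⟨F, G, rfl⟩
      rw [apply_sub, apply_sub, mul_apply_zero, mul_apply_zero]
      simp only [d_apply_zero]
      simp
    -- The contraction of the defect at `(F, G)` is the sum of the defects at `(- i_x F, G)` and
    -- `(- τ F, i_x G)`.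
    · rintro _ ⟨F, G, rfl⟩ x
      have h1 : ∀ F, iH R A Q x (T.d F) = T.lieH x F - T.d (iH R A Q x F) := fun F => by
        rw [lieH]; abel
      have e : iH R A Q x (T.d (mul R A H Q F G) - mul R A H Q (T.d F) G -
          mul R A H Q (tau R A H Q F) (T.d G)) =
          (T.d (mul R A H Q (iH R A Q x (-F)) G) - mul R A H Q (T.d (iH R A Q x (-F))) G -
            mul R A H Q (tau R A H Q (iH R A Q x (-F))) (T.d G)) +
          (T.d (mul R A H Q (tau R A H Q (-F)) (iH R A Q x G)) -
            mul R A H Q (T.d (tau R A H Q (-F))) (iH R A Q x G) -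
            mul R A H Q (tau R A H Q (tau R A H Q (-F))) (T.d (iH R A Q x G))) := by
        rw [map_sub, map_sub, h1, iH_mul, iH_mul, iH_mul, lieH_mul, h1, h1, iH_tau, d_tau, tau_tau,
          tau_tau]
        simp only [map_sub, map_add, map_neg, sub_mul', neg_mul']
        abel
      rw [e]
      exact Submodule.add_mem _ (Submodule.subset_span ⟨_, _, rfl⟩)
        (Submodule.subset_span ⟨_, _, rfl⟩)
  have e := h _ ⟨F, G, rfl⟩
  refine sub_eq_zero.1 (Eq.trans ?_ e)
  abel

theorem d_one : T.d (one R A H Q) = 0 := by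
  have h := T.d_mul (one R A H Q) (one R A H Q)
  rw [(hasParity_of_mem one_mem_comp).tau_even ⟨0, rfl⟩, mul_one', one_mul', mul_one'] at h
  have e : T.d (one R A H Q) = T.d (one R A H Q) + T.d (one R A H Q) - T.d (one R A H Q) := by abel
  rw [e, ← h]
  abel

variable (ω) in
/-- The derivation by which `ξ ∈ Q` acts on `Alt_A(H, Λ_A Q)`. It extends the action on
`Alt_A(H, A)` and the bracket of `Q`. -/
noncomputable def derQ (ξ : Q) (F : Form A H Q) : Form A H Q :=
  T.lieQ ω ξ F + mul R A H Q (T.Delta ω (ofQ R A H ξ)) F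

theorem derQ_add (ξ : Q) (F G : Form A H Q) :
    T.derQ ω ξ (F + G) = T.derQ ω ξ F + T.derQ ω ξ G := by
  simp only [derQ, lieQ, map_add]; abel

theorem derQ_neg (ξ : Q) (F : Form A H Q) : T.derQ ω ξ (-F) = - T.derQ ω ξ F := by
  simp only [derQ, lieQ, map_neg]; abel

theorem derQ_one (hφ : ∀ q, Function.Bijective (phi ω H q))
    (hQ : ∀ v : Fin (n + 1) → Q, ExteriorAlgebra.ιMulti A (n + 1) v = 0) (ξ : Q) :
    T.derQ ω ξ (one R A H Q) = 0 := by
  rw [derQ, lieQ, T.Delta_one hφ hQ, map_zero, zero_add, iQ_eq, mul_one', mul_one', map_neg]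
  abel

theorem derQ_iQ (hφ : ∀ q, Function.Bijective (phi ω H q))
    (hQ : ∀ v : Fin (n + 1) → Q, ExteriorAlgebra.ιMulti A (n + 1) v = 0) (ξ η : Q)
    (F : Form A H Q) : T.derQ ω ξ (iQ R A H η F) =
      iQ R A H η (T.derQ ω ξ F) + iQ R A H (T.strQ.bracket ξ η) F := by
  have h : mul R A H Q (T.Delta ω (ofQ R A H ξ)) (iQ R A H η F) =
      iQ R A H η (mul R A H Q (T.Delta ω (ofQ R A H ξ)) F) := by
    rw [iQ_eq, iQ_eq, map_neg, ← mul_assoc', ← mul_assoc',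
      mul_comm_of_mem_zero (T.Delta_mem hφ hQ (ofQ_mem_comp ξ)) (ofQ_mem_comp η)]
  rw [derQ, derQ, h, map_add, ← T.lieQ_iQ hφ hQ]
  abel

theorem derQ_iH (hφ : ∀ q, Function.Bijective (phi ω H q))
    (hQ : ∀ v : Fin (n + 1) → Q, ExteriorAlgebra.ιMulti A (n + 1) v = 0) (ξ : Q) (x : H)
    (F : Form A H Q) : T.derQ ω ξ (iH R A Q x F) - iH R A Q x (T.derQ ω ξ F) =
      iH R A Q (T.actQH.act ξ x) F := by
  have hz := T.Delta_mem hφ hQ (ofQ_mem_comp (R := R) (H := H) ξ)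
  have h0 : iH R A Q x (T.Delta ω (ofQ R A H ξ)) = 0 := by
    obtain ⟨f, -, hf⟩ := hz
    rw [← hf, iH_lof_zero]
  rw [derQ, derQ, map_add, iH_mul, (hasParity_of_mem hz).tau_even ⟨0, rfl⟩, h0, map_zero,
    LinearMap.zero_apply, zero_add, ← T.lieQ_iH hφ hQ]
  abel

theorem Delta_tau (hφ : ∀ q, Function.Bijective (phi ω H q))
    (hQ : ∀ v : Fin (n + 1) → Q, ExteriorAlgebra.ιMulti A (n + 1) v = 0) (F : Form A H Q) :
    T.Delta ω (tau R A H Q F) = - tau R A H Q (T.Delta ω F) := by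
  refine comp_induction (R := R) hQ (P := fun F =>
    T.Delta ω (tau R A H Q F) = - tau R A H Q (T.Delta ω F)) (fun q p F hF => ?_)
    (fun F G hF hG => by simp only [map_add]; rw [hF, hG]; abel) F
  cases p with
  | zero =>
    have h := T.Delta_eq_zero hφ hQ hF
    rw [h, map_zero]
    rcases Nat.even_or_odd (q + 0) with hj | hj
    · rw [(hasParity_of_mem hF).tau_even hj, h, neg_zero]
    · rw [(hasParity_of_mem hF).tau_odd hj, map_neg, h]
  | succ p =>
    have h := hasParity_of_mem (T.Delta_mem hφ hQ hF)
    rcases Nat.even_or_odd (q + p) with hj | hj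
    · rw [(hasParity_of_mem hF).tau_odd hj.add_one, map_neg, h.tau_even hj]
    · rw [(hasParity_of_mem hF).tau_even hj.add_one, h.tau_odd hj]
      abel

theorem derQ_tau (hφ : ∀ q, Function.Bijective (phi ω H q))
    (hQ : ∀ v : Fin (n + 1) → Q, ExteriorAlgebra.ιMulti A (n + 1) v = 0) (ξ : Q)
    (F : Form A H Q) : T.derQ ω ξ (tau R A H Q F) = tau R A H Q (T.derQ ω ξ F) := by
  have hz := T.Delta_mem hφ hQ (ofQ_mem_comp (R := R) (H := H) ξ)
  have h1 : ∀ F, iQ R A H ξ (tau R A H Q F) = - tau R A H Q (iQ R A H ξ F) := fun F => by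
    rw [tau_iQ]; abel
  rw [derQ, derQ, lieQ, lieQ, T.Delta_tau hφ hQ, map_neg, h1, h1, map_neg, T.Delta_tau hφ hQ,
    map_add, map_add, tau_mul, (hasParity_of_mem hz).tau_even ⟨0, rfl⟩]
  abel

theorem derQ_const_mul (hφ : ∀ q, Function.Bijective (phi ω H q))
    (hQ : ∀ v : Fin (n + 1) → Q, ExteriorAlgebra.ιMulti A (n + 1) v = 0) (ξ : Q) (a : A)
    (F : Form A H Q) : T.derQ ω ξ (mul R A H Q (const R H (algebraMap A _ a)) F) =
      mul R A H Q (const R H (algebraMap A _ (T.strQ.anchor ξ a))) F +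
      mul R A H Q (const R H (algebraMap A _ a)) (T.derQ ω ξ F) := by
  have hp : ∀ (a : A) k m (F : Form A H Q) w,
      pair ω k m (mul R A H Q (const R H (algebraMap A _ a)) F) w = a • pair ω k m F w := by
    intro a k m F w
    ext v
    rw [AlternatingMap.smul_apply, pair_apply, pair_apply, const_mul_apply, ← Algebra.smul_def,
      smul_mul_assoc, map_smul]
  have h : T.lieQ ω ξ (mul R A H Q (const R H (algebraMap A _ a)) F) =
      mul R A H Q (const R H (algebraMap A _ (T.strQ.anchor ξ a))) F +
      mul R A H Q (const R H (algebraMap A _ a)) (T.lieQ ω ξ F) := by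
    refine ext_of_pair ω hQ fun k m w v => ?_
    have e := (T.lieConn k).act_smul ξ a (pair ω k m F w)
    rw [lieConn_act, lieConn_act] at e
    rw [T.pair_lieQ hφ, pair_add, hp, hp, hp, e]
    simp only [AlternatingMap.add_apply, AlternatingMap.smul_apply, hp]
    rw [T.pair_lieQ hφ, smul_sub, Finset.smul_sum]
    abel
  have hc : const R H (algebraMap A (ExteriorAlgebra A Q) a) ∈ comp R A H Q 0 0 :=
    ⟨_, fun v => by
      have h := Submodule.smul_mem _ a (SetLike.one_mem_graded fun i : ℕ => ⋀[A]^i Q)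
      rwa [Algebra.smul_def, mul_one] at h, rfl⟩
  rw [derQ, derQ, h, map_add, ← mul_assoc', ← mul_assoc',
    mul_comm_of_mem_zero (T.Delta_mem hφ hQ (ofQ_mem_comp ξ)) hc]
  abel

/-- The operator `derQ ξ` preserves the forms without component of degree `0` in `H`. -/
theorem derQ_apply_zero (hφ : ∀ q, Function.Bijective (phi ω H q))
    (hQ : ∀ v : Fin (n + 1) → Q, ExteriorAlgebra.ιMulti A (n + 1) v = 0) (ξ : Q)
    {F : Form A H Q} (hF : F 0 ![] = 0) : T.derQ ω ξ F 0 ![] = 0 := by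
  have h0 : ∀ {F : Form A H Q}, F 0 ![] = 0 → T.Delta ω F 0 ![] = 0 := by
    intro F hF
    rw [T.Delta_apply_eq_zero hφ hQ (k := 0)]
    · rfl
    · ext v
      rw [Subsingleton.elim v ![], hF]; rfl
  have h1 : ∀ {F : Form A H Q}, F 0 ![] = 0 → iQ R A H ξ F 0 ![] = 0 := by
    intro F hF
    rw [iQ_apply, hF, mul_zero, neg_zero]
  rw [derQ, lieQ, apply_add, apply_add, mul_apply_zero, h1 (h0 hF), h0 (h1 hF), hF, mul_zero,
    add_zero, add_zero]

/-- The operator `derQ ξ` is a derivation. Hence `Δ_ω` is a differential operator of order `2`, as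
its defect with respect to `ξ` is `- derQ ξ`. -/
theorem derQ_mul (hφ : ∀ q, Function.Bijective (phi ω H q))
    (hQ : ∀ v : Fin (n + 1) → Q, ExteriorAlgebra.ιMulti A (n + 1) v = 0) (ξ : Q)
    (F G : Form A H Q) : T.derQ ω ξ (mul R A H Q F G) =
      mul R A H Q (T.derQ ω ξ F) G + mul R A H Q F (T.derQ ω ξ G) := by
  -- The product rule for a left factor in `Λ_A Q` is checked on the generators `A` and `Q`.
  have hconst : ∀ (u : ExteriorAlgebra A Q) G, T.derQ ω ξ (mul R A H Q (const R H u) G) =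
      mul R A H Q (T.derQ ω ξ (const R H u)) G + mul R A H Q (const R H u) (T.derQ ω ξ G) := by
    intro u
    induction u using CliffordAlgebra.left_induction with
    | algebraMap a =>
      intro G
      have h := T.derQ_const_mul hφ hQ ξ a (one R A H Q)
      rw [mul_one', mul_one', T.derQ_one hφ hQ, map_zero, add_zero] at h
      exact (T.derQ_const_mul hφ hQ ξ a G).trans (by rw [← h])
    | add u v hu hv =>
      intro G
      simp only [const_add, map_add, LinearMap.add_apply, derQ_add, hu, hv]
      abel
    | ι_mul u η hu =>
      intro G
      change T.derQ ω ξ (mul R A H Q (const R H (ExteriorAlgebra.ι A η * u)) G) =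
        mul R A H Q (T.derQ ω ξ (const R H (ExteriorAlgebra.ι A η * u))) G +
        mul R A H Q (const R H (ExteriorAlgebra.ι A η * u)) (T.derQ ω ξ G)
      have e : ∀ G, mul R A H Q (const R H (ExteriorAlgebra.ι A η * u)) G =
          - iQ R A H η (mul R A H Q (const R H u) G) := fun G => by
        rw [← const_mul_const, mul_assoc', iQ_eq, const_ι]; abel
      have e' : const R H (ExteriorAlgebra.ι A η * u) = - iQ R A H η (const R H u) := by
        rw [← const_mul_const, iQ_eq, const_ι]; abel
      have e'' : ∀ ζ F G, mul R A H Q (iQ R A H ζ F) G = iQ R A H ζ (mul R A H Q F G) :=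
        fun ζ F G => by
        rw [iQ_eq, iQ_eq, neg_mul', mul_assoc']
      rw [e, e, e', derQ_neg, derQ_neg, T.derQ_iQ hφ hQ, T.derQ_iQ hφ hQ, hu, neg_mul', map_add,
        map_add, LinearMap.add_apply, e'', e'']
      abel
  refine derivation_of_apply_zero (R := R) (X := T.derQ ω ξ) (c := fun y => T.actQH.act ξ y)
    (T.derQ_tau hφ hQ ξ) (T.derQ_add ξ) (T.derQ_iH hφ hQ ξ) (fun F G => ?_) F G
  -- In degree `0` with respect to `H`, only the component of `F` of degree `0` matters.
  have hF : ∀ G, T.derQ ω ξ (mul R A H Q F G) 0 ![] =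
      T.derQ ω ξ (mul R A H Q (const R H (F 0 ![])) G) 0 ![] := fun G => by
    have h := T.derQ_apply_zero hφ hQ ξ
      (F := mul R A H Q F G - mul R A H Q (const R H (F 0 ![])) G) (by
        rw [apply_sub, mul_apply_zero, mul_apply_zero, const_apply_zero, sub_self])
    rw [sub_eq_add_neg, derQ_add, derQ_neg, apply_add, apply_neg, ← sub_eq_add_neg,
      sub_eq_zero] at h
    exact h
  have hF' := hF (one R A H Q)
  rw [mul_one', mul_one'] at hF'
  rw [hF, hconst, apply_add, mul_apply_zero, mul_apply_zero, const_apply_zero, hF']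

end AlmostPreLRTriple

/-! ### The orders of the three operators -/

namespace Form

variable {R A H Q : Type*} [CommRing R] [CommRing A] [Algebra R A]
  [AddCommGroup H] [Module A H]
  [AddCommGroup Q] [Module R Q] [Module A Q] [IsScalarTower R A Q]

variable (R) in
/-- `F` is bihomogeneous, of total degree `i` modulo `2`. -/
def IsHomog (i : ℕ) (F : Form A H Q) : Prop := ∃ q p, i = q + p ∧ F ∈ comp R A H Q q p

theorem isHomog_of_mem {q p : ℕ} {F : Form A H Q} (hF : F ∈ comp R A H Q q p) :
    IsHomog R (q + p) F := ⟨q, p, rfl, hF⟩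

theorem IsHomog.hasParity {i : ℕ} {F : Form A H Q} (hF : IsHomog R i F) : HasParity i F := by
  obtain ⟨q, p, rfl, hF⟩ := hF
  exact hasParity_of_mem hF

theorem isGradedComm :
    DiffOp.IsGradedComm (G := Form A H Q) (mul R A H Q) (IsHomog R) where
  assoc := mul_assoc'
  comm _ _ _ _ ha hb := mul_comm' ha.hasParity hb.hasParity
  mul := by
    rintro _ a _ b ⟨q, p, rfl, ha⟩ ⟨q', p', rfl, hb⟩
    exact ⟨q + q', p + p', by ring, mul_mem_comp ha hb⟩

theorem ofQ_neg (ξ : Q) : ofQ R A H (-ξ) = - ofQ R A H ξ := by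
  refine form_ext fun k v => ?_
  cases k with
  | zero =>
    rw [Subsingleton.elim v ![], apply_neg, ← const_ι, ← const_ι, const_apply_zero,
      const_apply_zero, map_neg]
  | succ k =>
    rw [apply_neg, ofQ, ofQ, lof_apply_ne (by omega), lof_apply_ne (by omega)]
    exact neg_zero.symm

theorem ofQ_mul (ξ : Q) (F : Form A H Q) : mul R A H Q (ofQ R A H ξ) F = - iQ R A H ξ F := by
  rw [iQ_eq]; abel

theorem isHomog_induction (hc : ∀ q, Function.Bijective (canon A H Q q))
    {P : ℕ → Form A H Q → Prop} (hK : ∀ i, ∀ F ∈ comp R A H Q i 0, P i F)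
    (hg : ∀ ξ i F, IsHomog R i F → P i F → P (1 + i) (mul R A H Q (ofQ R A H ξ) F))
    (hadd : ∀ i F G, P i F → P i G → P i (F + G)) (i : ℕ) (F : Form A H Q) (hF : IsHomog R i F) :
    P i F := by
  obtain ⟨q, p, rfl, hF⟩ := hF
  refine comp_generator_induction (R := R) hc (P := fun q p F => P (q + p) F)
    (fun q β => hK _ _ (ofForm_mem_comp β)) (fun ξ q p F hF h => ?_)
    (fun q p F G => hadd _ F G) hF
  have e : iQ R A H ξ F = mul R A H Q (ofQ R A H (-ξ)) F := by
    rw [iQ_eq, ofQ_neg, neg_mul']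
  rw [e, show q + (p + 1) = 1 + (q + p) by ring]
  exact hg _ _ _ ⟨q, p, rfl, hF⟩ h

theorem eq_zero_of_isHomog {n : ℕ}
    (hQ : ∀ v : Fin (n + 1) → Q, ExteriorAlgebra.ιMulti A (n + 1) v = 0)
    (X : Form A H Q →ₗ[R] Form A H Q) (hX : ∀ i F, IsHomog R i F → X F = 0) : X = 0 :=
  LinearMap.ext fun F => comp_induction (R := R) hQ (P := fun F => X F = 0)
    (fun q p F hF => hX _ F ⟨q, p, rfl, hF⟩)
    (fun F G hF hG => by rw [map_add, hF, hG, add_zero]) F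

/-- `Alt_A(H, Λ_A Q)` is generated by the `Alt_A^i(H, A)` and by `Q`. -/
theorem isGeneratedBy {n : ℕ} (hc : ∀ q, Function.Bijective (canon A H Q q))
    (hQ : ∀ v : Fin (n + 1) → Q, ExteriorAlgebra.ιMulti A (n + 1) v = 0) :
    DiffOp.IsGeneratedBy (G := Form A H Q) (mul R A H Q) (IsHomog R)
      (fun i F => F ∈ comp R A H Q i 0) (ofQ R A H) where
  toP i b hb := ⟨i, 0, rfl, hb⟩
  mul _ _ _ _ hb hc := by
    have h := mul_mem_comp hb hc
    rwa [add_zero] at h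
  gen ξ := ⟨0, 1, rfl, ofQ_mem_comp ξ⟩
  induction _ hK hg hadd := isHomog_induction hc hK hg hadd
  ext := eq_zero_of_isHomog hQ

theorem hasOpParity {x : ℕ} {X : Form A H Q →ₗ[R] Form A H Q}
    (hX : ∀ q p, ∀ F ∈ comp R A H Q q p, HasParity (x + (q + p)) (X F)) :
    DiffOp.HasOpParity (G := Form A H Q) (mul R A H Q) (IsHomog R) x X := by
  rintro _ a j b ⟨q, p, rfl, ha⟩ hb
  exact mul_comm' (hX q p a ha) hb.hasParity

theorem hasParity_zero (i : ℕ) : HasParity i (0 : Form A H Q) := fun _ _ =>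
  Submodule.zero_mem _

end Form

namespace AlmostPreLRTriple

open Form AlmostLieRinehart

variable {R A H Q : Type*} [CommRing R] [CommRing A] [Algebra R A]
  [AddCommGroup H] [Module R H] [Module A H] [IsScalarTower R A H]
  [AddCommGroup Q] [Module R Q] [Module A Q] [IsScalarTower R A Q] (T : AlmostPreLRTriple R A H Q)
  {n : ℕ} {ω : ⋀[A]^n Q ≃ₗ[A] A}

theorem hasOpParity_d : DiffOp.HasOpParity (G := Form A H Q) (mul R A H Q) (IsHomog R) 1 T.d :=
  hasOpParity fun q p F hF => (hasParity_of_mem (T.d_mem hF)).congr ⟨q + 1 + p, by ring⟩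

theorem hasOpParity_Delta (hφ : ∀ q, Function.Bijective (phi ω H q))
    (hQ : ∀ v : Fin (n + 1) → Q, ExteriorAlgebra.ιMulti A (n + 1) v = 0) :
    DiffOp.HasOpParity (G := Form A H Q) (mul R A H Q) (IsHomog R) 1 (T.Delta ω) := by
  refine hasOpParity fun q p F hF => ?_
  cases p with
  | zero => rw [T.Delta_eq_zero hφ hQ hF]; exact hasParity_zero _
  | succ p => exact (hasParity_of_mem (T.Delta_mem hφ hQ hF)).congr ⟨q + p + 1, by ring⟩

theorem hasOpParity_Psi (hc : ∀ q, Function.Bijective (canon A H Q q)) :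
    DiffOp.HasOpParity (G := Form A H Q) (mul R A H Q) (IsHomog R) 1 T.Psi := by
  refine hasOpParity fun q p F hF => ?_
  by_cases h : q = 0 ∨ p ≤ 1
  · rw [T.Psi_eq_zero hc h hF]; exact hasParity_zero _
  · obtain ⟨q, rfl⟩ := Nat.exists_eq_add_of_le' (show 1 ≤ q by omega)
    obtain ⟨p, rfl⟩ := Nat.exists_eq_add_of_le' (show 2 ≤ p by omega)
    exact (hasParity_of_mem (T.Psi_mem hc hF)).congr ⟨q + p + 2, by ring⟩

theorem hasOrder_d : DiffOp.HasOrder (G := Form A H Q) (mul R A H Q) (IsHomog R) 1 1 T.d := by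
  refine DiffOp.hasOrder_one (G := Form A H Q) (fun i a hi ha b => ?_) fun i a hi ha b => ?_
  · rw [one_mul] at hi
    rw [T.d_mul, ha.hasParity.tau_even hi]
  · rw [one_mul] at hi
    rw [T.d_mul, ha.hasParity.tau_odd hi, neg_mul']
    exact (sub_eq_add_neg (G := Form A H Q) _ _).symm

/-- The defect of `Δ_ω` with respect to `ξ ∈ Q` is, up to the sign, the derivation `derQ ξ`. -/
theorem defect_Delta (ξ : Q) (F : Form A H Q) :
    DiffOp.defect (G := Form A H Q) (mul R A H Q) 1 1 (T.Delta ω) (ofQ R A H ξ) F =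
      - T.derQ ω ξ F := by
  refine (DiffOp.defect_one_one (G := Form A H Q) _ _ _).trans ?_
  rw [ofQ_mul, ofQ_mul, map_neg, derQ, lieQ]
  abel

theorem hasOrder_Delta (hφ : ∀ q, Function.Bijective (phi ω H q))
    (hc : ∀ q, Function.Bijective (canon A H Q q))
    (hQ : ∀ v : Fin (n + 1) → Q, ExteriorAlgebra.ιMulti A (n + 1) v = 0) :
    DiffOp.HasOrder (G := Form A H Q) (mul R A H Q) (IsHomog R) 2 1 (T.Delta ω) := by
  refine (isGeneratedBy hc hQ).hasOrder_succ isGradedComm (T.hasOpParity_Delta hφ hQ)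
    (fun i b hb => T.Delta_eq_zero hφ hQ hb) fun ξ => ?_
  refine DiffOp.hasOrder_one (G := Form A H Q) (fun i a _ _ b => ?_) fun i a hi _ b => ?_
  · rw [defect_Delta, defect_Delta, defect_Delta, T.derQ_mul hφ hQ, neg_mul', map_neg]
    abel
  · exact absurd hi (by simp)

theorem defect_Psi (hc : ∀ q, Function.Bijective (canon A H Q q)) (ξ : Q) (F : Form A H Q) :
    DiffOp.defect (G := Form A H Q) (mul R A H Q) 1 1 T.Psi (ofQ R A H ξ) F = - T.liePsi ξ F := by
  refine (DiffOp.defect_one_one (G := Form A H Q) _ _ _).trans ?_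
  rw [T.Psi_eq_zero hc (Or.inl rfl) (ofQ_mem_comp ξ), ofQ_mul, ofQ_mul, map_neg, liePsi, map_zero,
    LinearMap.zero_apply]
  abel

/-- The iterated defect of `Ψ_δ` with respect to `ξ, η ∈ Q` is the contraction with `δ(ξ, η)`, a
derivation. Hence `Ψ_δ` is a differential operator of order `3`. -/
theorem defect_defect_Psi (hc : ∀ q, Function.Bijective (canon A H Q q)) (ξ η : Q)
    (F : Form A H Q) : DiffOp.defect (G := Form A H Q) (mul R A H Q) 2 1
      (DiffOp.defect (G := Form A H Q) (mul R A H Q) 1 1 T.Psi (ofQ R A H ξ)) (ofQ R A H η) F =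
      iH R A Q (T.delta ξ η) F := by
  refine (DiffOp.defect_two (G := Form A H Q) _ _ _ _).trans ?_
  have h : T.liePsi ξ (ofQ R A H η) = 0 := by
    rw [liePsi, T.Psi_eq_zero hc (Or.inl rfl) (ofQ_mem_comp η),
      T.Psi_eq_zero hc (Or.inl rfl) (iQ_mem_comp (ofQ_mem_comp η) ξ), map_zero, add_zero]
  rw [T.defect_Psi hc, T.defect_Psi hc, T.defect_Psi hc, h, ofQ_mul, ofQ_mul, liePsi_neg,
    map_neg (iQ R A H η), ← T.liePsi_iQ hc, neg_mul', map_zero, LinearMap.zero_apply]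
  abel

theorem hasOrder_Psi (hc : ∀ q, Function.Bijective (canon A H Q q))
    (hQ : ∀ v : Fin (n + 1) → Q, ExteriorAlgebra.ιMulti A (n + 1) v = 0) :
    DiffOp.HasOrder (G := Form A H Q) (mul R A H Q) (IsHomog R) 3 1 T.Psi := by
  refine (isGeneratedBy hc hQ).hasOrder_succ isGradedComm (T.hasOpParity_Psi hc)
    (fun i b hb => T.Psi_eq_zero hc (Or.inr zero_le_one) hb) fun ξ => ?_
  refine (isGeneratedBy hc hQ).hasOrder_succ isGradedComm
    ((T.hasOpParity_Psi hc).defect isGradedComm ((isGeneratedBy hc hQ).gen ξ))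
    (fun i b hb => ?_) fun η => ?_
  · rw [T.defect_Psi hc, T.liePsi_eq_zero hc ξ hb]
    exact neg_zero (G := Form A H Q)
  refine DiffOp.hasOrder_one (G := Form A H Q) (fun i a hi ha b => ?_) fun i a hi ha b => ?_
  · have hi' : Even i := by rcases Nat.even_mul.1 hi with h | h; exacts [absurd h (by decide), h]
    rw [T.defect_defect_Psi hc, T.defect_defect_Psi hc, T.defect_defect_Psi hc, iH_mul,
      ha.hasParity.tau_even hi']
  · have hi' : Odd i := (Nat.odd_mul.1 hi).2
    rw [T.defect_defect_Psi hc, T.defect_defect_Psi hc, T.defect_defect_Psi hc, iH_mul,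
      ha.hasParity.tau_odd hi', neg_mul']
    exact (sub_eq_add_neg (G := Form A H Q) _ _).symm

theorem orderLeOne_d : OrderLeOne (mul R A H Q) (one R A H Q) (comp R A H Q) T.d :=
  fun _ _ _ _ _ ha b hb => (DiffOp.formTwo_eq (G := Form A H Q) T.hasOpParity_d T.d_one
    (isHomog_of_mem ha) (isHomog_of_mem hb)).trans
    (LinearMap.congr_fun (T.hasOrder_d _ _ (isHomog_of_mem ha)) b)

theorem orderLeTwo_Delta (hφ : ∀ q, Function.Bijective (phi ω H q))
    (hc : ∀ q, Function.Bijective (canon A H Q q))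
    (hQ : ∀ v : Fin (n + 1) → Q, ExteriorAlgebra.ιMulti A (n + 1) v = 0) :
    OrderLeTwo (mul R A H Q) (one R A H Q) (comp R A H Q) (T.Delta ω) :=
  fun _ _ _ _ _ _ _ ha _ hb c hc' => (DiffOp.formThree_eq (G := Form A H Q) isGradedComm
    (T.hasOpParity_Delta hφ hQ) (T.Delta_one hφ hQ) (isHomog_of_mem ha) (isHomog_of_mem hb)
    (isHomog_of_mem hc')).trans
    (LinearMap.congr_fun (T.hasOrder_Delta hφ hc hQ _ _ (isHomog_of_mem ha) _ _
      (isHomog_of_mem hb)) c)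

theorem orderLeThree_Psi (hc : ∀ q, Function.Bijective (canon A H Q q))
    (hQ : ∀ v : Fin (n + 1) → Q, ExteriorAlgebra.ιMulti A (n + 1) v = 0) :
    OrderLeThree (mul R A H Q) (one R A H Q) (comp R A H Q) T.Psi :=
  fun _ _ _ _ _ _ _ _ _ ha _ hb _ hc' e he => (DiffOp.formFour_eq (G := Form A H Q) isGradedComm
    (T.hasOpParity_Psi hc) T.Psi_one (isHomog_of_mem ha) (isHomog_of_mem hb)
    (isHomog_of_mem hc') (isHomog_of_mem he)).trans
    (LinearMap.congr_fun (T.hasOrder_Psi hc hQ _ _ (isHomog_of_mem ha) _ _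
      (isHomog_of_mem hb) _ _ (isHomog_of_mem hc')) e)

end AlmostPreLRTriple

/-! ### The bracket generated by an operator of order two -/

namespace DiffOp

variable {R G : Type*} [CommRing R] [AddCommGroup G] [Module R G]

/-- The bracket generated by the odd operator `Δ`, where `t` is the sign operator
`a ↦ (-1)^|a| a`. -/
def bracket (m : G →ₗ[R] G →ₗ[R] G) (t D : G →ₗ[R] G) : G →ₗ[R] G →ₗ[R] G :=
  (m ∘ₗ t).compr₂ D - m ∘ₗ D ∘ₗ t - m.compl₂ D

variable {m : G →ₗ[R] G →ₗ[R] G} {P : ℕ → G → Prop} {t D : G →ₗ[R] G}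

theorem bracket_apply (a b : G) :
    bracket m t D a b = D (m (t a) b) - m (D (t a)) b - m a (D b) := rfl

theorem bracket_eq (ht : ∀ i a, P i a → t a = (-1 : ℤ) ^ i • a) {i : ℕ} {a : G} (ha : P i a)
    (b : G) : bracket m t D a b = (-1 : ℤ) ^ i • defect m 1 i D a b := by
  rw [bracket_apply, ht i a ha, defect_apply, one_mul]
  simp only [map_zsmul, LinearMap.smul_apply, smul_sub, smul_smul, ← mul_pow, neg_one_mul, neg_neg,
    one_pow, one_smul]

/-- The antisymmetry of the bracket is the symmetry of the defect. -/
theorem bracket_skew (h : IsGradedComm m P) (ht : ∀ i a, P i a → t a = (-1 : ℤ) ^ i • a)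
    (hD : HasOpParity m P 1 D) {i j : ℕ} {a b : G} (ha : P i a) (hb : P j b) :
    bracket m t D a b = - ((-1 : ℤ) ^ ((i + 1) * (j + 1)) • bracket m t D b a) := by
  rw [bracket_eq ht ha, bracket_eq ht hb, defect_comm h hD ha hb, smul_smul, smul_smul, ← neg_smul]
  congr 1
  rw [show (i + 1) * (j + 1) = i * j + i + j + 1 by ring, pow_succ, pow_add, pow_add]
  rcases neg_one_pow_eq_or ℤ i with h1 | h1 <;>
  rcases neg_one_pow_eq_or ℤ j with h2 | h2 <;>
  rcases neg_one_pow_eq_or ℤ (i * j) with h3 | h3 <;>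
  simp [h1, h2, h3]

/-- The bracket generated by `D` is a derivation in its first argument, because `D` has order
`2`. -/
theorem bracket_mul (h : IsGradedComm m P) (ht : ∀ i a, P i a → t a = (-1 : ℤ) ^ i • a)
    (hD : HasOrder m P 2 1 D) {i j : ℕ} {a b : G} (ha : P i a) (hb : P j b) (c : G) :
    bracket m t D (m a b) c =
      m a (bracket m t D b c) + (-1 : ℤ) ^ (i * j) • m b (bracket m t D a c) := by
  have h0 : defect m (1 + i) j (defect m 1 i D a) b = 0 := hD i a ha j b hb
  rw [bracket_eq ht (h.mul i a j b ha hb), bracket_eq ht ha, bracket_eq ht hb,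
    defect_mul h 1 D i j a b, h0]
  simp only [LinearMap.add_apply, LinearMap.smul_apply, LinearMap.comp_apply, zero_add,
    smul_add, map_zsmul, smul_smul, add_mul, one_mul, pow_add]
  rcases neg_one_pow_eq_or ℤ i with h1 | h1 <;>
  rcases neg_one_pow_eq_or ℤ j with h2 | h2 <;>
  rcases neg_one_pow_eq_or ℤ (i * j) with h3 | h3 <;>
  simp only [h1, h2, h3, one_smul, neg_smul, mul_one, neg_neg, mul_neg] <;> abel

end DiffOp

namespace Form

variable {R A H Q : Type*} [CommRing R] [CommRing A] [Algebra R A]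
  [AddCommGroup H] [Module A H]
  [AddCommGroup Q] [Module R Q] [Module A Q] [IsScalarTower R A Q]

theorem sub_mem_comp {q p : ℕ} {F G : Form A H Q} (hF : F ∈ comp R A H Q q p)
    (hG : G ∈ comp R A H Q q p) : F - G ∈ comp R A H Q q p := by
  rw [mem_comp_iff] at *
  refine ⟨fun k hk => ?_, fun v => ?_⟩
  · ext v
    rw [apply_sub, hF.1 k hk, hG.1 k hk]; simp
  · rw [apply_sub]; exact Submodule.sub_mem _ (hF.2 v) (hG.2 v)

theorem zsmul_mem_comp {q p : ℕ} {F : Form A H Q} (hF : F ∈ comp R A H Q q p) (c : ℤ) :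
    c • F ∈ comp R A H Q q p := by
  rw [mem_comp_iff] at *
  refine ⟨fun k hk => ?_, fun v => ?_⟩
  · ext v
    rw [apply_zsmul, hF.1 k hk]; simp
  · rw [apply_zsmul]; exact zsmul_mem (hF.2 v) c

theorem tau_of_isHomog (i : ℕ) (F : Form A H Q) (hF : IsHomog R i F) :
    tau R A H Q F = (-1 : ℤ) ^ i • F := hF.hasParity.tau_eq

theorem iH_ofForm (x : H) {q : ℕ} (β : H [⋀^Fin (q + 1)]→ₗ[A] A) :
    iH R A Q x (ofForm R A Q β) = ofForm R A Q ((-1 : ℤ) ^ (q + 1) • β.curryLeft x) := by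
  rw [ofForm, iH_lof_succ]
  refine congrArg (DirectSum.lof R ℕ (FormDeg A H Q) q) ?_
  ext v
  change (-1 : ℤ) ^ (q + 1) • sgn A Q 1 (algebraMap A _ (β (Fin.cons x v))) =
    algebraMap A _ ((-1 : ℤ) ^ (q + 1) • β (Fin.cons x v))
  rw [sgn_algebraMap, map_zsmul]

theorem ofForm_zero (β : H [⋀^Fin 0]→ₗ[A] A) :
    ofForm R A Q β = const R H (algebraMap A _ (β ![])) := by
  refine congrArg (DirectSum.lof R ℕ (FormDeg A H Q) 0) ?_
  ext v
  rw [Subsingleton.elim v ![]]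
  rfl

theorem ofForm_sub {q : ℕ} (β γ : H [⋀^Fin q]→ₗ[A] A) :
    ofForm R A Q (β - γ) = ofForm R A Q β - ofForm R A Q γ := by
  refine (congrArg (DirectSum.lof R ℕ (FormDeg A H Q) q) ?_).trans
    (map_sub (DirectSum.lof R ℕ (FormDeg A H Q) q) _ _)
  ext v
  exact map_sub (algebraMap A (ExteriorAlgebra A Q)) _ _

end Form

namespace AlmostPreLRTriple

open Form AlmostLieRinehart

variable {R A H Q : Type*} [CommRing R] [CommRing A] [Algebra R A]
  [AddCommGroup H] [Module R H] [Module A H] [IsScalarTower R A H]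
  [AddCommGroup Q] [Module R Q] [Module A Q] [IsScalarTower R A Q] (T : AlmostPreLRTriple R A H Q)
  {n : ℕ} {ω : ⋀[A]^n Q ≃ₗ[A] A}

theorem lieAlt_curryLeft (ξ : Q) (x : H) {q : ℕ} (c : ℤ) (β : H [⋀^Fin (q + 1)]→ₗ[A] A) :
    T.lieAlt ξ (c • β.curryLeft x) - c • β.curryLeft (T.actQH.act ξ x) =
      c • (T.lieAlt ξ β).curryLeft x := by
  ext v
  change T.lieAlt ξ (c • β.curryLeft x) v - c • β (Fin.cons (T.actQH.act ξ x) v) =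
    c • T.lieAlt ξ β (Fin.cons x v)
  rw [lieAlt_apply, lieAlt_apply, Fin.sum_univ_succ]
  simp only [AlternatingMap.smul_apply, map_zsmul, Fin.cons_zero, Fin.cons_succ,
    Fin.update_cons_zero, ← Fin.cons_update, smul_sub, smul_add, Finset.smul_sum]
  change c • T.strQ.anchor ξ (β (Fin.cons x v)) - ∑ i, c • β (Fin.cons x _) - _ = _
  abel

/-- On `Alt_A(H, A)`, the derivation `derQ ξ` is the given action of `ξ`. -/
theorem derQ_ofForm (hφ : ∀ q, Function.Bijective (phi ω H q))
    (hQ : ∀ v : Fin (n + 1) → Q, ExteriorAlgebra.ιMulti A (n + 1) v = 0) (ξ : Q) {q : ℕ}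
    (β : H [⋀^Fin q]→ₗ[A] A) :
    T.derQ ω ξ (ofForm R A Q β) = ofForm R A Q (T.lieAlt ξ β) := by
  let S : Set (Form A H Q) := {E | ∃ (q : ℕ) (β : H [⋀^Fin q]→ₗ[A] A),
    E = T.derQ ω ξ (ofForm R A Q β) - ofForm R A Q (T.lieAlt ξ β)}
  refine sub_eq_zero.1 (vanish_of_iH (R := R) S ?_ ?_ _ ⟨q, β, rfl⟩)
  · rintro _ ⟨q, β, rfl⟩
    cases q with
    | zero =>
      have h := T.derQ_const_mul hφ hQ ξ (β ![]) (one R A H Q)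
      rw [mul_one', mul_one', T.derQ_one hφ hQ, map_zero, add_zero] at h
      rw [ofForm_zero, ofForm_zero, h, lieAlt_apply, Finset.univ_eq_empty,
          Finset.sum_empty, sub_zero]
      rw [apply_sub, sub_self]
    | succ q =>
      have h0 : ∀ β : H [⋀^Fin (q + 1)]→ₗ[A] A, ofForm R A Q β 0 ![] = 0 := fun β => by
        rw [ofForm, lof_apply_ne (by omega)]; rfl
      rw [apply_sub, h0, T.derQ_apply_zero hφ hQ ξ (h0 β), sub_zero]
  · rintro _ ⟨q, β, rfl⟩ x
    have h1 : iH R A Q x (T.derQ ω ξ (ofForm R A Q β)) = T.derQ ω ξ (iH R A Q x (ofForm R A Q β)) -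
        iH R A Q (T.actQH.act ξ x) (ofForm R A Q β) := by
      rw [← T.derQ_iH hφ hQ]; abel
    rw [map_sub, h1]
    cases q with
    | zero =>
      have h0 : ∀ (x : H) (β : H [⋀^Fin 0]→ₗ[A] A), iH R A Q x (ofForm R A Q β) = 0 := fun x β =>
        iH_lof_zero x _
      have h2 : T.derQ ω ξ (0 : Form A H Q) = 0 := by
        rw [derQ, lieQ]; simp only [map_zero]; exact (add_zero _).trans (add_zero _)
      rw [h0, h0, h0, h2]
      simp only [sub_zero]
      exact Submodule.zero_mem _
    | succ q =>
      rw [iH_ofForm, iH_ofForm, iH_ofForm, ← T.lieAlt_curryLeft, ofForm_sub]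
      refine Submodule.subset_span ⟨q, (-1 : ℤ) ^ (q + 1) • β.curryLeft x, ?_⟩
      abel

/-- On `Q`, the derivation `derQ ξ` is the bracket with `ξ`. -/
theorem derQ_ofQ (hφ : ∀ q, Function.Bijective (phi ω H q))
    (hQ : ∀ v : Fin (n + 1) → Q, ExteriorAlgebra.ιMulti A (n + 1) v = 0) (ξ η : Q) :
    T.derQ ω ξ (ofQ R A H η) = ofQ R A H (T.strQ.bracket ξ η) := by
  have h : ∀ η, ofQ R A H η = - iQ R A H η (one R A H Q) := fun η => by
    rw [← ofQ_mul, mul_one']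
  rw [h, h, derQ_neg, T.derQ_iQ hφ hQ, T.derQ_one hφ hQ, map_zero, zero_add]

variable (ω) in
/-- The bracket on `Alt_A(H, Λ_A Q)` which is generated by `Δ_ω`. -/
noncomputable def bracket : Form A H Q →ₗ[R] Form A H Q →ₗ[R] Form A H Q :=
  DiffOp.bracket (G := Form A H Q) (mul R A H Q) (tau R A H Q) (T.Delta ω)

theorem bracket_ofQ (ξ : Q) (F : Form A H Q) :
    T.bracket ω (ofQ R A H ξ) F = T.derQ ω ξ F := by
  refine (DiffOp.bracket_apply (G := Form A H Q) _ _).trans ?_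
  rw [(hasParity_of_mem (R := R) (ofQ_mem_comp ξ)).tau_odd ⟨0, rfl⟩, neg_mul', map_neg, map_neg,
    neg_mul', ofQ_mul, ofQ_mul, map_neg, derQ, lieQ]
  abel

theorem bracket_generates {q p : ℕ} {F : Form A H Q} (hF : F ∈ comp R A H Q q p)
    (G : Form A H Q) : T.bracket ω F G = (-1 : ℤ) ^ (q + p) • (T.Delta ω (mul R A H Q F G) -
      mul R A H Q (T.Delta ω F) G - (-1 : ℤ) ^ (q + p) • mul R A H Q F (T.Delta ω G)) := by
  refine (DiffOp.bracket_eq (G := Form A H Q) tau_of_isHomog (isHomog_of_mem hF) G).trans ?_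
  rw [DiffOp.defect_apply, one_mul]

theorem hasBracketBidegree_bracket (hφ : ∀ q, Function.Bijective (phi ω H q))
    (hQ : ∀ v : Fin (n + 1) → Q, ExteriorAlgebra.ιMulti A (n + 1) v = 0) :
    HasBracketBidegree (G := Form A H Q) (comp R A H Q) (T.bracket ω) := by
  intro q p q' p' a ha b hb
  rw [T.bracket_generates ha]
  constructor
  · intro r hr
    refine zsmul_mem_comp (sub_mem_comp (sub_mem_comp (T.Delta_mem hφ hQ ?_) ?_)
      (zsmul_mem_comp ?_ _)) _
    · rw [← hr]; exact mul_mem_comp ha hb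
    · cases p with
      | zero =>
        rw [T.Delta_eq_zero hφ hQ ha, map_zero]
        exact Submodule.zero_mem _
      | succ p =>
        rw [show r = p + p' by omega]
        exact mul_mem_comp (T.Delta_mem hφ hQ ha) hb
    · cases p' with
      | zero =>
        rw [T.Delta_eq_zero hφ hQ hb, map_zero]
        exact Submodule.zero_mem _
      | succ p' =>
        rw [show r = p + p' by omega]
        exact mul_mem_comp ha (T.Delta_mem hφ hQ hb)
  · intro h
    obtain ⟨rfl, rfl⟩ : p = 0 ∧ p' = 0 := by omega
    have hab := mul_mem_comp ha hb
    rw [add_zero] at hab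
    rw [T.Delta_eq_zero hφ hQ ha, T.Delta_eq_zero hφ hQ hb,
      T.Delta_eq_zero hφ hQ hab, map_zero, map_zero, LinearMap.zero_apply]
    refine form_ext fun k v => ?_
    rw [apply_zsmul, apply_sub, apply_sub, apply_zsmul]
    simp

theorem isExtendedBracket_bracket (hφ : ∀ q, Function.Bijective (phi ω H q))
    (hc : ∀ q, Function.Bijective (canon A H Q q))
    (hQ : ∀ v : Fin (n + 1) → Q, ExteriorAlgebra.ιMulti A (n + 1) v = 0) :
    T.IsExtendedBracket (T.bracket ω) where
  bidegree := T.hasBracketBidegree_bracket hφ hQ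
  skew _ _ _ _ _ ha _ hb := DiffOp.bracket_skew (G := Form A H Q) isGradedComm tau_of_isHomog
    (T.hasOpParity_Delta hφ hQ) (isHomog_of_mem ha) (isHomog_of_mem hb)
  derivation _ _ _ _ _ ha _ hb c := DiffOp.bracket_mul (G := Form A H Q) isGradedComm
    tau_of_isHomog (T.hasOrder_Delta hφ hc hQ) (isHomog_of_mem ha) (isHomog_of_mem hb) c
  bracket_form ξ q β := by rw [bracket_ofQ, T.derQ_ofForm hφ hQ]
  bracket_bracket ξ η := by rw [bracket_ofQ, T.derQ_ofQ hφ hQ]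

variable {T}

/-- Two extended brackets with `c` agree if they agree on the generators `Q` and `Alt_A(H, A)`. -/
theorem IsExtendedBracket.eq_left (hc : ∀ q, Function.Bijective (canon A H Q q))
    {br br' : Form A H Q →ₗ[R] Form A H Q →ₗ[R] Form A H Q} (h : T.IsExtendedBracket br)
    (h' : T.IsExtendedBracket br') {c : Form A H Q}
    (hξ : ∀ ξ, br (ofQ R A H ξ) c = br' (ofQ R A H ξ) c)
    (hβ : ∀ (q : ℕ) (β : H [⋀^Fin q]→ₗ[A] A), br (ofForm R A Q β) c = br' (ofForm R A Q β) c)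
    {q p : ℕ} {F : Form A H Q} (hF : F ∈ comp R A H Q q p) : br F c = br' F c := by
  refine comp_generator_induction (R := R) hc (P := fun _ _ F => br F c = br' F c) hβ
    (fun ξ q p F hF ih => ?_) (fun q p F G hF hG => ?_) hF
  · have e : iQ R A H ξ F = mul R A H Q (ofQ R A H (-ξ)) F := by
      rw [iQ_eq, ofQ_neg, neg_mul']
    rw [e, h.derivation _ _ _ _ _ (ofQ_mem_comp _) _ hF,
      h'.derivation _ _ _ _ _ (ofQ_mem_comp _) _ hF, ih, hξ]
  · rw [map_add, map_add, LinearMap.add_apply, LinearMap.add_apply, hF, hG]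

/-- There is at most one extended bracket, since the bracket with a fixed element is determined by
its values on generators. -/
theorem IsExtendedBracket.unique (hc : ∀ q, Function.Bijective (canon A H Q q))
    (hQ : ∀ v : Fin (n + 1) → Q, ExteriorAlgebra.ιMulti A (n + 1) v = 0)
    {br br' : Form A H Q →ₗ[R] Form A H Q →ₗ[R] Form A H Q} (h : T.IsExtendedBracket br)
    (h' : T.IsExtendedBracket br') : br = br' := by
  have swap : ∀ {q p q' p' : ℕ} {a b : Form A H Q}, a ∈ comp R A H Q q p → b ∈ comp R A H Q q' p' →
      br b a = br' b a → br a b = br' a b := fun ha hb e => by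
    rw [h.skew _ _ _ _ _ ha _ hb, h'.skew _ _ _ _ _ ha _ hb, e]
  have h1 : ∀ (η : Q) {q p : ℕ} {F : Form A H Q}, F ∈ comp R A H Q q p →
      br F (ofQ R A H η) = br' F (ofQ R A H η) := fun η _ _ _ hF =>
    h.eq_left hc h' (fun ξ => by rw [h.bracket_bracket, h'.bracket_bracket])
      (fun q β => swap (ofForm_mem_comp β) (ofQ_mem_comp η)
        (by rw [h.bracket_form, h'.bracket_form])) hF
  have h2 : ∀ {r : ℕ} (γ : H [⋀^Fin r]→ₗ[A] A) {q p : ℕ} {F : Form A H Q},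
      F ∈ comp R A H Q q p → br F (ofForm R A Q γ) = br' F (ofForm R A Q γ) :=
    fun γ _ _ _ hF => h.eq_left hc h' (fun ξ => by rw [h.bracket_form, h'.bracket_form])
      -- The bracket of two elements of `Alt_A(H, A)` vanishes for reasons of degree.
      (fun q β => by
        rw [(h.bidegree _ _ _ _ _ (ofForm_mem_comp β) _ (ofForm_mem_comp γ)).2 rfl,
          (h'.bidegree _ _ _ _ _ (ofForm_mem_comp β) _ (ofForm_mem_comp γ)).2 rfl]) hF
  have h3 : ∀ {q p q' p' : ℕ} {F G : Form A H Q}, F ∈ comp R A H Q q p → G ∈ comp R A H Q q' p' →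
      br F G = br' F G := fun hF hG =>
    h.eq_left hc h' (fun ξ => swap (ofQ_mem_comp ξ) hG (h1 ξ hG))
      (fun q β => swap (ofForm_mem_comp β) hG (h2 β hG)) hF
  refine LinearMap.ext fun F => LinearMap.ext fun G => ?_
  refine comp_induction (R := R) hQ (P := fun F => br F G = br' F G) (fun q p F hF => ?_)
    (fun F F' hF hF' => ?_) F
  · refine comp_induction (R := R) hQ (P := fun G => br F G = br' F G)
      (fun q' p' G hG => h3 hF hG) (fun G G' hG hG' => ?_) G
    rw [map_add, map_add, hG, hG']
  · rw [map_add, map_add, LinearMap.add_apply, LinearMap.add_apply, hF, hF']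

end AlmostPreLRTriple

theorem theorem6p10 {R A H Q : Type*} [CommRing R] [CommRing A] [Algebra R A]
    [AddCommGroup H] [Module R H] [Module A H] [IsScalarTower R A H]
    [AddCommGroup Q] [Module R Q] [Module A Q] [IsScalarTower R A Q]
    [Module.Finite A Q] [Module.Projective A Q] (n : ℕ)
    (hn : ∀ 𝔭 : PrimeSpectrum A, Module.rankAtStalk Q 𝔭 = n)
    (T : AlmostPreLRTriple R A H Q) (hT : T.IsPre)
    (ω : ⋀[A]^n Q ≃ₗ[A] A) (hω : T.IsInvariant ω) :
    (∀ q, Function.Bijective (Form.phi ω H q)) ∧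
    (∀ q, Function.Bijective (Form.canon A H Q q)) ∧
    (T.IsGenuine →
      IsQuasiBV (Form.mul R A H Q) (Form.one R A H Q) (Form.comp R A H Q)
        T.d (T.Delta ω) T.Psi ∧
      ∃ br : Form A H Q →ₗ[R] Form A H Q →ₗ[R] Form A H Q,
        T.IsExtendedBracket br ∧
        (∀ br' : Form A H Q →ₗ[R] Form A H Q →ₗ[R] Form A H Q,
          T.IsExtendedBracket br' → br' = br) ∧
        IsStrictGenerator (Form.mul R A H Q) (Form.one R A H Q) (Form.comp R A H Q)
          T.d (T.Delta ω) T.Psi br) ∧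
    (PropertyP A H →
      IsQuasiBV (Form.mul R A H Q) (Form.one R A H Q) (Form.comp R A H Q)
        T.d (T.Delta ω) T.Psi →
      T.IsGenuine) := by
  have hQ := Form.ιMulti_eq_zero_of_rank hn
  have hφ := Form.phi_bijective (H := H) ω hQ
  have hc := Form.canon_bijective (H := H) ω hQ
  refine ⟨hφ, hc, fun hG => ?_, fun hP h => ?_⟩
  · have hrel := T.relations_of_D_D hφ hQ (T.D_D_of_isGenuine hφ hc hQ hω hG)
    refine ⟨{
      algebra := Form.isBigradedCommAlgebra hQ
      d_mem := fun _ _ _ ha => T.d_mem ha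
      delta_mem := fun _ _ _ ha => T.Delta_mem hφ hQ ha
      delta_zero := fun _ _ ha => T.Delta_eq_zero hφ hQ ha
      psi_mem := fun _ _ _ ha => T.Psi_mem hc ha
      psi_zero := fun _ _ h _ ha => T.Psi_eq_zero hc h ha
      d_order := T.orderLeOne_d
      delta_order := T.orderLeTwo_Delta hφ hc hQ
      psi_order := T.orderLeThree_Psi hc hQ
      d_one := T.d_one
      delta_one := T.Delta_one hφ hQ
      psi_one := T.Psi_one
      d_d := fun a => (hrel a).1
      d_delta := fun a => (hrel a).2.1
      d_psi := fun a => (hrel a).2.2.1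
      delta_psi := fun a => (hrel a).2.2.2.1
      psi_psi := fun a => (hrel a).2.2.2.2 }, T.bracket ω, T.isExtendedBracket_bracket hφ hc hQ,
      fun br h => h.unique hc hQ (T.isExtendedBracket_bracket hφ hc hQ), {
      delta_mem := fun _ _ _ ha => T.Delta_mem hφ hQ ha
      delta_zero := fun _ _ ha => T.Delta_eq_zero hφ hQ ha
      generates := fun _ _ _ _ _ ha b _ => T.bracket_generates ha b
      delta_one := T.Delta_one hφ hQ
      d_delta := fun a => (hrel a).2.1
      d_psi := fun a => (hrel a).2.2.1
      delta_psi := fun a => (hrel a).2.2.2.1 }⟩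
  · refine T.isGenuine_of_D_D hφ hc hQ hω hP fun F => ?_
    have e := congrArg₂ (· + ·) (congrArg₂ (· + ·) (congrArg₂ (· + ·) (congrArg₂ (· + ·) (h.d_d F)
      (h.d_delta F)) (h.d_psi F)) (h.delta_psi F)) (h.psi_psi F)
    simp only [add_zero] at e
    refine Eq.trans ?_ e
    simp only [map_add]
    abel
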